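/- Let $n\ge 2$ and let $(M,g)$ be a smooth Lorentzian manifold of dimension $1+n$ and signature $(-,+,\dots,+)$. Let $(t,z)\in(-T,T)\times Z$, with $Z\subset\mathbb R^n$ an open neighborhood of $0$, be local coordinates on $M$ in which $g=-dt^2+g'(t,z)$ with $g'(t,\cdot)$ a Riemannian metric on $Z$ depending smoothly on $t$; put $h=g'(0,\cdot)$. Let $A\subset\mathbb R^{n-1}$ be an open neighborhood of $0$ and let $Z\times A\ni(z,a)\mapsto(z,\theta(z,a))$ be (the inverse of) a local coordinate system on the unit sphere bundle of $(Z,h)$. Let $\ell>0$ and, for $(z,a)\in\mathcal M:=Z\times A$, let $\gamma_{z,a}:[0,\ell]\to M$ be the (lightlike) geodesic such that, in the coordinates $(t,z)$, $\gamma_{z,a}(0)=(0,z)$ and $\dot\gamma_{z,a}(0)=(1,\theta(z,a))$. Put $\gamma_0=\gamma_{0,0}$. Let $\Omega\subset M$ be open and relatively compact, with $\gamma_{z,a}(0),\gamma_{z,a}(\ell)\notin\overline\Omega$ for all $(z,a)\in\mathcal M$. Let $$C_0=\{(z,a,s,\xi)\mid (z,a)\in\mathcal M,\ s\in(0,\ell),\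 \xi\in T^*_{\gamma_{z,a}(s)}\Omega,\ \xi\neq0,\ \langle\xi,\dot\gamma_{z,a}(s)\rangle=0\},$$ a smooth $3n$-dimensional manifold (which parametrizes the canonical relation of the light ray transform), and define $$\pi_{\mathcal M}:C_0\to T^*\mathcal M,\quad \pi_{\mathcal M}(z,a,s,\xi)=(z,a,\zeta,\alpha),\quad \zeta_j=\langle\xi,\partial_{z^j}\gamma_{z,a}(s)\rangle,\ \alpha_k=\langle\xi,\partial_{a^k}\gamma_{z,a}(s)\rangle,$$ $$\pi_M:C_0\to T^*M,\quad \pi_M(z,a,s,\xi)=(\gamma_{z,a}(s),\xi).$$ Let $\Sigma_s\subset T^*M$ be the set of spacelike covectors and let $N^*\gamma_0$ be the set of covectors at points $\gamma_0(s)$, $s\in[0,\ell]$, that annihilate $\dot\gamma_0(s)$. Then: 1. At every $(z,a,s,\xi)\in C_0$ with $\xi$ spacelike, the differential $d\pi_{\mathcal M}$ is injective and the differential $d\pi_M$ is surjective. 2. The projection $\pi_{\mathcal M}$ is injective in some neighborhood in $C_0$ of the set $\{(0,0,s,\xi)\in C_0\mid \xi \text{ spacelike}\}$ if and only if $\gamma_0$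 has no conjugate points over $\Omega$, that is, there are no $s_1\neq s_2$ in $[0,\ell]$ with $\gamma_0(s_1),\gamma_0(s_2)\in\Omega$ such that a not identically vanishing Jacobi field along $\gamma_0$ vanishes at both $s_1$ and $s_2$. 3. The projection $\pi_M$ is surjective onto a neighborhood of $\Sigma_s\cap N^*\gamma_0\cap T^*\Omega$ in $\Sigma_s$: there is an open set $W\subset T^*M$ containing $\Sigma_s\cap N^*\gamma_0\cap T^*\Omega$ with $W\cap\Sigma_s\subset\pi_M(C_0)$. -/

import Mathlib

open scoped Manifold ContDiff Topology
open Set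

noncomputable section

/-- The model space `ℝ^d` with its Euclidean structure. -/
abbrev Euc (d : ℕ) : Type := EuclideanSpace ℝ (Fin d)

/-- The `i`-th standard basis vector of `ℝ^d`. -/
def stdVec (d : ℕ) (i : Fin d) : Euc d := EuclideanSpace.single i 1

/-- The tangent vector of a curve `c` at time `t`, as an element of the fibre over `c t`. -/
def curveVel {E H N : Type*} [NormedAddCommGroup E] [NormedSpace ℝ E] [TopologicalSpace H]
    (I : ModelWithCorners ℝ E H) [TopologicalSpace N] [ChartedSpace H N]
    (c : ℝ → N) (t : ℝ) : TangentSpace I (c t) :=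
  mfderiv 𝓘(ℝ, ℝ) I c t (1 : ℝ)

/-- The same tangent vector as a point of the tangent bundle. -/
def curveVelTB {E H N : Type*} [NormedAddCommGroup E] [NormedSpace ℝ E] [TopologicalSpace H]
    (I : ModelWithCorners ℝ E H) [TopologicalSpace N] [ChartedSpace H N]
    (c : ℝ → N) (t : ℝ) : TangentBundle I N :=
  ⟨c t, curveVel I c t⟩

/-! ### Differentials of maps on a submanifold -/

/-- `c` is a smooth curve through `p` at time `0` which stays in `S` for small times. When `S` is an
embedded submanifold, the velocities at time `0` of such curves are exactly the tangent vectors of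
`S` at `p`. -/
structure IsCurveThrough {E H N : Type*} [NormedAddCommGroup E] [NormedSpace ℝ E]
    [TopologicalSpace H] (I : ModelWithCorners ℝ E H) [TopologicalSpace N] [ChartedSpace H N]
    (S : Set N) (p : N) (c : ℝ → N) : Prop where
  at_zero : c 0 = p
  smooth : ContMDiffAt 𝓘(ℝ, ℝ) I ∞ c 0
  mem : ∀ᶠ t in 𝓝 (0 : ℝ), c t ∈ S

/-- The differential at `p` of the restriction of `f` to the submanifold `S` is injective on the
tangent space of `S` at `p`: the differential sends the velocity of a curve `c` in `S` to that of
`f ∘ c`. -/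
def DifferentialInjectiveAt {E H N E' H' N' : Type*} [NormedAddCommGroup E] [NormedSpace ℝ E]
    [TopologicalSpace H] (I : ModelWithCorners ℝ E H) [TopologicalSpace N] [ChartedSpace H N]
    [NormedAddCommGroup E'] [NormedSpace ℝ E'] [TopologicalSpace H']
    (I' : ModelWithCorners ℝ E' H') [TopologicalSpace N'] [ChartedSpace H' N']
    (S : Set N) (f : N → N') (p : N) : Prop :=
  (∀ c, IsCurveThrough I S p c → MDifferentiableAt 𝓘(ℝ, ℝ) I' (f ∘ c) 0) ∧
  ∀ c₁ c₂, IsCurveThrough I S p c₁ → IsCurveThrough I S p c₂ →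
    curveVelTB I' (f ∘ c₁) 0 = curveVelTB I' (f ∘ c₂) 0 → curveVelTB I c₁ 0 = curveVelTB I c₂ 0

/-- The differential at `p` of the restriction of `f` to the submanifold `S` maps the tangent space
of `S` at `p` onto the tangent space of the target at `f p`. -/
def DifferentialSurjectiveAt {E H N E' H' N' : Type*} [NormedAddCommGroup E] [NormedSpace ℝ E]
    [TopologicalSpace H] (I : ModelWithCorners ℝ E H) [TopologicalSpace N] [ChartedSpace H N]
    [NormedAddCommGroup E'] [NormedSpace ℝ E'] [TopologicalSpace H']
    (I' : ModelWithCorners ℝ E' H') [TopologicalSpace N'] [ChartedSpace H' N']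
    (S : Set N) (f : N → N') (p : N) : Prop :=
  (∀ c, IsCurveThrough I S p c → MDifferentiableAt 𝓘(ℝ, ℝ) I' (f ∘ c) 0) ∧
  ∀ w : TangentSpace I' (f p), ∃ c, IsCurveThrough I S p c ∧
    curveVelTB I' (f ∘ c) 0 = (⟨f p, w⟩ : TangentBundle I' N')

/-! ### Lorentzian metrics, the Levi-Civita connection in charts, geodesics, Jacobi fields -/

section Lorentz

variable {n : ℕ} {M : Type*} [TopologicalSpace M] [ChartedSpace (Euc (n + 1)) M]

/-- The cotangent bundle of `M`. -/
abbrev CotangentBundle (n : ℕ) (M : Type*) [TopologicalSpace M] [ChartedSpace (Euc (n + 1)) M] :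
    Type _ :=
  Bundle.TotalSpace (Euc (n + 1) →L[ℝ] ℝ)
    (fun x : M => TangentSpace (𝓡 (n + 1)) x →L[ℝ] Bundle.Trivial M ℝ x)

/-- A smooth Lorentzian metric of signature `(-, +, …, +)` on a manifold of dimension `1 + n`. -/
structure LorentzianMetric (n : ℕ) (M : Type*) [TopologicalSpace M]
    [ChartedSpace (Euc (n + 1)) M] [IsManifold (𝓡 (n + 1)) ∞ M] where
  form : ∀ x : M, TangentSpace (𝓡 (n + 1)) x →L[ℝ] TangentSpace (𝓡 (n + 1)) x →L[ℝ] ℝ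
  symm : ∀ x v w, form x v w = form x w v
  signature : ∀ x : M, ∃ b : Module.Basis (Fin (n + 1)) ℝ (TangentSpace (𝓡 (n + 1)) x),
    ∀ i j, form x (b i) (b j) = if i = j then (if i = 0 then -1 else 1) else 0
  smooth : ContMDiff (𝓡 (n + 1))
    ((𝓡 (n + 1)).prod 𝓘(ℝ, Euc (n + 1) →L[ℝ] Euc (n + 1) →L[ℝ] ℝ)) ∞
    (fun x => Bundle.TotalSpace.mk' (Euc (n + 1) →L[ℝ] Euc (n + 1) →L[ℝ] ℝ)
      (E := fun x : M => TangentSpace (𝓡 (n + 1)) x →L[ℝ] TangentSpace (𝓡 (n + 1)) x →L[ℝ] ℝ)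
      x (form x))

/-- Components of `v ∈ T_x M` in the chart centred at `x₀`. -/
def toChart (x₀ x : M) (v : TangentSpace (𝓡 (n + 1)) x) : Euc (n + 1) :=
  mfderiv (𝓡 (n + 1)) 𝓘(ℝ, Euc (n + 1)) (extChartAt (𝓡 (n + 1)) x₀) x v

/-- The tangent vector at the point with coordinates `y` in the chart centred at `x₀` whose
components in that chart are `v`. -/
def ofChart (x₀ : M) (y v : Euc (n + 1)) :
    TangentSpace (𝓡 (n + 1)) ((extChartAt (𝓡 (n + 1)) x₀).symm y) :=
  mfderiv 𝓘(ℝ, Euc (n + 1)) (𝓡 (n + 1)) (extChartAt (𝓡 (n + 1)) x₀).symm y v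

/-- The partial derivative `∂_i f` at `y`. -/
def partialD (i : Fin (n + 1)) (f : Euc (n + 1) → ℝ) (y : Euc (n + 1)) : ℝ :=
  fderiv ℝ f y (stdVec (n + 1) i)

variable [IsManifold (𝓡 (n + 1)) ∞ M]

/-- The matrix `(g_{ij})` of the metric at coordinates `y` in the chart centred at `x₀`. -/
def gram (g : LorentzianMetric n M) (x₀ : M) (y : Euc (n + 1)) :
    Matrix (Fin (n + 1)) (Fin (n + 1)) ℝ :=
  Matrix.of fun i j => g.form ((extChartAt (𝓡 (n + 1)) x₀).symm y)
    (ofChart x₀ y (stdVec (n + 1) i)) (ofChart x₀ y (stdVec (n + 1) j))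

/-- The Christoffel symbol
`Γ^k_{ij} = ½ ∑_l g^{kl} (∂_i g_{jl} + ∂_j g_{il} - ∂_l g_{ij})`. -/
def christoffel (g : LorentzianMetric n M) (x₀ : M) (k i j : Fin (n + 1))
    (y : Euc (n + 1)) : ℝ :=
  (1 / 2) * ∑ l, (gram g x₀ y)⁻¹ k l *
    (partialD i (fun y' => gram g x₀ y' j l) y + partialD j (fun y' => gram g x₀ y' i l) y
      - partialD l (fun y' => gram g x₀ y' i j) y)

/-- The components of the curvature tensor, `R(∂_i, ∂_j) ∂_k = ∑_l R^l_{ijk} ∂_l`, where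
`R(X, Y) = ∇_X ∇_Y - ∇_Y ∇_X - ∇_{[X, Y]}`. -/
def riemannComp (g : LorentzianMetric n M) (x₀ : M) (l i j k : Fin (n + 1))
    (y : Euc (n + 1)) : ℝ :=
  partialD i (christoffel g x₀ l j k) y - partialD j (christoffel g x₀ l i k) y
    + ∑ m, (christoffel g x₀ l i m y * christoffel g x₀ m j k y
      - christoffel g x₀ l j m y * christoffel g x₀ m i k y)

/-- A vector of `T_x M` given by its components in the chart centred at `x`. -/
def ofOwnChart (x : M) (v : Euc (n + 1)) : TangentSpace (𝓡 (n + 1)) x :=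
  (mfderiv 𝓘(ℝ, Euc (n + 1)) (𝓡 (n + 1)) (extChartAt (𝓡 (n + 1)) x).symm
    (extChartAt (𝓡 (n + 1)) x x) v : Euc (n + 1))

/-- The curvature `R(u, v) w` at `x`. -/
def riemann (g : LorentzianMetric n M) (x : M) (u v w : TangentSpace (𝓡 (n + 1)) x) :
    TangentSpace (𝓡 (n + 1)) x :=
  ofOwnChart x (WithLp.toLp 2 fun l => ∑ i, ∑ j, ∑ k,
    riemannComp g x l i j k (extChartAt (𝓡 (n + 1)) x x)
      * toChart x x u i * toChart x x v j * toChart x x w k)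

/-- The Levi-Civita covariant derivative `V'(s) = ∇_s V` of a vector field `V` along a curve `γ`,
`(V')^k = dV^k/ds + ∑_{ij} Γ^k_{ij} (dγ^i/ds) V^j`, computed in the chart centred at `γ s`. -/
def covDeriv (g : LorentzianMetric n M) (γ : ℝ → M)
    (V : ∀ s, TangentSpace (𝓡 (n + 1)) (γ s)) (s : ℝ) : TangentSpace (𝓡 (n + 1)) (γ s) :=
  ofOwnChart (γ s) (deriv (fun r => toChart (γ s) (γ r) (V r)) s
    + WithLp.toLp 2 fun k => ∑ i, ∑ j,
        christoffel g (γ s) k i j (extChartAt (𝓡 (n + 1)) (γ s) (γ s))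
          * deriv (fun r => extChartAt (𝓡 (n + 1)) (γ s) (γ r)) s i
          * toChart (γ s) (γ s) (V s) j)

/-- `γ` is a geodesic on (a neighbourhood of) the set of times `S`: it is smooth and
`∇_s γ' = 0`. -/
def IsGeodesicOn (g : LorentzianMetric n M) (γ : ℝ → M) (S : Set ℝ) : Prop :=
  ∃ U : Set ℝ, IsOpen U ∧ S ⊆ U ∧ ContMDiffOn 𝓘(ℝ, ℝ) (𝓡 (n + 1)) ∞ γ U ∧
    ∀ s ∈ U, covDeriv g γ (curveVel (𝓡 (n + 1)) γ) s = 0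

/-- `J` is a Jacobi field along `γ` on (a neighbourhood of) the set of times `S`: it is smooth and
`J'' + R(J, γ') γ' = 0`. -/
def IsJacobiFieldOn (g : LorentzianMetric n M) (γ : ℝ → M)
    (J : ∀ s, TangentSpace (𝓡 (n + 1)) (γ s)) (S : Set ℝ) : Prop :=
  ∃ U : Set ℝ, IsOpen U ∧ S ⊆ U ∧
    ContMDiffOn 𝓘(ℝ, ℝ) (𝓡 (n + 1)).tangent ∞
      (fun s => (⟨γ s, J s⟩ : TangentBundle (𝓡 (n + 1)) M)) U ∧
    ∀ s ∈ U, covDeriv g γ (covDeriv g γ J) s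
      + riemann g (γ s) (J s) (curveVel (𝓡 (n + 1)) γ s) (curveVel (𝓡 (n + 1)) γ s) = 0

/-- The points `γ s₁`, `γ s₂` are conjugate along the geodesic segment `γ : [0, ℓ] → M`. -/
def AreConjugate (g : LorentzianMetric n M) (γ : ℝ → M) (ℓ s₁ s₂ : ℝ) : Prop :=
  s₁ ≠ s₂ ∧ ∃ J : ∀ s, TangentSpace (𝓡 (n + 1)) (γ s),
    IsJacobiFieldOn g γ J (Icc 0 ℓ) ∧ (∃ s ∈ Icc 0 ℓ, J s ≠ 0) ∧ J s₁ = 0 ∧ J s₂ = 0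

/-- The covector `p` is spacelike: the vector `v` with `g(v, ·) = p` satisfies `g(v, v) > 0`. -/
def IsSpacelike (g : LorentzianMetric n M) (p : CotangentBundle n M) : Prop :=
  ∃ v : TangentSpace (𝓡 (n + 1)) p.1, (∀ w, g.form p.1 v w = p.2 w) ∧ 0 < g.form p.1 v v

/-- The set `Σ_s` of spacelike covectors. -/
def spacelikeCone (g : LorentzianMetric n M) : Set (CotangentBundle n M) :=
  {p | IsSpacelike g p}

/-- The conormal bundle of the curve segment `γ : [0, ℓ] → M`. -/
def conormal (γ : ℝ → M) (ℓ : ℝ) : Set (CotangentBundle n M) :=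
  {p | ∃ s ∈ Icc 0 ℓ, ∃ ξ : TangentSpace (𝓡 (n + 1)) (γ s) →L[ℝ] ℝ,
    p = ⟨γ s, ξ⟩ ∧ ξ (curveVel (𝓡 (n + 1)) γ s) = 0}

/-! ### The local parametrization of lightlike geodesics and the canonical relation -/

/-- The local set-up: semigeodesic coordinates `(t, z) ∈ (-T, T) × Z` in which
`g = -dt² + g'(t, z)`, coordinates `(z, a) ↦ (z, θ(z, a))`, `(z, a) ∈ Z × A`, on the unit sphere
bundle of `h = g'(0, ·)`, the geodesics `γ_{z,a}` on `[0, ℓ]` issued from the point with coordinates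
`(0, z)` in the direction `(1, θ(z, a))`, and a relatively compact open set `Ω` whose closure
contains none of the end points. The central geodesic is `γ_{0,0}`. -/
structure LightRayFamily (g : LorentzianMetric n M) where
  T : ℝ
  T_pos : 0 < T
  Z : Set (Euc n)
  isOpen_Z : IsOpen Z
  zero_mem_Z : 0 ∈ Z
  A : Set (Euc (n - 1))
  isOpen_A : IsOpen A
  zero_mem_A : 0 ∈ A
  /-- The semigeodesic coordinates, with the hypersurface `{t = 0}`. -/
  coord : OpenPartialHomeomorph M (ℝ × Euc n)
  coord_target : coord.target = Ioo (-T) T ×ˢ Z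
  coord_smooth : ContMDiffOn (𝓡 (n + 1)) 𝓘(ℝ, ℝ × Euc n) ∞ coord coord.source
  coord_symm_smooth : ContMDiffOn 𝓘(ℝ, ℝ × Euc n) (𝓡 (n + 1)) ∞ coord.symm coord.target
  /-- `g(∂_t, ∂_t) = -1`. -/
  metric_tt : ∀ y ∈ coord.target, g.form (coord.symm y)
    (mfderiv 𝓘(ℝ, ℝ × Euc n) (𝓡 (n + 1)) coord.symm y ((1, 0) : ℝ × Euc n))
    (mfderiv 𝓘(ℝ, ℝ × Euc n) (𝓡 (n + 1)) coord.symm y ((1, 0) : ℝ × Euc n)) = -1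
  /-- There are no mixed terms. -/
  metric_tz : ∀ y ∈ coord.target, ∀ v : Euc n, g.form (coord.symm y)
    (mfderiv 𝓘(ℝ, ℝ × Euc n) (𝓡 (n + 1)) coord.symm y ((1, 0) : ℝ × Euc n))
    (mfderiv 𝓘(ℝ, ℝ × Euc n) (𝓡 (n + 1)) coord.symm y ((0, v) : ℝ × Euc n)) = 0
  /-- `g'` is Riemannian. -/
  metric_zz : ∀ y ∈ coord.target, ∀ v : Euc n, v ≠ 0 → 0 < g.form (coord.symm y)
    (mfderiv 𝓘(ℝ, ℝ × Euc n) (𝓡 (n + 1)) coord.symm y ((0, v) : ℝ × Euc n))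
    (mfderiv 𝓘(ℝ, ℝ × Euc n) (𝓡 (n + 1)) coord.symm y ((0, v) : ℝ × Euc n))
  /-- The direction `θ(z, a)`. The next four fields say that `(z, a) ↦ (z, θ(z, a))` is a smooth
  injective immersion of `Z × A` into the unit sphere bundle of `h`, which has the same dimension;
  that is, it is the inverse of a coordinate chart. -/
  θ : Euc n → Euc (n - 1) → Euc n
  θ_smooth : ContDiffOn ℝ ∞ (fun q : Euc n × Euc (n - 1) => θ q.1 q.2) (Z ×ˢ A)
  θ_unit : ∀ z ∈ Z, ∀ a ∈ A, g.form (coord.symm ((0, z) : ℝ × Euc n))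
    (mfderiv 𝓘(ℝ, ℝ × Euc n) (𝓡 (n + 1)) coord.symm (0, z) ((0, θ z a) : ℝ × Euc n))
    (mfderiv 𝓘(ℝ, ℝ × Euc n) (𝓡 (n + 1)) coord.symm (0, z) ((0, θ z a) : ℝ × Euc n)) = 1
  θ_injOn : ∀ z ∈ Z, InjOn (θ z) A
  θ_immersion : ∀ z ∈ Z, ∀ a ∈ A, Function.Injective (fderiv ℝ (θ z) a)
  ℓ : ℝ
  ℓ_pos : 0 < ℓ
  γ : Euc n → Euc (n - 1) → ℝ → M
  γ_geodesic : ∀ z ∈ Z, ∀ a ∈ A, IsGeodesicOn g (γ z a) (Icc 0 ℓ)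
  γ_init : ∀ z ∈ Z, ∀ a ∈ A, curveVelTB (𝓡 (n + 1)) (γ z a) 0 =
    (⟨coord.symm (0, z), mfderiv 𝓘(ℝ, ℝ × Euc n) (𝓡 (n + 1)) coord.symm (0, z)
      ((1, θ z a) : ℝ × Euc n)⟩ : TangentBundle (𝓡 (n + 1)) M)
  Ω : Set M
  isOpen_Ω : IsOpen Ω
  isCompact_Ω : IsCompact (closure Ω)
  start_notMem : ∀ z ∈ Z, ∀ a ∈ A, γ z a 0 ∉ closure Ω
  end_notMem : ∀ z ∈ Z, ∀ a ∈ A, γ z a ℓ ∉ closure Ω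

/-- The manifold containing `C₀`: quadruples of `z`, `a`, `s` and a covector of `M`. -/
abbrev ParamSpace (n : ℕ) (M : Type*) [TopologicalSpace M] [ChartedSpace (Euc (n + 1)) M] :
    Type _ :=
  (Euc n × Euc (n - 1) × ℝ) × CotangentBundle n M

/-- The model with corners of the cotangent bundle. -/
abbrev cotangentModel (n : ℕ) :=
  (𝓡 (n + 1)).prod 𝓘(ℝ, Euc (n + 1) →L[ℝ] ℝ)

/-- The model with corners of `ParamSpace`. -/
abbrev paramModel (n : ℕ) :=
  𝓘(ℝ, Euc n × Euc (n - 1) × ℝ).prod (cotangentModel n)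

/-- `T^*(Z × A)` in the coordinates `(z, a, ζ, α)`. -/
abbrev CotangentZA (n : ℕ) : Type :=
  (Euc n × Euc (n - 1)) × (Euc n × Euc (n - 1))

namespace LightRayFamily

variable {g : LorentzianMetric n M} (F : LightRayFamily g)

/-- The manifold `C₀` of all `(z, a, s, ξ)` with `(z, a) ∈ Z × A`, `s ∈ (0, ℓ)`,
`ξ ∈ T^*_{γ_{z,a}(s)} Ω`, `ξ ≠ 0` and `⟨ξ, γ_{z,a}'(s)⟩ = 0`, which parametrizes the canonical
relation. -/
def C₀ : Set (ParamSpace n M) :=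
  {q | ∃ z ∈ F.Z, ∃ a ∈ F.A, ∃ s ∈ Ioo 0 F.ℓ,
    ∃ ξ : TangentSpace (𝓡 (n + 1)) (F.γ z a s) →L[ℝ] ℝ,
      q = ((z, a, s), ⟨F.γ z a s, ξ⟩) ∧ F.γ z a s ∈ F.Ω ∧ ξ ≠ 0 ∧
      ξ (curveVel (𝓡 (n + 1)) (F.γ z a) s) = 0}

/-- The variation field `M_j = ∂_{z^j} γ_{z,a}(s)`. -/
def zField (z : Euc n) (a : Euc (n - 1)) (s : ℝ) (j : Fin n) :
    TangentSpace (𝓡 (n + 1)) (F.γ z a s) :=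
  mfderiv 𝓘(ℝ, Euc n) (𝓡 (n + 1)) (fun z' => F.γ z' a s) z (stdVec n j)

/-- The variation field `J_k = ∂_{a^k} γ_{z,a}(s)`. -/
def aField (z : Euc n) (a : Euc (n - 1)) (s : ℝ) (k : Fin (n - 1)) :
    TangentSpace (𝓡 (n + 1)) (F.γ z a s) :=
  mfderiv 𝓘(ℝ, Euc (n - 1)) (𝓡 (n + 1)) (fun a' => F.γ z a' s) a (stdVec (n - 1) k)

/-- The projection of the canonical relation to `T^*(Z × A)`,
`(z, a, s, ξ) ↦ (z, a, ζ, α)` with `ζ_j = ⟨ξ, M_j⟩`, `α_k = ⟨ξ, J_k⟩`. It is used only on `C₀`, where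
the base point of the covector is `γ_{z,a}(s)`. -/
def projZA (q : ParamSpace n M) : CotangentZA n :=
  ((q.1.1, q.1.2.1),
    (WithLp.toLp 2 fun j => q.2.2 (F.zField q.1.1 q.1.2.1 q.1.2.2 j),
     WithLp.toLp 2 fun k => q.2.2 (F.aField q.1.1 q.1.2.1 q.1.2.2 k)))

/-- The projection of the canonical relation to `T^*M`, `(z, a, s, ξ) ↦ (γ_{z,a}(s), ξ)`. -/
def projM (_F : LightRayFamily g) (q : ParamSpace n M) : CotangentBundle n M := q.2

/-- The central geodesic `γ₀ = γ_{0,0}`. -/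
def γ₀ : ℝ → M := F.γ 0 0

/-- The points `(0, 0, s, ξ) ∈ C₀` with `ξ` spacelike. -/
def centralSpacelike : Set (ParamSpace n M) :=
  {q | q ∈ F.C₀ ∧ q.1.1 = 0 ∧ q.1.2.1 = 0 ∧ IsSpacelike g q.2}

/-- No two distinct points of the part of `γ₀` lying over `Ω` are conjugate along `γ₀`. -/
def NoConjugatePoints : Prop :=
  ∀ s₁ ∈ Icc 0 F.ℓ, ∀ s₂ ∈ Icc 0 F.ℓ, F.γ₀ s₁ ∈ F.Ω → F.γ₀ s₂ ∈ F.Ω →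
    ¬ AreConjugate g F.γ₀ F.ℓ s₁ s₂

end LightRayFamily

end Lorentz

end

noncomputable section

set_option maxSynthPendingDepth 3
set_option linter.unusedSectionVars false

/-! ### Smooth dependence of solutions of ordinary differential equations -/

section Superposition

variable {K : Type*} [TopologicalSpace K] [CompactSpace K]
  {E F : Type*} [NormedAddCommGroup E] [NormedSpace ℝ E] [NormedAddCommGroup F] [NormedSpace ℝ F]

/-! Fix a ray γ = γ_{z,a} with velocity u. The variations of (z, a), together with the fields u and
s u, form a space L = `RayParam n × ℝ × ℝ` of Jacobi fields, of dimension n + (n - 1) + 2 = 2n + 1.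
All neighbouring rays are lightlike, so every J in L satisfies g(J', u) = 0, and at a given time the
pairs (J, J') with this property also form a space of dimension 2n + 1. The Wronskian g(J₁', J₂) -
g(J₁, J₂') is constant in s, so its radical on L can be computed at s = 0 from the block form of g
in semigeodesic coordinates and from the immersion property of θ: it is the line ℝ u (`radical`).
Hence J ↦ (J(s), J'(s)) is injective on L, and by dimension every value occurs with every derivative
orthogonal to u, at every s in [0, ℓ] (`IsRayFrame.surjective`). The three claims all rest on this.

Let ξ = g(v, ·) with v orthogonal to u and spacelike. In the kernel of the differential of π_𝓜 the
parameters do not move, and what remains is a covector w and a number σ with w(J) + σ g(v, J') = 0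
for all J in L. Data (x, 0) give w = 0, and data (0, v) give σ g(v, v) = 0, so σ = 0
(`eq_zero_of_forall_add`). For π_M, fields with J' = c v allow the constraint ⟨ξ, γ'⟩ = 0 to be kept
while (γ(s), ξ) varies in any prescribed direction (`exists_fderiv_eq`). The same submersion
property shows that π_M(C₀) is a neighbourhood of each of its spacelike covectors
(`image_projM_mem_nhds`), which is the third claim.

Since π_𝓜 keeps (z, a), two points with the same image lie over one ray. If their times s₁, s₂
differ, take J and K in L with data (0, v₁) at s₁ and (0, v₂) at s₂. The Wronskians with J and with
K both represent the common image, so J - K is a multiple of u, and a combination of J, u and s u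
vanishes at both times. It is nontrivial because the spacelike v₁ is not a multiple of u
(`IsRayFrame.exists_vanishing`). Conversely, for a Jacobi field J with zeros at s₁ and s₂ the
function g(J, u) is affine in s and vanishes twice, so J belongs to L; its derivatives there are
spacelike, and the two covectors g(J'(sᵢ), ·) have the same image, given by the Wronskian with J
(`conjugate_rayPoint`). To pass from γ₀ to a neighbourhood, the absence of fields with two zeros is
shown to be an open condition on (p, s₁, s₂), also near the diagonal, because a field and its
derivative have no common zero (`eventually_no_vanishing`). `exists_isOpen_fibrewise` converts this
into a neighbourhood.

The analytic groundwork is that the rays depend smoothly on (z, a) over all of [0, ℓ] and a little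
beyond (`exists_extension`), and that variation fields satisfy the Jacobi equation
(`isJacobiOpen_rayField`). The metric, the connection and the curvature are treated in charts
throughout. -/

/-- Pointwise application of a continuous family of operators, as a bounded bilinear map. -/
def ptwiseApply (K : Type*) [TopologicalSpace K] [CompactSpace K] (E F : Type*)
    [NormedAddCommGroup E] [NormedSpace ℝ E] [NormedAddCommGroup F] [NormedSpace ℝ F] :
    C(K, E →L[ℝ] F) →L[ℝ] C(K, E) →L[ℝ] C(K, F) :=
  LinearMap.mkContinuous₂
    (LinearMap.mk₂ ℝ (fun (A : C(K, E →L[ℝ] F)) (u : C(K, E)) =>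
      (⟨fun k => A k (u k), A.continuous.clm_apply u.continuous⟩ : C(K, F)))
      (by intros; ext; simp) (by intros; ext; simp) (by intros; ext; simp) (by intros; ext; simp))
    1 (by
      intro A u
      rw [one_mul, ContinuousMap.norm_le _ (by positivity)]
      intro k
      exact (ContinuousLinearMap.le_opNorm _ _).trans
        (mul_le_mul (A.norm_coe_le_norm k) (u.norm_coe_le_norm k) (norm_nonneg _) (by positivity)))

@[simp] lemma ptwiseApply_apply (A : C(K, E →L[ℝ] F)) (u : C(K, E)) (k : K) :
    ptwiseApply K E F A u k = A k (u k) := rfl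

/-- The range of `u` is compact, so `fderiv ℝ f` is uniformly continuous around it; the mean value
estimate for the remainder is then uniform in `k`. -/
lemma hasFDerivAt_superposition {f : E → F} (hf : ContDiff ℝ 1 f) (u : C(K, E)) :
    HasFDerivAt (fun u : C(K, E) => (⟨f, hf.continuous⟩ : C(E, F)).comp u)
      (ptwiseApply K E F
        ((⟨fderiv ℝ f, hf.continuous_fderiv one_ne_zero⟩ : C(E, E →L[ℝ] F)).comp u)) u := by
  have hc := hf.continuous_fderiv one_ne_zero
  rw [hasFDerivAt_iff_isLittleO, Asymptotics.isLittleO_iff]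
  intro ε hε
  have hcomp : IsCompact (range u) := isCompact_range u.continuous
  have h1 := hcomp.uniformContinuousAt_of_continuousAt (fderiv ℝ f)
    (fun a _ => hc.continuousAt) (Metric.dist_mem_uniformity hε)
  obtain ⟨δ, hδ, h2⟩ := Metric.mem_uniformity_dist.1 h1
  filter_upwards [Metric.ball_mem_nhds u hδ] with v hv
  rw [ContinuousMap.norm_le _ (by positivity)]
  intro k
  have hvk : dist (u k) (v k) < δ :=
    (ContinuousMap.dist_apply_le_dist k).trans_lt (by rwa [dist_comm])
  have h3 := (convex_ball (u k) δ).norm_image_sub_le_of_norm_hasFDerivWithin_le'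
    (f := f) (f' := fderiv ℝ f) (φ := fderiv ℝ f (u k)) (C := ε) (x := u k) (y := v k)
    (fun x _ => (hf.differentiable one_ne_zero x).hasFDerivAt.hasFDerivWithinAt)
    (fun x hx => by
      have := @h2 (u k) x (by rw [dist_comm]; exact hx) (mem_range_self k)
      rw [← dist_eq_norm, dist_comm]; exact le_of_lt this)
    (Metric.mem_ball_self hδ) (by rw [Metric.mem_ball, dist_comm]; exact hvk)
  refine (le_of_eq ?_).trans (h3.trans ?_)
  · simp
  · gcongr
    exact (v - u).norm_coe_le_norm k

/-- The derivative of superposition with `f` is superposition with `fderiv ℝ f` followed by the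
bounded map `ptwiseApply`. The induction therefore changes the codomain, which is why the spaces are
quantified inside the statement and live in one universe. -/
lemma contDiff_superposition_nat (n : ℕ) : ∀ {E F : Type} [NormedAddCommGroup E] [NormedSpace ℝ E]
    [NormedAddCommGroup F] [NormedSpace ℝ F] {f : E → F} (_ : ContDiff ℝ n f)
    (hc : Continuous f), ContDiff ℝ n (fun u : C(K, E) => (⟨f, hc⟩ : C(E, F)).comp u) := by
  induction n with
  | zero =>
    intro E F _ _ _ _ f hf hc
    rw [Nat.cast_zero, contDiff_zero]
    exact ContinuousMap.continuous_postcomp _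
  | succ n ih =>
    intro E F _ _ _ _ f hf hc
    have hf1 : ContDiff ℝ 1 f := hf.of_le (by norm_cast; omega)
    have hd : ContDiff ℝ n (fderiv ℝ f) := hf.fderiv_right (by norm_cast)
    rw [Nat.cast_add, Nat.cast_one, contDiff_succ_iff_fderiv]
    refine ⟨fun u => (hasFDerivAt_superposition hf1 u).differentiableAt, by simp, ?_⟩
    have : fderiv ℝ (fun u : C(K, E) => (⟨f, hc⟩ : C(E, F)).comp u) =
        fun u => ptwiseApply K E F ((⟨fderiv ℝ f, hd.continuous⟩ : C(E, E →L[ℝ] F)).comp u) := by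
      ext1 u
      exact (hasFDerivAt_superposition hf1 u).fderiv
    rw [this]
    exact (ptwiseApply K E F).contDiff.comp (ih hd hd.continuous)

/-- The superposition operator `u ↦ f ∘ u` on continuous functions is smooth if `f` is. -/
lemma contDiff_superposition {E F : Type} [NormedAddCommGroup E] [NormedSpace ℝ E]
    [NormedAddCommGroup F] [NormedSpace ℝ F] {f : E → F} (hf : ContDiff ℝ ∞ f) :
    ContDiff ℝ ∞ (fun u : C(K, E) => (⟨f, hf.continuous⟩ : C(E, F)).comp u) :=
  contDiff_infty.2 fun n => contDiff_superposition_nat n (contDiff_infty.1 hf n) hf.continuous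

end Superposition

/-! ### Local flows by the implicit function theorem in C([0, 1], E) -/

section Flow

variable {E : Type} [NormedAddCommGroup E] [NormedSpace ℝ E]

abbrev unitI : Set ℝ := Icc (0 : ℝ) 1

/-- The Volterra operator `u ↦ (r ↦ ∫₀ʳ u)` on `C([0, 1], E)`. -/
def volterra (E : Type) [NormedAddCommGroup E] [NormedSpace ℝ E] :
    C(unitI, E) →L[ℝ] C(unitI, E) :=
  LinearMap.mkContinuous
    { toFun := fun u => ⟨fun r => ∫ τ in (0 : ℝ)..r, u (projIcc 0 1 zero_le_one τ), by
        have : Continuous fun τ : ℝ => u (projIcc 0 1 zero_le_one τ) :=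
          u.continuous.comp continuous_projIcc
        exact (intervalIntegral.continuous_primitive
          (fun a b => this.intervalIntegrable a b) 0).comp continuous_subtype_val⟩
      map_add' := by
        intro u v
        ext r
        have h : ∀ w : C(unitI, E), Continuous fun τ : ℝ => w (projIcc 0 1 zero_le_one τ) :=
          fun w => w.continuous.comp continuous_projIcc
        simpa using intervalIntegral.integral_add ((h u).intervalIntegrable 0 r)
          ((h v).intervalIntegrable 0 r)
      map_smul' := by
        intro c u
        ext r
        simp }
    1 (by
      intro u
      rw [one_mul, ContinuousMap.norm_le _ (by positivity)]
      intro r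
      refine (intervalIntegral.norm_integral_le_of_norm_le_const (C := ‖u‖)
        (fun τ _ => u.norm_coe_le_norm _)).trans ?_
      have h := r.2
      rw [sub_zero, abs_of_nonneg h.1]
      exact mul_le_of_le_one_right (norm_nonneg _) h.2)

lemma volterra_apply (u : C(unitI, E)) (r : unitI) :
    volterra E u r = ∫ τ in (0 : ℝ)..r, u (projIcc 0 1 zero_le_one τ) := rfl

variable [FiniteDimensional ℝ E]

/-- A cutoff: superposition operators need a globally smooth map, whereas vector fields read in
charts are smooth only locally. -/
lemma exists_contDiff_eventuallyEq {F : Type*} [NormedAddCommGroup F] [NormedSpace ℝ F]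
    {f : E → F} {x₀ : E} (hf : ∀ᶠ x in 𝓝 x₀, ContDiffAt ℝ ∞ f x) :
    ∃ f' : E → F, ContDiff ℝ ∞ f' ∧ f' =ᶠ[𝓝 x₀] f := by
  obtain ⟨ε, hε, h⟩ := Metric.eventually_nhds_iff_ball.1 hf
  let b : ContDiffBump x₀ := ⟨ε / 3, ε / 2, by positivity, by linarith⟩
  refine ⟨fun x => b x • f x, ?_, ?_⟩
  · rw [contDiff_iff_contDiffAt]
    intro x
    by_cases hx : x ∈ Metric.ball x₀ ε
    · exact b.contDiff.contDiffAt.smul (h x hx)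
    · have : (fun x => b x • f x) =ᶠ[𝓝 x] fun _ => 0 := by
        have hx' : x ∉ Metric.closedBall x₀ (ε / 2) := fun h' =>
          hx (Metric.closedBall_subset_ball (by linarith) h')
        filter_upwards [Metric.isClosed_closedBall.isOpen_compl.mem_nhds hx'] with y hy
        rw [b.zero_of_le_dist (not_le.1 (by simpa using hy)).le, zero_smul]
      exact contDiffAt_const.congr_of_eventuallyEq this
  · filter_upwards [b.eventuallyEq_one] with x hx
    simp [hx]

/-- A smooth implicit function is smooth near the base point. -/
lemma eventually_contDiffAt_implicit {X W F : Type*} [NormedAddCommGroup X] [NormedSpace ℝ X]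
    [CompleteSpace X] [NormedAddCommGroup W] [NormedSpace ℝ W] [CompleteSpace W]
    [NormedAddCommGroup F] [NormedSpace ℝ F] [CompleteSpace F] {G : X × W → F}
    (hG : ContDiff ℝ ∞ G) {ψ : X → W} {x₀ : X} (hψ : ContDiffAt ℝ ∞ ψ x₀)
    (h0 : ∀ᶠ x in 𝓝 x₀, G (x, ψ x) = 0)
    (hinv : (fderiv ℝ G (x₀, ψ x₀) ∘L .inr ℝ X W).IsInvertible) :
    ∀ᶠ x in 𝓝 x₀, ContDiffAt ℝ ∞ ψ x := by
  have hne : (∞ : ℕ∞ω) ≠ 0 := by simp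
  have hcont : ∀ᶠ x in 𝓝 x₀, ContinuousAt ψ x :=
    ((hψ.of_le (show (1 : ℕ∞ω) ≤ ∞ by norm_cast)).eventually (by simp)).mono
      fun x hx => hx.continuousAt
  have hopen : IsOpen {A : W →L[ℝ] F | A.IsInvertible} := ContinuousLinearEquiv.isOpen
  have hcd : Continuous fun q : X × W => fderiv ℝ G q ∘L .inr ℝ X W :=
    (hG.continuous_fderiv (by simp)).clm_comp continuous_const
  have hinv' : ∀ᶠ x in 𝓝 x₀, (fderiv ℝ G (x, ψ x) ∘L .inr ℝ X W).IsInvertible := by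
    have h1 : ContinuousAt (fun x => fderiv ℝ G (x, ψ x) ∘L .inr ℝ X W) x₀ :=
      ContinuousAt.comp (f := fun x => (x, ψ x)) hcd.continuousAt
        (continuousAt_id.prodMk hψ.continuousAt)
    exact h1.eventually (hopen.mem_nhds hinv)
  filter_upwards [hcont, hinv', h0.eventually_nhds] with x hx hxinv hx0
  have hGat : ContDiffAt ℝ ∞ G (x, ψ x) := hG.contDiffAt
  -- Smoothness of order `∞` at one point gives no common neighbourhood for all finite orders. The
  -- implicit function theorem is therefore applied afresh at `x`, and local uniqueness identifies
  -- its solution with `ψ`.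
  refine (hGat.contDiffAt_implicitFunction hne hxinv).congr_of_eventuallyEq ?_
  have h1 := hGat.eventually_apply_eq_iff_implicitFunction hne hxinv
  have h2 : Filter.Tendsto (fun x' => (x', ψ x')) (𝓝 x) (𝓝 (x, ψ x)) :=
    continuousAt_id.prodMk hx
  filter_upwards [h2.eventually h1, hx0] with x' h3 h4
  exact (h3.1 (by rw [h4, hx0.self_of_nhds])).symm

/-- A smooth vector field has a local flow which is smooth jointly in the initial value and time. -/
theorem exists_contDiffAt_flow {f : E → E} {x₀ : E} (hf : ∀ᶠ x in 𝓝 x₀, ContDiffAt ℝ ∞ f x) :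
    ∃ α : E × ℝ → E, α (x₀, 0) = x₀ ∧
      ∀ᶠ q in 𝓝 (x₀, (0 : ℝ)), ContDiffAt ℝ ∞ α q ∧ α (q.1, 0) = q.1 ∧
        HasDerivAt (fun t => α (q.1, t)) (f (α q)) q.2 := by
  obtain ⟨f', hf', hff'⟩ := exists_contDiff_eventuallyEq hf
  obtain ⟨ε, hε, a, r, L, C, hr, hpl⟩ :=
    IsPicardLindelof.of_contDiffAt_one (f := f') (x₀ := x₀) (hf'.contDiffAt.of_le (by simp))
  obtain ⟨α, hα, hαc⟩ :=
    (hpl 0).exists_forall_mem_closedBall_eq_hasDerivWithinAt_continuousOn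
  simp only [zero_sub, zero_add] at hα hαc
  have hα0 : α (x₀, 0) = x₀ := (hα x₀ (Metric.mem_closedBall_self r.2)).1
  set B : Set (E × ℝ) := Metric.ball x₀ r ×ˢ Ioo (-ε) ε with hB
  have hBo : IsOpen B := Metric.isOpen_ball.prod isOpen_Ioo
  have hB0 : (x₀, (0 : ℝ)) ∈ B := ⟨Metric.mem_ball_self hr, by simpa using hε⟩
  have hcB : ContinuousOn α B :=
    hαc.mono (prod_mono Metric.ball_subset_closedBall Ioo_subset_Icc_self)
  have hder : ∀ x ∈ Metric.ball x₀ r, ∀ t ∈ Ioo (-ε) ε,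
      HasDerivAt (fun t => α (x, t)) (f' (α (x, t))) t := fun x hx t ht =>
    ((hα x (Metric.ball_subset_closedBall hx)).2 t (Ioo_subset_Icc_self ht)).hasDerivAt
      (Icc_mem_nhds ht.1 ht.2)
  -- Rescaled to unit time, the trajectory u(ρ) = α(x, tρ) solves u = x + t ∫₀ f'(u), that is, G((x,
  -- t), u) = 0. At t = 0 the partial derivative in u is the identity, so solutions depend smoothly
  -- on (x, t).
  let G : (E × ℝ) × C(unitI, E) → C(unitI, E) := fun q =>
    q.2 - ContinuousMap.const _ q.1.1 - q.1.2 •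
      volterra E ((⟨f', hf'.continuous⟩ : C(E, E)).comp q.2)
  let u₀ : C(unitI, E) := ContinuousMap.const _ x₀
  let constL : E →L[ℝ] C(unitI, E) := ContinuousLinearMap.const ℝ unitI
  have hG : ContDiff ℝ ∞ G := by
    have h1 : ContDiff ℝ ∞ fun q : (E × ℝ) × C(unitI, E) =>
        volterra E ((⟨f', hf'.continuous⟩ : C(E, E)).comp q.2) :=
      (volterra E).contDiff.comp ((contDiff_superposition hf').comp contDiff_snd)
    have h2 : ContDiff ℝ ∞ fun q : (E × ℝ) × C(unitI, E) => constL q.1.1 :=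
      constL.contDiff.comp (contDiff_fst.comp contDiff_fst)
    exact (contDiff_snd.sub h2).sub ((contDiff_snd.comp contDiff_fst).smul h1)
  have hG0 : G ((x₀, 0), u₀) = 0 := by simp [G, u₀]
  have hpart : fderiv ℝ G ((x₀, 0), u₀) ∘L .inr ℝ (E × ℝ) C(unitI, E) =
      ContinuousLinearMap.id ℝ _ := by
    have h1 := (hG.differentiable (by simp) ((x₀, 0), u₀)).hasFDerivAt.comp u₀
      (hasFDerivAt_prodMk_right (x₀, (0 : ℝ)) u₀)
    have h2 : HasFDerivAt (G ∘ fun u => ((x₀, (0 : ℝ)), u)) (ContinuousLinearMap.id ℝ _) u₀ := by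
      have : (G ∘ fun u => ((x₀, (0 : ℝ)), u)) = fun u => u - ContinuousMap.const _ x₀ := by
        ext u r
        simp [G]
      rw [this]
      exact (hasFDerivAt_id u₀).sub_const _
    exact h1.unique h2
  have hinv : (fderiv ℝ G ((x₀, 0), u₀) ∘L .inr ℝ (E × ℝ) C(unitI, E)).IsInvertible := by
    rw [hpart]
    exact ⟨ContinuousLinearEquiv.refl ℝ _, rfl⟩
  have hGat : ContDiffAt ℝ ∞ G ((x₀, 0), u₀) := hG.contDiffAt
  have hne : (∞ : ℕ∞ω) ≠ 0 := by simp
  let ψ := hGat.implicitFunction hne hinv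
  have hψ : ContDiffAt ℝ ∞ ψ (x₀, 0) := hGat.contDiffAt_implicitFunction hne hinv
  have hψeq := hGat.eventually_apply_eq_iff_implicitFunction hne hinv
  -- the rescaled trajectories
  have hmem : ∀ q ∈ B, ∀ ρ : unitI, ((q.1, q.2 * ρ) : E × ℝ) ∈ B := by
    rintro ⟨x, t⟩ ⟨hx, ht⟩ ⟨ρ, hρ⟩
    refine ⟨hx, ?_⟩
    have h1 : |t| < ε := abs_lt.2 ht
    refine abs_lt.1 ?_
    calc |t * ρ| = |t| * ρ := by rw [abs_mul, abs_of_nonneg hρ.1]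
      _ ≤ |t| := mul_le_of_le_one_right (abs_nonneg _) hρ.2
      _ < ε := h1
  let traj : B → C(unitI, E) := fun q =>
    ⟨fun ρ => α (q.1.1, q.1.2 * ρ), by
      refine hcB.comp_continuous (by fun_prop) (fun ρ => hmem _ q.2 ρ)⟩
  have htrajc : Continuous traj := by
    refine ContinuousMap.continuous_of_continuous_uncurry _ ?_
    refine hcB.comp_continuous (f := fun q : B × unitI => (q.1.1.1, q.1.1.2 * q.2))
      (by fun_prop) (fun q => hmem _ q.1.2 q.2)
  have htraj0 : traj ⟨_, hB0⟩ = u₀ := by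
    ext ρ
    simp [traj, u₀, hα0]
  have hGtraj : ∀ q : B, G (q.1, traj q) = 0 := by
    rintro ⟨⟨x, t⟩, hq⟩
    ext ρ
    have hint : t • ∫ τ in (0 : ℝ)..ρ, f' (α (x, t * τ)) = α (x, t * ρ) - α (x, t * 0) := by
      have hd : ∀ τ ∈ uIcc (0 : ℝ) ρ,
          HasDerivAt (fun τ => α (x, t * τ)) (t • f' (α (x, t * τ))) τ := by
        intro τ hτ
        rw [uIcc_of_le ρ.2.1] at hτ
        have hτ1 : τ ∈ unitI := ⟨hτ.1, hτ.2.trans ρ.2.2⟩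
        have := (hder x hq.1 (t * τ) (hmem _ hq ⟨τ, hτ1⟩).2)
        have h2 : HasDerivAt (fun τ : ℝ => t * τ) t τ := by
          simpa using (hasDerivAt_id τ).const_mul t
        exact this.scomp τ h2
      rw [← intervalIntegral.integral_smul]
      refine intervalIntegral.integral_eq_sub_of_hasDerivAt hd ?_
      refine ContinuousOn.intervalIntegrable ?_
      refine continuousOn_const.smul (hf'.continuous.comp_continuousOn ?_)
      refine hcB.comp (by fun_prop) ?_
      intro τ hτ
      rw [uIcc_of_le ρ.2.1] at hτ
      exact hmem _ hq ⟨τ, ⟨hτ.1, hτ.2.trans ρ.2.2⟩⟩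
    have hcongr : (∫ τ in (0 : ℝ)..ρ, f' (α (x, t * (projIcc 0 1 zero_le_one τ : unitI)))) =
        ∫ τ in (0 : ℝ)..ρ, f' (α (x, t * τ)) := by
      refine intervalIntegral.integral_congr fun τ hτ => ?_
      rw [uIcc_of_le ρ.2.1] at hτ
      rw [projIcc_of_mem zero_le_one ⟨hτ.1, hτ.2.trans ρ.2.2⟩]
    have hx0 : α (x, 0) = x := (hα x (Metric.ball_subset_closedBall hq.1)).1
    have hv : volterra E ((⟨f', hf'.continuous⟩ : C(E, E)).comp (traj ⟨(x, t), hq⟩)) ρ =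
        ∫ τ in (0 : ℝ)..ρ, f' (α (x, t * τ)) := by
      rw [volterra_apply, ← hcongr]
      rfl
    simp only [G, ContinuousMap.sub_apply, ContinuousMap.const_apply, ContinuousMap.smul_apply,
      ContinuousMap.zero_apply]
    rw [hv, hint, mul_zero, hx0]
    simp [traj]
  -- Joint continuity of `α` keeps `traj q` close to `u₀`, where the zero of `G` is unique.
  -- Evaluation at ρ = 1 recovers `α` from the implicit function.
  have hαψ : α =ᶠ[𝓝 (x₀, (0 : ℝ))] fun q => ψ q ⟨1, by simp⟩ := by
    have hten : Filter.Tendsto (fun q : B => (q.1, traj q)) (𝓝 ⟨_, hB0⟩)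
        (𝓝 ((x₀, (0 : ℝ)), u₀)) := by
      have : Continuous fun q : B => (q.1, traj q) := continuous_subtype_val.prodMk htrajc
      have h := this.tendsto ⟨_, hB0⟩
      rwa [htraj0] at h
    have h1 := hten.eventually hψeq
    rw [nhds_subtype, Filter.eventually_comap] at h1
    filter_upwards [h1, hBo.mem_nhds hB0] with q hq hqB
    have h2 := hq ⟨q, hqB⟩ rfl
    have h3 : ψ q = traj ⟨q, hqB⟩ := h2.1 (by rw [hGtraj, hG0])
    rw [h3]
    simp [traj]
  have hψev : ∀ᶠ q in 𝓝 (x₀, (0 : ℝ)), ContDiffAt ℝ ∞ ψ q := by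
    have hψ0 : ψ (x₀, 0) = u₀ := hGat.implicitFunction_apply_self hne hinv
    refine eventually_contDiffAt_implicit hG hψ ?_ (by rw [hψ0]; exact hinv)
    filter_upwards [hGat.eventually_apply_implicitFunction hne hinv] with q hq
    rw [← hG0]
    exact hq
  have hαsm : ∀ᶠ q in 𝓝 (x₀, (0 : ℝ)), ContDiffAt ℝ ∞ α q := by
    filter_upwards [hψev, hαψ.eventuallyEq_nhds] with q hq hqe
    refine ContDiffAt.congr_of_eventuallyEq ?_ hqe
    exact (ContinuousMap.evalCLM ℝ (⟨1, by simp⟩ : unitI)).contDiff.contDiffAt.comp _ hq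
  refine ⟨α, hα0, ?_⟩
  · have hcα : ContinuousAt α (x₀, 0) := hcB.continuousAt (hBo.mem_nhds hB0)
    have hev : ∀ᶠ q in 𝓝 (x₀, (0 : ℝ)), f' (α q) = f (α q) :=
      hcα.eventually (by rw [hα0]; exact hff')
    filter_upwards [hαsm, hev, hBo.mem_nhds hB0] with q hqs hq hqB
    refine ⟨hqs, (hα q.1 (Metric.ball_subset_closedBall hqB.1)).1, ?_⟩
    rw [← hq]
    exact hder q.1 hqB.1 q.2 hqB.2

end Flow

/-! ### Christoffel symbols of a metric on an open set of a vector space -/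

section ChartGeometry

variable {E : Type*} [NormedAddCommGroup E] [NormedSpace ℝ E]

/-- `C` is the Christoffel map at `y` of the bilinear form field `G`. -/
def IsChristoffel (G : E → E →L[ℝ] E →L[ℝ] ℝ) (y : E) (C : E →L[ℝ] E →L[ℝ] E) : Prop :=
  ∀ u v w, G y (C u v) w =
    (1 / 2) * (fderiv ℝ G y u v w + fderiv ℝ G y v u w - fderiv ℝ G y w u v)

/-- The Christoffel map of a bilinear form field. -/
def chr (G : E → E →L[ℝ] E →L[ℝ] ℝ) (y : E) : E →L[ℝ] E →L[ℝ] E :=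
  (ContinuousLinearMap.compL ℝ E (E →L[ℝ] ℝ) E (ContinuousLinearMap.inverse (G y))).comp
    ((1 / 2 : ℝ) • (fderiv ℝ G y + (fderiv ℝ G y).flip -
      ((ContinuousLinearMap.flipₗᵢ ℝ E E ℝ).toContinuousLinearEquiv :
        (E →L[ℝ] E →L[ℝ] ℝ) →L[ℝ] (E →L[ℝ] E →L[ℝ] ℝ)).comp (fderiv ℝ G y).flip))

lemma isChristoffel_chr {G : E → E →L[ℝ] E →L[ℝ] ℝ} {y : E} (h : (G y).IsInvertible) :
    IsChristoffel G y (chr G y) := by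
  intro u v w
  obtain ⟨e, he⟩ := h
  have h1 : ∀ f, G y ((G y).inverse f) = f := by
    intro f
    rw [← he, ContinuousLinearMap.inverse_equiv]
    simp
  simp only [chr, ContinuousLinearMap.comp_apply, ContinuousLinearMap.compL_apply, h1]
  simp

lemma contDiffAt_chr [CompleteSpace E] {G : E → E →L[ℝ] E →L[ℝ] ℝ} {y : E}
    (hG : ContDiffAt ℝ ∞ G y) (h : (G y).IsInvertible) : ContDiffAt ℝ ∞ (chr G) y := by
  have hd : ContDiffAt ℝ ∞ (fderiv ℝ G) y := hG.fderiv_right (by simp)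
  have hf : ContDiffAt ℝ ∞ (fun y => (fderiv ℝ G y).flip) y :=
    (ContinuousLinearMap.flipₗᵢ ℝ E E (E →L[ℝ] ℝ)).contDiff.contDiffAt.comp y hd
  have hinv : ContDiffAt ℝ ∞ (fun y => (G y).inverse) y := by
    obtain ⟨e, he⟩ := h
    exact ContDiffAt.comp y (he ▸ contDiffAt_map_inverse e) hG
  refine ContDiffAt.clm_comp ?_ ?_
  · exact (ContinuousLinearMap.compL ℝ E (E →L[ℝ] ℝ) E).contDiff.contDiffAt.comp y hinv
  · refine ContDiffAt.const_smul (1 / 2 : ℝ) ((hd.add hf).sub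
      ((ContinuousLinearMap.compL ℝ E (E →L[ℝ] E →L[ℝ] ℝ) (E →L[ℝ] E →L[ℝ] ℝ)
        ((ContinuousLinearMap.flipₗᵢ ℝ E E ℝ).toContinuousLinearEquiv :
        (E →L[ℝ] E →L[ℝ] ℝ) →L[ℝ] (E →L[ℝ] E →L[ℝ] ℝ))).contDiff.contDiffAt.comp y hf))

lemma isInvertible_of_nondegenerate [FiniteDimensional ℝ E] {B : E →L[ℝ] E →L[ℝ] ℝ}
    (h : ∀ v, (∀ w, B v w = 0) → v = 0) : B.IsInvertible := by
  have hinj : Function.Injective B := by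
    rw [injective_iff_map_eq_zero]
    intro v hv
    exact h v fun w => by rw [hv]; rfl
  have hd : Module.finrank ℝ E = Module.finrank ℝ (E →L[ℝ] ℝ) := by
    rw [← (LinearMap.toContinuousLinearMap (𝕜 := ℝ) (E := E) (F' := ℝ)).finrank_eq]
    exact (Subspace.dual_finrank_eq).symm
  let e := LinearEquiv.ofInjectiveOfFinrankEq (B : E →ₗ[ℝ] E →L[ℝ] ℝ) hinj hd
  exact ⟨e.toContinuousLinearEquiv, by ext; rfl⟩

variable {G : E → E →L[ℝ] E →L[ℝ] ℝ} {y : E} {C : E →L[ℝ] E →L[ℝ] E}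

lemma fderiv_symm_of_eventually (hG : DifferentiableAt ℝ G y)
    (hs : ∀ᶠ y' in 𝓝 y, ∀ u v, G y' u v = G y' v u) (a u v : E) :
    fderiv ℝ G y a u v = fderiv ℝ G y a v u := by
  have h1 : ∀ u v, HasFDerivAt (fun y' => G y' u v)
      ((fderiv ℝ G y).flip u |>.flip v) y := by
    intro u v
    have := (hG.hasFDerivAt.clm_apply (hasFDerivAt_const u y)).clm_apply (hasFDerivAt_const v y)
    refine this.congr_fderiv ?_
    ext w
    simp
  have h2 := (h1 u v).unique ((h1 v u).congr_of_eventuallyEq (hs.mono fun y' h => h u v))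
  simpa using congrArg (fun f => f a) h2

lemma IsChristoffel.symm (hC : IsChristoffel G y C) (hG : DifferentiableAt ℝ G y)
    (hs : ∀ᶠ y' in 𝓝 y, ∀ u v, G y' u v = G y' v u)
    (hn : ∀ v, (∀ w, G y v w = 0) → v = 0) (u v : E) : C u v = C v u := by
  refine sub_eq_zero.1 (hn _ fun w => ?_)
  rw [map_sub, sub_apply, hC, hC, fderiv_symm_of_eventually hG hs w u v]
  ring

lemma IsChristoffel.compat (hC : IsChristoffel G y C) (hG : DifferentiableAt ℝ G y)
    (hs : ∀ᶠ y' in 𝓝 y, ∀ u v, G y' u v = G y' v u) (v a b : E) :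
    fderiv ℝ G y v a b = G y (C v a) b + G y a (C v b) := by
  rw [hs.self_of_nhds a (C v b), hC, hC, fderiv_symm_of_eventually hG hs v b a,
    fderiv_symm_of_eventually hG hs a v b, fderiv_symm_of_eventually hG hs b v a]
  ring

/-- The transformation law of Christoffel maps under a change of coordinates. -/
lemma IsChristoffel.transform {E' : Type*} [NormedAddCommGroup E'] [NormedSpace ℝ E']
    {G' : E' → E' →L[ℝ] E' →L[ℝ] ℝ} {C' : E' →L[ℝ] E' →L[ℝ] E'} {ψ : E → E'}
    (hψ : ContDiffAt ℝ 2 ψ y) (hG' : DifferentiableAt ℝ G' (ψ y))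
    (hs : ∀ u v, G' (ψ y) u v = G' (ψ y) v u)
    (hn : ∀ v, (∀ w, G' (ψ y) v w = 0) → v = 0)
    (hsurj : Function.Surjective (fderiv ℝ ψ y))
    (hpull : ∀ᶠ y' in 𝓝 y, ∀ u v, G y' u v = G' (ψ y') (fderiv ℝ ψ y' u) (fderiv ℝ ψ y' v))
    (hGd : DifferentiableAt ℝ G y)
    (hC : IsChristoffel G y C) (hC' : IsChristoffel G' (ψ y) C') (u v : E) :
    fderiv ℝ ψ y (C u v) =
      C' (fderiv ℝ ψ y u) (fderiv ℝ ψ y v) + fderiv ℝ (fderiv ℝ ψ) y u v := by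
  have hsymm : ∀ u v, fderiv ℝ (fderiv ℝ ψ) y u v = fderiv ℝ (fderiv ℝ ψ) y v u := fun u v =>
    (hψ.isSymmSndFDerivAt (by simp)) u v
  have hψd : DifferentiableAt ℝ ψ y := hψ.differentiableAt (by simp)
  have hψ2 : DifferentiableAt ℝ (fderiv ℝ ψ) y :=
    (hψ.fderiv_right (m := 1) (by norm_num)).differentiableAt (by simp)
  -- This is the derivative of the pullback identity. Its terms with second derivatives of `ψ`
  -- produce the inhomogeneous term of the transformation law once they are combined in the Koszul
  -- formula.
  have hder : ∀ a b c, fderiv ℝ G y a b c =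
      fderiv ℝ G' (ψ y) (fderiv ℝ ψ y a) (fderiv ℝ ψ y b) (fderiv ℝ ψ y c) +
      G' (ψ y) (fderiv ℝ (fderiv ℝ ψ) y a b) (fderiv ℝ ψ y c) +
      G' (ψ y) (fderiv ℝ ψ y b) (fderiv ℝ (fderiv ℝ ψ) y a c) := by
    intro a b c
    have h1 := (hGd.hasFDerivAt.clm_apply (hasFDerivAt_const b y)).clm_apply
      (hasFDerivAt_const c y)
    have h2 := ((hG'.hasFDerivAt.comp y hψd.hasFDerivAt).clm_apply
      (hψ2.hasFDerivAt.clm_apply (hasFDerivAt_const b y))).clm_apply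
      (hψ2.hasFDerivAt.clm_apply (hasFDerivAt_const c y))
    have h3 := h1.unique (h2.congr_of_eventuallyEq (hpull.mono fun y' h => h b c))
    have h4 := congrArg (fun f => f a) h3
    simp at h4
    rw [h4]
    ring
  refine sub_eq_zero.1 (hn _ fun w' => ?_)
  obtain ⟨w, rfl⟩ := hsurj w'
  have h5 := hpull.self_of_nhds (C u v) w
  rw [hC, hder, hder, hder] at h5
  simp only [map_sub, map_add, sub_apply, add_apply]
  rw [← h5, hC', hsymm v u, hsymm w u, hsymm w v,
    hs (fderiv ℝ ψ y v) (fderiv ℝ (fderiv ℝ ψ) y u w)]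
  ring

/-- The covariant derivative along a curve is independent of the coordinates. -/
lemma covDeriv_transform {E' : Type*} [NormedAddCommGroup E'] [NormedSpace ℝ E']
    {C' : E' →L[ℝ] E' →L[ℝ] E'} {ψ : E → E'} {c V : ℝ → E} {s : ℝ} {v V' : E}
    (hψ : ContDiffAt ℝ 2 ψ (c s))
    (hC : ∀ u v, fderiv ℝ ψ (c s) (C u v) =
      C' (fderiv ℝ ψ (c s) u) (fderiv ℝ ψ (c s) v) + fderiv ℝ (fderiv ℝ ψ) (c s) u v)
    (hc : HasDerivAt c v s) (hV : HasDerivAt V V' s) :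
    deriv (fun r => fderiv ℝ ψ (c r) (V r)) s +
      C' (deriv (fun r => ψ (c r)) s) (fderiv ℝ ψ (c s) (V s)) =
      fderiv ℝ ψ (c s) (V' + C v (V s)) := by
  have hψd : DifferentiableAt ℝ ψ (c s) := hψ.differentiableAt (by simp)
  have hψ2 : DifferentiableAt ℝ (fderiv ℝ ψ) (c s) :=
    (hψ.fderiv_right (m := 1) (by norm_num)).differentiableAt (by simp)
  have h1 : HasDerivAt (fun r => fderiv ℝ ψ (c r) (V r))
      (fderiv ℝ (fderiv ℝ ψ) (c s) v (V s) + fderiv ℝ ψ (c s) V') s :=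
    (hψ2.hasFDerivAt.comp_hasDerivAt s hc).clm_apply hV
  have h2 : HasDerivAt (fun r => ψ (c r)) (fderiv ℝ ψ (c s) v) s :=
    hψd.hasFDerivAt.comp_hasDerivAt s hc
  rw [h1.deriv, h2.deriv, map_add, hC]
  abel

/-- Metric compatibility along a curve. -/
lemma hasDerivAt_metric {c a b : ℝ → E} {s : ℝ} {v a' b' : E}
    (hG : DifferentiableAt ℝ G (c s))
    (hs : ∀ᶠ y' in 𝓝 (c s), ∀ u v, G y' u v = G y' v u) (hC : IsChristoffel G (c s) C)
    (hc : HasDerivAt c v s) (ha : HasDerivAt a a' s) (hb : HasDerivAt b b' s) :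
    HasDerivAt (fun r => G (c r) (a r) (b r))
      (G (c s) (a' + C v (a s)) (b s) + G (c s) (a s) (b' + C v (b s))) s := by
  have h := ((hG.hasFDerivAt.comp_hasDerivAt s hc).clm_apply ha).clm_apply hb
  refine h.congr_deriv ?_
  have := hC.compat hG hs v (a s) (b s)
  simp only [map_add, add_apply, Function.comp_apply, this]
  ring

/-- The Wronskian of two solutions of the linearised geodesic equation has zero derivative. -/
lemma hasDerivAt_wronskian {Γ : E → E →L[ℝ] E →L[ℝ] E} {c v J₁ K₁ J₂ K₂ : ℝ → E} {s : ℝ}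
    (hG : ContDiffAt ℝ 2 G (c s)) (hΓ : DifferentiableAt ℝ Γ (c s))
    (hs : ∀ᶠ y' in 𝓝 (c s), ∀ u v, G y' u v = G y' v u)
    (hC : ∀ᶠ y' in 𝓝 (c s), IsChristoffel G y' (Γ y'))
    (hc : HasDerivAt c (v s) s) (hv : HasDerivAt v (-Γ (c s) (v s) (v s)) s)
    (hJ₁ : HasDerivAt J₁ (K₁ s) s) (hJ₂ : HasDerivAt J₂ (K₂ s) s)
    (hK₁ : HasDerivAt K₁
      (-((2 : ℝ) • Γ (c s) (v s) (K₁ s) + fderiv ℝ Γ (c s) (J₁ s) (v s) (v s))) s)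
    (hK₂ : HasDerivAt K₂
      (-((2 : ℝ) • Γ (c s) (v s) (K₂ s) + fderiv ℝ Γ (c s) (J₂ s) (v s) (v s))) s) :
    HasDerivAt (fun r => G (c r) (K₁ r + Γ (c r) (v r) (J₁ r)) (J₂ r)
      - G (c r) (J₁ r) (K₂ r + Γ (c r) (v r) (J₂ r))) 0 s := by
  have hGd : ∀ᶠ y' in 𝓝 (c s), DifferentiableAt ℝ G y' := by
    filter_upwards [hG.eventually (by simp)] with y' h using h.differentiableAt (by simp)
  have hG1 : DifferentiableAt ℝ G (c s) := hGd.self_of_nhds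
  have hG2 : DifferentiableAt ℝ (fderiv ℝ G) (c s) :=
    (hG.fderiv_right (m := 1) (by norm_num)).differentiableAt (by simp)
  have hss := hs.eventually_nhds
  -- By the Koszul formula the Christoffel terms reduce to first derivatives of `G`, since the parts
  -- symmetric in J₁ and J₂ cancel. Differentiating this form needs only symmetry of second
  -- derivatives, and no curvature identities.
  have hev : (fun r => G (c r) (K₁ r + Γ (c r) (v r) (J₁ r)) (J₂ r)
      - G (c r) (J₁ r) (K₂ r + Γ (c r) (v r) (J₂ r))) =ᶠ[𝓝 s]
      fun r => G (c r) (K₁ r) (J₂ r) - G (c r) (J₁ r) (K₂ r) +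
        (fderiv ℝ G (c r) (J₁ r) (v r) (J₂ r) - fderiv ℝ G (c r) (J₂ r) (v r) (J₁ r)) := by
    filter_upwards [hc.continuousAt.eventually hGd, hc.continuousAt.eventually hss,
      hc.continuousAt.eventually hC] with r h1 h2 h3
    have h4 := h3 (v r) (J₁ r) (J₂ r)
    have h5 := h3 (v r) (J₂ r) (J₁ r)
    have h6 := fderiv_symm_of_eventually h1 h2 (v r) (J₁ r) (J₂ r)
    simp only [map_add, add_apply]
    rw [h2.self_of_nhds (J₁ r) (Γ (c r) (v r) (J₂ r)), h4, h5, h6]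
    ring
  refine HasDerivAt.congr_of_eventuallyEq ?_ hev
  have hGc := hG1.hasFDerivAt.comp_hasDerivAt s hc
  have hGGc := hG2.hasFDerivAt.comp_hasDerivAt s hc
  have d1 := (hGc.clm_apply hK₁).clm_apply hJ₂
  have d2 := (hGc.clm_apply hJ₁).clm_apply hK₂
  have d3 := ((hGGc.clm_apply hJ₁).clm_apply hv).clm_apply hJ₂
  have d4 := ((hGGc.clm_apply hJ₂).clm_apply hv).clm_apply hJ₁
  have D := (d1.sub d2).add (d3.sub d4)
  refine D.congr_deriv ?_
  have hC0 := hC.self_of_nhds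
  have hs0 := hs.self_of_nhds
  -- the derivative of the defining identity of the Christoffel map
  have key : ∀ a w, G (c s) (fderiv ℝ Γ (c s) a (v s) (v s)) w =
      fderiv ℝ (fderiv ℝ G) (c s) a (v s) (v s) w
      - (1 / 2) * fderiv ℝ (fderiv ℝ G) (c s) a w (v s) (v s)
      - fderiv ℝ G (c s) a (Γ (c s) (v s) (v s)) w := by
    intro a w
    set p := v s with hp
    have e1 := (hG1.hasFDerivAt.clm_apply ((hΓ.hasFDerivAt.clm_apply
      (hasFDerivAt_const p (c s))).clm_apply (hasFDerivAt_const p (c s)))).clm_apply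
      (hasFDerivAt_const w (c s))
    have e2 := ((hG2.hasFDerivAt.clm_apply (hasFDerivAt_const p (c s))).clm_apply
      (hasFDerivAt_const p (c s))).clm_apply (hasFDerivAt_const w (c s))
    have e3 := ((hG2.hasFDerivAt.clm_apply (hasFDerivAt_const w (c s))).clm_apply
      (hasFDerivAt_const p (c s))).clm_apply (hasFDerivAt_const p (c s))
    have e4 := e1.unique ((e2.sub (e3.const_mul (1 / 2))).congr_of_eventuallyEq
      (hC.mono fun y' h => by
        have := h p p w
        simp only [Pi.sub_apply]
        rw [this]
        ring))
    have e5 := congrArg (fun f => f a) e4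
    simp at e5
    linarith
  have hsym2 : ∀ a b x z, fderiv ℝ (fderiv ℝ G) (c s) a b x z =
      fderiv ℝ (fderiv ℝ G) (c s) b a x z := by
    intro a b x z
    rw [(hG.isSymmSndFDerivAt (by simp)) a b]
  have ks := fun a x w => fderiv_symm_of_eventually hG1 hs a x w
  have c1 := hC0 (v s) (K₁ s) (J₂ s)
  have c2 := hC0 (v s) (K₂ s) (J₁ s)
  have k1 := key (J₁ s) (J₂ s)
  have k2 := key (J₂ s) (J₁ s)
  simp only [Function.comp, map_neg, map_add, map_smul, neg_apply,
    add_apply, smul_apply, smul_eq_mul]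
  rw [hs0 (J₁ s) (Γ (c s) (v s) (K₂ s)), hs0 (J₁ s) (fderiv ℝ Γ (c s) (J₂ s) (v s) (v s)),
    c1, c2, k1, k2, hsym2 (J₂ s) (J₁ s), hsym2 (J₂ s) (v s), hsym2 (J₁ s) (v s),
    hs0 (K₁ s) (K₂ s), ks (v s) (J₁ s) (K₂ s)]
  ring

end ChartGeometry

/-! ### The metric and the covariant derivative in a chart -/

section Charts

variable {n : ℕ} {M : Type*} [TopologicalSpace M] [ChartedSpace (Euc (n + 1)) M]
  [IsManifold (𝓡 (n + 1)) ∞ M]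

/-- The chart centred at `x₀`. -/
abbrev lchart (x₀ : M) : PartialEquiv M (Euc (n + 1)) := extChartAt (𝓡 (n + 1)) x₀

/-- `toChart` as a continuous linear map. -/
def toChartL (x₀ x : M) : Euc (n + 1) →L[ℝ] Euc (n + 1) :=
  mfderiv (𝓡 (n + 1)) 𝓘(ℝ, Euc (n + 1)) (extChartAt (𝓡 (n + 1)) x₀) x

/-- `ofChart` as a continuous linear map. -/
def ofChartL (x₀ : M) (y : Euc (n + 1)) : Euc (n + 1) →L[ℝ] Euc (n + 1) :=
  mfderiv 𝓘(ℝ, Euc (n + 1)) (𝓡 (n + 1)) (extChartAt (𝓡 (n + 1)) x₀).symm y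

lemma isOpen_lchart_source (x₀ : M) : IsOpen (lchart (n := n) x₀).source := isOpen_extChartAt_source
    x₀

lemma isOpen_lchart_target (x₀ : M) : IsOpen (lchart (n := n) x₀).target := isOpen_extChartAt_target
    x₀

lemma mem_lchart_source (x₀ : M) : x₀ ∈ (lchart (n := n) x₀).source := mem_extChartAt_source x₀

lemma toChart_eq (x₀ x : M) (v : TangentSpace (𝓡 (n + 1)) x) :
    toChart x₀ x v = toChartL x₀ x v := rfl

lemma ofChartL_eq (x₀ x : M) :
    ofChartL (n := n) x₀ (lchart x₀ x) =
      mfderivWithin 𝓘(ℝ, Euc (n + 1)) (𝓡 (n + 1)) (extChartAt (𝓡 (n + 1)) x₀).symm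
        (range (𝓡 (n + 1))) (extChartAt (𝓡 (n + 1)) x₀ x) := by
  rw [ModelWithCorners.range_eq_univ, mfderivWithin_univ]
  rfl

lemma ofChartL_toChartL {x₀ x : M} (hx : x ∈ (lchart (n := n) x₀).source) (v : Euc (n + 1)) :
    ofChartL x₀ (lchart x₀ x) (toChartL x₀ x v) = v := by
  rw [ofChartL_eq]
  have := mfderivWithin_extChartAt_symm_comp_mfderiv_extChartAt' (I := 𝓡 (n + 1))
    (M := M) (x := x₀) (y := x) hx
  exact congrArg (fun f => f v) this

lemma toChartL_ofChartL {x₀ x : M} (hx : x ∈ (lchart (n := n) x₀).source) (v : Euc (n + 1)) :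
    toChartL x₀ x (ofChartL x₀ (lchart x₀ x) v) = v := by
  rw [ofChartL_eq]
  have := mfderiv_extChartAt_comp_mfderivWithin_extChartAt_symm' (I := 𝓡 (n + 1))
    (M := M) (x := x₀) (y := x) hx
  exact congrArg (fun f => f v) this

lemma toChartL_injective {x₀ x : M} (hx : x ∈ (lchart (n := n) x₀).source) :
    Function.Injective (toChartL (n := n) x₀ x) :=
  Function.LeftInverse.injective (ofChartL_toChartL hx)

lemma toChartL_surjective {x₀ x : M} (hx : x ∈ (lchart (n := n) x₀).source) :
    Function.Surjective (toChartL (n := n) x₀ x) :=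
  Function.RightInverse.surjective (toChartL_ofChartL hx)

/-- The metric in the chart centred at `x₀`. -/
def chartMetric (g : LorentzianMetric n M) (x₀ : M) (y : Euc (n + 1)) :
    Euc (n + 1) →L[ℝ] Euc (n + 1) →L[ℝ] ℝ :=
  ContinuousLinearMap.bilinearComp
    (g.form ((lchart x₀).symm y) : Euc (n + 1) →L[ℝ] Euc (n + 1) →L[ℝ] ℝ)
    (ofChartL x₀ y) (ofChartL x₀ y)

lemma chartMetric_apply (g : LorentzianMetric n M) (x₀ : M) (y v w : Euc (n + 1)) :
    chartMetric g x₀ y v w = g.form ((lchart x₀).symm y) (ofChart x₀ y v) (ofChart x₀ y w) := rfl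

lemma gram_eq (g : LorentzianMetric n M) (x₀ : M) (y : Euc (n + 1)) (i j : Fin (n + 1)) :
    gram g x₀ y i j = chartMetric g x₀ y (stdVec (n + 1) i) (stdVec (n + 1) j) := rfl

lemma form_eq_chartMetric (g : LorentzianMetric n M) {x₀ x : M}
    (hx : x ∈ (lchart (n := n) x₀).source) (v w : TangentSpace (𝓡 (n + 1)) x) :
    g.form x v w = chartMetric g x₀ (lchart x₀ x) (toChart x₀ x v) (toChart x₀ x w) := by
  have h1 : ∀ x' : M, x' = x → ∀ v' w' : Euc (n + 1), v' = v → w' = w →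
      g.form x' v' w' = g.form x v w := by
    rintro x' rfl v' w' rfl rfl
    rfl
  exact (h1 _ ((lchart x₀).left_inv hx) _ _ (ofChartL_toChartL hx v) (ofChartL_toChartL hx w)).symm

lemma form_nondegenerate (g : LorentzianMetric n M) (x : M) (v : TangentSpace (𝓡 (n + 1)) x)
    (h : ∀ w, g.form x v w = 0) : v = 0 := by
  obtain ⟨b, hb⟩ := g.signature x
  refine b.ext_elem_iff.2 fun i => ?_
  have h1 := h (b i)
  rw [← b.sum_repr v] at h1
  simp only [map_sum, map_smul, sum_apply, smul_apply, hb, smul_eq_mul] at h1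
  have h2 : b.repr v i * (if i = 0 then -1 else 1) = 0 := by
    simpa using h1
  rcases mul_eq_zero.1 h2 with h3 | h3
  · simp [h3]
  · split_ifs at h3 <;> norm_num at h3

lemma chartMetric_symm (g : LorentzianMetric n M) (x₀ : M) (y u v : Euc (n + 1)) :
    chartMetric g x₀ y u v = chartMetric g x₀ y v u := g.symm _ _ _

lemma lchart_symm_mem {x₀ : M} {y : Euc (n + 1)} (hy : y ∈ (lchart x₀).target) :
    (lchart x₀).symm y ∈ (lchart (n := n) x₀).source := (lchart x₀).map_target hy

lemma chartMetric_nondegenerate (g : LorentzianMetric n M) {x₀ : M} {y : Euc (n + 1)}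
    (hy : y ∈ (lchart x₀).target) (v : Euc (n + 1)) (h : ∀ w, chartMetric g x₀ y v w = 0) :
    v = 0 := by
  have hx := lchart_symm_mem hy
  have hy' : lchart x₀ ((lchart x₀).symm y) = y := (lchart x₀).right_inv hy
  have h1 : (ofChartL x₀ y v) = 0 := by
    refine form_nondegenerate g ((lchart x₀).symm y) _ fun w => ?_
    have h2 := h (toChartL x₀ ((lchart x₀).symm y) w)
    rw [chartMetric_apply] at h2
    have h3 := ofChartL_toChartL hx w
    rw [hy'] at h3
    have h4 : ofChart x₀ y (toChartL x₀ ((lchart x₀).symm y) w) = w := h3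
    rw [h4] at h2
    exact h2
  have h5 := toChartL_ofChartL hx v
  rw [hy', h1, map_zero] at h5
  exact h5.symm

lemma isInvertible_chartMetric (g : LorentzianMetric n M) {x₀ : M} {y : Euc (n + 1)}
    (hy : y ∈ (lchart x₀).target) : (chartMetric g x₀ y).IsInvertible :=
  isInvertible_of_nondegenerate (chartMetric_nondegenerate g hy)

lemma trivializationAt_tangent {x₀ x : M} (hx : x ∈ (lchart (n := n) x₀).source)
    (v : TangentSpace (𝓡 (n + 1)) x) :
    (trivializationAt (Euc (n + 1)) (TangentSpace (𝓡 (n + 1))) x₀ ⟨x, v⟩).2 = toChart x₀ x v := by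
  rw [extChartAt_source] at hx
  have h := TangentBundle.continuousLinearMapAt_trivializationAt (I := 𝓡 (n + 1)) (M := M) hx
  have h2 := DFunLike.congr_fun h v
  refine Eq.trans ?_ h2
  rw [Bundle.Trivialization.continuousLinearMapAt_apply,
    Bundle.Trivialization.linearMapAt_apply, if_pos (by simpa using hx)]

lemma trivializationAt_tangent_symm {x₀ x : M} (hx : x ∈ (lchart (n := n) x₀).source)
    (v : Euc (n + 1)) :
    (trivializationAt (Euc (n + 1)) (TangentSpace (𝓡 (n + 1))) x₀).symm x v =
      ofChartL x₀ (lchart x₀ x) v := by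
  have hx' := hx
  rw [extChartAt_source] at hx
  have h := TangentBundle.symmL_trivializationAt (I := 𝓡 (n + 1)) (M := M) hx
  have h2 := congrArg (fun f => f v) h
  rw [ofChartL_eq]
  exact (Bundle.Trivialization.symmL_apply _ (by simpa using hx) _).symm.trans h2

/-- Smoothness of `g` is given through the trivialization of the bundle of bilinear forms. On a
chart domain that trivialization composes the form with `ofChartL` in both slots, which is
`chartMetric`. -/
lemma contDiffAt_chartMetric (g : LorentzianMetric n M) {x₀ : M} {y : Euc (n + 1)}
    (hy : y ∈ (lchart x₀).target) : ContDiffAt ℝ ∞ (chartMetric g x₀) y := by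
  have hx := lchart_symm_mem hy
  have hx' := hx
  rw [extChartAt_source] at hx'
  let e := trivializationAt (Euc (n + 1) →L[ℝ] Euc (n + 1) →L[ℝ] ℝ)
    (fun x : M => TangentSpace (𝓡 (n + 1)) x →L[ℝ] TangentSpace (𝓡 (n + 1)) x →L[ℝ] ℝ) x₀
  have h1 := g.smooth ((lchart x₀).symm y)
  have hmem : ∀ x ∈ (lchart (n := n) x₀).source,
      (Bundle.TotalSpace.mk' (Euc (n + 1) →L[ℝ] Euc (n + 1) →L[ℝ] ℝ)
      (E := fun x : M => TangentSpace (𝓡 (n + 1)) x →L[ℝ] TangentSpace (𝓡 (n + 1)) x →L[ℝ] ℝ)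
      x (g.form x)) ∈ e.source := by
    intro x hx
    rw [Bundle.Trivialization.mem_source]
    simpa [e] using hx
  have h2 := ((Bundle.Trivialization.contMDiffAt_iff (e := e) (f := fun x =>
    Bundle.TotalSpace.mk' (Euc (n + 1) →L[ℝ] Euc (n + 1) →L[ℝ] ℝ) x (g.form x)) (hmem _ hx)).1 h1).2
  have hs : ContMDiffAt 𝓘(ℝ, Euc (n + 1)) (𝓡 (n + 1)) ∞ (lchart x₀).symm y :=
    (contMDiffOn_extChartAt_symm x₀).contMDiffAt (extChartAt_target_mem_nhds' hy)
  have h3 := ContMDiffAt.comp y h2 hs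
  rw [← contMDiffAt_iff_contDiffAt]
  refine h3.congr_of_eventuallyEq ?_
  filter_upwards [extChartAt_target_mem_nhds' hy] with y' hy'
  have hx1 := lchart_symm_mem hy'
  have hy1 : lchart x₀ ((lchart x₀).symm y') = y' := (lchart x₀).right_inv hy'
  have hb : (lchart x₀).symm y' ∈
      (trivializationAt (Euc (n + 1)) (TangentSpace (𝓡 (n + 1))) x₀).baseSet := by
    simpa using hx1
  ext v w
  rw [chartMetric_apply]
  have h5 := inCoordinates_apply_eq₂ (F₁ := Euc (n + 1)) (F₂ := Euc (n + 1)) (F₃ := ℝ)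
    (E₁ := fun x : M => TangentSpace (𝓡 (n + 1)) x)
    (E₂ := fun x : M => TangentSpace (𝓡 (n + 1)) x) (E₃ := Bundle.Trivial M ℝ) (𝕜 := ℝ)
    (x₀ := x₀) (x := (lchart x₀).symm y') (ϕ := g.form ((lchart x₀).symm y')) (v := v) (w := w)
    hb hb (by simp)
  refine Eq.trans ?_ h5.symm
  rw [trivializationAt_tangent_symm hx1, trivializationAt_tangent_symm hx1, hy1]
  simp [Bundle.Trivial.linearMapAt_trivialization]
  rfl

end Charts

/-! ### Expansion of multilinear maps in the standard basis -/

section Coordinates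

lemma sum_stdVec {d : ℕ} (u : Euc d) : ∑ i, u i • stdVec d i = u := by
  ext k
  simp [stdVec, Finset.sum_apply, Pi.single_apply]

lemma clm_eq_sum {d : ℕ} {F : Type*} [NormedAddCommGroup F] [NormedSpace ℝ F] (f : Euc d →L[ℝ] F)
    (u : Euc d) : f u = ∑ i, u i • f (stdVec d i) := by
  conv_lhs => rw [← sum_stdVec u]
  simp [map_sum]

lemma bilin_eq_sum {d : ℕ} {F : Type*} [NormedAddCommGroup F] [NormedSpace ℝ F]
    (f : Euc d →L[ℝ] Euc d →L[ℝ] F) (u v : Euc d) :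
    f u v = ∑ i, ∑ j, (u i * v j) • f (stdVec d i) (stdVec d j) := by
  rw [clm_eq_sum f u]
  simp only [sum_apply, smul_apply]
  refine Finset.sum_congr rfl fun i _ => ?_
  rw [clm_eq_sum (f (stdVec d i)) v, Finset.smul_sum]
  exact Finset.sum_congr rfl fun j _ => by rw [smul_smul]

lemma trilin_eq_sum {d : ℕ} {F : Type*} [NormedAddCommGroup F] [NormedSpace ℝ F]
    (f : Euc d →L[ℝ] Euc d →L[ℝ] Euc d →L[ℝ] F) (u v w : Euc d) :
    f u v w = ∑ i, ∑ j, ∑ k, (u i * v j * w k) • f (stdVec d i) (stdVec d j) (stdVec d k) := by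
  rw [bilin_eq_sum f u v]
  simp only [sum_apply, smul_apply]
  refine Finset.sum_congr rfl fun i _ => Finset.sum_congr rfl fun j _ => ?_
  rw [clm_eq_sum (f (stdVec d i) (stdVec d j)) w, Finset.smul_sum]
  exact Finset.sum_congr rfl fun k _ => by rw [smul_smul]

end Coordinates

/-! ### Coordinate changes; Christoffel symbols and curvature in components -/

section Charts

variable {n : ℕ} {M : Type*} [TopologicalSpace M] [ChartedSpace (Euc (n + 1)) M]
  [IsManifold (𝓡 (n + 1)) ∞ M]

/-- The coordinate change from the chart centred at `x₀` to the one centred at `x₁`. -/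
def transition (x₀ x₁ : M) (y : Euc (n + 1)) : Euc (n + 1) := lchart (n := n) x₁
    ((lchart (n := n) x₀).symm y)

lemma contMDiffAt_lchart {x₀ x : M} (hx : x ∈ (lchart (n := n) x₀).source) :
    ContMDiffAt (𝓡 (n + 1)) 𝓘(ℝ, Euc (n + 1)) ∞ (lchart (n := n) x₀) x :=
  contMDiffAt_extChartAt' (by rwa [extChartAt_source] at hx)

lemma contMDiffAt_lchart_symm {x₀ : M} {y : Euc (n + 1)} (hy : y ∈ (lchart (n := n) x₀).target) :
    ContMDiffAt 𝓘(ℝ, Euc (n + 1)) (𝓡 (n + 1)) ∞ (lchart (n := n) x₀).symm y :=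
  (contMDiffOn_extChartAt_symm x₀).contMDiffAt (extChartAt_target_mem_nhds' hy)

lemma contDiffAt_transition {x₀ x₁ x : M} (h₀ : x ∈ (lchart (n := n) x₀).source)
    (h₁ : x ∈ (lchart (n := n) x₁).source) :
    ContDiffAt ℝ ∞ (transition x₀ x₁) (lchart (n := n) x₀ x) := by
  rw [← contMDiffAt_iff_contDiffAt]
  refine ContMDiffAt.comp (lchart (n := n) x₀ x) (g := lchart (n := n) x₁)
      (f := (lchart (n := n) x₀).symm) ?_
    (contMDiffAt_lchart_symm ((lchart (n := n) x₀).map_source h₀))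
  rw [(lchart (n := n) x₀).left_inv h₀]
  exact contMDiffAt_lchart h₁

lemma transition_lchart {x₀ x₁ x : M} (h₀ : x ∈ (lchart (n := n) x₀).source) :
    transition x₀ x₁ (lchart (n := n) x₀ x) = lchart (n := n) x₁ x := by
  rw [transition, (lchart (n := n) x₀).left_inv h₀]

lemma mdifferentiableAt_lchart {x₀ x : M} (hx : x ∈ (lchart (n := n) x₀).source) :
    MDifferentiableAt (𝓡 (n + 1)) 𝓘(ℝ, Euc (n + 1)) (lchart (n := n) x₀) x :=
  (contMDiffAt_lchart hx).mdifferentiableAt (by simp)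

lemma fderiv_transition {x₀ x₁ x : M} (h₀ : x ∈ (lchart (n := n) x₀).source)
    (h₁ : x ∈ (lchart (n := n) x₁).source) (v : Euc (n + 1)) :
    fderiv ℝ (transition x₀ x₁) (lchart (n := n) x₀ x) (toChartL x₀ x v) = toChartL x₁ x v := by
  have hd : MDifferentiableAt 𝓘(ℝ, Euc (n + 1)) 𝓘(ℝ, Euc (n + 1)) (transition x₀ x₁)
      (lchart (n := n) x₀ x) :=
    ((contDiffAt_transition h₀ h₁).differentiableAt (by simp)).mdifferentiableAt
  have h2 := mfderiv_comp x hd (mdifferentiableAt_lchart h₀)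
  have h3 : (transition x₀ x₁ ∘ lchart (n := n) x₀) =ᶠ[𝓝 x]
      (lchart (n := n) x₁ : M → Euc (n + 1)) := by
    filter_upwards [(isOpen_lchart_source x₀).mem_nhds h₀] with x' hx'
    exact transition_lchart hx'
  rw [h3.mfderiv_eq, mfderiv_eq_fderiv] at h2
  exact (DFunLike.congr_fun h2 v).symm

lemma chartMetric_transition (g : LorentzianMetric n M) {x₀ x₁ x : M}
    (h₀ : x ∈ (lchart (n := n) x₀).source) (h₁ : x ∈ (lchart (n := n) x₁).source)
    (u v : Euc (n + 1)) :
    chartMetric g x₀ (lchart (n := n) x₀ x) u v =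
      chartMetric g x₁ (transition x₀ x₁ (lchart (n := n) x₀ x))
        (fderiv ℝ (transition x₀ x₁) (lchart (n := n) x₀ x) u)
        (fderiv ℝ (transition x₀ x₁) (lchart (n := n) x₀ x) v) := by
  obtain ⟨u, rfl⟩ := toChartL_surjective h₀ u
  obtain ⟨v, rfl⟩ := toChartL_surjective h₀ v
  rw [fderiv_transition h₀ h₁, fderiv_transition h₀ h₁, transition_lchart h₀]
  exact (form_eq_chartMetric g h₀ u v).symm.trans (form_eq_chartMetric g h₁ u v)

lemma eventually_lchart {x₀ x : M} (h₀ : x ∈ (lchart (n := n) x₀).source) {p : M → Prop}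
    (h : ∀ᶠ x' in 𝓝 x, p x') :
    ∀ᶠ y in 𝓝 (lchart (n := n) x₀ x), y ∈ (lchart (n := n) x₀).target ∧
      p ((lchart (n := n) x₀).symm y) := by
  have hy := (lchart (n := n) x₀).map_source h₀
  have hc : ContinuousAt (lchart (n := n) x₀).symm (lchart (n := n) x₀ x) :=
    (contMDiffAt_lchart_symm hy).continuousAt
  refine ((isOpen_lchart_target x₀).mem_nhds hy |> Filter.eventually_of_mem <| fun _ h => h).and ?_
  exact hc.eventually (by rwa [(lchart (n := n) x₀).left_inv h₀])

/-- The Christoffel map of the metric in the chart centred at `x₀`. -/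
def chartChr (g : LorentzianMetric n M) (x₀ : M) (y : Euc (n + 1)) :
    Euc (n + 1) →L[ℝ] Euc (n + 1) →L[ℝ] Euc (n + 1) := chr (chartMetric g x₀) y

lemma isChristoffel_chartChr (g : LorentzianMetric n M) {x₀ : M} {y : Euc (n + 1)}
    (hy : y ∈ (lchart (n := n) x₀).target) : IsChristoffel (chartMetric g x₀) y (chartChr g x₀ y) :=
  isChristoffel_chr (isInvertible_chartMetric g hy)

lemma contDiffAt_chartChr (g : LorentzianMetric n M) {x₀ : M} {y : Euc (n + 1)}
    (hy : y ∈ (lchart (n := n) x₀).target) : ContDiffAt ℝ ∞ (chartChr g x₀) y :=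
  contDiffAt_chr (contDiffAt_chartMetric g hy) (isInvertible_chartMetric g hy)

lemma differentiableAt_chartMetric (g : LorentzianMetric n M) {x₀ : M} {y : Euc (n + 1)}
    (hy : y ∈ (lchart (n := n) x₀).target) : DifferentiableAt ℝ (chartMetric g x₀) y :=
  (contDiffAt_chartMetric g hy).differentiableAt (by simp)

lemma chartMetric_symm_nhds (g : LorentzianMetric n M) (x₀ : M) (y : Euc (n + 1)) :
    ∀ᶠ y' in 𝓝 y, ∀ u v, chartMetric g x₀ y' u v = chartMetric g x₀ y' v u :=
  Filter.Eventually.of_forall fun y' => chartMetric_symm g x₀ y'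

lemma chartChr_symm (g : LorentzianMetric n M) {x₀ : M} {y : Euc (n + 1)}
    (hy : y ∈ (lchart (n := n) x₀).target) (u v : Euc (n + 1)) :
    chartChr g x₀ y u v = chartChr g x₀ y v u :=
  (isChristoffel_chartChr g hy).symm (differentiableAt_chartMetric g hy)
    (chartMetric_symm_nhds g x₀ y) (chartMetric_nondegenerate g hy) u v

lemma chartChr_transition (g : LorentzianMetric n M) {x₀ x₁ x : M}
    (h₀ : x ∈ (lchart (n := n) x₀).source) (h₁ : x ∈ (lchart (n := n) x₁).source)
    (u v : Euc (n + 1)) :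
    fderiv ℝ (transition x₀ x₁) (lchart (n := n) x₀ x) (chartChr g x₀ (lchart (n := n) x₀ x) u v) =
      chartChr g x₁ (lchart (n := n) x₁ x) (fderiv ℝ (transition x₀ x₁) (lchart (n := n) x₀ x) u)
        (fderiv ℝ (transition x₀ x₁) (lchart (n := n) x₀ x) v) +
      fderiv ℝ (fderiv ℝ (transition x₀ x₁)) (lchart (n := n) x₀ x) u v := by
  have ht : transition x₀ x₁ (lchart (n := n) x₀ x) = lchart (n := n) x₁ x := transition_lchart h₀
  have hy₀ := (lchart (n := n) x₀).map_source h₀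
  have hy₁ := (lchart (n := n) x₁).map_source h₁
  refine IsChristoffel.transform (G := chartMetric g x₀) (G' := chartMetric g x₁)
    ((contDiffAt_transition h₀ h₁).of_le (by norm_cast)) ?_ ?_ ?_ ?_ ?_ ?_ ?_ ?_ u v
  · rw [ht]; exact differentiableAt_chartMetric g hy₁
  · exact chartMetric_symm g x₁ _
  · rw [ht]; exact chartMetric_nondegenerate g hy₁
  · intro w
    obtain ⟨w, rfl⟩ := toChartL_surjective h₁ w
    exact ⟨_, fderiv_transition h₀ h₁ w⟩
  · have h2 : ∀ᶠ x' in 𝓝 x, x' ∈ (lchart (n := n) x₁).source :=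
      (isOpen_lchart_source x₁).mem_nhds h₁
    filter_upwards [eventually_lchart h₀ h2] with y hy u v
    have h3 := chartMetric_transition g (lchart_symm_mem hy.1) hy.2 u v
    rwa [(lchart (n := n) x₀).right_inv hy.1] at h3
  · exact differentiableAt_chartMetric g hy₀
  · exact isChristoffel_chartChr g hy₀
  · rw [ht]; exact isChristoffel_chartChr g hy₁

lemma isUnit_det_gram (g : LorentzianMetric n M) {x₀ : M} {y : Euc (n + 1)}
    (hy : y ∈ (lchart (n := n) x₀).target) : IsUnit (gram g x₀ y).det := by
  rw [isUnit_iff_ne_zero]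
  intro h
  obtain ⟨v, hv, hv0⟩ := Matrix.exists_mulVec_eq_zero_iff.2 h
  have h1 : (WithLp.toLp 2 v : Euc (n + 1)) = 0 := by
    refine chartMetric_nondegenerate g hy _ fun w => ?_
    rw [chartMetric_symm, bilin_eq_sum]
    have h2 : ∀ i, ∑ j, v j * gram g x₀ y i j = 0 := by
      intro i
      have := congrFun hv0 i
      simpa [Matrix.mulVec, dotProduct, mul_comm] using this
    refine Finset.sum_eq_zero fun i _ => ?_
    have h3 : ∀ j, (w i * (WithLp.toLp 2 v : Euc (n + 1)) j) •
        chartMetric g x₀ y (stdVec (n + 1) i) (stdVec (n + 1) j) =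
        w i * (v j * gram g x₀ y i j) := by
      intro j
      rw [gram_eq, smul_eq_mul]
      ring
    rw [Finset.sum_congr rfl fun j _ => h3 j, ← Finset.mul_sum, h2, mul_zero]
  apply hv
  simpa using congrArg WithLp.ofLp h1

lemma partialD_gram (g : LorentzianMetric n M) {x₀ : M} {y : Euc (n + 1)}
    (hy : y ∈ (lchart (n := n) x₀).target) (i j l : Fin (n + 1)) :
    partialD i (fun y' => gram g x₀ y' j l) y =
      fderiv ℝ (chartMetric g x₀) y (stdVec _ i) (stdVec _ j) (stdVec _ l) := by
  have h := ((differentiableAt_chartMetric g hy).hasFDerivAt.clm_apply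
    (hasFDerivAt_const (stdVec _ j) y)).clm_apply (hasFDerivAt_const (stdVec _ l) y)
  rw [partialD]
  have h2 := h.fderiv
  simp only [gram_eq]
  rw [h2]
  simp

/-- The Koszul formula says that the bracket in the definition is twice the Gram matrix applied to
the components of `chartChr`; the inverse Gram matrix undoes this. -/
lemma christoffel_eq (g : LorentzianMetric n M) {x₀ : M} {y : Euc (n + 1)}
    (hy : y ∈ (lchart (n := n) x₀).target) (k i j : Fin (n + 1)) :
    christoffel g x₀ k i j y = chartChr g x₀ y (stdVec _ i) (stdVec _ j) k := by
  set c : Euc (n + 1) := chartChr g x₀ y (stdVec _ i) (stdVec _ j) with hc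
  have h1 : ∀ l, (partialD i (fun y' => gram g x₀ y' j l) y
      + partialD j (fun y' => gram g x₀ y' i l) y - partialD l (fun y' => gram g x₀ y' i j) y) =
      2 * (Matrix.mulVec (gram g x₀ y) c.ofLp) l := by
    intro l
    have h2 := isChristoffel_chartChr g hy (stdVec _ i) (stdVec _ j) (stdVec _ l)
    rw [← hc, chartMetric_symm, clm_eq_sum] at h2
    have h3 : Matrix.mulVec (gram g x₀ y) c.ofLp l =
        ∑ i, c i • chartMetric g x₀ y (stdVec (n + 1) l) (stdVec (n + 1) i) := by
      simp [Matrix.mulVec, dotProduct, gram_eq, mul_comm]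
    rw [h3, h2, partialD_gram g hy, partialD_gram g hy, partialD_gram g hy]
    ring
  have h4 : christoffel g x₀ k i j y =
      Matrix.mulVec (gram g x₀ y)⁻¹ (Matrix.mulVec (gram g x₀ y) c.ofLp) k := by
    rw [christoffel]
    conv_rhs => rw [Matrix.mulVec, dotProduct]
    rw [Finset.mul_sum]
    refine Finset.sum_congr rfl fun l _ => ?_
    rw [h1]
    ring
  rw [h4, Matrix.mulVec_mulVec, Matrix.nonsing_inv_mul _ (isUnit_det_gram g hy),
    Matrix.one_mulVec]

lemma christoffel_sum_eq (g : LorentzianMetric n M) {x₀ : M} {y : Euc (n + 1)}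
    (hy : y ∈ (lchart (n := n) x₀).target) (u v : Euc (n + 1)) :
    (WithLp.toLp 2 fun k => ∑ i, ∑ j, christoffel g x₀ k i j y * u i * v j : Euc (n + 1)) =
      chartChr g x₀ y u v := by
  ext k
  rw [bilin_eq_sum (chartChr g x₀ y) u v]
  simp only [WithLp.ofLp_sum, Finset.sum_apply, WithLp.ofLp_smul, Pi.smul_apply, smul_eq_mul]
  refine Finset.sum_congr rfl fun i _ => Finset.sum_congr rfl fun j _ => ?_
  rw [christoffel_eq g hy]
  ring

/-- The curvature tensor of a Christoffel map. -/
def curvature {E : Type*} [NormedAddCommGroup E] [NormedSpace ℝ E] (Γ : E → E →L[ℝ] E →L[ℝ] E)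
    (y u v w : E) : E :=
  fderiv ℝ Γ y u v w - fderiv ℝ Γ y v u w + (Γ y u (Γ y v w) - Γ y v (Γ y u w))

lemma partialD_christoffel (g : LorentzianMetric n M) {x₀ : M} {y : Euc (n + 1)}
    (hy : y ∈ (lchart (n := n) x₀).target) (l i j k : Fin (n + 1)) :
    partialD i (christoffel g x₀ l j k) y =
      fderiv ℝ (chartChr g x₀) y (stdVec _ i) (stdVec _ j) (stdVec _ k) l := by
  have hd := (contDiffAt_chartChr g hy).differentiableAt (by simp)
  have h := (EuclideanSpace.proj l : Euc (n + 1) →L[ℝ] ℝ).hasFDerivAt.comp y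
    ((hd.hasFDerivAt.clm_apply
    (hasFDerivAt_const (stdVec _ j) y)).clm_apply (hasFDerivAt_const (stdVec _ k) y))
  have h2 : christoffel g x₀ l j k =ᶠ[𝓝 y]
      (EuclideanSpace.proj l : Euc (n + 1) →L[ℝ] ℝ) ∘
      fun y => chartChr g x₀ y (stdVec _ j) (stdVec _ k) := by
    filter_upwards [(isOpen_lchart_target x₀).mem_nhds hy] with y' hy'
    rw [christoffel_eq g hy']
    rfl
  rw [partialD, h2.fderiv_eq, h.fderiv]
  simp

lemma riemannComp_sum_eq (g : LorentzianMetric n M) {x₀ : M} {y : Euc (n + 1)}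
    (hy : y ∈ (lchart (n := n) x₀).target) (u v w : Euc (n + 1)) :
    (WithLp.toLp 2 fun l => ∑ i, ∑ j, ∑ k, riemannComp g x₀ l i j k y * u i * v j * w k :
      Euc (n + 1)) = curvature (chartChr g x₀) y u v w := by
  let L : Euc (n + 1) →L[ℝ] Euc (n + 1) →L[ℝ] Euc (n + 1) →L[ℝ] Euc (n + 1) :=
    ((ContinuousLinearMap.compL ℝ (Euc (n + 1)) (Euc (n + 1)) (Euc (n + 1))).bilinearComp
      (chartChr g x₀ y) (chartChr g x₀ y))
  let D := fderiv ℝ (chartChr g x₀) y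
  have hL : ∀ u v w, L u v w = chartChr g x₀ y u (chartChr g x₀ y v w) := fun u v w => rfl
  -- The curvature is assembled as a trilinear map, so that it is determined by its values on basis
  -- vectors, which are the `riemannComp`.
  let R := D - D.flip + (L - L.flip)
  have hR : ∀ u v w, R u v w = curvature (chartChr g x₀) y u v w := fun u v w => rfl
  have hcomp : ∀ i j k l, riemannComp g x₀ l i j k y =
      R (stdVec _ i) (stdVec _ j) (stdVec _ k) l := by
    intro i j k l
    rw [hR, curvature, riemannComp, partialD_christoffel g hy, partialD_christoffel g hy]
    simp only [WithLp.ofLp_add, WithLp.ofLp_sub, Pi.add_apply, Pi.sub_apply]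
    congr 1
    rw [Finset.sum_sub_distrib]
    congr 1
    · rw [clm_eq_sum (chartChr g x₀ y (stdVec _ i))]
      simp only [WithLp.ofLp_sum, Finset.sum_apply, WithLp.ofLp_smul, Pi.smul_apply, smul_eq_mul]
      refine Finset.sum_congr rfl fun m _ => ?_
      rw [christoffel_eq g hy, christoffel_eq g hy, mul_comm]
    · rw [clm_eq_sum (chartChr g x₀ y (stdVec _ j))]
      simp only [WithLp.ofLp_sum, Finset.sum_apply, WithLp.ofLp_smul, Pi.smul_apply, smul_eq_mul]
      refine Finset.sum_congr rfl fun m _ => ?_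
      rw [christoffel_eq g hy, christoffel_eq g hy, mul_comm]
  rw [← hR, trilin_eq_sum R]
  ext l
  simp only [WithLp.ofLp_sum, Finset.sum_apply, WithLp.ofLp_smul, Pi.smul_apply, smul_eq_mul]
  refine Finset.sum_congr rfl fun i _ => Finset.sum_congr rfl fun j _ =>
    Finset.sum_congr rfl fun k _ => ?_
  rw [hcomp]
  ring

end Charts

/-! ### Geodesics and Jacobi fields in charts -/

lemma contDiffAt_deriv_infty {E : Type*} [NormedAddCommGroup E] [NormedSpace ℝ E] {f : ℝ → E}
    {s : ℝ} (hf : ContDiffAt ℝ ∞ f s) : ContDiffAt ℝ ∞ (deriv f) s := by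
  have h : ContDiffAt ℝ ∞ (fun r => fderiv ℝ f r 1) s :=
    (hf.fderiv_right (m := ∞) (by norm_cast)).clm_apply contDiffAt_const
  exact h

section Curves

variable {n : ℕ} {M : Type*} [TopologicalSpace M] [ChartedSpace (Euc (n + 1)) M]
  [IsManifold (𝓡 (n + 1)) ∞ M]

lemma contDiffAt_lchart_comp {x₀ : M} {σ : ℝ → M} {s : ℝ} (hx : σ s ∈ (lchart (n := n) x₀).source)
    (hσ : ContMDiffAt 𝓘(ℝ, ℝ) (𝓡 (n + 1)) ∞ σ s) :
    ContDiffAt ℝ ∞ (fun r => lchart (n := n) x₀ (σ r)) s := by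
  rw [← contMDiffAt_iff_contDiffAt]
  exact ContMDiffAt.comp s (contMDiffAt_lchart hx) hσ

lemma hasDerivAt_lchart_comp {x₀ : M} {σ : ℝ → M} {s : ℝ} (hx : σ s ∈ (lchart (n := n) x₀).source)
    (hσ : MDifferentiableAt 𝓘(ℝ, ℝ) (𝓡 (n + 1)) σ s) :
    HasDerivAt (fun r => lchart (n := n) x₀ (σ r)) (toChart x₀ (σ s) (curveVel (𝓡 (n + 1)) σ s))
      s := by
  have h1 := mfderiv_comp s (mdifferentiableAt_lchart hx) hσ
  have h2 : DifferentiableAt ℝ (fun r => lchart (n := n) x₀ (σ r)) s :=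
    ((mdifferentiableAt_lchart hx).comp s hσ).differentiableAt
  refine h2.hasDerivAt.congr_deriv ?_
  have h3 := DFunLike.congr_fun h1 (1 : ℝ)
  rw [mfderiv_eq_fderiv] at h3
  exact h3

lemma eventually_mem_source {x₀ : M} {σ : ℝ → M} {s : ℝ} (hx : σ s ∈ (lchart (n := n) x₀).source)
    (hσ : ContinuousAt σ s) : ∀ᶠ r in 𝓝 s, σ r ∈ (lchart (n := n) x₀).source :=
  hσ.eventually ((isOpen_lchart_source x₀).mem_nhds hx)

lemma ofOwnChart_toChart (x : M) (v : TangentSpace (𝓡 (n + 1)) x) :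
    ofOwnChart x (toChartL x x v) = v := ofChartL_toChartL (mem_lchart_source x) v

lemma toChart_ofOwnChart (x : M) (v : Euc (n + 1)) : toChart x x (ofOwnChart x v) = v :=
  toChartL_ofChartL (mem_lchart_source x) v

lemma contMDiffAt_tangent_iff {N : Type*} {EN HN : Type*} [NormedAddCommGroup EN]
    [NormedSpace ℝ EN] [TopologicalSpace HN] {IN : ModelWithCorners ℝ EN HN} [TopologicalSpace N]
    [ChartedSpace HN N] {x₀ : M} {σ : N → M} {V : ∀ s, TangentSpace (𝓡 (n + 1)) (σ s)} {s : N}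
    (hx : σ s ∈ (lchart (n := n) x₀).source) :
    ContMDiffAt IN (𝓡 (n + 1)).tangent ∞
      (fun s => (⟨σ s, V s⟩ : TangentBundle (𝓡 (n + 1)) M)) s ↔
    ContMDiffAt IN (𝓡 (n + 1)) ∞ σ s ∧
      ContMDiffAt IN 𝓘(ℝ, Euc (n + 1)) ∞ (fun r => toChart x₀ (σ r) (V r)) s := by
  let e := trivializationAt (Euc (n + 1)) (TangentSpace (𝓡 (n + 1)) (M := M)) x₀
  have hmem : (⟨σ s, V s⟩ : TangentBundle (𝓡 (n + 1)) M) ∈ e.source := by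
    rw [Bundle.Trivialization.mem_source]
    simpa [e] using hx
  refine (Bundle.Trivialization.contMDiffAt_iff (e := e)
    (f := fun s => (⟨σ s, V s⟩ : TangentBundle (𝓡 (n + 1)) M)) hmem).trans ?_
  refine and_congr_right fun h => ?_
  refine Filter.EventuallyEq.contMDiffAt_iff ?_
  filter_upwards [h.continuousAt.eventually ((isOpen_lchart_source x₀).mem_nhds hx)] with r hr
  exact trivializationAt_tangent hr _

/-- The covariant derivative along a curve, computed in an arbitrary chart. -/
lemma toChart_covDeriv (g : LorentzianMetric n M) {x₀ : M} {σ : ℝ → M}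
    {V : ∀ s, TangentSpace (𝓡 (n + 1)) (σ s)} {s : ℝ} (hx : σ s ∈ (lchart (n := n) x₀).source)
    (hσ : ContMDiffAt 𝓘(ℝ, ℝ) (𝓡 (n + 1)) ∞ σ s)
    (hV : DifferentiableAt ℝ (fun r => toChart x₀ (σ r) (V r)) s) :
    toChart x₀ (σ s) (covDeriv g σ V s) = deriv (fun r => toChart x₀ (σ r) (V r)) s +
      chartChr g x₀ (lchart (n := n) x₀ (σ s)) (deriv (fun r => lchart (n := n) x₀ (σ r)) s)
        (toChart x₀ (σ s) (V s)) := by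
  -- The definition of `covDeriv` uses the chart centred at the current point, which changes with
  -- `s`. The transformation law compares that chart with the fixed one at the single time `s`.
  set x₁ := σ s with hx₁
  have h₁ := mem_lchart_source (n := n) x₁
  have hψ := (contDiffAt_transition (x₁ := x₁) hx h₁).of_le (show (2 : ℕ∞ω) ≤ ∞ by norm_cast)
  have hev₀ := eventually_mem_source hx hσ.continuousAt
  have hev₁ : ∀ᶠ r in 𝓝 s, σ r ∈ (lchart (n := n) x₁).source :=
    eventually_mem_source h₁ hσ.continuousAt
  have hc : HasDerivAt (fun r => lchart (n := n) x₀ (σ r))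
      (deriv (fun r => lchart (n := n) x₀ (σ r)) s) s :=
    ((contDiffAt_lchart_comp hx hσ).differentiableAt (by simp)).hasDerivAt
  have key := covDeriv_transform (C := chartChr g x₀ (lchart (n := n) x₀ (σ s)))
    (C' := chartChr g x₁ (lchart (n := n) x₁ x₁)) (ψ := transition x₀ x₁)
    (c := fun r => lchart (n := n) x₀ (σ r)) (V := fun r => toChart x₀ (σ r) (V r)) (s := s)
    hψ (chartChr_transition g hx h₁) hc hV.hasDerivAt
  have e1 : (fun r => fderiv ℝ (transition x₀ x₁) (lchart (n := n) x₀ (σ r))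
      (toChart x₀ (σ r) (V r)))
      =ᶠ[𝓝 s] fun r => toChart x₁ (σ r) (V r) := by
    filter_upwards [hev₀, hev₁] with r h h'
    exact fderiv_transition h h' _
  have e2 : (fun r => transition x₀ x₁ (lchart (n := n) x₀ (σ r))) =ᶠ[𝓝 s] fun r => lchart (n := n)
      x₁ (σ r) := by
    filter_upwards [hev₀] with r h
    exact transition_lchart h
  have e3 : fderiv ℝ (transition x₀ x₁) (lchart (n := n) x₀ (σ s)) (toChart x₀ (σ s) (V s)) =
      toChart x₁ x₁ (V s) := fderiv_transition hx h₁ _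
  rw [e1.deriv_eq, e2.deriv_eq, e3] at key
  have e4 : covDeriv g σ V s = ofOwnChart x₁ (deriv (fun r => toChart x₁ (σ r) (V r)) s +
      chartChr g x₁ (lchart (n := n) x₁ x₁) (deriv (fun r => lchart (n := n) x₁ (σ r)) s)
        (toChart x₁ x₁ (V s))) := by
    rw [covDeriv, christoffel_sum_eq g ((lchart (n := n) x₁).map_source h₁)]
  rw [e4, key]
  obtain ⟨w, hw⟩ := toChartL_surjective hx (deriv (fun r => toChart x₀ (σ r) (V r)) s +
      chartChr g x₀ (lchart (n := n) x₀ (σ s)) (deriv (fun r => lchart (n := n) x₀ (σ r)) s)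
        (toChart x₀ (σ s) (V s)))
  rw [← hw, fderiv_transition hx h₁, toChart_eq]
  congr 1
  exact ofOwnChart_toChart x₁ w

variable {g : LorentzianMetric n M} {γ : ℝ → M} {U : Set ℝ}

/-- `γ` is a geodesic on the open set of times `U`. -/
structure IsGeodesicOpen (g : LorentzianMetric n M) (γ : ℝ → M) (U : Set ℝ) : Prop where
  isOpen : IsOpen U
  smooth : ContMDiffOn 𝓘(ℝ, ℝ) (𝓡 (n + 1)) ∞ γ U
  eq : ∀ s ∈ U, covDeriv g γ (curveVel (𝓡 (n + 1)) γ) s = 0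

lemma isGeodesicOn_iff {S : Set ℝ} :
    IsGeodesicOn g γ S ↔ ∃ U, IsGeodesicOpen g γ U ∧ S ⊆ U :=
  ⟨fun ⟨U, h1, h2, h3, h4⟩ => ⟨U, ⟨h1, h3, h4⟩, h2⟩, fun ⟨U, h, h2⟩ => ⟨U, h.1, h2, h.2, h.3⟩⟩

/-- `V` is a smooth vector field along `γ` on the open set of times `U`. -/
def IsSmoothFieldOn (γ : ℝ → M) (V : ∀ s, TangentSpace (𝓡 (n + 1)) (γ s)) (U : Set ℝ) : Prop :=
  ContMDiffOn 𝓘(ℝ, ℝ) (𝓡 (n + 1)).tangent ∞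
    (fun s => (⟨γ s, V s⟩ : TangentBundle (𝓡 (n + 1)) M)) U

/-- `J` is a Jacobi field along `γ` on the set of times `U`. -/
structure IsJacobiOpen (g : LorentzianMetric n M) (γ : ℝ → M)
    (J : ∀ s, TangentSpace (𝓡 (n + 1)) (γ s)) (U : Set ℝ) : Prop where
  smooth : IsSmoothFieldOn γ J U
  eq : ∀ s ∈ U, covDeriv g γ (covDeriv g γ J) s
      + riemann g (γ s) (J s) (curveVel (𝓡 (n + 1)) γ s) (curveVel (𝓡 (n + 1)) γ s) = 0

lemma IsGeodesicOpen.mono (h : IsGeodesicOpen g γ U) {U' : Set ℝ} (hU' : IsOpen U')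
    (hs : U' ⊆ U) : IsGeodesicOpen g γ U' :=
  ⟨hU', h.smooth.mono hs, fun s hs' => h.eq s (hs hs')⟩

lemma IsJacobiOpen.mono {J : ∀ s, TangentSpace (𝓡 (n + 1)) (γ s)} (h : IsJacobiOpen g γ J U)
    {U' : Set ℝ} (hs : U' ⊆ U) : IsJacobiOpen g γ J U' :=
  ⟨h.smooth.mono hs, fun s hs' => h.eq s (hs hs')⟩

lemma IsSmoothFieldOn.contDiffAt {V : ∀ s, TangentSpace (𝓡 (n + 1)) (γ s)}
    (hV : IsSmoothFieldOn γ V U) (hU : IsOpen U) {s : ℝ} (hs : s ∈ U) {x₀ : M}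
    (hx : γ s ∈ (lchart (n := n) x₀).source) :
    ContDiffAt ℝ ∞ (fun r => toChart x₀ (γ r) (V r)) s :=
  contMDiffAt_iff_contDiffAt.1
    ((contMDiffAt_tangent_iff hx).1 (hV.contMDiffAt (hU.mem_nhds hs))).2

lemma isSmoothFieldOn_of_charts (hγ : ContMDiffOn 𝓘(ℝ, ℝ) (𝓡 (n + 1)) ∞ γ U) (hU : IsOpen U)
    {V : ∀ s, TangentSpace (𝓡 (n + 1)) (γ s)}
    (hV : ∀ s ∈ U, ContDiffAt ℝ ∞ (fun r => toChart (γ s) (γ r) (V r)) s) :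
    IsSmoothFieldOn γ V U := fun s hs =>
  ((contMDiffAt_tangent_iff (mem_lchart_source (γ s))).2
    ⟨hγ.contMDiffAt (hU.mem_nhds hs), contMDiffAt_iff_contDiffAt.2 (hV s hs)⟩).contMDiffWithinAt

lemma eventually_deriv_lchart (hγ : ContMDiffOn 𝓘(ℝ, ℝ) (𝓡 (n + 1)) ∞ γ U) (hU : IsOpen U)
    {s : ℝ} (hs : s ∈ U) {x₀ : M} (hx : γ s ∈ (lchart (n := n) x₀).source) :
    ∀ᶠ r in 𝓝 s, deriv (fun r => lchart (n := n) x₀ (γ r)) r =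
      toChart x₀ (γ r) (curveVel (𝓡 (n + 1)) γ r) := by
  have hc := (hγ.contMDiffAt (hU.mem_nhds hs)).continuousAt
  filter_upwards [eventually_mem_source hx hc, hU.mem_nhds hs] with r hr hrU
  exact (hasDerivAt_lchart_comp hr
    ((hγ.contMDiffAt (hU.mem_nhds hrU)).mdifferentiableAt (by simp))).deriv

lemma isSmoothFieldOn_curveVel (hγ : ContMDiffOn 𝓘(ℝ, ℝ) (𝓡 (n + 1)) ∞ γ U) (hU : IsOpen U) :
    IsSmoothFieldOn γ (curveVel (𝓡 (n + 1)) γ) U := by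
  refine isSmoothFieldOn_of_charts hγ hU fun s hs => ?_
  have h1 := contDiffAt_lchart_comp (mem_lchart_source (γ s)) (hγ.contMDiffAt (hU.mem_nhds hs))
  have h2 : ContDiffAt ℝ ∞ (deriv fun r => lchart (n := n) (γ s) (γ r)) s := contDiffAt_deriv_infty
      h1
  refine h2.congr_of_eventuallyEq ?_
  filter_upwards [eventually_deriv_lchart hγ hU hs (mem_lchart_source (γ s))] with r hr
  exact hr.symm

/-- The covariant derivative in a chart, on a neighbourhood of a time. -/
lemma eventually_toChart_covDeriv (hγ : ContMDiffOn 𝓘(ℝ, ℝ) (𝓡 (n + 1)) ∞ γ U) (hU : IsOpen U)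
    {V : ∀ s, TangentSpace (𝓡 (n + 1)) (γ s)} (hV : IsSmoothFieldOn γ V U)
    {s : ℝ} (hs : s ∈ U) {x₀ : M} (hx : γ s ∈ (lchart (n := n) x₀).source) :
    ∀ᶠ r in 𝓝 s, toChart x₀ (γ r) (covDeriv g γ V r) =
      deriv (fun r => toChart x₀ (γ r) (V r)) r +
      chartChr g x₀ (lchart (n := n) x₀ (γ r)) (deriv (fun r => lchart (n := n) x₀ (γ r)) r)
        (toChart x₀ (γ r) (V r)) := by
  have hc := (hγ.contMDiffAt (hU.mem_nhds hs)).continuousAt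
  filter_upwards [eventually_mem_source hx hc, hU.mem_nhds hs] with r hr hrU
  exact toChart_covDeriv g hr (hγ.contMDiffAt (hU.mem_nhds hrU))
    ((hV.contDiffAt hU hrU hr).differentiableAt (by simp))

lemma contDiffAt_chartChr_comp (hγ : ContMDiffOn 𝓘(ℝ, ℝ) (𝓡 (n + 1)) ∞ γ U) (hU : IsOpen U)
    {s : ℝ} (hs : s ∈ U) {x₀ : M} (hx : γ s ∈ (lchart (n := n) x₀).source) :
    ContDiffAt ℝ ∞ (fun r => chartChr g x₀ (lchart (n := n) x₀ (γ r))) s :=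
  ContDiffAt.comp s (contDiffAt_chartChr g ((lchart (n := n) x₀).map_source hx))
    (contDiffAt_lchart_comp hx (hγ.contMDiffAt (hU.mem_nhds hs)))

lemma IsSmoothFieldOn.covDeriv (hγ : ContMDiffOn 𝓘(ℝ, ℝ) (𝓡 (n + 1)) ∞ γ U) (hU : IsOpen U)
    {V : ∀ s, TangentSpace (𝓡 (n + 1)) (γ s)} (hV : IsSmoothFieldOn γ V U) :
    IsSmoothFieldOn γ (covDeriv g γ V) U := by
  refine isSmoothFieldOn_of_charts hγ hU fun s hs => ?_
  have hx := mem_lchart_source (n := n) (γ s)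
  have h1 := hV.contDiffAt hU hs hx
  have h2 : ContDiffAt ℝ ∞ (deriv (fun r => toChart (γ s) (γ r) (V r))) s :=
    contDiffAt_deriv_infty h1
  have h3 : ContDiffAt ℝ ∞ (deriv fun r => lchart (n := n) (γ s) (γ r)) s :=
    contDiffAt_deriv_infty (contDiffAt_lchart_comp hx (hγ.contMDiffAt (hU.mem_nhds hs)))
  exact (h2.add (((contDiffAt_chartChr_comp (g := g) hγ hU hs hx).clm_apply h3).clm_apply
    h1)).congr_of_eventuallyEq (eventually_toChart_covDeriv hγ hU hV hs hx)

/-- The geodesic equation in an arbitrary chart. -/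
lemma IsGeodesicOpen.hasDerivAt_deriv (h : IsGeodesicOpen g γ U) {s : ℝ} (hs : s ∈ U) {x₀ : M}
    (hx : γ s ∈ (lchart (n := n) x₀).source) :
    HasDerivAt (deriv fun r => lchart (n := n) x₀ (γ r))
      (-chartChr g x₀ (lchart (n := n) x₀ (γ s)) (deriv (fun r => lchart (n := n) x₀ (γ r)) s)
        (deriv (fun r => lchart (n := n) x₀ (γ r)) s)) s := by
  have hγs := h.smooth.contMDiffAt (h.isOpen.mem_nhds hs)
  have h1 : ContDiffAt ℝ ∞ (deriv fun r => lchart (n := n) x₀ (γ r)) s :=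
    contDiffAt_deriv_infty (contDiffAt_lchart_comp hx hγs)
  refine (h1.differentiableAt (by simp)).hasDerivAt.congr_deriv ?_
  have h2 := eventually_deriv_lchart h.smooth h.isOpen hs hx
  have h3 := (eventually_toChart_covDeriv (g := g) h.smooth h.isOpen
    (isSmoothFieldOn_curveVel h.smooth h.isOpen) hs hx).self_of_nhds
  rw [h.eq s hs, ← h2.self_of_nhds] at h3
  have h4 : (fun r => toChart x₀ (γ r) (curveVel (𝓡 (n + 1)) γ r)) =ᶠ[𝓝 s]
      deriv fun r => lchart (n := n) x₀ (γ r) := h2.mono fun r hr => hr.symm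
  rw [h4.deriv_eq] at h3
  have h5 : toChart x₀ (γ s) (0 : TangentSpace (𝓡 (n + 1)) (γ s)) = 0 :=
    map_zero (toChartL x₀ (γ s))
  rw [h5] at h3
  exact eq_neg_of_add_eq_zero_left h3.symm

/-- Metric compatibility. -/
lemma hasDerivAt_form (hγ : ContMDiffOn 𝓘(ℝ, ℝ) (𝓡 (n + 1)) ∞ γ U) (hU : IsOpen U)
    {V W : ∀ s, TangentSpace (𝓡 (n + 1)) (γ s)} (hV : IsSmoothFieldOn γ V U)
    (hW : IsSmoothFieldOn γ W U) {s : ℝ} (hs : s ∈ U) :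
    HasDerivAt (fun r => g.form (γ r) (V r) (W r))
      (g.form (γ s) (covDeriv g γ V s) (W s) + g.form (γ s) (V s) (covDeriv g γ W s)) s := by
  have hx := mem_lchart_source (n := n) (γ s)
  have hy := (lchart (n := n) (γ s)).map_source hx
  have hγs := hγ.contMDiffAt (hU.mem_nhds hs)
  have h1 := hasDerivAt_metric (G := chartMetric g (γ s))
      (c := fun r => lchart (n := n) (γ s) (γ r))
    (differentiableAt_chartMetric g hy) (chartMetric_symm_nhds g _ _) (isChristoffel_chartChr g hy)
    ((contDiffAt_lchart_comp hx hγs).differentiableAt (by simp)).hasDerivAt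
    ((hV.contDiffAt hU hs hx).differentiableAt (by simp)).hasDerivAt
    ((hW.contDiffAt hU hs hx).differentiableAt (by simp)).hasDerivAt
  rw [← (eventually_toChart_covDeriv (g := g) hγ hU hV hs hx).self_of_nhds,
    ← (eventually_toChart_covDeriv (g := g) hγ hU hW hs hx).self_of_nhds,
    ← form_eq_chartMetric g hx, ← form_eq_chartMetric g hx] at h1
  refine h1.congr_of_eventuallyEq ?_
  filter_upwards [eventually_mem_source hx hγs.continuousAt] with r hr
  exact form_eq_chartMetric g hr _ _

lemma toChart_riemann (x : M) (u v w : TangentSpace (𝓡 (n + 1)) x) :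
    toChart x x (riemann g x u v w) =
      curvature (chartChr g x) (lchart (n := n) x x) (toChart x x u) (toChart x x v)
        (toChart x x w) := by
  rw [riemann, toChart_ofOwnChart]
  exact riemannComp_sum_eq g ((lchart (n := n) x).map_source (mem_lchart_source x)) _ _ _

/-- The Jacobi operator at time `s` is the linearised geodesic operator in the chart centred
at `γ s`. -/
lemma toChart_jacobi (h : IsGeodesicOpen g γ U) {J : ∀ s, TangentSpace (𝓡 (n + 1)) (γ s)}
    (hJ : IsSmoothFieldOn γ J U) {s : ℝ} (hs : s ∈ U) :
    toChart (γ s) (γ s) (covDeriv g γ (covDeriv g γ J) s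
      + riemann g (γ s) (J s) (curveVel (𝓡 (n + 1)) γ s) (curveVel (𝓡 (n + 1)) γ s)) =
    deriv (deriv fun r => toChart (γ s) (γ r) (J r)) s +
      ((2 : ℝ) • chartChr g (γ s) (lchart (n := n) (γ s) (γ s))
        (deriv (fun r => lchart (n := n) (γ s) (γ r)) s)
        (deriv (fun r => toChart (γ s) (γ r) (J r)) s) +
      fderiv ℝ (chartChr g (γ s)) (lchart (n := n) (γ s) (γ s)) (toChart (γ s) (γ s) (J s))
        (deriv (fun r => lchart (n := n) (γ s) (γ r)) s)
          (deriv (fun r => lchart (n := n) (γ s) (γ r)) s)) := by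
  set x := γ s with hxdef
  have hx := mem_lchart_source (n := n) x
  have hy := (lchart (n := n) x).map_source hx
  have hγs := h.smooth.contMDiffAt (h.isOpen.mem_nhds hs)
  have hΓd : DifferentiableAt ℝ (chartChr g x) (lchart (n := n) x x) :=
    (contDiffAt_chartChr g hy).differentiableAt (by simp)
  set Γ := chartChr g x with hΓ
  set c : ℝ → Euc (n + 1) := fun r => lchart (n := n) x (γ r) with hc
  set v := deriv c with hv
  set Jc : ℝ → Euc (n + 1) := fun r => toChart x (γ r) (J r) with hJc
  have dc : HasDerivAt c (v s) s :=
    ((contDiffAt_lchart_comp hx hγs).differentiableAt (by simp)).hasDerivAt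
  have dv : HasDerivAt v (-Γ (c s) (v s) (v s)) s := h.hasDerivAt_deriv hs hx
  have cJ : ContDiffAt ℝ ∞ Jc s := hJ.contDiffAt h.isOpen hs hx
  have dJ : HasDerivAt Jc (deriv Jc s) s := (cJ.differentiableAt (by simp)).hasDerivAt
  have cK : ContDiffAt ℝ ∞ (deriv Jc) s := contDiffAt_deriv_infty cJ
  have dK : HasDerivAt (deriv Jc) (deriv (deriv Jc) s) s :=
    (cK.differentiableAt (by simp)).hasDerivAt
  have dΓ : HasDerivAt (fun r => Γ (c r)) (fderiv ℝ Γ (c s) (v s)) s :=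
    hΓd.hasFDerivAt.comp_hasDerivAt s dc
  have e1 := eventually_toChart_covDeriv (g := g) h.smooth h.isOpen hJ hs hx
  have e2 := (eventually_toChart_covDeriv (g := g) h.smooth h.isOpen
    (IsSmoothFieldOn.covDeriv (g := g) h.smooth h.isOpen hJ) hs hx).self_of_nhds
  have e3 : (fun r => toChart x (γ r) (covDeriv g γ J r)) =ᶠ[𝓝 s]
      fun r => deriv Jc r + Γ (c r) (v r) (Jc r) := e1
  have e4 := (eventually_deriv_lchart h.smooth h.isOpen hs hx).self_of_nhds
  have d2 : HasDerivAt (fun r => deriv Jc r + Γ (c r) (v r) (Jc r)) _ s :=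
    dK.add ((dΓ.clm_apply dv).clm_apply dJ)
  rw [e3.deriv_eq, d2.deriv, e1.self_of_nhds] at e2
  have hadd : ∀ a b : TangentSpace (𝓡 (n + 1)) x, toChart x x (a + b) =
      toChart x x a + toChart x x b := fun a b => map_add (toChartL x x) a b
  rw [hadd]
  have e5 := toChart_riemann (g := g) x (J s) (curveVel (𝓡 (n + 1)) γ s)
    (curveVel (𝓡 (n + 1)) γ s)
  rw [← hxdef] at e2 e4
  rw [e2, e5, ← e4]
  change _ + curvature Γ (c s) (Jc s) (v s) (v s) = _
  have hsym := chartChr_symm g (x₀ := x) hy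
  have hsym' : ∀ u w, fderiv ℝ Γ (c s) (v s) u w = fderiv ℝ Γ (c s) (v s) w u := by
    intro u w
    have f1 := (hΓd.hasFDerivAt.clm_apply (hasFDerivAt_const u _)).clm_apply
      (hasFDerivAt_const w _)
    have f2 := (hΓd.hasFDerivAt.clm_apply (hasFDerivAt_const w _)).clm_apply
      (hasFDerivAt_const u _)
    have f3 := f1.unique (f2.congr_of_eventuallyEq (by
      filter_upwards [(isOpen_lchart_target x).mem_nhds hy] with y hy'
      exact chartChr_symm g hy' u w))
    have f4 := DFunLike.congr_fun f3 (v s)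
    simp at f4
    exact f4
  -- With v' = -Γ(v, v), the curvature cancels every quadratic term in Γ and replaces DΓ(v)(v, J) by
  -- DΓ(J)(v, v). What is left is the formal derivative of the geodesic equation in the direction J.
  simp only [curvature, map_add, map_neg, add_apply, neg_apply]
  rw [hsym' (v s) (Jc s), show Γ (c s) (Jc s) (v s) = Γ (c s) (v s) (Jc s) from hsym _ _,
    show Γ (c s) (Γ (c s) (v s) (v s)) (Jc s) = Γ (c s) (Jc s) (Γ (c s) (v s) (v s)) from
      hsym _ _, two_smul]
  change _ = _ + (Γ (c s) (v s) (deriv Jc s) + Γ (c s) (v s) (deriv Jc s) +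
    fderiv ℝ Γ (c s) (Jc s) (v s) (v s))
  abel

/-- The Wronskian `g(J₁', J₂) - g(J₁, J₂')`. -/
def wronskian (g : LorentzianMetric n M) (γ : ℝ → M)
    (J₁ J₂ : ∀ s, TangentSpace (𝓡 (n + 1)) (γ s)) (s : ℝ) : ℝ :=
  g.form (γ s) (covDeriv g γ J₁ s) (J₂ s) - g.form (γ s) (J₁ s) (covDeriv g γ J₂ s)

lemma IsJacobiOpen.hasDerivAt_deriv (h : IsGeodesicOpen g γ U)
    {J : ∀ s, TangentSpace (𝓡 (n + 1)) (γ s)} (hJ : IsJacobiOpen g γ J U) {s : ℝ} (hs : s ∈ U) :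
    HasDerivAt (deriv fun r => toChart (γ s) (γ r) (J r))
      (-((2 : ℝ) • chartChr g (γ s) (lchart (n := n) (γ s) (γ s))
        (deriv (fun r => lchart (n := n) (γ s) (γ r)) s)
        (deriv (fun r => toChart (γ s) (γ r) (J r)) s) +
      fderiv ℝ (chartChr g (γ s)) (lchart (n := n) (γ s) (γ s)) (toChart (γ s) (γ s) (J s))
        (deriv (fun r => lchart (n := n) (γ s) (γ r)) s)
          (deriv (fun r => lchart (n := n) (γ s) (γ r)) s))) s := by
  have h1 := toChart_jacobi h hJ.smooth hs
  rw [hJ.eq s hs] at h1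
  have h2 : toChart (γ s) (γ s) (0 : TangentSpace (𝓡 (n + 1)) (γ s)) = 0 :=
    map_zero (toChartL (γ s) (γ s))
  rw [h2] at h1
  have h3 : ContDiffAt ℝ ∞ (deriv fun r => toChart (γ s) (γ r) (J r)) s :=
    contDiffAt_deriv_infty (hJ.smooth.contDiffAt h.isOpen hs (mem_lchart_source (γ s)))
  refine (h3.differentiableAt (by simp)).hasDerivAt.congr_deriv ?_
  exact eq_neg_of_add_eq_zero_left h1.symm

lemma hasDerivAt_wronskian_jacobi (h : IsGeodesicOpen g γ U)
    {J₁ J₂ : ∀ s, TangentSpace (𝓡 (n + 1)) (γ s)} (h₁ : IsJacobiOpen g γ J₁ U)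
    (h₂ : IsJacobiOpen g γ J₂ U) {s : ℝ} (hs : s ∈ U) :
    HasDerivAt (wronskian g γ J₁ J₂) 0 s := by
  have hx := mem_lchart_source (n := n) (γ s)
  have hy := (lchart (n := n) (γ s)).map_source hx
  have hγs := h.smooth.contMDiffAt (h.isOpen.mem_nhds hs)
  have key := hasDerivAt_wronskian (G := chartMetric g (γ s)) (Γ := chartChr g (γ s))
    (c := fun r => lchart (n := n) (γ s) (γ r)) (s := s)
    ((contDiffAt_chartMetric g hy).of_le (by norm_cast))
    ((contDiffAt_chartChr g hy).differentiableAt (by simp)) (chartMetric_symm_nhds g _ _)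
    (by filter_upwards [(isOpen_lchart_target (γ s)).mem_nhds hy] with y hy'
        exact isChristoffel_chartChr g hy')
    ((contDiffAt_lchart_comp hx hγs).differentiableAt (by simp)).hasDerivAt
    (h.hasDerivAt_deriv hs hx)
    ((h₁.smooth.contDiffAt h.isOpen hs hx).differentiableAt (by simp)).hasDerivAt
    ((h₂.smooth.contDiffAt h.isOpen hs hx).differentiableAt (by simp)).hasDerivAt
    (IsJacobiOpen.hasDerivAt_deriv h h₁ hs) (IsJacobiOpen.hasDerivAt_deriv h h₂ hs)
  refine key.congr_of_eventuallyEq ?_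
  filter_upwards [eventually_mem_source hx hγs.continuousAt,
    eventually_toChart_covDeriv (g := g) h.smooth h.isOpen h₁.smooth hs hx,
    eventually_toChart_covDeriv (g := g) h.smooth h.isOpen h₂.smooth hs hx] with r hr e₁ e₂
  rw [wronskian, form_eq_chartMetric g hr, form_eq_chartMetric g hr, e₁, e₂]

end Curves

/-! ### Uniqueness of geodesics and smooth families of geodesics -/

section Families

variable {n : ℕ} {M : Type*} [TopologicalSpace M] [ChartedSpace (Euc (n + 1)) M]
  [IsManifold (𝓡 (n + 1)) ∞ M] {g : LorentzianMetric n M} {γ σ : ℝ → M} {U U' : Set ℝ}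

/-- The geodesic spray in a chart. -/
def spray (g : LorentzianMetric n M) (x₀ : M) (y : Euc (n + 1) × Euc (n + 1)) :
    Euc (n + 1) × Euc (n + 1) :=
  (y.2, -chartChr g x₀ y.1 y.2 y.2)

lemma contDiffAt_spray (g : LorentzianMetric n M) {x₀ : M} {y : Euc (n + 1) × Euc (n + 1)}
    (hy : y.1 ∈ (lchart (n := n) x₀).target) : ContDiffAt ℝ ∞ (spray g x₀) y := by
  have h1 : ContDiffAt ℝ ∞ (fun y : Euc (n + 1) × Euc (n + 1) => chartChr g x₀ y.1) y :=
    ContDiffAt.comp y (contDiffAt_chartChr g hy) contDiffAt_fst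
  exact contDiffAt_snd.prodMk ((h1.clm_apply contDiffAt_snd).clm_apply contDiffAt_snd).neg

lemma IsGeodesicOpen.continuousAt (h : IsGeodesicOpen g γ U) {s : ℝ} (hs : s ∈ U) :
    ContinuousAt γ s := (h.smooth.contMDiffAt (h.isOpen.mem_nhds hs)).continuousAt

lemma IsGeodesicOpen.hasDerivAt_spray (h : IsGeodesicOpen g γ U) {s : ℝ} (hs : s ∈ U) {x₀ : M}
    (hx : γ s ∈ (lchart (n := n) x₀).source) :
    HasDerivAt (fun r => (lchart (n := n) x₀ (γ r), deriv (fun r => lchart (n := n) x₀ (γ r)) r))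
      (spray g x₀ (lchart (n := n) x₀ (γ s), deriv (fun r => lchart (n := n) x₀ (γ r)) s)) s :=
  (((contDiffAt_lchart_comp hx (h.smooth.contMDiffAt (h.isOpen.mem_nhds hs))).differentiableAt
    (by simp)).hasDerivAt).prodMk (h.hasDerivAt_deriv hs hx)

lemma toChart_eq_of_tangentBundle_eq (x₀ : M) {p q : TangentBundle (𝓡 (n + 1)) M} (h : p = q) :
    toChart x₀ p.1 p.2 = toChart x₀ q.1 q.2 := by rw [h]

lemma curveVelTB_eq_of_eventuallyEq {s : ℝ} (h : γ =ᶠ[𝓝 s] σ) :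
    curveVelTB (𝓡 (n + 1)) γ s = curveVelTB (𝓡 (n + 1)) σ s := by
  have h1 := h.self_of_nhds
  have h2 : mfderiv 𝓘(ℝ, ℝ) (𝓡 (n + 1)) γ s = (mfderiv 𝓘(ℝ, ℝ) (𝓡 (n + 1)) σ s : ℝ →L[ℝ] Euc (n + 1)) :=
    h.mfderiv_eq
  have h3 : (curveVel (𝓡 (n + 1)) γ s : Euc (n + 1)) = curveVel (𝓡 (n + 1)) σ s :=
    DFunLike.congr_fun h2 1
  exact Bundle.TotalSpace.ext h1 (heq_of_eq h3)

/-- Geodesics which agree to first order at a time agree near that time. -/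
lemma IsGeodesicOpen.eventuallyEq (hγ : IsGeodesicOpen g γ U) (hσ : IsGeodesicOpen g σ U')
    {s : ℝ} (hs : s ∈ U) (hs' : s ∈ U') {x₀ : M} (hx : γ s ∈ (lchart (n := n) x₀).source)
    (h0 : γ s = σ s)
    (h1 : deriv (fun r => lchart (n := n) x₀ (γ r)) s = deriv (fun r => lchart (n := n) x₀ (σ r)) s)
      :
    γ =ᶠ[𝓝 s] σ := by
  have hx' : σ s ∈ (lchart (n := n) x₀).source := h0 ▸ hx
  obtain ⟨K, t, ht, hK⟩ := ((contDiffAt_spray g (y := (lchart (n := n) x₀ (γ s),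
    deriv (fun r => lchart (n := n) x₀ (γ r)) s)) ((lchart (n := n) x₀).map_source hx)).of_le
      (show (1 : ℕ∞ω) ≤ ∞ by norm_cast)).exists_lipschitzOnWith
  have e1 := eventually_mem_source hx (hγ.continuousAt hs)
  have e2 := eventually_mem_source hx' (hσ.continuousAt hs')
  have c1 := (hγ.hasDerivAt_spray hs hx).continuousAt
  have c2 := (hσ.hasDerivAt_spray hs' hx').continuousAt
  have h2 : (lchart (n := n) x₀ (γ s), deriv (fun r => lchart (n := n) x₀ (γ r)) s) =
      (lchart (n := n) x₀ (σ s), deriv (fun r => lchart (n := n) x₀ (σ r)) s) := by rw [h1, h0]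
  -- Position and velocity in the chart solve the first-order system of the spray, which is
  -- Lipschitz near the common initial value.
  have key := ODE_solution_unique_of_eventually (v := fun _ => spray g x₀) (s := fun _ => t)
    (t₀ := s) (K := K) (.of_forall fun _ => hK)
    (f := fun r => (lchart (n := n) x₀ (γ r), deriv (fun r => lchart (n := n) x₀ (γ r)) r))
    (g := fun r => (lchart (n := n) x₀ (σ r), deriv (fun r => lchart (n := n) x₀ (σ r)) r))
    (by filter_upwards [e1, hγ.isOpen.mem_nhds hs, c1.eventually_mem ht] with r a b c
        exact ⟨hγ.hasDerivAt_spray b a, c⟩)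
    (by filter_upwards [e2, hσ.isOpen.mem_nhds hs', c2.eventually_mem (h2 ▸ ht)] with r a b c
        exact ⟨hσ.hasDerivAt_spray b a, c⟩) h2
  filter_upwards [key, e1, e2] with r hr a b
  exact (lchart (n := n) x₀).injOn a b (congrArg Prod.fst hr)

lemma IsGeodesicOpen.deriv_lchart (hγ : IsGeodesicOpen g γ U) {s : ℝ} (hs : s ∈ U) {x₀ : M}
    (hx : γ s ∈ (lchart (n := n) x₀).source) :
    deriv (fun r => lchart (n := n) x₀ (γ r)) s = toChart x₀ (γ s) (curveVel (𝓡 (n + 1)) γ s) :=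
  (eventually_deriv_lchart hγ.smooth hγ.isOpen hs hx).self_of_nhds

/-- Two geodesics with the same velocity at one time of an interval agree on that interval. -/
lemma IsGeodesicOpen.eqOn [T2Space M] (hγ : IsGeodesicOpen g γ U) (hσ : IsGeodesicOpen g σ U')
    {S : Set ℝ} (hS : IsPreconnected S) (hSU : S ⊆ U) (hSU' : S ⊆ U') {s₀ : ℝ} (hs₀ : s₀ ∈ S)
    (h0 : curveVelTB (𝓡 (n + 1)) γ s₀ = curveVelTB (𝓡 (n + 1)) σ s₀) :
    ∀ s ∈ S, γ =ᶠ[𝓝 s] σ := by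
  have hopen : IsOpen {s | γ =ᶠ[𝓝 s] σ} := isOpen_setOfPred_eventually_nhds
  -- The times at which the germs agree form an open set. At a limit point in `S` position and chart
  -- velocity agree by continuity, so the germs agree there by local uniqueness.
  refine hS.subset_of_closure_inter_subset hopen ⟨s₀, hs₀, ?_⟩ ?_
  · have hx := mem_lchart_source (n := n) (γ s₀)
    have h00 : γ s₀ = σ s₀ := congrArg Bundle.TotalSpace.proj h0
    refine hγ.eventuallyEq hσ (hSU hs₀) (hSU' hs₀) hx h00 ?_
    rw [hγ.deriv_lchart (hSU hs₀) hx, hσ.deriv_lchart (hSU' hs₀) (h00 ▸ hx)]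
    exact toChart_eq_of_tangentBundle_eq (γ s₀) h0
  · rintro s ⟨hcl, hs⟩
    have hx := mem_lchart_source (n := n) (γ s)
    have hfr : ∃ᶠ r in 𝓝 s, γ =ᶠ[𝓝 r] σ := mem_closure_iff_frequently.1 hcl
    have h00 : γ s = σ s :=
      tendsto_nhds_unique_of_frequently_eq (hγ.continuousAt (hSU hs)) (hσ.continuousAt (hSU' hs))
        (hfr.mono fun r hr => hr.self_of_nhds)
    refine hγ.eventuallyEq hσ (hSU hs) (hSU' hs) hx h00 ?_
    refine tendsto_nhds_unique_of_frequently_eq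
      (hγ.hasDerivAt_deriv (hSU hs) hx).continuousAt
      (hσ.hasDerivAt_deriv (hSU' hs) (h00 ▸ hx)).continuousAt (hfr.mono fun r hr => ?_)
    refine Filter.EventuallyEq.deriv_eq ?_
    filter_upwards [hr] with t ht
    rw [ht]

/-- The geodesic equation follows from the equation in a chart. -/
lemma covDeriv_curveVel_eq_zero (hγ : ContMDiffOn 𝓘(ℝ, ℝ) (𝓡 (n + 1)) ∞ γ U) (hU : IsOpen U)
    {s : ℝ} (hs : s ∈ U) {x₀ : M} (hx : γ s ∈ (lchart (n := n) x₀).source)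
    (h : HasDerivAt (deriv fun r => lchart (n := n) x₀ (γ r))
      (-chartChr g x₀ (lchart (n := n) x₀ (γ s)) (deriv (fun r => lchart (n := n) x₀ (γ r)) s)
        (deriv (fun r => lchart (n := n) x₀ (γ r)) s)) s) :
    covDeriv g γ (curveVel (𝓡 (n + 1)) γ) s = 0 := by
  have h2 := eventually_deriv_lchart hγ hU hs hx
  have h3 := (eventually_toChart_covDeriv (g := g) hγ hU
    (isSmoothFieldOn_curveVel hγ hU) hs hx).self_of_nhds
  have h4 : (fun r => toChart x₀ (γ r) (curveVel (𝓡 (n + 1)) γ r)) =ᶠ[𝓝 s]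
      deriv fun r => lchart (n := n) x₀ (γ r) := h2.mono fun r hr => hr.symm
  rw [h4.deriv_eq, h.deriv, ← h2.self_of_nhds, neg_add_cancel] at h3
  exact toChartL_injective hx (h3.trans (map_zero (toChartL x₀ (γ s))).symm)

variable {V W : Type*} [NormedAddCommGroup V] [NormedSpace ℝ V] [NormedAddCommGroup W]
  [NormedSpace ℝ W]

/-- A smooth family of geodesics, with domain `O`. -/
structure IsGeodesicFamily (g : LorentzianMetric n M) (G : V × ℝ → M) (O : Set (V × ℝ)) :
    Prop where
  isOpen : IsOpen O
  smooth : ContMDiffOn 𝓘(ℝ, V × ℝ) (𝓡 (n + 1)) ∞ G O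
  eq : ∀ q ∈ O, covDeriv g (fun r => G (q.1, r)) (curveVel (𝓡 (n + 1)) fun r => G (q.1, r)) q.2 = 0

variable {G : V × ℝ → M} {O : Set (V × ℝ)}

lemma IsGeodesicFamily.mono (h : IsGeodesicFamily g G O) {O' : Set (V × ℝ)} (hO : IsOpen O')
    (hs : O' ⊆ O) : IsGeodesicFamily g G O' :=
  ⟨hO, h.smooth.mono hs, fun q hq => h.eq q (hs hq)⟩

lemma IsGeodesicFamily.slice (h : IsGeodesicFamily g G O) (p : V) :
    IsGeodesicOpen g (fun r => G (p, r)) {r | (p, r) ∈ O} := by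
  refine ⟨h.isOpen.preimage (by fun_prop), ?_, fun s hs => h.eq (p, s) hs⟩
  intro s hs
  have h1 : ContMDiffAt 𝓘(ℝ, ℝ) 𝓘(ℝ, V × ℝ) ∞ (fun r : ℝ => (p, r)) s :=
    (contDiff_const.prodMk contDiff_id).contDiffAt.contMDiffAt
  exact (ContMDiffAt.comp s (h.smooth.contMDiffAt (h.isOpen.mem_nhds hs)) h1).contMDiffWithinAt

/-- Reparametrization of a family of geodesics, with a shift in time. -/
lemma IsGeodesicFamily.comp_shift {Φ : W × ℝ → M} {B : Set (W × ℝ)} (h : IsGeodesicFamily g Φ B)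
    {b : V → W} {N : Set V} (hN : IsOpen N) (hb : ContDiffOn ℝ ∞ b N) (a : ℝ) :
    IsGeodesicFamily g (fun q : V × ℝ => Φ (b q.1, q.2 - a))
      {q | q.1 ∈ N ∧ (b q.1, q.2 - a) ∈ B} := by
  have hmaps : ContDiffOn ℝ ∞ (fun q : V × ℝ => (b q.1, q.2 - a)) (N ×ˢ univ) :=
    (hb.comp contDiffOn_fst fun q hq => hq.1).prodMk (contDiff_snd.sub contDiff_const).contDiffOn
  have hopen : IsOpen {q : V × ℝ | q.1 ∈ N ∧ (b q.1, q.2 - a) ∈ B} := by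
    have := hmaps.continuousOn.isOpen_inter_preimage (hN.prod isOpen_univ) h.isOpen
    have heq : {q : V × ℝ | q.1 ∈ N ∧ (b q.1, q.2 - a) ∈ B} =
        N ×ˢ univ ∩ (fun q => (b q.1, q.2 - a)) ⁻¹' B := by
      ext q
      exact ⟨fun h => ⟨⟨h.1, mem_univ _⟩, h.2⟩, fun h => ⟨h.1.1, h.2⟩⟩
    rw [heq]
    exact this
  have hsm : ContMDiffOn 𝓘(ℝ, V × ℝ) (𝓡 (n + 1)) ∞ (fun q : V × ℝ => Φ (b q.1, q.2 - a))
      {q | q.1 ∈ N ∧ (b q.1, q.2 - a) ∈ B} := fun q hq =>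
    (ContMDiffAt.comp q (h.smooth.contMDiffAt (h.isOpen.mem_nhds hq.2))
      ((hmaps.contDiffAt ((hN.prod isOpen_univ).mem_nhds ⟨hq.1, mem_univ _⟩)).contMDiffAt)
      ).contMDiffWithinAt
  refine ⟨hopen, hsm, ?_⟩
  rintro ⟨p, s⟩ ⟨hp, hs⟩
  have hsl := h.slice (b p)
  have hx := mem_lchart_source (n := n) (Φ (b p, s - a))
  have h1 := hsl.hasDerivAt_deriv (s := s - a) hs hx
  set c : ℝ → Euc (n + 1) := fun r => lchart (n := n) (Φ (b p, s - a)) (Φ (b p, r)) with hc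
  have hsl' : ContMDiffOn 𝓘(ℝ, ℝ) (𝓡 (n + 1)) ∞ (fun r => Φ (b p, r - a))
      {r | (b p, r - a) ∈ B} := by
    intro r hr
    have h2 : ContMDiffAt 𝓘(ℝ, ℝ) 𝓘(ℝ, ℝ) ∞ (fun r : ℝ => r - a) r :=
      (contDiff_id.sub contDiff_const).contDiffAt.contMDiffAt
    exact (ContMDiffAt.comp r (hsl.smooth.contMDiffAt (hsl.isOpen.mem_nhds hr)) h2
      ).contMDiffWithinAt
  refine covDeriv_curveVel_eq_zero (g := g) (γ := fun r => Φ (b p, r - a)) hsl'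
    (h.isOpen.preimage (by fun_prop)) hs hx ?_
  have h2 : (deriv fun r => c (r - a)) = fun r => deriv c (r - a) := by
    ext1 r
    rw [deriv_comp_sub_const]
  change HasDerivAt (deriv fun r => c (r - a)) (-chartChr g _ (c (s - a))
    (deriv (fun r => c (r - a)) s) (deriv (fun r => c (r - a)) s)) s
  rw [h2]
  exact h1.comp_sub_const s a

/-- The local geodesic flow. -/
lemma exists_geodesicFlow (g : LorentzianMetric n M) {x₀ : M} {b₀ : Euc (n + 1) × Euc (n + 1)}
    (hb₀ : b₀.1 ∈ (lchart (n := n) x₀).target) :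
    ∃ (Φ : (Euc (n + 1) × Euc (n + 1)) × ℝ → M) (B : Set (Euc (n + 1) × Euc (n + 1))) (ε : ℝ),
      IsOpen B ∧ b₀ ∈ B ∧ 0 < ε ∧ IsGeodesicFamily g Φ (B ×ˢ Ioo (-ε) ε) ∧
      ∀ b ∈ B, b.1 ∈ (lchart (n := n) x₀).target ∧ Φ (b, 0) = (lchart (n := n) x₀).symm b.1 ∧
        toChart x₀ (Φ (b, 0)) (curveVel (𝓡 (n + 1)) (fun r => Φ (b, r)) 0) = b.2 := by
  have hev : ∀ᶠ b in 𝓝 b₀, b.1 ∈ (lchart (n := n) x₀).target :=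
    continuousAt_fst.eventually ((isOpen_lchart_target x₀).mem_nhds hb₀)
  obtain ⟨α, hα0, hα⟩ := exists_contDiffAt_flow (f := spray g x₀) (x₀ := b₀)
    (hev.mono fun b hb => contDiffAt_spray g hb)
  have hc : ContinuousAt α (b₀, 0) := hα.self_of_nhds.1.continuousAt
  have hev2 : ∀ᶠ q in 𝓝 (b₀, (0 : ℝ)), (α q).1 ∈ (lchart (n := n) x₀).target := by
    have := hc.fst
    exact this.eventually ((isOpen_lchart_target x₀).mem_nhds (by
      change (α (b₀, 0)).1 ∈ _
      rw [hα0]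
      exact hb₀))
  obtain ⟨B, hBo, hb, D, hDo, h0D, hBD⟩ :
      ∃ B : Set (Euc (n + 1) × Euc (n + 1)), IsOpen B ∧ b₀ ∈ B ∧ ∃ D : Set ℝ, IsOpen D ∧ 0 ∈ D ∧
        ∀ b ∈ B, ∀ t ∈ D, (ContDiffAt ℝ ∞ α (b, t) ∧ α (b, 0) = b ∧
        HasDerivAt (fun t => α (b, t)) (spray g x₀ (α (b, t))) t) ∧
        (α (b, t)).1 ∈ (lchart (n := n) x₀).target := by
    have h1 := hα.and hev2
    rw [nhds_prod_eq, Filter.eventually_prod_iff] at h1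
    obtain ⟨pa, ha, pb, hb, hab⟩ := h1
    obtain ⟨B, hB, hBo, hB0⟩ := eventually_nhds_iff.1 ha
    obtain ⟨D, hD, hDo, hD0⟩ := eventually_nhds_iff.1 hb
    exact ⟨B, hBo, hB0, D, hDo, hD0, fun b hb' t ht => hab (hB b hb') (hD t ht)⟩
  obtain ⟨ε, hε, hεD⟩ := Metric.isOpen_iff.1 hDo 0 h0D
  rw [Real.ball_eq_Ioo, zero_sub, zero_add] at hεD
  have h0 : (0 : ℝ) ∈ Ioo (-ε) ε := ⟨by linarith, hε⟩
  have hsm : ContMDiffOn 𝓘(ℝ, (Euc (n + 1) × Euc (n + 1)) × ℝ) (𝓡 (n + 1)) ∞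
      (fun q => (lchart (n := n) x₀).symm (α q).1) (B ×ˢ Ioo (-ε) ε) := by
    rintro ⟨b, t⟩ ⟨hb', ht⟩
    have h1 := hBD b hb' t (hεD ht)
    exact (ContMDiffAt.comp (x := (b, t)) (contMDiffAt_lchart_symm h1.2)
      (h1.1.1.fst.contMDiffAt)).contMDiffWithinAt
  have hlc : ∀ b ∈ B, ∀ t ∈ Ioo (-ε) ε,
      (fun r => lchart (n := n) x₀ ((lchart (n := n) x₀).symm (α (b, r)).1)) =ᶠ[𝓝 t] fun r =>
        (α (b, r)).1 := by
    intro b hb' t ht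
    filter_upwards [Ioo_mem_nhds ht.1 ht.2] with r hr
    exact (lchart (n := n) x₀).right_inv (hBD b hb' r (hεD hr)).2
  have hder : ∀ b ∈ B, ∀ t ∈ Ioo (-ε) ε,
      deriv (fun r => lchart (n := n) x₀ ((lchart (n := n) x₀).symm (α (b, r)).1)) t =
        (α (b, t)).2 := by
    intro b hb' t ht
    rw [(hlc b hb' t ht).deriv_eq]
    exact ((ContinuousLinearMap.fst ℝ (Euc (n + 1)) (Euc (n + 1))).hasFDerivAt.comp_hasDerivAt t
      (hBD b hb' t (hεD ht)).1.2.2).deriv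
  have hslice : ∀ b ∈ B, ContMDiffOn 𝓘(ℝ, ℝ) (𝓡 (n + 1)) ∞
      (fun r => (lchart (n := n) x₀).symm (α (b, r)).1) (Ioo (-ε) ε) := by
    intro b hb' t ht
    have h1 : ContMDiffAt 𝓘(ℝ, ℝ) 𝓘(ℝ, (Euc (n + 1) × Euc (n + 1)) × ℝ) ∞
      (fun r : ℝ => (b, r)) t := (contDiff_const.prodMk contDiff_id).contDiffAt.contMDiffAt
    exact (ContMDiffAt.comp t (hsm.contMDiffAt ((hBo.prod isOpen_Ioo).mem_nhds ⟨hb', ht⟩)) h1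
      ).contMDiffWithinAt
  refine ⟨fun q => (lchart (n := n) x₀).symm (α q).1, B, ε, hBo, hb, hε,
      ⟨hBo.prod isOpen_Ioo, hsm, ?_⟩, ?_⟩
  · rintro ⟨b, t⟩ ⟨hb', ht⟩
    have h1 := hBD b hb' t (hεD ht)
    refine covDeriv_curveVel_eq_zero (g := g) (γ := fun r => (lchart (n := n) x₀).symm (α (b, r)).1)
      (hslice b hb') isOpen_Ioo ht (lchart_symm_mem h1.2) ?_
    have h3 : (deriv fun r => lchart (n := n) x₀ ((lchart (n := n) x₀).symm (α (b, r)).1)) =ᶠ[𝓝 t]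
        fun r => (α (b, r)).2 := by
      filter_upwards [Ioo_mem_nhds ht.1 ht.2] with r hr
      exact hder b hb' r hr
    have h4 : lchart (n := n) x₀ ((lchart (n := n) x₀).symm (α (b, t)).1) = (α (b, t)).1 :=
      (hlc b hb' t ht).self_of_nhds
    change HasDerivAt (deriv fun r => lchart (n := n) x₀ ((lchart (n := n) x₀).symm (α (b, r)).1))
      (-chartChr g x₀ (lchart (n := n) x₀ ((lchart (n := n) x₀).symm (α (b, t)).1)) _ _) t
    rw [hder b hb' t ht, h4]
    exact ((ContinuousLinearMap.snd ℝ (Euc (n + 1)) (Euc (n + 1))).hasFDerivAt.comp_hasDerivAt t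
      h1.1.2.2).congr_of_eventuallyEq h3
  · intro b hb'
    have h1 := hBD b hb' 0 h0D
    have h2 : α (b, 0) = b := h1.1.2.1
    refine ⟨by rw [← h2]; exact h1.2, by simp only [h2], ?_⟩
    have h3 := (eventually_deriv_lchart (hslice b hb') isOpen_Ioo h0
      (lchart_symm_mem h1.2)).self_of_nhds
    exact h3.symm.trans ((hder b hb' 0 h0).trans (congrArg Prod.snd h2))

end Families

/-! ### Smooth dependence of geodesics on the initial velocity, over a compact interval -/

section Extension

variable {n : ℕ} {M : Type*} [TopologicalSpace M] [ChartedSpace (Euc (n + 1)) M]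
  [IsManifold (𝓡 (n + 1)) ∞ M] {g : LorentzianMetric n M}
  {V : Type*} [NormedAddCommGroup V] [NormedSpace ℝ V]

lemma tangentBundle_eq_of_toChart {x₀ : M} {p q : TangentBundle (𝓡 (n + 1)) M} (h : p.1 = q.1)
    (hx : p.1 ∈ (lchart (n := n) x₀).source) (h' : toChart x₀ p.1 p.2 = toChart x₀ q.1 q.2) : p =
      q := by
  obtain ⟨x, v⟩ := p
  obtain ⟨y, w⟩ := q
  change x = y at h
  subst h
  have : v = w := toChartL_injective hx h'
  rw [this]

lemma IsGeodesicFamily.congr {G G' : V × ℝ → M} {O : Set (V × ℝ)} (h : IsGeodesicFamily g G O)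
    (he : ∀ q ∈ O, G' q = G q) : IsGeodesicFamily g G' O := by
  have hsm : ContMDiffOn 𝓘(ℝ, V × ℝ) (𝓡 (n + 1)) ∞ G' O := h.smooth.congr he
  refine ⟨h.isOpen, hsm, ?_⟩
  rintro ⟨p, s⟩ hq
  have hx := mem_lchart_source (n := n) (G (p, s))
  have hU : IsOpen {r | (p, r) ∈ O} := h.isOpen.preimage (by fun_prop)
  have hsl : ContMDiffOn 𝓘(ℝ, ℝ) (𝓡 (n + 1)) ∞ (fun r => G' (p, r)) {r | (p, r) ∈ O} :=
    (h.slice p).smooth.congr fun r hr => he (p, r) hr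
  have hev : (fun r => lchart (n := n) (G (p, s)) (G' (p, r))) =ᶠ[𝓝 s]
      fun r => lchart (n := n) (G (p, s)) (G (p, r)) := by
    filter_upwards [hU.mem_nhds hq] with r hr
    rw [he (p, r) hr]
  have h1 := (h.slice p).hasDerivAt_deriv (s := s) hq hx
  refine covDeriv_curveVel_eq_zero (g := g) (γ := fun r => G' (p, r)) hsl hU hq
    (x₀ := G (p, s)) ((he _ hq).symm ▸ hx) ?_
  rw [hev.deriv_eq, show G' (p, (p, s).2) = G (p, s) from he _ hq]
  exact h1.congr_of_eventuallyEq hev.deriv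

lemma IsGeodesicFamily.contMDiffAt_velocity {G : V × ℝ → M} {O : Set (V × ℝ)}
    (h : IsGeodesicFamily g G O) {q : V × ℝ} (hq : q ∈ O) :
    ContMDiffAt 𝓘(ℝ, V × ℝ) (𝓡 (n + 1)).tangent ∞
      (fun q => curveVelTB (𝓡 (n + 1)) (fun r => G (q.1, r)) q.2) q := by
  have hx := mem_lchart_source (n := n) (G q)
  have hGq := h.smooth.contMDiffAt (h.isOpen.mem_nhds hq)
  refine (contMDiffAt_tangent_iff (σ := G)
    (V := fun q => curveVel (𝓡 (n + 1)) (fun r => G (q.1, r)) q.2) hx).2 ⟨hGq, ?_⟩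
  have hc : ContDiffAt ℝ ∞ (fun q' => lchart (n := n) (G q) (G q')) q :=
    contMDiffAt_iff_contDiffAt.1 (ContMDiffAt.comp q (contMDiffAt_lchart hx) hGq)
  have h1 : ContDiffAt ℝ ∞ (fun q' => fderiv ℝ (fun q' => lchart (n := n) (G q) (G q')) q' (0, 1))
      q :=
    (hc.fderiv_right (m := ∞) (by norm_cast)).clm_apply contDiffAt_const
  refine ContDiffAt.contMDiffAt (h1.congr_of_eventuallyEq ?_)
  have h2 : ∀ᶠ q' in 𝓝 q, G q' ∈ (lchart (n := n) (G q)).source :=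
    hGq.continuousAt.eventually ((isOpen_lchart_source _).mem_nhds hx)
  filter_upwards [h2, h.isOpen.mem_nhds hq] with q' h3 h4
  have h5 : DifferentiableAt ℝ (fun q' => lchart (n := n) (G q) (G q')) q' :=
    (contMDiffAt_iff_contDiffAt.1 (ContMDiffAt.comp q' (contMDiffAt_lchart h3)
      (h.smooth.contMDiffAt (h.isOpen.mem_nhds h4)))).differentiableAt (by simp)
  have h6 : HasDerivAt (fun r : ℝ => (q'.1, r)) ((0 : V), (1 : ℝ)) q'.2 :=
    (hasDerivAt_const _ _).prodMk (hasDerivAt_id _)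
  have h7 := (h5.hasFDerivAt (x := (q'.1, q'.2))).comp_hasDerivAt q'.2 h6
  have h8 := (h.slice q'.1).deriv_lchart (s := q'.2) h4 h3
  exact h8.symm.trans h7.deriv

variable [T2Space M] {P : Set V} {γ : V → ℝ → M} {ℓ : ℝ}

/-- The family `G` has the same velocities as `γ` at the times in `[0, ℓ]`. -/
def AgreesOn (γ : V → ℝ → M) (ℓ : ℝ) (G : V × ℝ → M) (O : Set (V × ℝ)) : Prop :=
  ∀ q ∈ O, q.2 ∈ Icc 0 ℓ →
    curveVelTB (𝓡 (n + 1)) (fun r => G (q.1, r)) q.2 = curveVelTB (𝓡 (n + 1)) (γ q.1) q.2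

/-- The velocities at time `s` depend smoothly on the parameter, near `p`. -/
def SmoothVelocityAt (γ : V → ℝ → M) (p : V) (s : ℝ) : Prop :=
  ∀ᶠ p' in 𝓝 p, ContMDiffAt 𝓘(ℝ, V) (𝓡 (n + 1)).tangent ∞
    (fun p => curveVelTB (𝓡 (n + 1)) (γ p) s) p'

/-- The point is that `δ` depends on `s₁` but not on `s₂`. The geodesic flow near the velocity at
`s₁` has a uniform life span, so smooth dependence at any one time within `δ` of `s₁` can be
propagated to the whole interval of radius `δ`. -/
lemma exists_family_of_smoothVelocity (hP : IsOpen P)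
    (hγ : ∀ p ∈ P, IsGeodesicOn g (γ p) (Icc 0 ℓ)) {p₀ : V} (hp₀ : p₀ ∈ P) {s₁ : ℝ}
    (hs₁ : s₁ ∈ Icc 0 ℓ) : ∃ δ > 0, ∀ s₂ ∈ Icc 0 ℓ, |s₂ - s₁| < δ → SmoothVelocityAt (n := n) γ p₀
      s₂ →
      ∃ (G : V × ℝ → M) (O : Set (V × ℝ)), IsGeodesicFamily g G O ∧ (∀ q ∈ O, q.1 ∈ P) ∧
        (∀ s, |s - s₁| < δ → (p₀, s) ∈ O) ∧ AgreesOn (n := n) γ ℓ G O := by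
  set x₀ := γ p₀ s₁ with hx₀
  have hx := mem_lchart_source (n := n) x₀
  let b : ℝ → V → Euc (n + 1) × Euc (n + 1) := fun s p =>
    (lchart (n := n) x₀ (γ p s), toChart x₀ (γ p s) (curveVel (𝓡 (n + 1)) (γ p) s))
  obtain ⟨Φ, B, ε, hBo, hbB, hε, hΦ, hB⟩ := exists_geodesicFlow g (x₀ := x₀) (b₀ := b s₁ p₀)
    ((lchart (n := n) x₀).map_source hx)
  obtain ⟨U₀, hU₀, hIU₀⟩ := isGeodesicOn_iff.1 (hγ p₀ hp₀)
  have hev : ∀ᶠ s in 𝓝 s₁, γ p₀ s ∈ (lchart (n := n) x₀).source ∧ b s p₀ ∈ B := by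
    have c := (hU₀.hasDerivAt_spray (hIU₀ hs₁) hx).continuousAt
    have e := eventually_deriv_lchart hU₀.smooth hU₀.isOpen (hIU₀ hs₁) hx
    have e2 := e.self_of_nhds
    have hm : (lchart (n := n) x₀ (γ p₀ s₁), deriv (fun r => lchart (n := n) x₀ (γ p₀ r)) s₁) ∈ B :=
        by
      rw [e2]; exact hbB
    filter_upwards [eventually_mem_source hx (hU₀.continuousAt (hIU₀ hs₁)), e,
      c.eventually_mem (hBo.mem_nhds hm)] with s h1 h2 h3
    refine ⟨h1, ?_⟩
    change (lchart (n := n) x₀ (γ p₀ s), deriv (fun r => lchart (n := n) x₀ (γ p₀ r)) s) ∈ B at h3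
    rw [h2] at h3
    exact h3
  obtain ⟨δ₀, hδ₀, hδ⟩ := Metric.eventually_nhds_iff.1 hev
  -- Both s and s₂ lie within ε/2 of s₁, so the elapsed time s - s₂ stays inside the life span ε of
  -- the flow.
  refine ⟨min δ₀ (ε / 2), lt_min hδ₀ (by linarith), fun s₂ hs₂ hs₂₁ hD => ?_⟩
  obtain ⟨hx₂, hb₂⟩ := hδ (y := s₂) (lt_of_lt_of_le hs₂₁ (min_le_left _ _))
  have hb : ∀ p, γ p s₂ ∈ (lchart (n := n) x₀).source → ContMDiffAt 𝓘(ℝ, V) (𝓡 (n + 1)).tangent ∞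
      (fun p => curveVelTB (𝓡 (n + 1)) (γ p) s₂) p → ContDiffAt ℝ ∞ (b s₂) p := by
    intro p h1 h2
    have h3 := (contMDiffAt_tangent_iff (σ := fun p => γ p s₂)
      (V := fun p => curveVel (𝓡 (n + 1)) (γ p) s₂) (s := p) h1).1 h2
    exact (contMDiffAt_iff_contDiffAt.1 (ContMDiffAt.comp p (contMDiffAt_lchart h1) h3.1)).prodMk
      (contMDiffAt_iff_contDiffAt.1 h3.2)
  have hsrc : ∀ᶠ p in 𝓝 p₀, γ p s₂ ∈ (lchart (n := n) x₀).source := by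
    have h3 := (contMDiffAt_tangent_iff (σ := fun p => γ p s₂)
      (V := fun p => curveVel (𝓡 (n + 1)) (γ p) s₂) (s := p₀) hx₂).1 hD.self_of_nhds
    exact h3.1.continuousAt.eventually ((isOpen_lchart_source _).mem_nhds hx₂)
  have hbc := (hb p₀ hx₂ hD.self_of_nhds).continuousAt
  obtain ⟨N, hN, hNo, hN0⟩ := eventually_nhds_iff.1 ((hD.and hsrc).and
    ((hbc.eventually (hBo.mem_nhds hb₂)).and (hP.mem_nhds hp₀)))
  have hbN : ContDiffOn ℝ ∞ (b s₂) N := fun p hp =>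
    (hb p (hN p hp).1.2 (hN p hp).1.1).contDiffWithinAt
  have hfam := hΦ.comp_shift hNo hbN s₂
  refine ⟨_, _, hfam, fun q hq => (hN q.1 hq.1).2.2, fun s hs => ⟨hN0, hb₂, ?_⟩, ?_⟩
  · have h1 := abs_lt.1 (lt_of_lt_of_le hs (min_le_right _ _))
    have h2 := abs_lt.1 (lt_of_lt_of_le hs₂₁ (min_le_right _ _))
    constructor <;> dsimp only <;> linarith [h1.1, h1.2, h2.1, h2.2]
  · rintro ⟨p, s⟩ ⟨hp, hpB, hsI⟩ hs
    obtain ⟨U, hU, hIU⟩ := isGeodesicOn_iff.1 (hγ p (hN p hp).2.2)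
    have hsl := hfam.slice p
    have h0 : (0 : ℝ) ∈ Ioo (-ε) ε := ⟨by linarith, hε⟩
    -- An interval on which both the restarted geodesic and the given one are defined, as uniqueness
    -- requires.
    let S := Icc 0 ℓ ∩ Ioo (s₂ - ε) (s₂ + ε)
    have hSp : IsPreconnected S := (ordConnected_Icc.inter ordConnected_Ioo).isPreconnected
    have hS : ∀ r ∈ S, (b s₂ p, r - s₂) ∈ B ×ˢ Ioo (-ε) ε := fun r hr =>
      ⟨hpB, by constructor <;> dsimp only <;> linarith [hr.2.1, hr.2.2]⟩
    have hs₂S : s₂ ∈ S := ⟨hs₂, by constructor <;> linarith⟩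
    have hsS : s ∈ S := ⟨hs, by
      have h1 : -ε < s - s₂ := hsI.1
      have h2 : s - s₂ < ε := hsI.2
      constructor <;> linarith⟩
    have hxp := (hN p hp).1.2
    obtain ⟨k1, k2, k3⟩ := hB _ hpB
    have hbase : Φ (b s₂ p, s₂ - s₂) = γ p s₂ := by
      rw [sub_self, k2]
      exact (lchart (n := n) x₀).left_inv hxp
    have hbase0 : Φ (b s₂ p, 0) = γ p s₂ := by rw [← hbase, sub_self]
    have hvel : curveVelTB (𝓡 (n + 1)) (fun r => Φ (b s₂ p, r - s₂)) s₂ =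
        curveVelTB (𝓡 (n + 1)) (γ p) s₂ := by
      refine tangentBundle_eq_of_toChart (x₀ := x₀) hbase ?_ ?_
      · change Φ (b s₂ p, s₂ - s₂) ∈ _
        rw [hbase]
        exact hxp
      have e1 := hsl.deriv_lchart (s := s₂) ⟨hp, hS _ hs₂S⟩ (x₀ := x₀) (by
        change Φ (b s₂ p, s₂ - s₂) ∈ _
        rw [hbase]
        exact hxp)
      have e2 := (hΦ.slice (b s₂ p)).deriv_lchart (s := 0) ⟨hpB, h0⟩ (x₀ := x₀) (by
        rw [hbase0]; exact hxp)
      refine e1.symm.trans (Eq.trans ?_ (e2.trans k3))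
      have e3 := deriv_comp_sub_const (f := fun r => lchart (n := n) x₀ (Φ (b s₂ p, r))) s₂ s₂
      rw [sub_self] at e3
      exact e3
    have heq := hsl.eqOn hU hSp (fun r hr => ⟨hp, hS r hr⟩) (fun r hr => hIU hr.1) hs₂S hvel s hsS
    exact curveVelTB_eq_of_eventuallyEq heq

lemma smoothVelocityAt_of_agreesOn {G : V × ℝ → M} {O : Set (V × ℝ)}
    (h : IsGeodesicFamily g G O) (hA : AgreesOn (n := n) γ ℓ G O) {p : V} {s : ℝ}
    (hps : (p, s) ∈ O) (hs : s ∈ Icc 0 ℓ) : SmoothVelocityAt (n := n) γ p s := by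
  have hO : IsOpen {p | (p, s) ∈ O} := h.isOpen.preimage (by fun_prop)
  filter_upwards [hO.mem_nhds hps] with p' hp'
  have h1 : ContMDiffAt 𝓘(ℝ, V) 𝓘(ℝ, V × ℝ) ∞ (fun p : V => (p, s)) p' :=
    (contDiff_id.prodMk contDiff_const).contDiffAt.contMDiffAt
  refine (ContMDiffAt.comp p' (h.contMDiffAt_velocity hp') h1).congr_of_eventuallyEq ?_
  filter_upwards [hO.mem_nhds hp'] with p'' hp''
  exact (hA _ hp'' hs).symm

/-- Because `δ` is uniform, smoothness at one of two nearby times implies it at the other, in both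
directions. Connectedness of [0, ℓ] then carries it from time 0 to every time. -/
lemma smoothVelocityAt_all (hP : IsOpen P) (hγ : ∀ p ∈ P, IsGeodesicOn g (γ p) (Icc 0 ℓ))
    {p₀ : V} (hp₀ : p₀ ∈ P) (h0 : SmoothVelocityAt (n := n) γ p₀ 0) {s : ℝ} (hs : s ∈ Icc 0 ℓ) :
    SmoothVelocityAt (n := n) γ p₀ s := by
  have h0I : (0 : ℝ) ∈ Icc 0 ℓ := ⟨le_rfl, hs.1.trans hs.2⟩
  refine (isPreconnected_Icc.induction₂
    (fun a b => SmoothVelocityAt (n := n) γ p₀ a ↔ SmoothVelocityAt (n := n) γ p₀ b) ?_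
    (fun a b c _ _ _ h1 h2 => h1.trans h2) (fun a b _ _ h1 => h1.symm) h0I hs).1 h0
  intro s₁ hs₁
  obtain ⟨δ, hδ, H⟩ := exists_family_of_smoothVelocity hP hγ hp₀ hs₁
  filter_upwards [nhdsWithin_le_nhds (Metric.ball_mem_nhds s₁ hδ), self_mem_nhdsWithin]
    with s₂ hs₂ hs₂I
  constructor
  · intro h
    obtain ⟨G, O, h1, -, h3, h4⟩ := H s₁ hs₁ (by simpa using hδ) h
    exact smoothVelocityAt_of_agreesOn h1 h4 (h3 s₂ hs₂) hs₂I
  · intro h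
    obtain ⟨G, O, h1, -, h3, h4⟩ := H s₂ hs₂I hs₂ h
    exact smoothVelocityAt_of_agreesOn h1 h4 (h3 s₁ (by simpa using hδ)) hs₁

/-- Geodesics over `[0, ℓ]` whose initial velocities depend smoothly on a parameter extend locally
to a smooth family over a neighbourhood of `[0, ℓ]`. -/
lemma exists_extension (hP : IsOpen P) (hγ : ∀ p ∈ P, IsGeodesicOn g (γ p) (Icc 0 ℓ))
    (hℓ : 0 < ℓ) {p₀ : V} (hp₀ : p₀ ∈ P) (h0 : SmoothVelocityAt (n := n) γ p₀ 0) :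
    ∃ (Γ : V × ℝ → M) (N : Set V) (I : Set ℝ), IsOpen N ∧ p₀ ∈ N ∧ N ⊆ P ∧ IsOpen I ∧
      Icc 0 ℓ ⊆ I ∧ IsGeodesicFamily g Γ (N ×ˢ I) ∧
      (∀ p, ∀ s ∈ Icc 0 ℓ, Γ (p, s) = γ p s) ∧ AgreesOn (n := n) γ ℓ Γ (N ×ˢ I) := by
  have germ : ∀ s₁ ∈ Icc 0 ℓ, ∃ (G : V × ℝ → M) (O : Set (V × ℝ)), IsGeodesicFamily g G O ∧
      (∀ q ∈ O, q.1 ∈ P) ∧ (p₀, s₁) ∈ O ∧ AgreesOn (n := n) γ ℓ G O := by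
    intro s₁ hs₁
    obtain ⟨δ, hδ, H⟩ := exists_family_of_smoothVelocity hP hγ hp₀ hs₁
    obtain ⟨G, O, h1, h2, h3, h4⟩ := H s₁ hs₁ (by simpa using hδ)
      (smoothVelocityAt_all hP hγ hp₀ h0 hs₁)
    exact ⟨G, O, h1, h2, h3 s₁ (by simpa using hδ), h4⟩
  obtain ⟨G₀, O₀, fam₀, hP₀, mem₀, ag₀⟩ := germ 0 ⟨le_rfl, hℓ.le⟩
  obtain ⟨G₁, O₁, fam₁, hP₁, mem₁, ag₁⟩ := germ ℓ ⟨hℓ.le, le_rfl⟩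
  classical
  -- Beyond [0, ℓ] the geodesics `γ p` are defined on neighbourhoods that may shrink with p, without
  -- joint smoothness. There they are replaced by the smooth families constructed near the two end
  -- times.
  let Γ : V × ℝ → M := fun q =>
    if q.2 < 0 then G₀ q else if q.2 ≤ ℓ then γ q.1 q.2 else G₁ q
  have hΓγ : ∀ p, ∀ s ∈ Icc 0 ℓ, Γ (p, s) = γ p s := fun p s hs => by
    simp [Γ, not_lt.2 hs.1, hs.2]
  have base : ∀ {G O}, AgreesOn (n := n) γ ℓ G O → ∀ q ∈ O, q.2 ∈ Icc 0 ℓ → Γ q = G q := by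
    intro G O ag q hq hs
    rw [hΓγ q.1 q.2 hs]
    exact (congrArg Bundle.TotalSpace.proj (ag q hq hs)).symm
  have loc : ∀ s₁ ∈ Icc 0 ℓ, ∃ O : Set (V × ℝ), (p₀, s₁) ∈ O ∧ IsGeodesicFamily g Γ O ∧
      (∀ q ∈ O, q.1 ∈ P) ∧ AgreesOn (n := n) γ ℓ Γ O := by
    intro s₁ hs₁
    obtain ⟨G, O, fam, hPO, mem, ag, hΓ⟩ : ∃ (G : V × ℝ → M) (O : Set (V × ℝ)),
        IsGeodesicFamily g G O ∧ (∀ q ∈ O, q.1 ∈ P) ∧ (p₀, s₁) ∈ O ∧ AgreesOn (n := n) γ ℓ G O ∧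
        ∀ q ∈ O, Γ q = G q := by
      rcases eq_or_lt_of_le hs₁.1 with h | h
      · subst h
        refine ⟨G₀, O₀ ∩ {q | q.2 < ℓ}, fam₀.mono (fam₀.isOpen.inter
          (isOpen_lt continuous_snd continuous_const)) inter_subset_left,
          fun q hq => hP₀ q hq.1, ⟨mem₀, hℓ⟩, fun q hq => ag₀ q hq.1, fun q hq => ?_⟩
        by_cases h : q.2 < 0
        · simp [Γ, h]
        · exact base ag₀ q hq.1 ⟨not_lt.1 h, hq.2.le⟩
      rcases eq_or_lt_of_le hs₁.2 with h' | h'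
      · subst h'
        refine ⟨G₁, O₁ ∩ {q | 0 < q.2}, fam₁.mono (fam₁.isOpen.inter
          (isOpen_lt continuous_const continuous_snd)) inter_subset_left,
          fun q hq => hP₁ q hq.1, ⟨mem₁, hℓ⟩, fun q hq => ag₁ q hq.1, fun q hq => ?_⟩
        have hq2 : 0 < q.2 := hq.2
        by_cases h : q.2 ≤ s₁
        · exact base ag₁ q hq.1 ⟨hq2.le, h⟩
        · simp [Γ, h, not_lt.2 hq2.le]
      · obtain ⟨G, O, fam, hPO, mem, ag⟩ := germ s₁ hs₁
        refine ⟨G, O ∩ {q | q.2 ∈ Ioo 0 ℓ}, fam.mono (fam.isOpen.inter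
          (isOpen_Ioo.preimage continuous_snd)) inter_subset_left,
          fun q hq => hPO q hq.1, ⟨mem, h, h'⟩, fun q hq => ag q hq.1, fun q hq => ?_⟩
        exact base ag q hq.1 (Ioo_subset_Icc_self hq.2)
    refine ⟨O, mem, fam.congr hΓ, hPO, ?_⟩
    rintro ⟨p, s⟩ hq hs
    rw [← ag (p, s) hq hs]
    refine curveVelTB_eq_of_eventuallyEq ?_
    filter_upwards [(fam.slice p).isOpen.mem_nhds hq] with r hr
    exact hΓ (p, r) hr
  choose! O mem fam hPO ag using loc
  let T := ⋃ s ∈ Icc 0 ℓ, O s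
  have hT : ∀ q ∈ T, ∃ s ∈ Icc 0 ℓ, q ∈ O s := fun q hq => by simpa [T] using hq
  have hTo : IsOpen T := isOpen_biUnion fun s hs => (fam s hs).isOpen
  -- Compactness of [0, ℓ] gives one parameter neighbourhood and one time neighbourhood for the
  -- union of the local domains.
  obtain ⟨N, I, hN, hI, hpN, hII, hNI⟩ := generalized_tube_lemma (isCompact_singleton (x := p₀))
    (isCompact_Icc (a := (0 : ℝ)) (b := ℓ)) hTo (by
      rintro ⟨p, s⟩ ⟨hp, hs⟩
      rw [mem_singleton_iff] at hp
      subst hp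
      exact mem_biUnion hs (mem s hs))
  refine ⟨Γ, N, I, hN, hpN rfl, ?_, hI, hII, ⟨hN.prod hI, ?_, ?_⟩, hΓγ, ?_⟩
  · intro p hp
    obtain ⟨s, hs, hq⟩ := hT (p, 0) (hNI ⟨hp, hII ⟨le_rfl, hℓ.le⟩⟩)
    exact hPO s hs _ hq
  · intro q hq
    obtain ⟨s, hs, hq⟩ := hT q (hNI hq)
    exact ((fam s hs).smooth.contMDiffAt ((fam s hs).isOpen.mem_nhds hq)).contMDiffWithinAt
  · intro q hq
    obtain ⟨s, hs, hq⟩ := hT q (hNI hq)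
    exact (fam s hs).eq q hq
  · intro q hq
    obtain ⟨s, hs, hq⟩ := hT q (hNI hq)
    exact ag s hs q hq

end Extension

/-! ### Variation fields of families of geodesics -/

section Variation

variable {n : ℕ} {M : Type*} [TopologicalSpace M] [ChartedSpace (Euc (n + 1)) M]
  [IsManifold (𝓡 (n + 1)) ∞ M] {g : LorentzianMetric n M}

/-- The Jacobi equation follows from the linearised geodesic equation in charts. -/
lemma isJacobiOpen_of_chart {γ : ℝ → M} {U : Set ℝ} (h : IsGeodesicOpen g γ U)
    {J : ∀ s, TangentSpace (𝓡 (n + 1)) (γ s)}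
    (hJ : ∀ s ∈ U, ContDiffAt ℝ ∞ (fun r => toChart (γ s) (γ r) (J r)) s)
    (hJ' : ∀ s ∈ U, HasDerivAt (deriv fun r => toChart (γ s) (γ r) (J r))
      (-((2 : ℝ) • chartChr g (γ s) (lchart (n := n) (γ s) (γ s))
        (deriv (fun r => lchart (n := n) (γ s) (γ r)) s)
        (deriv (fun r => toChart (γ s) (γ r) (J r)) s) +
      fderiv ℝ (chartChr g (γ s)) (lchart (n := n) (γ s) (γ s)) (toChart (γ s) (γ s) (J s))
        (deriv (fun r => lchart (n := n) (γ s) (γ r)) s)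
          (deriv (fun r => lchart (n := n) (γ s) (γ r)) s))) s) :
    IsJacobiOpen g γ J U := by
  have hsm := isSmoothFieldOn_of_charts h.smooth h.isOpen hJ
  refine ⟨hsm, fun s hs => ?_⟩
  have h1 := toChart_jacobi h hsm hs
  rw [(hJ' s hs).deriv, neg_add_cancel] at h1
  exact toChartL_injective (mem_lchart_source (γ s)) (h1.trans (map_zero (toChartL _ (γ s))).symm)

lemma fderiv_fderiv_apply_symm {W F : Type*} [NormedAddCommGroup W] [NormedSpace ℝ W]
    [NormedAddCommGroup F] [NormedSpace ℝ F] {f : W → F} {q : W} (hf : ContDiffAt ℝ ∞ f q)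
    (u v : W) : fderiv ℝ (fun q => fderiv ℝ f q u) q v = fderiv ℝ (fun q => fderiv ℝ f q v) q u :=
      by
  have h1 : ContDiffAt ℝ ∞ (fderiv ℝ f) q := hf.fderiv_right (by norm_cast)
  have h2 := (h1.differentiableAt (by simp)).hasFDerivAt
  have h3 : ∀ u v, fderiv ℝ (fun q => fderiv ℝ f q u) q v = fderiv ℝ (fderiv ℝ f) q v u := by
    intro u v
    rw [(h2.clm_apply (hasFDerivAt_const u q)).fderiv]
    simp
  rw [h3, h3]
  exact (hf.isSymmSndFDerivAt (by simp; norm_cast)) v u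

lemma contDiffAt_fderiv_apply {W F : Type*} [NormedAddCommGroup W] [NormedSpace ℝ W]
    [NormedAddCommGroup F] [NormedSpace ℝ F] {f : W → F} {q : W} (hf : ContDiffAt ℝ ∞ f q)
    (u : W) : ContDiffAt ℝ ∞ (fun q => fderiv ℝ f q u) q :=
  (hf.fderiv_right (m := ∞) (by norm_cast)).clm_apply contDiffAt_const

variable {V : Type*} [NormedAddCommGroup V] [NormedSpace ℝ V] {Γ : V × ℝ → M} {O : Set (V × ℝ)}

/-- The variation field of a family of geodesics in the direction `(δ, c + d s)`, where
`l = (δ, c, d)`. -/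
def rayField (Γ : V × ℝ → M) (p : V) (l : V × ℝ × ℝ) (s : ℝ) :
    TangentSpace (𝓡 (n + 1)) (Γ (p, s)) :=
  mfderiv 𝓘(ℝ, V × ℝ) (𝓡 (n + 1)) Γ (p, s) ((l.1, l.2.1 + l.2.2 * s) : V × ℝ)

/-- The covariant derivative of the variation field. -/
def rayField' (g : LorentzianMetric n M) (Γ : V × ℝ → M) (p : V) (l : V × ℝ × ℝ) (s : ℝ) :
    TangentSpace (𝓡 (n + 1)) (Γ (p, s)) :=
  covDeriv g (fun r => Γ (p, r)) (rayField Γ p l) s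

/-- The velocity of the geodesics of the family. -/
def rayVel (Γ : V × ℝ → M) (p : V) (s : ℝ) : TangentSpace (𝓡 (n + 1)) (Γ (p, s)) :=
  curveVel (𝓡 (n + 1)) (fun r => Γ (p, r)) s

/-- The family in a chart. -/
def chartFamily (x₀ : M) (Γ : V × ℝ → M) (q : V × ℝ) : Euc (n + 1) := lchart (n := n) x₀ (Γ q)

/-- The velocity of the family in a chart. -/
def chartVel (x₀ : M) (Γ : V × ℝ → M) (q : V × ℝ) : Euc (n + 1) :=
  fderiv ℝ (chartFamily (n := n) x₀ Γ) q (0, 1)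

namespace IsGeodesicFamily

lemma contMDiffAt (h : IsGeodesicFamily g Γ O) {q : V × ℝ} (hq : q ∈ O) :
    ContMDiffAt 𝓘(ℝ, V × ℝ) (𝓡 (n + 1)) ∞ Γ q := h.smooth.contMDiffAt (h.isOpen.mem_nhds hq)

lemma contDiffAt_chartFamily (h : IsGeodesicFamily g Γ O) {q : V × ℝ} (hq : q ∈ O) {x₀ : M}
    (hx : Γ q ∈ (lchart (n := n) x₀).source) : ContDiffAt ℝ ∞ (chartFamily (n := n) x₀ Γ) q :=
  contMDiffAt_iff_contDiffAt.1 (ContMDiffAt.comp q (contMDiffAt_lchart hx) (h.contMDiffAt hq))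

lemma contDiffAt_chartVel (h : IsGeodesicFamily g Γ O) {q : V × ℝ} (hq : q ∈ O) {x₀ : M}
    (hx : Γ q ∈ (lchart (n := n) x₀).source) : ContDiffAt ℝ ∞ (chartVel (n := n) x₀ Γ) q :=
  contDiffAt_fderiv_apply (h.contDiffAt_chartFamily hq hx) _

lemma eventually_mem (h : IsGeodesicFamily g Γ O) {q : V × ℝ} (hq : q ∈ O) {x₀ : M}
    (hx : Γ q ∈ (lchart (n := n) x₀).source) : ∀ᶠ q' in 𝓝 q, q' ∈ O ∧ Γ q' ∈
      (lchart (n := n) x₀).source :=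
  Filter.Eventually.and (h.isOpen.mem_nhds hq)
    ((h.contMDiffAt hq).continuousAt.eventually ((isOpen_lchart_source _).mem_nhds hx))

lemma toChart_mfderiv (h : IsGeodesicFamily g Γ O) {q : V × ℝ} (hq : q ∈ O) {x₀ : M}
    (hx : Γ q ∈ (lchart (n := n) x₀).source) (w : V × ℝ) :
    toChart x₀ (Γ q) (mfderiv 𝓘(ℝ, V × ℝ) (𝓡 (n + 1)) Γ q w) =
      fderiv ℝ (chartFamily (n := n) x₀ Γ) q w := by
  have h1 := mfderiv_comp q (mdifferentiableAt_lchart hx)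
    ((h.contMDiffAt hq).mdifferentiableAt (by simp))
  have h3 := DFunLike.congr_fun h1 w
  rw [mfderiv_eq_fderiv] at h3
  exact h3.symm

lemma hasDerivAt_slice {W : Type*} [NormedAddCommGroup W] [NormedSpace ℝ W] {f : V × ℝ → W}
    {p : V} {s : ℝ} (hf : DifferentiableAt ℝ f (p, s)) :
    HasDerivAt (fun r => f (p, r)) (fderiv ℝ f (p, s) (0, 1)) s := by
  have h6 : HasDerivAt (fun r : ℝ => (p, r)) ((0 : V), (1 : ℝ)) s :=
    (hasDerivAt_const _ _).prodMk (hasDerivAt_id _)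
  exact hf.hasFDerivAt.comp_hasDerivAt s h6

lemma deriv_chartFamily (h : IsGeodesicFamily g Γ O) {p : V} {s : ℝ} (hq : (p, s) ∈ O) {x₀ : M}
    (hx : Γ (p, s) ∈ (lchart (n := n) x₀).source) :
    deriv (fun r => chartFamily (n := n) x₀ Γ (p, r)) s = chartVel (n := n) x₀ Γ (p, s) :=
  (hasDerivAt_slice ((h.contDiffAt_chartFamily hq hx).differentiableAt (by simp))).deriv

lemma toChart_rayVel (h : IsGeodesicFamily g Γ O) {p : V} {s : ℝ} (hq : (p, s) ∈ O) {x₀ : M}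
    (hx : Γ (p, s) ∈ (lchart (n := n) x₀).source) :
    toChart x₀ (Γ (p, s)) (rayVel (n := n) Γ p s) = chartVel (n := n) x₀ Γ (p, s) :=
  ((h.slice p).deriv_lchart (s := s) hq hx).symm.trans (h.deriv_chartFamily hq hx)

lemma rayVel_eq (h : IsGeodesicFamily g Γ O) {p : V} {s : ℝ} (hq : (p, s) ∈ O) :
    rayVel (n := n) Γ p s = mfderiv 𝓘(ℝ, V × ℝ) (𝓡 (n + 1)) Γ (p, s) ((0, 1) : V × ℝ) := by
  have hx := mem_lchart_source (n := n) (Γ (p, s))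
  exact toChartL_injective hx ((h.toChart_rayVel hq hx).trans (h.toChart_mfderiv hq hx _).symm)

/-- The geodesic equation in a chart. -/
lemma fderiv_chartVel (h : IsGeodesicFamily g Γ O) {q : V × ℝ} (hq : q ∈ O) {x₀ : M}
    (hx : Γ q ∈ (lchart (n := n) x₀).source) :
    fderiv ℝ (chartVel (n := n) x₀ Γ) q (0, 1) = -chartChr g x₀ (chartFamily (n := n) x₀ Γ q)
      (chartVel (n := n) x₀ Γ q) (chartVel (n := n) x₀ Γ q) := by
  obtain ⟨p, s⟩ := q
  have h1 := (h.slice p).hasDerivAt_deriv (s := s) hq hx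
  have h2 := hasDerivAt_slice ((h.contDiffAt_chartVel hq hx).differentiableAt (by simp))
  have h3 : (fun r => chartVel (n := n) x₀ Γ (p, r)) =ᶠ[𝓝 s]
      deriv fun r => chartFamily (n := n) x₀ Γ (p, r) := by
    have h4 : ContinuousAt (fun r : ℝ => (p, r)) s := by fun_prop
    filter_upwards [h4.eventually (h.eventually_mem hq hx)] with r hr
    exact (h.deriv_chartFamily hr.1 hr.2).symm
  have h5 := (h2.congr_of_eventuallyEq h3.symm).unique h1
  rw [h5]
  change -chartChr g x₀ (chartFamily (n := n) x₀ Γ (p, s))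
    (deriv (fun r => chartFamily (n := n) x₀ Γ (p, r)) s)
    (deriv (fun r => chartFamily (n := n) x₀ Γ (p, r)) s) = _
  rw [h.deriv_chartFamily hq hx]

lemma toChart_rayField (h : IsGeodesicFamily g Γ O) {p : V} {s : ℝ} (hq : (p, s) ∈ O) {x₀ : M}
    (hx : Γ (p, s) ∈ (lchart (n := n) x₀).source) (l : V × ℝ × ℝ) :
    toChart x₀ (Γ (p, s)) (rayField (n := n) Γ p l s) =
      fderiv ℝ (chartFamily (n := n) x₀ Γ) (p, s) (l.1, l.2.1) +
        (l.2.2 * s) • chartVel (n := n) x₀ Γ (p, s) := by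
  rw [rayField, h.toChart_mfderiv hq hx, chartVel, ← map_smul, ← map_add]
  simp

/-- The derivative of a variation field in a chart. -/
lemma hasDerivAt_rayField (h : IsGeodesicFamily g Γ O) {p : V} {s : ℝ} (hq : (p, s) ∈ O) {x₀ : M}
    (hx : Γ (p, s) ∈ (lchart (n := n) x₀).source) (l : V × ℝ × ℝ) :
    HasDerivAt (fun r => toChart x₀ (Γ (p, r)) (rayField (n := n) Γ p l r))
      (fderiv ℝ (chartVel (n := n) x₀ Γ) (p, s) (l.1, l.2.1 + l.2.2 * s) +
        l.2.2 • chartVel (n := n) x₀ Γ (p, s)) s := by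
  have hc := h.contDiffAt_chartFamily hq hx
  have h1 := hasDerivAt_slice ((contDiffAt_fderiv_apply hc (l.1, l.2.1)).differentiableAt (by simp))
  have h2 := hasDerivAt_slice ((h.contDiffAt_chartVel hq hx).differentiableAt (by simp))
  have h3 : HasDerivAt (fun r => l.2.2 * r) l.2.2 s := by
    simpa using (hasDerivAt_id s).const_mul l.2.2
  have h4 := h1.add (h3.smul h2)
  rw [fderiv_fderiv_apply_symm hc] at h4
  refine (h4.congr_of_eventuallyEq ?_).congr_deriv ?_
  · have h5 : ContinuousAt (fun r : ℝ => (p, r)) s := by fun_prop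
    filter_upwards [h5.eventually (h.eventually_mem hq hx)] with r hr
    exact h.toChart_rayField hr.1 hr.2 l
  · change fderiv ℝ (chartVel (n := n) x₀ Γ) (p, s) _ + _ = _
    have h6 : ((l.1, l.2.1 + l.2.2 * s) : V × ℝ) = (l.1, l.2.1) + (l.2.2 * s) • (0, 1) := by simp
    rw [h6, map_add, map_smul, add_assoc]

lemma contDiffAt_rayField (h : IsGeodesicFamily g Γ O) {p : V} {s : ℝ} (hq : (p, s) ∈ O) {x₀ : M}
    (hx : Γ (p, s) ∈ (lchart (n := n) x₀).source) (l : V × ℝ × ℝ) :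
    ContDiffAt ℝ ∞ (fun q : V × ℝ => toChart x₀ (Γ q) (rayField (n := n) Γ q.1 l q.2)) (p, s) := by
  have h1 : ContDiffAt ℝ ∞ (fun q : V × ℝ => fderiv ℝ (chartFamily (n := n) x₀ Γ) q (l.1, l.2.1) +
      (l.2.2 * q.2) • chartVel (n := n) x₀ Γ q) (p, s) :=
    (contDiffAt_fderiv_apply (h.contDiffAt_chartFamily hq hx) _).add
      ((contDiffAt_const.mul contDiffAt_snd).smul (h.contDiffAt_chartVel hq hx))
  refine h1.congr_of_eventuallyEq ?_
  filter_upwards [h.eventually_mem hq hx] with q hq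
  exact h.toChart_rayField hq.1 hq.2 l

lemma contDiffAt_rayField_slice (h : IsGeodesicFamily g Γ O) {p : V} {s : ℝ} (hq : (p, s) ∈ O)
    {x₀ : M} (hx : Γ (p, s) ∈ (lchart (n := n) x₀).source) (l : V × ℝ × ℝ) :
    ContDiffAt ℝ ∞ (fun r => toChart x₀ (Γ (p, r)) (rayField (n := n) Γ p l r)) s := by
  have h2 : ContDiffAt ℝ ∞ (fun r : ℝ => (p, r)) s := contDiffAt_const.prodMk contDiffAt_id
  exact ContDiffAt.comp s (h.contDiffAt_rayField hq hx l) h2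

/-- Variation fields are Jacobi fields. -/
lemma isJacobiOpen_rayField (h : IsGeodesicFamily g Γ O) (p : V) (l : V × ℝ × ℝ) :
    IsJacobiOpen g (fun r => Γ (p, r)) (rayField Γ p l) {r | (p, r) ∈ O} := by
  refine isJacobiOpen_of_chart (h.slice p) (fun s hs =>
    h.contDiffAt_rayField_slice hs (mem_lchart_source (Γ (p, s))) l) fun s hs => ?_
  set x₀ := Γ (p, s) with hx₀
  have hx : Γ (p, s) ∈ (lchart (n := n) x₀).source := mem_lchart_source (Γ (p, s))
  have hd := h.deriv_chartFamily hs hx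
  have h5 : ContinuousAt (fun r : ℝ => (p, r)) s := by fun_prop
  have hev := h5.eventually (h.eventually_mem hs hx)
  have hcv := h.contDiffAt_chartVel hs hx
  have e1 : (deriv fun r => toChart x₀ (Γ (p, r)) (rayField (n := n) Γ p l r)) =ᶠ[𝓝 s] fun r =>
      fderiv ℝ (chartVel (n := n) x₀ Γ) (p, r) (l.1, l.2.1) +
        ((l.2.2 * r) • (-chartChr g x₀ (chartFamily (n := n) x₀ Γ (p, r))
          (chartVel (n := n) x₀ Γ (p, r)) (chartVel (n := n) x₀ Γ (p, r))) +
        l.2.2 • chartVel (n := n) x₀ Γ (p, r)) := by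
    filter_upwards [hev] with r hr
    rw [(h.hasDerivAt_rayField hr.1 hr.2 l).deriv, ← h.fderiv_chartVel hr.1 hr.2, ← map_smul,
      ← add_assoc, ← map_add]
    simp
  -- Exchanging the time derivative with the parameter derivative turns the left side into the
  -- parameter derivative of the geodesic equation, which is the linearised equation for the field.
  have e2 : fderiv ℝ (fun q => fderiv ℝ (chartVel (n := n) x₀ Γ) q (l.1, l.2.1)) (p, s) (0, 1) =
      fderiv ℝ (fun q => -chartChr g x₀ (chartFamily (n := n) x₀ Γ q)
          (chartVel (n := n) x₀ Γ q) (chartVel (n := n) x₀ Γ q)) (p, s) (l.1, l.2.1) := by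
    rw [fderiv_fderiv_apply_symm hcv]
    have e3 : (fun q => fderiv ℝ (chartVel (n := n) x₀ Γ) q (0, 1)) =ᶠ[𝓝 (p, s)] fun q =>
        -chartChr g x₀ (chartFamily (n := n) x₀ Γ q)
          (chartVel (n := n) x₀ Γ q) (chartVel (n := n) x₀ Γ q) := by
      filter_upwards [h.eventually_mem hs hx] with q hq
      exact h.fderiv_chartVel hq.1 hq.2
    rw [e3.fderiv_eq]
  have hy : chartFamily (n := n) x₀ Γ (p, s) ∈ (lchart (n := n) x₀).target :=
      (lchart (n := n) x₀).map_source hx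
  have hΓd : HasFDerivAt (chartChr g x₀) _ (chartFamily (n := n) x₀ Γ (p, s)) :=
    ((contDiffAt_chartChr g hy).differentiableAt (by simp)).hasFDerivAt
  have hF := ((h.contDiffAt_chartFamily hs hx).differentiableAt (by simp)).hasFDerivAt
  have hv := (hcv.differentiableAt (by simp)).hasFDerivAt
  have hsp : HasFDerivAt (fun q => -chartChr g x₀ (chartFamily (n := n) x₀ Γ q)
          (chartVel (n := n) x₀ Γ q) (chartVel (n := n) x₀ Γ q)) _ (p, s) :=
    (((hΓd.comp (p, s) hF).clm_apply hv).clm_apply hv).neg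
  have d1 := hasDerivAt_slice ((contDiffAt_fderiv_apply hcv (l.1, l.2.1)).differentiableAt (by simp))
  have d2 := hasDerivAt_slice hsp.differentiableAt
  have d3 := hasDerivAt_slice (hcv.differentiableAt (by simp))
  have d4 : HasDerivAt (fun r => l.2.2 * r) l.2.2 s := by
    simpa using (hasDerivAt_id s).const_mul l.2.2
  have d5 := (d1.add ((d4.smul d2).add (d3.const_smul l.2.2))).congr_of_eventuallyEq e1
  refine d5.congr_deriv ?_
  have hdJ := (h.hasDerivAt_rayField hs hx l).deriv
  change _ = -((2 : ℝ) • chartChr g x₀ (chartFamily (n := n) x₀ Γ (p, s))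
    (deriv (fun r => chartFamily (n := n) x₀ Γ (p, r)) s)
    (deriv (fun r => toChart x₀ (Γ (p, r)) (rayField (n := n) Γ p l r)) s) +
    fderiv ℝ (chartChr g x₀) (chartFamily (n := n) x₀ Γ (p, s))
      (toChart x₀ (Γ (p, s)) (rayField (n := n) Γ p l s))
      (deriv (fun r => chartFamily (n := n) x₀ Γ (p, r)) s)
      (deriv (fun r => chartFamily (n := n) x₀ Γ (p, r)) s))
  rw [hd, hdJ, h.toChart_rayField hs hx l, e2, hsp.fderiv]
  have h6 : ((l.1, l.2.1 + l.2.2 * s) : V × ℝ) = (l.1, l.2.1) + (l.2.2 * s) • (0, 1) := by simp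
  have hsym : ∀ u w, chartChr g x₀ (chartFamily (n := n) x₀ Γ (p, s)) u w =
      chartChr g x₀ (chartFamily (n := n) x₀ Γ (p, s)) w u := chartChr_symm g hy
  have hg1 := h.fderiv_chartVel hs hx
  rw [h6, map_add, map_smul]
  simp only [neg_apply, add_apply, Function.comp_apply, ContinuousLinearMap.flip_apply,
      ContinuousLinearMap.comp_apply,
    map_add, map_smul, smul_apply, hg1, map_neg]
  rw [hsym (fderiv ℝ (chartVel (n := n) x₀ Γ) (p, s) (l.1, l.2.1))]
  rw [show fderiv ℝ (chartFamily (n := n) x₀ Γ) (p, s) (0, 1) = chartVel (n := n) x₀ Γ (p, s)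
    from rfl, hsym (chartChr g x₀ (chartFamily (n := n) x₀ Γ (p, s)) _ _)]
  module

/-- The covariant derivative of a variation field in a chart. -/
lemma toChart_rayField' (h : IsGeodesicFamily g Γ O) {p : V} {s : ℝ} (hq : (p, s) ∈ O) {x₀ : M}
    (hx : Γ (p, s) ∈ (lchart (n := n) x₀).source) (l : V × ℝ × ℝ) :
    toChart x₀ (Γ (p, s)) (rayField' g Γ p l s) =
      fderiv ℝ (chartVel (n := n) x₀ Γ) (p, s) (l.1, l.2.1 + l.2.2 * s) +
        l.2.2 • chartVel (n := n) x₀ Γ (p, s) +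
      chartChr g x₀ (chartFamily (n := n) x₀ Γ (p, s)) (chartVel (n := n) x₀ Γ (p, s))
        (fderiv ℝ (chartFamily (n := n) x₀ Γ) (p, s) (l.1, l.2.1 + l.2.2 * s)) := by
  have h1 := (eventually_toChart_covDeriv (g := g) (h.slice p).smooth (h.slice p).isOpen
    (h.isJacobiOpen_rayField p l).smooth (s := s) hq hx).self_of_nhds
  refine h1.trans ?_
  rw [(h.hasDerivAt_rayField hq hx l).deriv, ← h.toChart_mfderiv hq hx,
    ← h.deriv_chartFamily hq hx]
  rfl

end IsGeodesicFamily

end Variation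

/-! ### Symplectic linear algebra of Jacobi fields along a lightlike geodesic -/

section RayFrame

variable {L E E₁ E₂ : Type*} [AddCommGroup L] [Module ℝ L] [FiniteDimensional ℝ L]
  [AddCommGroup E] [Module ℝ E] [FiniteDimensional ℝ E]
  [AddCommGroup E₁] [Module ℝ E₁] [FiniteDimensional ℝ E₁]
  [AddCommGroup E₂] [Module ℝ E₂] [FiniteDimensional ℝ E₂]

/-- The values `X` and derivatives `X'` at time `s` of a space `L` of Jacobi fields along a
  lightlike
geodesic with velocity `u`: `e₃` and `e₄` parametrize `u` and `s u`, the Wronskian `W` has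
radical `ℝ e₃`, and `L` has the largest possible dimension. -/
structure IsRayFrame (G : LinearMap.BilinForm ℝ E) (X X' : L →ₗ[ℝ] E) (u : E) (W : L → L → ℝ)
    (e₃ e₄ : L) (s : ℝ) : Prop where
  symm : ∀ v w, G v w = G w v
  nondegenerate : ∀ v, (∀ w, G v w = 0) → v = 0
  wronskian : ∀ l m, W l m = G (X' l) (X m) - G (X l) (X' m)
  X_e₃ : X e₃ = u
  X'_e₃ : X' e₃ = 0
  X_e₄ : X e₄ = s • u
  X'_e₄ : X' e₄ = u
  e₄_ne : ∀ c : ℝ, e₄ ≠ c • e₃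
  orth : ∀ l, G (X' l) u = 0
  radical : ∀ l, (∀ m, W l m = 0) → ∃ c : ℝ, l = c • e₃
  finrank : Module.finrank ℝ L + 1 = 2 * Module.finrank ℝ E

namespace IsRayFrame

variable {G : LinearMap.BilinForm ℝ E} {X X' : L →ₗ[ℝ] E} {u : E} {W : L → L → ℝ} {e₃ e₄ : L}
  {s : ℝ}

lemma null (h : IsRayFrame G X X' u W e₃ e₄ s) : G u u = 0 := by
  rw [← h.orth e₄, h.X'_e₄]

/-- If u = 0, then `e₄` would have zero value and zero derivative, hence lie in the radical,
contrary to `e₄_ne`. -/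
lemma u_ne_zero (h : IsRayFrame G X X' u W e₃ e₄ s) : u ≠ 0 := by
  intro hu
  obtain ⟨c, hc⟩ := h.radical e₄ fun m => by
    rw [h.wronskian, h.X'_e₄, h.X_e₄, hu]
    simp
  exact h.e₄_ne c hc

/-- Zero data annihilate all Wronskians, so `l` is a multiple of `e₃`, whose value u is nonzero. -/
lemma injective (h : IsRayFrame G X X' u W e₃ e₄ s) {l : L} (h₁ : X l = 0) (h₂ : X' l = 0) :
    l = 0 := by
  obtain ⟨c, hc⟩ := h.radical l fun m => by rw [h.wronskian, h₁, h₂]; simp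
  rw [hc, map_smul, h.X_e₃, smul_eq_zero] at h₁
  rw [hc, h₁.resolve_right h.u_ne_zero, zero_smul]

/-- A dimension count: (X, X') is injective and lands in the hyperplane of pairs whose second entry
is orthogonal to u. That hyperplane has dimension 2 dim E - 1, which is dim L. -/
lemma surjective (h : IsRayFrame G X X' u W e₃ e₄ s) (v : E) {v' : E} (hv' : G v' u = 0) :
    ∃ l, X l = v ∧ X' l = v' := by
  let T : L →ₗ[ℝ] E × E := X.prod X'
  let f : E × E →ₗ[ℝ] ℝ := (G u).comp (LinearMap.snd ℝ E E)
  have hT : Function.Injective T := by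
    rw [injective_iff_map_eq_zero]
    intro l hl
    exact h.injective (congrArg Prod.fst hl) (congrArg Prod.snd hl)
  have hf : Function.Surjective f := by
    refine LinearMap.surjective fun hf => h.u_ne_zero (h.nondegenerate u fun w => ?_)
    exact LinearMap.congr_fun hf (0, w)
  have hle : LinearMap.range T ≤ LinearMap.ker f := by
    rintro _ ⟨l, rfl⟩
    rw [LinearMap.mem_ker]
    change G u (X' l) = 0
    rw [h.symm, h.orth]
  have h1 := LinearMap.finrank_range_add_finrank_ker f
  rw [LinearMap.range_eq_top.2 hf, finrank_top, Module.finrank_self, Module.finrank_prod] at h1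
  have h2 := LinearMap.finrank_range_of_inj hT
  have h3 := h.finrank
  have heq : LinearMap.range T = LinearMap.ker f :=
    Submodule.eq_of_le_of_finrank_eq hle (by omega)
  have hmem : (v, v') ∈ LinearMap.range T := by
    rw [heq, LinearMap.mem_ker]
    change G u v' = 0
    rw [h.symm, hv']
  obtain ⟨l, hl⟩ := hmem
  exact ⟨l, congrArg Prod.fst hl, congrArg Prod.snd hl⟩

lemma eq_zero_of_forall (h : IsRayFrame G X X' u W e₃ e₄ s) {w : E} (hw : ∀ l, G w (X l) = 0) :
    w = 0 := by
  refine h.nondegenerate w fun v => ?_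
  obtain ⟨l, hl, -⟩ := h.surjective v (v' := 0) (by simp)
  rw [← hl, hw]

/-- The transversality at the heart of the local theory: only trivial covector variations
annihilate all variation fields. -/
lemma eq_zero_of_forall_add (h : IsRayFrame G X X' u W e₃ e₄ s) {w : E →ₗ[ℝ] ℝ} {v : E} {σ : ℝ}
    (hv : G v u = 0) (hvv : 0 < G v v) (hw : ∀ l, w (X l) + σ * G v (X' l) = 0) :
    w = 0 ∧ σ = 0 := by
  have hw0 : w = 0 := by
    ext x
    obtain ⟨l, hl, hl'⟩ := h.surjective x (v' := 0) (by simp)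
    have := hw l
    rwa [hl, hl', map_zero, mul_zero, add_zero] at this
  refine ⟨hw0, ?_⟩
  -- Since `v` is orthogonal to `u`, it is itself an admissible derivative; the identity becomes σ
  -- G(v, v) = 0.
  obtain ⟨l, hl, hl'⟩ := h.surjective 0 hv
  have := hw l
  rw [hw0, hl', LinearMap.zero_apply, zero_add, mul_eq_zero] at this
  exact this.resolve_right hvv.ne'

lemma ne_smul_of_spacelike (h : IsRayFrame G X X' u W e₃ e₄ s) {v : E} (hvv : 0 < G v v) (c : ℝ) :
    v ≠ c • u := by
  rintro rfl
  simp [h.null] at hvv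

end IsRayFrame

/-- Equal images of two spacelike covectors force a Jacobi field which vanishes twice. -/
lemma IsRayFrame.exists_vanishing {G₁ : LinearMap.BilinForm ℝ E₁} {G₂ : LinearMap.BilinForm ℝ E₂}
    {X₁ X₁' : L →ₗ[ℝ] E₁} {X₂ X₂' : L →ₗ[ℝ] E₂} {u₁ : E₁} {u₂ : E₂} {W : L → L → ℝ} {e₃ e₄ : L}
    {s₁ s₂ : ℝ} (h₁ : IsRayFrame G₁ X₁ X₁' u₁ W e₃ e₄ s₁)
    (h₂ : IsRayFrame G₂ X₂ X₂' u₂ W e₃ e₄ s₂) (hs : s₁ ≠ s₂) {v₁ : E₁} {v₂ : E₂}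
    (hv₁ : G₁ v₁ u₁ = 0) (hv₂ : G₂ v₂ u₂ = 0) (hvv : 0 < G₁ v₁ v₁)
    (heq : ∀ l, G₁ v₁ (X₁ l) = G₂ v₂ (X₂ l)) : ∃ l, l ≠ 0 ∧ X₁ l = 0 ∧ X₂ l = 0 := by
  -- With data (0, v₁) at s₁ the Wronskian with `l` is the functional G₁(v₁, X₁ ·), and likewise for
  -- `m` at s₂. Equality of the two functionals puts l - m in the radical.
  obtain ⟨l, hl, hl'⟩ := h₁.surjective 0 hv₁
  obtain ⟨m, hm, hm'⟩ := h₂.surjective 0 hv₂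
  obtain ⟨c, hc⟩ := h₁.radical (l - m) fun k => by
    have e1 : W l k = G₁ v₁ (X₁ k) := by rw [h₁.wronskian, hl, hl']; simp
    have e2 : W m k = G₂ v₂ (X₂ k) := by rw [h₂.wronskian, hm, hm']; simp
    have e3 : W (l - m) k = W l k - W m k := by
      simp only [h₁.wronskian, map_sub, LinearMap.sub_apply]
      ring
    rw [e3, e1, e2, heq, sub_self]
  have hne : s₂ - s₁ ≠ 0 := sub_ne_zero.2 hs.symm
  -- Subtracting the field d (s - s₁) u keeps the zero at s₁. At s₂, where the value of `l` is c u,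
  -- the new value is (c - d (s₂ - s₁)) u, so this d makes it vanish.
  set d := c / (s₂ - s₁) with hd
  have hcd : c = d * (s₂ - s₁) := by rw [hd]; field_simp
  have hlm : l = m + c • e₃ := by rw [← hc]; abel
  refine ⟨l - d • e₄ + (d * s₁) • e₃, fun h0 => ?_, ?_, ?_⟩
  · have := congrArg X₁' h0
    rw [map_add, map_sub, map_smul, map_smul, hl', h₁.X'_e₃, h₁.X'_e₄, smul_zero, add_zero,
        map_zero,
      sub_eq_zero] at this
    exact h₁.ne_smul_of_spacelike hvv d this
  · rw [map_add, map_sub, map_smul, map_smul, hl, h₁.X_e₃, h₁.X_e₄]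
    module
  · rw [hlm, map_add, map_sub, map_add, map_smul, map_smul, map_smul, hm, h₂.X_e₃, h₂.X_e₄, hcd]
    module

end RayFrame

/-! ### The family of light rays -/

section Rays

variable {n : ℕ} {M : Type*} [TopologicalSpace M] [ChartedSpace (Euc (n + 1)) M]
  [IsManifold (𝓡 (n + 1)) ∞ M] {g : LorentzianMetric n M}

/-- The metric at a point as a bilinear form. -/
def formB (g : LorentzianMetric n M) (x : M) :
    LinearMap.BilinForm ℝ (TangentSpace (𝓡 (n + 1)) x) :=
  LinearMap.mk₂ ℝ (fun v w => g.form x v w) (fun a b c => by simp) (fun c a b => by simp)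
    (fun a b c => by simp) (fun c a b => by simp)

section Linear

variable {V : Type*} [NormedAddCommGroup V] [NormedSpace ℝ V] {Γ : V × ℝ → M} {O : Set (V × ℝ)}

lemma rayField_add (p : V) (s : ℝ) (l m : V × ℝ × ℝ) :
    rayField (n := n) Γ p (l + m) s = rayField Γ p l s + rayField Γ p m s := by
  have h : ((l + m).1, (l + m).2.1 + (l + m).2.2 * s) =
      (l.1, l.2.1 + l.2.2 * s) + (m.1, m.2.1 + m.2.2 * s) := by
    ext <;> simp
    ring
  simp only [rayField]
  rw [h]
  exact map_add (mfderiv 𝓘(ℝ, V × ℝ) (𝓡 (n + 1)) Γ (p, s)) _ _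

lemma rayField_smul (p : V) (s c : ℝ) (l : V × ℝ × ℝ) :
    rayField (n := n) Γ p (c • l) s = c • rayField Γ p l s := by
  have h : ((c • l).1, (c • l).2.1 + (c • l).2.2 * s) = c • (l.1, l.2.1 + l.2.2 * s) := by
    ext <;> simp
    ring
  simp only [rayField]
  rw [h]
  exact map_smul (mfderiv 𝓘(ℝ, V × ℝ) (𝓡 (n + 1)) Γ (p, s)) _ _

/-- The values at time `s` of the variation fields. -/
def rayFieldL (Γ : V × ℝ → M) (p : V) (s : ℝ) :
    V × ℝ × ℝ →ₗ[ℝ] TangentSpace (𝓡 (n + 1)) (Γ (p, s)) where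
  toFun l := rayField Γ p l s
  map_add' l m := rayField_add p s l m
  map_smul' c l := rayField_smul p s c l

lemma IsGeodesicFamily.rayField'_add (h : IsGeodesicFamily g Γ O) {p : V} {s : ℝ}
    (hq : (p, s) ∈ O) (l m : V × ℝ × ℝ) :
    rayField' g Γ p (l + m) s = rayField' g Γ p l s + rayField' g Γ p m s := by
  have hx := mem_lchart_source (n := n) (Γ (p, s))
  refine toChartL_injective hx ?_
  refine Eq.trans ?_ (map_add (toChartL (Γ (p, s)) (Γ (p, s))) _ _).symm
  change toChart _ _ _ = toChart _ _ _ + toChart _ _ _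
  rw [h.toChart_rayField' hq hx, h.toChart_rayField' hq hx, h.toChart_rayField' hq hx]
  have hw : ((l + m).1, (l + m).2.1 + (l + m).2.2 * s) =
      (l.1, l.2.1 + l.2.2 * s) + (m.1, m.2.1 + m.2.2 * s) := by
    ext <;> simp
    ring
  rw [hw, map_add, map_add, map_add, show (l + m).2.2 = l.2.2 + m.2.2 from rfl]
  module

lemma IsGeodesicFamily.rayField'_smul (h : IsGeodesicFamily g Γ O) {p : V} {s : ℝ}
    (hq : (p, s) ∈ O) (c : ℝ) (l : V × ℝ × ℝ) :
    rayField' g Γ p (c • l) s = c • rayField' g Γ p l s := by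
  have hx := mem_lchart_source (n := n) (Γ (p, s))
  refine toChartL_injective hx ?_
  refine Eq.trans ?_ (map_smul (toChartL (Γ (p, s)) (Γ (p, s))) c _).symm
  change toChart _ _ _ = c • toChart _ _ _
  rw [h.toChart_rayField' hq hx, h.toChart_rayField' hq hx]
  have hw : ((c • l).1, (c • l).2.1 + (c • l).2.2 * s) = c • (l.1, l.2.1 + l.2.2 * s) := by
    ext <;> simp
    ring
  rw [hw, map_smul, map_smul, map_smul, show (c • l).2.2 = c * l.2.2 from rfl]
  module

/-- The derivatives at time `s` of the variation fields. -/
def IsGeodesicFamily.rayFieldL' (h : IsGeodesicFamily g Γ O) {p : V} {s : ℝ} (hq : (p, s) ∈ O) :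
    V × ℝ × ℝ →ₗ[ℝ] TangentSpace (𝓡 (n + 1)) (Γ (p, s)) where
  toFun l := rayField' g Γ p l s
  map_add' l m := h.rayField'_add hq l m
  map_smul' c l := h.rayField'_smul hq c l

/-- The Wronskian of two variation fields, at time `0`. -/
def rayWronskian (g : LorentzianMetric n M) (Γ : V × ℝ → M) (p : V) (l m : V × ℝ × ℝ) : ℝ :=
  wronskian g (fun r => Γ (p, r)) (rayField Γ p l) (rayField Γ p m) 0

/-- The Wronskian of two Jacobi fields has zero derivative. It can thus be evaluated at time 0,
where the initial conditions of the rays are explicit. -/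
lemma wronskian_eq_rayWronskian {N : Set V} {I : Set ℝ} (h : IsGeodesicFamily g Γ (N ×ˢ I)) {ℓ : ℝ}
    (hI : Icc 0 ℓ ⊆ I) {p : V} (hp : p ∈ N) (l m : V × ℝ × ℝ) {s : ℝ} (hs : s ∈ Icc 0 ℓ) :
    g.form (Γ (p, s)) (rayField' g Γ p l s) (rayField Γ p m s) -
      g.form (Γ (p, s)) (rayField Γ p l s) (rayField' g Γ p m s) = rayWronskian g Γ p l m := by
  have hd : ∀ r ∈ Icc 0 ℓ, HasDerivAt (wronskian g (fun r => Γ (p, r)) (rayField Γ p l)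
      (rayField Γ p m)) 0 r := fun r hr =>
    hasDerivAt_wronskian_jacobi (h.slice p) (h.isJacobiOpen_rayField p l)
      (h.isJacobiOpen_rayField p m) (s := r) ⟨hp, hI hr⟩
  exact constant_of_has_deriv_right_zero (fun r hr => (hd r hr).continuousAt.continuousWithinAt)
    (fun r hr => (hd r (Ico_subset_Icc_self hr)).hasDerivWithinAt) s hs

lemma IsGeodesicFamily.rayField_e₃ (h : IsGeodesicFamily g Γ O) {p : V} {s : ℝ} (hq : (p, s) ∈ O) :
    rayField (n := n) Γ p (0, 1, 0) s = rayVel Γ p s := by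
  rw [h.rayVel_eq hq, rayField]
  simp

lemma IsGeodesicFamily.rayField_e₄ (h : IsGeodesicFamily g Γ O) {p : V} {s : ℝ} (hq : (p, s) ∈ O) :
    rayField (n := n) Γ p (0, 0, 1) s = s • rayVel Γ p s := by
  rw [h.rayVel_eq hq, rayField]
  have h1 : (((0 : V), (0 : ℝ) + 1 * s) : V × ℝ) = s • ((0, 1) : V × ℝ) := by simp
  rw [show (((0, 0, 1) : V × ℝ × ℝ).1, ((0, 0, 1) : V × ℝ × ℝ).2.1 +
    ((0, 0, 1) : V × ℝ × ℝ).2.2 * s) = s • ((0, 1) : V × ℝ) from h1]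
  exact map_smul (mfderiv 𝓘(ℝ, V × ℝ) (𝓡 (n + 1)) Γ (p, s)) _ _

lemma IsGeodesicFamily.rayField'_e₃ (h : IsGeodesicFamily g Γ O) {p : V} {s : ℝ}
    (hq : (p, s) ∈ O) : rayField' g Γ p (0, 1, 0) s = 0 := by
  have hx := mem_lchart_source (n := n) (Γ (p, s))
  refine toChartL_injective hx ?_
  refine Eq.trans ?_ (map_zero (toChartL (Γ (p, s)) (Γ (p, s)))).symm
  refine (h.toChart_rayField' hq hx _).trans ?_
  simp only [zero_mul, add_zero, zero_smul]
  rw [h.fderiv_chartVel hq hx, chartVel, neg_add_cancel]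

lemma IsGeodesicFamily.rayField'_e₄ (h : IsGeodesicFamily g Γ O) {p : V} {s : ℝ}
    (hq : (p, s) ∈ O) : rayField' g Γ p (0, 0, 1) s = rayVel Γ p s := by
  have hx := mem_lchart_source (n := n) (Γ (p, s))
  refine toChartL_injective hx ?_
  refine (h.toChart_rayField' hq hx _).trans (Eq.trans ?_ (h.toChart_rayVel hq hx).symm)
  have h1 : (((0 : V), (0 : ℝ) + 1 * s) : V × ℝ) = s • ((0, 1) : V × ℝ) := by simp
  simp only [h1, one_smul, map_smul, h.fderiv_chartVel hq hx]
  rw [show fderiv ℝ (chartFamily (n := n) (Γ (p, s)) Γ) (p, s) (0, 1) =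
    chartVel (n := n) (Γ (p, s)) Γ (p, s) from rfl]
  module

end Linear

/-- The parameters `(z, a)` of the light rays. -/
abbrev RayParam (n : ℕ) : Type := Euc n × Euc (n - 1)

namespace LightRayFamily

variable (F : LightRayFamily g)

/-- The semigeodesic coordinates, in a chart of `M`. -/
def coordChart (x₀ : M) (y : ℝ × Euc n) : Euc (n + 1) := lchart (n := n) x₀ (F.coord.symm y)

lemma mem_target {z : Euc n} (hz : z ∈ F.Z) : ((0, z) : ℝ × Euc n) ∈ F.coord.target := by
  rw [F.coord_target]
  exact ⟨⟨by linarith [F.T_pos], F.T_pos⟩, hz⟩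

lemma contMDiffAt_coord_symm {y : ℝ × Euc n} (hy : y ∈ F.coord.target) :
    ContMDiffAt 𝓘(ℝ, ℝ × Euc n) (𝓡 (n + 1)) ∞ F.coord.symm y :=
  F.coord_symm_smooth.contMDiffAt (F.coord.open_target.mem_nhds hy)

lemma contDiffAt_coordChart {y : ℝ × Euc n} (hy : y ∈ F.coord.target) {x₀ : M}
    (hx : F.coord.symm y ∈ (lchart (n := n) x₀).source) : ContDiffAt ℝ ∞ (F.coordChart x₀) y :=
  contMDiffAt_iff_contDiffAt.1 (ContMDiffAt.comp y (contMDiffAt_lchart hx)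
    (F.contMDiffAt_coord_symm hy))

lemma toChart_coord {y : ℝ × Euc n} (hy : y ∈ F.coord.target) {x₀ : M}
    (hx : F.coord.symm y ∈ (lchart (n := n) x₀).source) (w : ℝ × Euc n) :
    toChart x₀ (F.coord.symm y) (mfderiv 𝓘(ℝ, ℝ × Euc n) (𝓡 (n + 1)) F.coord.symm y w) =
      fderiv ℝ (F.coordChart x₀) y w := by
  have h1 := mfderiv_comp y (mdifferentiableAt_lchart hx)
    ((F.contMDiffAt_coord_symm hy).mdifferentiableAt (by simp))
  have h3 := DFunLike.congr_fun h1 w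
  rw [mfderiv_eq_fderiv] at h3
  exact h3.symm

lemma form_coord {y : ℝ × Euc n} (hy : y ∈ F.coord.target) {x₀ : M}
    (hx : F.coord.symm y ∈ (lchart (n := n) x₀).source) (v w : ℝ × Euc n) :
    g.form (F.coord.symm y) (mfderiv 𝓘(ℝ, ℝ × Euc n) (𝓡 (n + 1)) F.coord.symm y v)
      (mfderiv 𝓘(ℝ, ℝ × Euc n) (𝓡 (n + 1)) F.coord.symm y w) =
    chartMetric g x₀ (F.coordChart x₀ y) (fderiv ℝ (F.coordChart x₀) y v)
      (fderiv ℝ (F.coordChart x₀) y w) := by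
  rw [form_eq_chartMetric g hx, F.toChart_coord hy hx, F.toChart_coord hy hx]
  rfl

lemma chartMetric_coord {y : ℝ × Euc n} (hy : y ∈ F.coord.target) {x₀ : M}
    (hx : F.coord.symm y ∈ (lchart (n := n) x₀).source) (c d : ℝ) (v w : Euc n) :
    chartMetric g x₀ (F.coordChart x₀ y) (fderiv ℝ (F.coordChart x₀) y (c, v))
      (fderiv ℝ (F.coordChart x₀) y (d, w)) = -(c * d) +
    chartMetric g x₀ (F.coordChart x₀ y) (fderiv ℝ (F.coordChart x₀) y (0, v))
      (fderiv ℝ (F.coordChart x₀) y (0, w)) := by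
  have h1 : ∀ (c : ℝ) (v : Euc n), ((c, v) : ℝ × Euc n) = c • (1, 0) + (0, v) := by
    intro c v; simp
  have tt := F.metric_tt y hy
  have tz := F.metric_tz y hy
  simp only [F.form_coord hy hx] at tt tz
  have zt : ∀ v, chartMetric g x₀ (F.coordChart x₀ y) (fderiv ℝ (F.coordChart x₀) y (0, v))
      (fderiv ℝ (F.coordChart x₀) y (1, 0)) = 0 := fun v => by
    rw [chartMetric_symm, tz]
  rw [h1 c v, h1 d w]
  simp only [map_add, map_smul, add_apply, smul_apply, tt, tz, zt, smul_eq_mul]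
  ring

end LightRayFamily

end Rays

/-! ### Light rays: Jacobi fields and the radical of the Wronskian -/

namespace LightRayFamily

variable {n : ℕ} {M : Type*} [TopologicalSpace M] [ChartedSpace (Euc (n + 1)) M]
  [IsManifold (𝓡 (n + 1)) ∞ M] {g : LorentzianMetric n M} (F : LightRayFamily g)

/-- The parameter set `Z × A`. -/
def param : Set (RayParam n) := F.Z ×ˢ F.A

/-- The rays, with uncurried parameters. -/
def ray (p : RayParam n) (s : ℝ) : M := F.γ p.1 p.2 s

/-- The direction of the ray in semigeodesic coordinates. -/
def dir (p : RayParam n) : ℝ × Euc n := (1, F.θ p.1 p.2)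

lemma isOpen_param : IsOpen F.param := F.isOpen_Z.prod F.isOpen_A

lemma ray_init {p : RayParam n} (hp : p ∈ F.param) : curveVelTB (𝓡 (n + 1)) (F.ray p) 0 =
    (⟨F.coord.symm (0, p.1), mfderiv 𝓘(ℝ, ℝ × Euc n) (𝓡 (n + 1)) F.coord.symm (0, p.1)
      (F.dir p)⟩ : TangentBundle (𝓡 (n + 1)) M) := F.γ_init p.1 hp.1 p.2 hp.2

lemma contDiffAt_dir {p : RayParam n} (hp : p ∈ F.param) : ContDiffAt ℝ ∞ F.dir p :=
  contDiffAt_const.prodMk (F.θ_smooth.contDiffAt (F.isOpen_param.mem_nhds hp))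

lemma ray_zero {p : RayParam n} (hp : p ∈ F.param) : F.ray p 0 = F.coord.symm (0, p.1) :=
  congrArg Bundle.TotalSpace.proj (F.ray_init hp)

lemma smoothVelocityAt_zero {p : RayParam n} (hp : p ∈ F.param) :
    SmoothVelocityAt (n := n) F.ray p 0 := by
  filter_upwards [F.isOpen_param.mem_nhds hp] with p' hp'
  set x₀ := F.coord.symm (0, p'.1) with hx₀
  have hx : F.coord.symm (0, p'.1) ∈ (lchart (n := n) x₀).source := mem_lchart_source x₀
  have hy := F.mem_target hp'.1
  have hb : ContMDiffAt 𝓘(ℝ, RayParam n) 𝓘(ℝ, ℝ × Euc n) ∞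
      (fun q : RayParam n => ((0 : ℝ), q.1)) p' :=
    (contDiffAt_const.prodMk contDiffAt_fst).contMDiffAt
  have h1 : ContMDiffAt 𝓘(ℝ, RayParam n) (𝓡 (n + 1)) ∞
      (fun q : RayParam n => F.coord.symm (0, q.1)) p' :=
    ContMDiffAt.comp p' (F.contMDiffAt_coord_symm hy) hb
  have h2 : ContMDiffAt 𝓘(ℝ, RayParam n) (𝓡 (n + 1)).tangent ∞ (fun q : RayParam n =>
      (⟨F.coord.symm (0, q.1), mfderiv 𝓘(ℝ, ℝ × Euc n) (𝓡 (n + 1)) F.coord.symm (0, q.1)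
      (F.dir q)⟩ : TangentBundle (𝓡 (n + 1)) M)) p' := by
    refine (contMDiffAt_tangent_iff (σ := fun q : RayParam n => F.coord.symm (0, q.1))
      (V := fun q : RayParam n => mfderiv 𝓘(ℝ, ℝ × Euc n) (𝓡 (n + 1)) F.coord.symm (0, q.1)
      (F.dir q)) hx).2 ⟨h1, ContDiffAt.contMDiffAt ?_⟩
    have h3 : ContDiffAt ℝ ∞ (fun q : RayParam n =>
        fderiv ℝ (F.coordChart x₀) (0, q.1) (F.dir q)) p' :=
      (ContDiffAt.comp p' ((F.contDiffAt_coordChart hy hx).fderiv_right (m := ∞) (by norm_cast))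
        (contDiffAt_const.prodMk contDiffAt_fst)).clm_apply (F.contDiffAt_dir hp')
    refine h3.congr_of_eventuallyEq ?_
    filter_upwards [F.isOpen_param.mem_nhds hp',
      h1.continuousAt.eventually ((isOpen_lchart_source x₀).mem_nhds hx)] with q hq hqx
    exact F.toChart_coord (F.mem_target hq.1) hqx _
  refine h2.congr_of_eventuallyEq ?_
  filter_upwards [F.isOpen_param.mem_nhds hp'] with q hq
  exact F.ray_init hq

/-- A smooth extension of the rays beyond the interval `[0, ℓ]`, near some parameters. -/
structure IsExtension (Γ : RayParam n × ℝ → M) (N : Set (RayParam n)) (I : Set ℝ) : Prop where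
  isOpen_N : IsOpen N
  subset : N ⊆ F.param
  isOpen_I : IsOpen I
  Icc_subset : Icc 0 F.ℓ ⊆ I
  family : IsGeodesicFamily g Γ (N ×ˢ I)
  eq : ∀ p, ∀ s ∈ Icc 0 F.ℓ, Γ (p, s) = F.ray p s
  agrees : AgreesOn (n := n) F.ray F.ℓ Γ (N ×ˢ I)

lemma exists_isExtension [T2Space M] {p : RayParam n} (hp : p ∈ F.param) :
    ∃ Γ N I, p ∈ N ∧ F.IsExtension Γ N I := by
  obtain ⟨Γ, N, I, h1, h2, h3, h4, h5, h6, h7, h8⟩ := exists_extension (g := g) (γ := F.ray)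
    F.isOpen_param (fun p hp => F.γ_geodesic p.1 hp.1 p.2 hp.2) F.ℓ_pos hp
    (F.smoothVelocityAt_zero hp)
  exact ⟨Γ, N, I, h2, h1, h3, h4, h5, h6, h7, h8⟩

namespace IsExtension

variable {F} {Γ : RayParam n × ℝ → M} {N : Set (RayParam n)} {I : Set ℝ}

lemma zero_mem : (0 : ℝ) ∈ Icc 0 F.ℓ := ⟨le_rfl, F.ℓ_pos.le⟩

lemma mem (h : F.IsExtension Γ N I) {p : RayParam n} (hp : p ∈ N) {s : ℝ} (hs : s ∈ Icc 0 F.ℓ) :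
    (p, s) ∈ N ×ˢ I := ⟨hp, h.Icc_subset hs⟩

lemma apply_zero (h : F.IsExtension Γ N I) {p : RayParam n} (hp : p ∈ N) :
    Γ (p, 0) = F.coord.symm (0, p.1) := by
  rw [h.eq p 0 zero_mem, F.ray_zero (h.subset hp)]

lemma chartVel_zero (h : F.IsExtension Γ N I) {p : RayParam n} (hp : p ∈ N) {x₀ : M}
    (hx : Γ (p, 0) ∈ (lchart (n := n) x₀).source) :
    chartVel (n := n) x₀ Γ (p, 0) = fderiv ℝ (F.coordChart x₀) (0, p.1) (F.dir p) := by
  have h1 := h.agrees (p, 0) (h.mem hp zero_mem) zero_mem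
  rw [F.ray_init (h.subset hp)] at h1
  have h2 := toChart_eq_of_tangentBundle_eq x₀ h1
  rw [← h.family.toChart_rayVel (h.mem hp zero_mem) hx]
  refine h2.trans (F.toChart_coord (F.mem_target (h.subset hp).1) ?_ _)
  rw [← h.apply_zero hp]
  exact hx

lemma chartFamily_zero (h : F.IsExtension Γ N I) {p : RayParam n} (hp : p ∈ N) (x₀ : M) :
    chartFamily (n := n) x₀ Γ (p, 0) = F.coordChart x₀ (0, p.1) := by
  rw [chartFamily, h.apply_zero hp]
  rfl

lemma coord_mem (h : F.IsExtension Γ N I) {p : RayParam n} (hp : p ∈ N) {x₀ : M}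
    (hx : Γ (p, 0) ∈ (lchart (n := n) x₀).source) : F.coord.symm (0, p.1) ∈
      (lchart (n := n) x₀).source := by
  rw [← h.apply_zero hp]
  exact hx

lemma θ_unit (h : F.IsExtension Γ N I) {p : RayParam n} (hp : p ∈ N) {x₀ : M}
    (hx : Γ (p, 0) ∈ (lchart (n := n) x₀).source) :
    chartMetric g x₀ (F.coordChart x₀ (0, p.1))
      (fderiv ℝ (F.coordChart x₀) (0, p.1) (0, F.θ p.1 p.2))
      (fderiv ℝ (F.coordChart x₀) (0, p.1) (0, F.θ p.1 p.2)) = 1 := by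
  have hp' := h.subset hp
  rw [← F.form_coord (F.mem_target hp'.1) (h.coord_mem hp hx)]
  exact F.θ_unit p.1 hp'.1 p.2 hp'.2

lemma null_zero (h : F.IsExtension Γ N I) {p : RayParam n} (hp : p ∈ N) {x₀ : M}
    (hx : Γ (p, 0) ∈ (lchart (n := n) x₀).source) :
    chartMetric g x₀ (chartFamily (n := n) x₀ Γ (p, 0)) (chartVel (n := n) x₀ Γ (p, 0))
      (chartVel (n := n) x₀ Γ (p, 0)) = 0 := by
  rw [h.chartVel_zero hp hx, h.chartFamily_zero hp, dir,
    F.chartMetric_coord (F.mem_target (h.subset hp).1) (h.coord_mem hp hx), h.θ_unit hp hx]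
  ring

lemma hasDerivAt_line {W : Type*} [NormedAddCommGroup W] [NormedSpace ℝ W]
    {f : RayParam n × ℝ → W} {p : RayParam n} (hf : DifferentiableAt ℝ f (p, 0)) (δ : RayParam n) :
    HasDerivAt (fun t : ℝ => f (p + t • δ, 0)) (fderiv ℝ f (p, 0) (δ, 0)) 0 := by
  have h1 : HasDerivAt (fun t : ℝ => ((p + t • δ, 0) : RayParam n × ℝ)) (δ, 0) 0 := by
    have h2 : HasDerivAt (fun t : ℝ => p + t • δ) δ 0 := by
      simpa using ((hasDerivAt_id (0 : ℝ)).smul_const δ).const_add p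
    exact h2.prodMk (hasDerivAt_const _ _)
  have h3 : HasFDerivAt f (fderiv ℝ f (p, 0)) (p + (0 : ℝ) • δ, 0) := by
    simpa using hf.hasFDerivAt
  exact HasFDerivAt.comp_hasDerivAt (f := fun t : ℝ => ((p + t • δ, 0) : RayParam n × ℝ)) 0 h3 h1

lemma tendsto_line (p δ : RayParam n) :
    ContinuousAt (fun t : ℝ => ((p + t • δ, 0) : RayParam n × ℝ)) 0 := by fun_prop

lemma eventually_line (h : F.IsExtension Γ N I) {p : RayParam n} (hp : p ∈ N) (δ : RayParam n)
    {x₀ : M} (hx : Γ (p, 0) ∈ (lchart (n := n) x₀).source) :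
    ∀ᶠ t : ℝ in 𝓝 0, p + t • δ ∈ N ∧ Γ (p + t • δ, 0) ∈ (lchart (n := n) x₀).source := by
  have h1 := h.family.eventually_mem (h.mem hp zero_mem) hx
  have h2 : (p + (0 : ℝ) • δ, (0 : ℝ)) = (p, 0) := by simp
  have h3 := tendsto_line p δ
  rw [ContinuousAt, h2] at h3
  filter_upwards [h3.eventually h1] with t ht
  exact ⟨ht.1.1, ht.2⟩

/-- The derivatives of variation fields are orthogonal to the ray, at time `0`. -/
lemma orth_zero (h : F.IsExtension Γ N I) {p : RayParam n} (hp : p ∈ N)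
    (l : RayParam n × ℝ × ℝ) :
    g.form (Γ (p, 0)) (rayField' g Γ p l 0) (rayVel Γ p 0) = 0 := by
  have hq := h.mem hp zero_mem
  have hx := mem_lchart_source (n := n) (Γ (p, 0))
  set x₀ := Γ (p, 0) with hx₀
  have hx' : Γ (p, 0) ∈ (lchart (n := n) x₀).source := hx
  have hy : chartFamily (n := n) x₀ Γ (p, 0) ∈ (lchart (n := n) x₀).target :=
      (lchart (n := n) x₀).map_source hx
  have hC := (h.family.contDiffAt_chartFamily hq hx').differentiableAt (by simp)
  have hV := (h.family.contDiffAt_chartVel hq hx').differentiableAt (by simp)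
  have h0 : (p + (0 : ℝ) • l.1, (0 : ℝ)) = (p, 0) := by simp
  -- The identity g(V, V) = 0 for the initial velocities is differentiated along the line p + t δ in
  -- the parameters.
  have d := hasDerivAt_metric (G := chartMetric g x₀)
    (c := fun t : ℝ => chartFamily (n := n) x₀ Γ (p + t • l.1, 0)) (s := 0)
    (by simp only [h0]; exact differentiableAt_chartMetric g hy)
    (by simp only [h0]; exact chartMetric_symm_nhds g _ _)
    (by simp only [h0]; exact isChristoffel_chartChr g hy) (hasDerivAt_line hC l.1)
    (hasDerivAt_line hV l.1) (hasDerivAt_line hV l.1)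
  simp only [h0] at d
  have d0 : (fun t : ℝ => chartMetric g x₀ (chartFamily (n := n) x₀ Γ (p + t • l.1, 0))
      (chartVel (n := n) x₀ Γ (p + t • l.1, 0)) (chartVel (n := n) x₀ Γ (p + t • l.1, 0)))
      =ᶠ[𝓝 0] fun _ => 0 := by
    filter_upwards [h.eventually_line hp l.1 hx'] with t ht
    exact h.null_zero ht.1 ht.2
  have d1 := d.unique ((hasDerivAt_const (0 : ℝ) (0 : ℝ)).congr_of_eventuallyEq d0)
  rw [chartMetric_symm g _ _ (chartVel (n := n) x₀ Γ (p, 0)), ← two_mul, mul_eq_zero] at d1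
  have d2 := d1.resolve_left two_ne_zero
  have hnull := h.null_zero hp hx'
  rw [form_eq_chartMetric g hx', h.family.toChart_rayField' hq hx', h.family.toChart_rayVel hq hx']
  have hw : ((l.1, l.2.1 + l.2.2 * 0) : RayParam n × ℝ) = (l.1, 0) + l.2.1 • (0, 1) := by simp
  have hs := chartChr_symm g hy
  rw [hw, map_add (fderiv ℝ (chartVel (n := n) x₀ Γ) (p, 0)),
    map_add (fderiv ℝ (chartFamily (n := n) x₀ Γ) (p, 0)), map_smul (fderiv ℝ _ (p, 0)),
    map_smul (fderiv ℝ _ (p, 0)), h.family.fderiv_chartVel hq hx',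
    show fderiv ℝ (chartFamily (n := n) x₀ Γ) (p, 0) (0, 1) = chartVel (n := n) x₀ Γ (p, 0) from
      rfl]
  -- Separates the contributions of u and s u: the former cancels by the geodesic equation, and the
  -- latter is a multiple of the null velocity.
  have e : ∀ a b v : Euc (n + 1), a + l.2.1 • -chartChr g x₀ (chartFamily (n := n) x₀ Γ (p, 0)) v v
      +
      l.2.2 • v + chartChr g x₀ (chartFamily (n := n) x₀ Γ (p, 0)) v (b + l.2.1 • v) =
      (a + chartChr g x₀ (chartFamily (n := n) x₀ Γ (p, 0)) b v) + l.2.2 • v := by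
    intro a b v
    rw [map_add, map_smul, show chartChr g x₀ (chartFamily (n := n) x₀ Γ (p, 0)) v b =
      chartChr g x₀ (chartFamily (n := n) x₀ Γ (p, 0)) b v from hs v b]
    module
  rw [e, map_add, map_smul, add_apply, smul_apply]
  change chartMetric g x₀ (chartFamily (n := n) x₀ Γ (p, 0)) _ _ + l.2.2 • chartMetric g x₀
    (chartFamily (n := n) x₀ Γ (p, 0)) _ _ = 0
  rw [d2, hnull, smul_zero, add_zero]

/-- The initial value of a variation field. -/
lemma toChart_rayField_zero (h : F.IsExtension Γ N I) {p : RayParam n} (hp : p ∈ N) {x₀ : M}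
    (hx : Γ (p, 0) ∈ (lchart (n := n) x₀).source) (l : RayParam n × ℝ × ℝ) :
    toChart x₀ (Γ (p, 0)) (rayField (n := n) Γ p l 0) =
      fderiv ℝ (F.coordChart x₀) (0, p.1) (l.2.1, l.1.1 + l.2.1 • F.θ p.1 p.2) := by
  have hq := h.mem hp zero_mem
  have hC := (h.family.contDiffAt_chartFamily hq hx).differentiableAt (by simp)
  have h1 := hasDerivAt_line hC l.1
  have hK : HasFDerivAt (F.coordChart x₀) _ (0, p.1) :=
    ((F.contDiffAt_coordChart (F.mem_target (h.subset hp).1) (h.coord_mem hp hx)).differentiableAt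
      (by simp)).hasFDerivAt
  have h2 : HasDerivAt (fun t : ℝ => F.coordChart x₀ (0, p.1 + t • l.1.1))
      (fderiv ℝ (F.coordChart x₀) (0, p.1) (0, l.1.1)) 0 := by
    have h3 : HasDerivAt (fun t : ℝ => p.1 + t • l.1.1) l.1.1 0 := by
      simpa using ((hasDerivAt_id (0 : ℝ)).smul_const l.1.1).const_add p.1
    have h4 : HasDerivAt (fun t : ℝ => ((0 : ℝ), p.1 + t • l.1.1)) (0, l.1.1) 0 :=
      (hasDerivAt_const _ _).prodMk h3
    have h5 : HasFDerivAt (F.coordChart x₀) (fderiv ℝ (F.coordChart x₀) (0, p.1))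
      (0, p.1 + (0 : ℝ) • l.1.1) := by simpa using hK
    exact h5.comp_hasDerivAt 0 h4
  have h6 : (fun t : ℝ => chartFamily (n := n) x₀ Γ (p + t • l.1, 0)) =ᶠ[𝓝 0]
      fun t : ℝ => F.coordChart x₀ (0, p.1 + t • l.1.1) := by
    filter_upwards [h.eventually_line hp l.1 hx] with t ht
    exact h.chartFamily_zero ht.1 x₀
  have h7 := (h2.congr_of_eventuallyEq h6).unique h1
  have hw : ((l.1, l.2.1) : RayParam n × ℝ) = (l.1, 0) + l.2.1 • (0, 1) := by simp
  rw [h.family.toChart_rayField hq hx, mul_zero, zero_smul, add_zero, hw, map_add, map_smul, ← h7,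
    show fderiv ℝ (chartFamily (n := n) x₀ Γ) (p, 0) (0, 1) = chartVel (n := n) x₀ Γ (p, 0) from
      rfl,
    h.chartVel_zero hp hx, ← map_smul, ← map_add, dir]
  simp

/-- The initial derivative of a variation field which comes from a change of direction. -/
lemma toChart_rayField'_zero (h : F.IsExtension Γ N I) {p : RayParam n} (hp : p ∈ N) {x₀ : M}
    (hx : Γ (p, 0) ∈ (lchart (n := n) x₀).source) (a : Euc (n - 1)) :
    toChart x₀ (Γ (p, 0)) (rayField' g Γ p ((0, a), 0, 0) 0) =
      fderiv ℝ (F.coordChart x₀) (0, p.1) (0, fderiv ℝ (F.θ p.1) p.2 a) := by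
  have hq := h.mem hp zero_mem
  have hV := (h.family.contDiffAt_chartVel hq hx).differentiableAt (by simp)
  have hpp := h.subset hp
  have h1 := hasDerivAt_line hV (0, a)
  have hθ : HasFDerivAt (F.θ p.1) (fderiv ℝ (F.θ p.1) p.2) (p.2 + (0 : ℝ) • a) := by
    have hc : ContDiffAt ℝ ∞ (fun b => F.θ p.1 b) p.2 :=
      ContDiffAt.comp (g := fun q : RayParam n => F.θ q.1 q.2) (f := fun b => (p.1, b)) p.2
        (F.θ_smooth.contDiffAt (F.isOpen_param.mem_nhds hpp))
        (contDiffAt_const.prodMk contDiffAt_id)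
    simpa using (hc.differentiableAt (by simp)).hasFDerivAt
  have h2 : HasDerivAt (fun t : ℝ => fderiv ℝ (F.coordChart x₀) (0, p.1)
      (1, F.θ p.1 (p.2 + t • a))) (fderiv ℝ (F.coordChart x₀) (0, p.1)
      (0, fderiv ℝ (F.θ p.1) p.2 a)) 0 := by
    have h3 : HasDerivAt (fun t : ℝ => p.2 + t • a) a 0 := by
      simpa using ((hasDerivAt_id (0 : ℝ)).smul_const a).const_add p.2
    have h4 := (hasDerivAt_const (0 : ℝ) (1 : ℝ)).prodMk (hθ.comp_hasDerivAt 0 h3)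
    exact (fderiv ℝ (F.coordChart x₀) (0, p.1)).hasFDerivAt.comp_hasDerivAt 0 h4
  have h6 : (fun t : ℝ => chartVel (n := n) x₀ Γ (p + t • (0, a), 0)) =ᶠ[𝓝 0]
      fun t : ℝ => fderiv ℝ (F.coordChart x₀) (0, p.1) (1, F.θ p.1 (p.2 + t • a)) := by
    filter_upwards [h.eventually_line hp (0, a) hx] with t ht
    have h7 := h.chartVel_zero ht.1 ht.2
    rw [h7, dir]
    simp
  have h7 := (h2.congr_of_eventuallyEq h6).unique h1
  -- At time 0 a change of `a` alters only the direction and not the base point, so the Christoffel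
  -- term of the covariant derivative drops out.
  have h8 : fderiv ℝ (chartFamily (n := n) x₀ Γ) (p, 0) ((0, a), 0) = 0 := by
    have e1 := h.family.toChart_rayField hq hx ((0, a), 0, 0)
    rw [h.toChart_rayField_zero hp hx] at e1
    simp only [zero_mul, zero_smul, add_zero] at e1
    exact e1.symm.trans (map_zero (fderiv ℝ (F.coordChart x₀) (0, p.1)))
  rw [h.family.toChart_rayField' hq hx]
  simp [h8, ← h7]

end IsExtension

end LightRayFamily

/-- A unit vector and an orthogonal hyperplane span the space. -/
lemma exists_smul_add {n : ℕ} (hn : 2 ≤ n) {H : LinearMap.BilinForm ℝ (Euc n)} {θ : Euc n}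
    {D : Euc (n - 1) →L[ℝ] Euc n} (Hθ : H θ θ = 1) (HθD : ∀ a, H θ (D a) = 0)
    (Dinj : Function.Injective D) :
    (∀ (d : ℝ) (a : Euc (n - 1)), d • θ + D a = 0 → d = 0 ∧ a = 0) ∧
      ∀ z, ∃ (d : ℝ) (a : Euc (n - 1)), d • θ + D a = z := by
  have Tinj : ∀ (d : ℝ) (a : Euc (n - 1)), d • θ + D a = 0 → d = 0 ∧ a = 0 := by
    intro d a hda
    have h1 : H θ (d • θ + D a) = 0 := by rw [hda, map_zero]
    rw [map_add, map_smul, Hθ, HθD, smul_eq_mul, mul_one, add_zero] at h1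
    refine ⟨h1, Dinj ?_⟩
    rwa [h1, zero_smul, zero_add, ← map_zero D] at hda
  refine ⟨Tinj, fun z => ?_⟩
  let T : ℝ × Euc (n - 1) →ₗ[ℝ] Euc n :=
    LinearMap.coprod (LinearMap.toSpanSingleton ℝ (Euc n) θ) D.toLinearMap
  have hT : Function.Injective T := by
    rw [injective_iff_map_eq_zero]
    rintro ⟨d', a'⟩ h1
    have h2 : d' • θ + D a' = 0 := by simpa [T] using h1
    obtain ⟨e1, e2⟩ := Tinj d' a' h2
    rw [e1, e2]
    rfl
  have hTs : Function.Surjective T := by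
    refine (LinearMap.injective_iff_surjective_of_finrank_eq_finrank ?_).1 hT
    rw [Module.finrank_prod, Module.finrank_self, finrank_euclideanSpace_fin,
      finrank_euclideanSpace_fin]
    omega
  obtain ⟨⟨d', a'⟩, h1⟩ := hTs z
  exact ⟨d', a', by simpa [T] using h1⟩

namespace LightRayFamily.IsExtension

variable {n : ℕ} {M : Type*} [TopologicalSpace M] [ChartedSpace (Euc (n + 1)) M]
  [IsManifold (𝓡 (n + 1)) ∞ M] {g : LorentzianMetric n M} {F : LightRayFamily g}
  {Γ : RayParam n × ℝ → M} {N : Set (RayParam n)} {I : Set ℝ}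

/-- The direction `u` of a ray. -/
abbrev e₃ (n : ℕ) : RayParam n × ℝ × ℝ := (0, 1, 0)

/-- The direction `s u` of a ray. -/
abbrev e₄ (n : ℕ) : RayParam n × ℝ × ℝ := (0, 0, 1)

/-- Pairing with the velocity leaves only g(J', u), because the velocity is parallel; this vanishes
at time 0, all initial velocities being null. -/
lemma rayWronskian_e₃ (h : F.IsExtension Γ N I) {p : RayParam n} (hp : p ∈ N)
    (l : RayParam n × ℝ × ℝ) : rayWronskian g Γ p l (e₃ n) = 0 := by
  have hq := h.mem hp zero_mem
  rw [← wronskian_eq_rayWronskian h.family h.Icc_subset hp l (e₃ n) zero_mem,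
    h.family.rayField_e₃ hq, h.family.rayField'_e₃ hq, h.orth_zero hp, map_zero, sub_zero]

/-- At every time g(J', u) is the Wronskian of J with the velocity field, so its vanishing at time 0
persists. -/
lemma orth (h : F.IsExtension Γ N I) {p : RayParam n} (hp : p ∈ N)
    (l : RayParam n × ℝ × ℝ) {s : ℝ} (hs : s ∈ Icc 0 F.ℓ) :
    g.form (Γ (p, s)) (rayField' g Γ p l s) (rayVel Γ p s) = 0 := by
  have hq := h.mem hp hs
  have h1 := wronskian_eq_rayWronskian h.family h.Icc_subset hp l (e₃ n) hs
  rwa [h.rayWronskian_e₃ hp, h.family.rayField_e₃ hq, h.family.rayField'_e₃ hq, map_zero,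
    sub_zero] at h1

set_option maxHeartbeats 400000 in
/-- The radical of the Wronskian is spanned by the velocity. -/
lemma radical (h : F.IsExtension Γ N I) (hn : 2 ≤ n) {p : RayParam n} (hp : p ∈ N)
    {l : RayParam n × ℝ × ℝ} (hl : ∀ m, rayWronskian g Γ p l m = 0) :
    ∃ c : ℝ, l = c • e₃ n := by
  have hq := h.mem hp zero_mem
  have hpp := h.subset hp
  set x₀ := Γ (p, 0) with hx₀
  have hx : Γ (p, 0) ∈ (lchart (n := n) x₀).source := mem_lchart_source x₀
  have hy := F.mem_target hpp.1
  have hxy := h.coord_mem hp hx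
  set K := fderiv ℝ (F.coordChart x₀) (0, p.1) with hK
  set B := chartMetric g x₀ (F.coordChart x₀ (0, p.1)) with hB
  have hBL : lchart (n := n) x₀ (Γ (p, 0)) = F.coordChart x₀ (0, p.1) := h.chartFamily_zero hp x₀
  set θ := F.θ p.1 p.2 with hθ
  set D := fderiv ℝ (F.θ p.1) p.2 with hD
  have X0 : ∀ m : RayParam n × ℝ × ℝ, toChart x₀ (Γ (p, 0)) (rayField (n := n) Γ p m 0) =
      K (m.2.1, m.1.1 + m.2.1 • θ) := fun m => h.toChart_rayField_zero hp hx m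
  have X0' : ∀ a, toChart x₀ (Γ (p, 0)) (rayField' g Γ p ((0, a), 0, 0) 0) = K (0, D a) :=
    fun a => h.toChart_rayField'_zero hp hx a
  have vel0 : toChart x₀ (Γ (p, 0)) (rayVel (n := n) Γ p 0) = K (1, θ) :=
    (h.family.toChart_rayVel hq hx).trans (h.chartVel_zero hp hx)
  have form0 : ∀ v w : TangentSpace (𝓡 (n + 1)) (Γ (p, 0)), g.form (Γ (p, 0)) v w =
      B (toChart x₀ (Γ (p, 0)) v) (toChart x₀ (Γ (p, 0)) w) := by
    intro v w
    rw [form_eq_chartMetric g hx, hBL]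
  have BK : ∀ (c d : ℝ) (v w : Euc n), B (K (c, v)) (K (d, w)) =
      -(c * d) + B (K (0, v)) (K (0, w)) := F.chartMetric_coord hy hxy
  -- `H` is the Riemannian metric h at the starting point, in semigeodesic coordinates. For it θ is
  -- a unit vector orthogonal to the range of D, so θ and D span ℝⁿ.
  obtain ⟨H, HB⟩ : ∃ H : LinearMap.BilinForm ℝ (Euc n),
      ∀ v w, B (K (0, v)) (K (0, w)) = H v w := by
    let K₀ : Euc n →L[ℝ] Euc (n + 1) := K.comp (ContinuousLinearMap.inr ℝ ℝ (Euc n))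
    refine ⟨LinearMap.mk₂ ℝ (fun v w => B (K₀ v) (K₀ w))
      (fun a b c => by rw [map_add, map_add, add_apply])
      (fun c a b => by rw [map_smul, map_smul, smul_apply])
      (fun a b c => by rw [map_add, map_add]) (fun c a b => by rw [map_smul, map_smul]), ?_⟩
    intro v w
    rfl
  have Hsymm : ∀ v w, H v w = H w v := fun v w => by
    rw [← HB, ← HB, hB, chartMetric_symm]
  have Hpos : ∀ v, v ≠ 0 → 0 < H v v := fun v hv => by
    rw [← HB, hB, ← F.form_coord hy hxy]
    exact F.metric_zz _ hy v hv
  have Hθ : H θ θ = 1 := by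
    rw [← HB]
    exact h.θ_unit hp hx
  have HθD : ∀ a, H θ (D a) = 0 := by
    intro a
    have h1 := h.orth hp ((0, a), 0, 0) (zero_mem (F := F))
    rw [form0, X0', vel0, BK, HB, Hsymm] at h1
    linarith
  have Dinj : Function.Injective D := F.θ_immersion p.1 hpp.1 p.2 hpp.2
  have wr : ∀ l m, rayWronskian g Γ p l m =
      g.form (Γ (p, 0)) (rayField' g Γ p l 0) (rayField Γ p m 0) -
      g.form (Γ (p, 0)) (rayField Γ p l 0) (rayField' g Γ p m 0) := fun l m =>
    (wronskian_eq_rayWronskian h.family h.Icc_subset hp l m zero_mem).symm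
  obtain ⟨Tinj, Tsurj⟩ := exists_smul_add hn Hθ HθD Dinj
  obtain ⟨⟨z, a⟩, c, d⟩ := l
  -- the base point does not move
  have hz : z = 0 := by
    have t1 : ∀ a', H (z + c • θ) (D a') = 0 := by
      intro a'
      have h1 := hl ((0, a'), 0, 0)
      rw [wr, form0, form0, X0', X0, X0] at h1
      simp only [zero_smul, add_zero] at h1
      rw [show ((0, 0) : ℝ × Euc n) = 0 from rfl, map_zero, map_zero, zero_sub, neg_eq_zero, BK,
        HB, mul_zero, neg_zero, zero_add] at h1
      exact h1
    have t2 : H z θ = 0 := by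
      have h1 := hl (e₄ n)
      rw [wr, h.family.rayField_e₄ hq, h.family.rayField'_e₄ hq, zero_smul, map_zero, zero_sub,
        neg_eq_zero, form0, X0, vel0, BK, HB] at h1
      simp only [map_add, map_smul, LinearMap.add_apply, LinearMap.smul_apply, Hθ, smul_eq_mul]
        at h1
      linarith
    have t3 : ∀ a', H z (D a') = 0 := by
      intro a'
      have h1 := t1 a'
      rwa [map_add, map_smul, LinearMap.add_apply, LinearMap.smul_apply, HθD, smul_zero,
        add_zero] at h1
    -- Testing the radical against changes of direction gave z ⊥ D a', and testing against s u gave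
    -- z ⊥ θ. As these span, z is orthogonal to itself.
    obtain ⟨d', a', h2⟩ := Tsurj z
    by_contra hz
    have h3 := Hpos z hz
    have h4 : H z z = 0 := by
      nth_rw 2 [← h2]
      rw [map_add, map_smul, t2, t3, smul_zero, add_zero]
    linarith
  subst hz
  have hcomb : ((((0 : Euc n), a), c, d) : RayParam n × ℝ × ℝ) =
      ((0, a), 0, 0) + c • e₃ n + d • e₄ n := by simp
  -- Now J(0) = c u is orthogonal to all derivatives, so testing against displacements z' of the
  -- base point sees only J'(0), whose spatial part is D a + d θ.
  have key : ∀ z', H (D a + d • θ) z' = 0 := by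
    intro z'
    have h1 := hl ((z', 0), 0, 0)
    have h2 := h.orth hp ((z', 0), 0, 0) (zero_mem (F := F))
    have e1 : rayField (n := n) Γ p ((0, a), c, d) 0 = c • rayVel Γ p 0 := by
      rw [hcomb, rayField_add, rayField_add, rayField_smul, rayField_smul, h.family.rayField_e₃ hq,
        h.family.rayField_e₄ hq, zero_smul, smul_zero, add_zero]
      have e2 : rayField (n := n) Γ p ((0, a), 0, 0) 0 = 0 := by
        refine toChartL_injective hx ((X0 _).trans ?_)
        simp only [zero_smul, add_zero]
        exact (map_zero K).trans (map_zero (toChartL x₀ (Γ (p, 0)))).symm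
      rw [e2, zero_add]
    have e3 : rayField' g Γ p ((0, a), c, d) 0 =
        rayField' g Γ p ((0, a), 0, 0) 0 + d • rayVel Γ p 0 := by
      rw [hcomb, h.family.rayField'_add hq, h.family.rayField'_add hq, h.family.rayField'_smul hq,
        h.family.rayField'_smul hq, h.family.rayField'_e₃ hq, h.family.rayField'_e₄ hq, smul_zero,
        add_zero]
    rw [wr, e1, e3, map_smul, smul_apply, g.symm _ _ (rayField' g Γ p ((z', 0), 0, 0) 0), h2,
      smul_zero, sub_zero, map_add, map_smul, add_apply, smul_apply, form0, form0, X0, X0', vel0,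
      BK, HB, BK 1, HB] at h1
    simp only [zero_smul, add_zero, mul_zero, neg_zero, zero_add] at h1
    rw [map_add, map_smul, LinearMap.add_apply, LinearMap.smul_apply]
    exact h1
  have hzero : d • θ + D a = 0 := by
    by_contra hne
    have := Hpos _ hne
    rw [add_comm, key] at this
    exact lt_irrefl _ this
  obtain ⟨hd, ha⟩ := Tinj d a hzero
  refine ⟨c, ?_⟩
  rw [hd, ha]
  simp

/-- Along every ray the variation fields form a space of Jacobi fields of the largest possible
dimension. -/
lemma isRayFrame (h : F.IsExtension Γ N I) (hn : 2 ≤ n) {p : RayParam n} (hp : p ∈ N) {s : ℝ}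
    (hs : s ∈ Icc 0 F.ℓ) :
    IsRayFrame (formB g (Γ (p, s))) (rayFieldL Γ p s) (h.family.rayFieldL' (h.mem hp hs))
      (rayVel Γ p s) (rayWronskian g Γ p) (e₃ n) (e₄ n) s where
  symm v w := g.symm _ v w
  nondegenerate v hv := form_nondegenerate g _ v hv
  wronskian l m := (wronskian_eq_rayWronskian h.family h.Icc_subset hp l m hs).symm
  X_e₃ := h.family.rayField_e₃ (h.mem hp hs)
  X'_e₃ := h.family.rayField'_e₃ (h.mem hp hs)
  X_e₄ := h.family.rayField_e₄ (h.mem hp hs)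
  X'_e₄ := h.family.rayField'_e₄ (h.mem hp hs)
  e₄_ne c hc := by
    have := congrArg (fun l : RayParam n × ℝ × ℝ => l.2.2) hc
    simp at this
  orth l := h.orth hp l hs
  radical l hl := h.radical hn hp hl
  -- There are n directions for z, n - 1 for a, and two for u and s u; adding one gives 2 (n + 1).
  -- The truncated subtraction n - 1 is harmless because n ≥ 2.
  finrank := by
    have h1 : Module.finrank ℝ (TangentSpace (𝓡 (n + 1)) (Γ (p, s))) = n + 1 :=
      finrank_euclideanSpace_fin (𝕜 := ℝ) (n := n + 1)
    rw [h1, Module.finrank_prod, Module.finrank_prod, Module.finrank_prod, Module.finrank_self,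
      finrank_euclideanSpace_fin, finrank_euclideanSpace_fin]
    omega

end LightRayFamily.IsExtension

/-! ### Charts of the cotangent bundle -/

section Velocity

variable {E H N : Type*} [NormedAddCommGroup E] [NormedSpace ℝ E] [TopologicalSpace H]
  {I : ModelWithCorners ℝ E H} [TopologicalSpace N] [ChartedSpace H N]

lemma curveVel_eq_deriv {c : ℝ → N} {t : ℝ} (h : MDifferentiableAt 𝓘(ℝ, ℝ) I c t) :
    (curveVel I c t : E) = deriv (fun r => extChartAt I (c t) (c r)) t := by
  rw [curveVel, h.mfderiv]
  simp only [writtenInExtChartAt, extChartAt_model_space_eq_id, PartialEquiv.refl_coe,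
    PartialEquiv.refl_symm, modelWithCornersSelf_coe, range_id, fderivWithin_univ, id_eq,
    Function.comp_id]
  exact fderiv_apply_one_eq_deriv (f := fun r => extChartAt I (c t) (c r)) (x := t)

lemma deriv_eq_of_curveVelTB_eq {c₁ c₂ : ℝ → N} {t : ℝ} {p : N}
    (h₁ : MDifferentiableAt 𝓘(ℝ, ℝ) I c₁ t)
    (h₂ : MDifferentiableAt 𝓘(ℝ, ℝ) I c₂ t) (hp₁ : c₁ t = p) (hp₂ : c₂ t = p)
    (h : curveVelTB I c₁ t = curveVelTB I c₂ t) :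
    deriv (fun r => extChartAt I p (c₁ r)) t = deriv (fun r => extChartAt I p (c₂ r)) t := by
  have key : ∀ q : TangentBundle I N, q = curveVelTB I c₂ t → (q.2 : E) = curveVel I c₂ t := by
    rintro _ rfl
    rfl
  have h3 := key _ h
  change (curveVel I c₁ t : E) = _ at h3
  rw [curveVel_eq_deriv h₁, curveVel_eq_deriv h₂, hp₁, hp₂] at h3
  exact h3

lemma curveVelTB_eq_of_deriv_eq {c₁ c₂ : ℝ → N} {t : ℝ} {p : N}
    (h₁ : MDifferentiableAt 𝓘(ℝ, ℝ) I c₁ t)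
    (h₂ : MDifferentiableAt 𝓘(ℝ, ℝ) I c₂ t) (hp₁ : c₁ t = p) (hp₂ : c₂ t = p)
    (h : deriv (fun r => extChartAt I p (c₁ r)) t = deriv (fun r => extChartAt I p (c₂ r)) t) :
    curveVelTB I c₁ t = curveVelTB I c₂ t := by
  refine Bundle.TotalSpace.ext (hp₁.trans hp₂.symm) (heq_of_eq ?_)
  change (curveVel I c₁ t : E) = curveVel I c₂ t
  rw [curveVel_eq_deriv h₁, curveVel_eq_deriv h₂, hp₁, hp₂]
  exact h

lemma curveVelTB_eq_mk {c : ℝ → N} {t : ℝ} {p : N} (h : MDifferentiableAt 𝓘(ℝ, ℝ) I c t)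
    (hp : c t = p) (w : TangentSpace I p)
    (hw : deriv (fun r => extChartAt I p (c r)) t = (w : E)) :
    curveVelTB I c t = (⟨p, w⟩ : TangentBundle I N) := by
  refine Bundle.TotalSpace.ext hp (heq_of_eq ?_)
  change (curveVel I c t : E) = w
  rw [curveVel_eq_deriv h, hp]
  exact hw

end Velocity

section Cotangent

variable {n : ℕ} {M : Type*} [TopologicalSpace M] [ChartedSpace (Euc (n + 1)) M]
  [IsManifold (𝓡 (n + 1)) ∞ M]

/-- The chart of the cotangent bundle induced by the chart of `M` at `x₀`. -/
def covChart (x₀ : M) : PartialEquiv (CotangentBundle n M) (Euc (n + 1) × (Euc (n + 1) →L[ℝ] ℝ)) :=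
  extChartAt (cotangentModel n) (⟨x₀, 0⟩ : CotangentBundle n M)

/-- The bundle chart at a covector depends only on its base point, so the chart at the zero covector
serves the whole fibre. -/
lemma extChartAt_cotangent (p : CotangentBundle n M) :
    extChartAt (cotangentModel n) p = covChart p.1 := by
  rw [covChart, FiberBundle.extChartAt, FiberBundle.extChartAt]

lemma covChart_source (x₀ : M) : (covChart (n := n) x₀).source =
    {p | p.1 ∈ (lchart (n := n) x₀).source} := by
  ext p
  rw [covChart, extChartAt_source, extChartAt_source]
  rw [FiberBundle.chartedSpace_chartAt]
  simp
  intro h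
  exact h

lemma mem_covChart_source {x₀ : M} {p : CotangentBundle n M} :
    p ∈ (covChart (n := n) x₀).source ↔ p.1 ∈ (lchart (n := n) x₀).source := by
  rw [covChart_source]
  rfl

lemma covChart_apply {x₀ : M} {p : CotangentBundle n M} (hp : p.1 ∈ (lchart (n := n) x₀).source) :
    covChart (n := n) x₀ p =
      (lchart (n := n) x₀ p.1, ContinuousLinearMap.comp (p.2 : Euc (n + 1) →L[ℝ] ℝ)
        (ofChartL x₀ (lchart (n := n) x₀ p.1))) := by
  have hp' := hp
  rw [extChartAt_source] at hp'
  have hb : p.1 ∈ (trivializationAt (Euc (n + 1)) (TangentSpace (𝓡 (n + 1)) (M := M)) x₀).baseSet :=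
      by
    simpa using hp
  rw [covChart, FiberBundle.extChartAt]
  have h1 : (trivializationAt (Euc (n + 1) →L[ℝ] ℝ)
      (fun x : M => TangentSpace (𝓡 (n + 1)) x →L[ℝ] Bundle.Trivial M ℝ x) x₀) p =
      (p.1, ContinuousLinearMap.comp (p.2 : Euc (n + 1) →L[ℝ] ℝ)
        (ofChartL x₀ (lchart (n := n) x₀ p.1))) := by
    rw [hom_trivializationAt_apply]
    refine Prod.ext rfl ?_
    ext v
    have h2 := trivializationAt_tangent_symm hp v
    rw [← Bundle.Trivialization.symmL_apply (R := ℝ) _ (by simpa using hp')] at h2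
    have h3 := congrArg p.2 h2
    refine Eq.trans ?_ h3
    exact DFunLike.congr_fun
      (Bundle.Trivial.continuousLinearMapAt_trivialization ℝ M ℝ p.1) _
  change (lchart (n := n) x₀ ((trivializationAt _ _ x₀) p).1, ((trivializationAt _ _ x₀) p).2) = _
  rw [h1]

lemma isOpen_covChart_source (x₀ : M) : IsOpen (covChart (n := n) x₀).source :=
  isOpen_extChartAt_source _

lemma covChart_target (x₀ : M) : (covChart (n := n) x₀).target = (lchart (n := n) x₀).target ×ˢ
    univ := by
  rw [covChart, FiberBundle.extChartAt_target]
  congr 1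
  refine inter_eq_left.2 fun y hy => ?_
  have := (lchart (n := n) x₀).map_target hy
  simpa using this

lemma contMDiffAt_covChart {x₀ : M} {p : CotangentBundle n M}
    (hp : p.1 ∈ (lchart (n := n) x₀).source) :
    ContMDiffAt (cotangentModel n) 𝓘(ℝ, Euc (n + 1) × (Euc (n + 1) →L[ℝ] ℝ)) ∞ (covChart x₀) p :=
  contMDiffAt_extChartAt' (by
    have := mem_covChart_source.2 hp
    rwa [covChart, extChartAt_source] at this)

lemma contMDiffAt_covChart_symm {x₀ : M} {y : Euc (n + 1) × (Euc (n + 1) →L[ℝ] ℝ)}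
    (hy : y.1 ∈ (lchart (n := n) x₀).target) :
    ContMDiffAt 𝓘(ℝ, Euc (n + 1) × (Euc (n + 1) →L[ℝ] ℝ)) (cotangentModel n) ∞
      (covChart x₀).symm y := by
  refine (contMDiffOn_extChartAt_symm _).contMDiffAt (extChartAt_target_mem_nhds' ?_)
  change y ∈ (covChart x₀).target
  rw [covChart_target]
  exact ⟨hy, mem_univ _⟩

/-- The value of a covector in a chart. -/
lemma covChart_toChart {x₀ : M} {p : CotangentBundle n M} (hp : p.1 ∈ (lchart (n := n) x₀).source)
    (v : TangentSpace (𝓡 (n + 1)) p.1) : (covChart (n := n) x₀ p).2 (toChart x₀ p.1 v) = p.2 v := by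
  rw [covChart_apply hp]
  exact congrArg p.2 (ofChartL_toChartL hp v)

lemma extChartAt_paramSpace (q : ParamSpace n M) :
    extChartAt (paramModel n) q = (PartialEquiv.refl _).prod (covChart (n := n) q.2.1) := by
  rw [extChartAt_prod, extChartAt_cotangent, extChartAt_model_space_eq_id]

end Cotangent

/-! ### The canonical relation in charts -/

section Coords

/-- The coordinates of a covector on the parameter space. -/
def coordsL (n : ℕ) : (RayParam n →L[ℝ] ℝ) →L[ℝ] RayParam n :=
  LinearMap.toContinuousLinearMap
    { toFun := fun f => (WithLp.toLp 2 fun j => f (stdVec n j, 0),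
        WithLp.toLp 2 fun k => f (0, stdVec (n - 1) k))
      map_add' := fun f g => by ext <;> simp
      map_smul' := fun c f => by ext <;> simp }

lemma coordsL_apply (n : ℕ) (f : RayParam n →L[ℝ] ℝ) : coordsL n f =
    (WithLp.toLp 2 fun j => f (stdVec n j, 0), WithLp.toLp 2 fun k => f (0, stdVec (n - 1) k)) :=
  rfl

lemma coordsL_injective (n : ℕ) : Function.Injective (coordsL n) := by
  rw [injective_iff_map_eq_zero]
  intro f hf
  rw [coordsL_apply] at hf
  have h1 : ∀ j, f (stdVec n j, 0) = 0 := fun j =>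
    congrArg (fun v : RayParam n => v.1 j) hf
  have h2 : ∀ k, f (0, stdVec (n - 1) k) = 0 := fun k =>
    congrArg (fun v : RayParam n => v.2 k) hf
  ext v
  · have h3 : f.comp (ContinuousLinearMap.inl ℝ _ _) = (0 : Euc n →L[ℝ] ℝ) := by
      refine ContinuousLinearMap.coe_injective
        ((EuclideanSpace.basisFun (Fin n) ℝ).toBasis.ext fun j => ?_)
      simpa [stdVec] using h1 j
    simpa using DFunLike.congr_fun h3 v
  · have h3 : f.comp (ContinuousLinearMap.inr ℝ _ _) = (0 : Euc (n - 1) →L[ℝ] ℝ) := by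
      refine ContinuousLinearMap.coe_injective
        ((EuclideanSpace.basisFun (Fin (n - 1)) ℝ).toBasis.ext fun j => ?_)
      simpa [stdVec] using h2 j
    simpa using DFunLike.congr_fun h3 v

end Coords

namespace LightRayFamily.IsExtension

variable {n : ℕ} {M : Type*} [TopologicalSpace M] [ChartedSpace (Euc (n + 1)) M]
  [IsManifold (𝓡 (n + 1)) ∞ M] {g : LorentzianMetric n M} {F : LightRayFamily g}
  {Γ : RayParam n × ℝ → M} {N : Set (RayParam n)} {I : Set ℝ}

/-- The parameters of a point of `ParamSpace`. -/
def parOf (q : ParamSpace n M) : RayParam n := (q.1.1, q.1.2.1)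

lemma toChart_curveVel (h : F.IsExtension Γ N I) {p : RayParam n} (hp : p ∈ N) {s : ℝ}
    (hs : s ∈ Icc 0 F.ℓ) {x₀ : M} (hx : Γ (p, s) ∈ (lchart (n := n) x₀).source) :
    toChart x₀ (F.γ p.1 p.2 s) (curveVel (𝓡 (n + 1)) (F.γ p.1 p.2) s) =
      chartVel (n := n) x₀ Γ (p, s) := by
  have h1 := toChart_eq_of_tangentBundle_eq x₀ (h.agrees (p, s) (h.mem hp hs) hs)
  rw [← h.family.toChart_rayVel (h.mem hp hs) hx]
  exact h1.symm

/-- Membership in the canonical relation, in a chart. -/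
lemma mem_C₀_iff (h : F.IsExtension Γ N I) {q : ParamSpace n M} (hp : parOf q ∈ N) {x₀ : M}
    (hx : q.2.1 ∈ (lchart (n := n) x₀).source) :
    q ∈ F.C₀ ↔ q.1.2.2 ∈ Ioo 0 F.ℓ ∧ q.2.1 = Γ (parOf q, q.1.2.2) ∧ q.2.1 ∈ F.Ω ∧
      (covChart x₀ q.2).2 ≠ 0 ∧ (covChart x₀ q.2).2 (chartVel x₀ Γ (parOf q, q.1.2.2)) = 0 := by
  have hne : ∀ Q : CotangentBundle n M, Q.1 ∈ (lchart (n := n) x₀).source →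
      ((covChart x₀ Q).2 ≠ 0 ↔ Q.2 ≠ 0) := by
    intro Q hQ
    refine not_congr ⟨fun h0 => ?_, fun h0 => ?_⟩
    · ext v
      rw [← covChart_toChart hQ v, h0]
      rfl
    · rw [covChart_apply hQ, h0]
      ext v
      rfl
  constructor
  · rintro ⟨z, hz, a, ha, s, hs, ξ, rfl, hΩ, hξ, hξv⟩
    have hs' := Ioo_subset_Icc_self hs
    have he : Γ ((z, a), s) = F.γ z a s := h.eq (z, a) s hs'
    refine ⟨hs, he.symm, hΩ, (hne _ hx).2 hξ, ?_⟩
    have h1 := h.toChart_curveVel hp hs' (x₀ := x₀) (by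
      change Γ ((z, a), s) ∈ _
      rw [he]
      exact hx)
    change (covChart x₀ _).2 (chartVel x₀ Γ ((z, a), s)) = 0
    rw [parOf] at h1
    rw [← h1]
    exact (covChart_toChart hx _).trans hξv
  · obtain ⟨⟨z, a, s⟩, ⟨x, ξ⟩⟩ := q
    rintro ⟨hs, hbase, hΩ, hξ, hξv⟩
    have hs' := Ioo_subset_Icc_self hs
    have he : Γ ((z, a), s) = F.γ z a s := h.eq (z, a) s hs'
    change x = Γ ((z, a), s) at hbase
    rw [he] at hbase
    subst hbase
    have hpp := h.subset hp
    refine ⟨z, hpp.1, a, hpp.2, s, hs, ξ, rfl, hΩ, (hne _ hx).1 hξ, ?_⟩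
    have h1 := h.toChart_curveVel hp hs' (x₀ := x₀) (by
      change Γ ((z, a), s) ∈ _
      rw [he]
      exact hx)
    change (covChart x₀ _).2 (chartVel x₀ Γ ((z, a), s)) = 0 at hξv
    rw [parOf] at h1
    rw [← h1] at hξv
    exact (covChart_toChart hx _).symm.trans hξv

lemma toChart_mfderiv_of_mdifferentiableAt {W : Type*} [NormedAddCommGroup W] [NormedSpace ℝ W]
    {f : W → M} {w : W} (hf : MDifferentiableAt 𝓘(ℝ, W) (𝓡 (n + 1)) f w) {x₀ : M}
    (hx : f w ∈ (lchart (n := n) x₀).source) (v : W) :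
    toChart x₀ (f w) (mfderiv 𝓘(ℝ, W) (𝓡 (n + 1)) f w v) =
      fderiv ℝ (fun w => lchart (n := n) x₀ (f w)) w v := by
  have h1 := mfderiv_comp w (mdifferentiableAt_lchart hx) hf
  have h3 := DFunLike.congr_fun h1 v
  rw [mfderiv_eq_fderiv] at h3
  exact h3.symm

/-- Derivatives of the rays in a parameter, in a chart. -/
lemma toChart_mfderiv_param (h : F.IsExtension Γ N I) {p : RayParam n} (hp : p ∈ N) {s : ℝ}
    (hs : s ∈ Icc 0 F.ℓ) {x₀ : M} (hx : Γ (p, s) ∈ (lchart (n := n) x₀).source)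
    {W : Type*} [NormedAddCommGroup W] [NormedSpace ℝ W] {i : W → RayParam n}
      {i' : W →L[ℝ] RayParam n}
    {w : W} (hi : HasFDerivAt i i' w) (hiw : i w = p) {f : W → M} (hf : ∀ w, f w = Γ (i w, s))
      (v : W) :
    toChart x₀ (f w) (mfderiv 𝓘(ℝ, W) (𝓡 (n + 1)) f w v) =
      fderiv ℝ (chartFamily (n := n) x₀ Γ) (p, s) (i' v, 0) := by
  have hff : f = fun w => Γ (i w, s) := funext hf
  subst hff
  subst hiw
  have h1 : HasFDerivAt (fun w => (i w, s)) (i'.prod 0) w := hi.prodMk (hasFDerivAt_const s w)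
  have h2 : MDifferentiableAt 𝓘(ℝ, W) (𝓡 (n + 1)) (fun w => Γ (i w, s)) w :=
    MDifferentiableAt.comp w ((h.family.contMDiffAt (h.mem hp hs)).mdifferentiableAt (by simp))
      h1.differentiableAt.mdifferentiableAt
  rw [toChart_mfderiv_of_mdifferentiableAt h2 hx]
  have h3 := ((h.family.contDiffAt_chartFamily (h.mem hp hs) hx).differentiableAt
    (by simp)).hasFDerivAt
  have h4 := HasFDerivAt.comp (f := fun w => (i w, s)) w h3 h1
  exact DFunLike.congr_fun h4.fderiv v

/-- The projection to the parameter side, in a chart. -/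
lemma projZA_eq (h : F.IsExtension Γ N I) {q : ParamSpace n M} (hq : q ∈ F.C₀) (hp : parOf q ∈ N)
    {x₀ : M} (hx : q.2.1 ∈ (lchart (n := n) x₀).source) :
    F.projZA q = (parOf q, coordsL n (((covChart x₀ q.2).2.comp
      (fderiv ℝ (chartFamily (n := n) x₀ Γ) (parOf q, q.1.2.2))).comp
        (ContinuousLinearMap.inl ℝ (RayParam n) ℝ))) := by
  obtain ⟨z, hz, a, ha, s, hs, ξ, rfl, hΩ, hξ, hξv⟩ := hq
  have hs' := Ioo_subset_Icc_self hs
  have he : Γ ((z, a), s) = F.γ z a s := h.eq (z, a) s hs'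
  have hx' : Γ ((z, a), s) ∈ (lchart (n := n) x₀).source := by
    rw [he]
    exact hx
  have e1 : ∀ j, ξ (F.zField z a s j) = (covChart x₀ (⟨F.γ z a s, ξ⟩ : CotangentBundle n M)).2
      (fderiv ℝ (chartFamily (n := n) x₀ Γ) ((z, a), s) ((stdVec n j, 0), 0)) := by
    intro j
    have h1 := h.toChart_mfderiv_param hp hs' (x₀ := x₀) hx' (W := Euc n) (w := z)
      ((hasFDerivAt_id z).prodMk (hasFDerivAt_const a z)) rfl (f := fun z' => F.γ z' a s)
      (fun z' => (h.eq (z', a) s hs').symm) (stdVec n j)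
    refine (covChart_toChart (p := (⟨F.γ z a s, ξ⟩ : CotangentBundle n M)) hx _).symm.trans ?_
    exact congrArg _ h1
  have e2 : ∀ k, ξ (F.aField z a s k) = (covChart x₀ (⟨F.γ z a s, ξ⟩ : CotangentBundle n M)).2
      (fderiv ℝ (chartFamily (n := n) x₀ Γ) ((z, a), s) ((0, stdVec (n - 1) k), 0)) := by
    intro k
    have h1 := h.toChart_mfderiv_param hp hs' (x₀ := x₀) hx' (W := Euc (n - 1)) (w := a)
      ((hasFDerivAt_const z a).prodMk (hasFDerivAt_id a)) rfl (f := fun a' => F.γ z a' s)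
      (fun a' => (h.eq (z, a') s hs').symm) (stdVec (n - 1) k)
    refine (covChart_toChart (p := (⟨F.γ z a s, ξ⟩ : CotangentBundle n M)) hx _).symm.trans ?_
    exact congrArg _ h1
  rw [coordsL_apply]
  refine Prod.ext rfl (Prod.ext ?_ ?_)
  · ext j
    exact e1 j
  · ext k
    exact e2 k

end LightRayFamily.IsExtension

/-! ### The differentials of the two projections -/

section Spacelike

variable {n : ℕ} {M : Type*} [TopologicalSpace M] [ChartedSpace (Euc (n + 1)) M]
  [IsManifold (𝓡 (n + 1)) ∞ M] {g : LorentzianMetric n M}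

lemma exists_toChart_eq {x₀ x : M} (hx : x ∈ (lchart (n := n) x₀).source) (ν : Euc (n + 1)) :
    ∃ v : TangentSpace (𝓡 (n + 1)) x, toChart x₀ x v = ν := toChartL_surjective hx ν

lemma form_smul_right (x : M) (v w : TangentSpace (𝓡 (n + 1)) x) (c : ℝ) :
    g.form x v (c • w) = c * g.form x v w := (g.form x v).map_smul c w

instance (x : M) : FiniteDimensional ℝ (TangentSpace (𝓡 (n + 1)) x) :=
  inferInstanceAs (FiniteDimensional ℝ (Euc (n + 1)))

lemma isSpacelike_iff {x₀ : M} {p : CotangentBundle n M} (hp : p.1 ∈ (lchart (n := n) x₀).source) :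
    IsSpacelike g p ↔ ∃ ν : Euc (n + 1),
      (∀ w, chartMetric g x₀ (lchart (n := n) x₀ p.1) ν w = (covChart x₀ p).2 w) ∧
      0 < chartMetric g x₀ (lchart (n := n) x₀ p.1) ν ν := by
  constructor
  · rintro ⟨v, hv, hvv⟩
    refine ⟨toChart x₀ p.1 v, fun w => ?_, ?_⟩
    · obtain ⟨w, rfl⟩ := toChartL_surjective hp w
      exact (form_eq_chartMetric g hp v w).symm.trans ((hv w).trans (covChart_toChart hp w).symm)
    · rw [← form_eq_chartMetric g hp]
      exact hvv
  · rintro ⟨ν, hν, hνν⟩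
    obtain ⟨v, rfl⟩ := exists_toChart_eq hp ν
    refine ⟨v, fun w => ?_, ?_⟩
    · exact (form_eq_chartMetric g hp v w).trans ((hν _).trans (covChart_toChart hp w))
    · rw [form_eq_chartMetric g hp]
      exact hνν

end Spacelike

namespace LightRayFamily.IsExtension

variable {n : ℕ} {M : Type*} [TopologicalSpace M] [ChartedSpace (Euc (n + 1)) M]
  [IsManifold (𝓡 (n + 1)) ∞ M] {g : LorentzianMetric n M} {F : LightRayFamily g}
  {Γ : RayParam n × ℝ → M} {N : Set (RayParam n)} {I : Set ℝ}

lemma fderiv_chartFamily_zero_one (h : F.IsExtension Γ N I) {p : RayParam n} (hp : p ∈ N) {s : ℝ}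
    (hs : s ∈ Icc 0 F.ℓ) {x₀ : M} (hx : Γ (p, s) ∈ (lchart (n := n) x₀).source) :
    fderiv ℝ (chartFamily (n := n) x₀ Γ) (p, s) (0, 1) = chartVel (n := n) x₀ Γ (p, s) := by
  have h1 := (h.family.contDiffAt_chartFamily (h.mem hp hs) hx).differentiableAt (by simp)
  rw [← h.family.deriv_chartFamily (h.mem hp hs) hx]
  exact (IsGeodesicFamily.hasDerivAt_slice h1).deriv.symm

/-- Mixed second derivatives of the family, in a chart. -/
lemma fderiv_fderiv_chartFamily (h : F.IsExtension Γ N I) {p : RayParam n} (hp : p ∈ N) {s : ℝ}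
    (hs : s ∈ Icc 0 F.ℓ) {x₀ : M} (hx : Γ (p, s) ∈ (lchart (n := n) x₀).source) (w : RayParam n × ℝ)
      :
    fderiv ℝ (fderiv ℝ (chartFamily (n := n) x₀ Γ)) (p, s) (0, 1) w =
      fderiv ℝ (chartVel (n := n) x₀ Γ) (p, s) w := by
  have hC := h.family.contDiffAt_chartFamily (h.mem hp hs) hx
  have hC' : DifferentiableAt ℝ (fderiv ℝ (chartFamily (n := n) x₀ Γ)) (p, s) :=
    (hC.fderiv_right (m := 1) (by norm_cast)).differentiableAt (by simp)
  have e : ∀ u v, fderiv ℝ (fun q => fderiv ℝ (chartFamily (n := n) x₀ Γ) q u) (p, s) v =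
      fderiv ℝ (fderiv ℝ (chartFamily (n := n) x₀ Γ)) (p, s) v u := fun u v => by
    rw [(hC'.hasFDerivAt.clm_apply (hasFDerivAt_const u (p, s))).fderiv]
    simp
  rw [← e, fderiv_fderiv_apply_symm hC]
  refine DFunLike.congr_fun (Filter.EventuallyEq.fderiv_eq ?_) w
  filter_upwards [h.family.eventually_mem (h.mem hp hs) hx] with q hq
  obtain ⟨p', s'⟩ := q
  have h1 := (h.family.contDiffAt_chartFamily hq.1 hq.2).differentiableAt (by simp)
  rw [← h.family.deriv_chartFamily hq.1 hq.2]
  exact (IsGeodesicFamily.hasDerivAt_slice h1).deriv.symm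

/-- The covector equation that governs the kernel of the differential of the canonical relation has
only the trivial solution at spacelike covectors. -/
lemma eq_zero_of_forall_chart (h : F.IsExtension Γ N I) (hn : 2 ≤ n) {p : RayParam n} (hp : p ∈ N)
    {s : ℝ} (hs : s ∈ Icc 0 F.ℓ) {x₀ : M} (hx : Γ (p, s) ∈ (lchart (n := n) x₀).source)
    {ξ : Euc (n + 1) →L[ℝ] ℝ} (hξ : ξ (chartVel (n := n) x₀ Γ (p, s)) = 0) {ν : Euc (n + 1)}
    (hν : ∀ w, chartMetric g x₀ (chartFamily (n := n) x₀ Γ (p, s)) ν w = ξ w)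
    (hνν : 0 < chartMetric g x₀ (chartFamily (n := n) x₀ Γ (p, s)) ν ν)
    {η : Euc (n + 1) →L[ℝ] ℝ} {σ : ℝ}
    (hη : ∀ w, η (fderiv ℝ (chartFamily (n := n) x₀ Γ) (p, s) w) +
      σ * ξ (fderiv ℝ (chartVel (n := n) x₀ Γ) (p, s) w) = 0) : η = 0 ∧ σ = 0 := by
  have hq := h.mem hp hs
  obtain ⟨v, rfl⟩ := exists_toChart_eq hx ν
  have hform : ∀ w : TangentSpace (𝓡 (n + 1)) (Γ (p, s)),
      g.form (Γ (p, s)) v w = ξ (toChart x₀ (Γ (p, s)) w) := fun w =>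
    (form_eq_chartMetric g hx v w).trans (hν _)
  -- The derivative of the chart velocity differs from the covariant derivative X' by a Christoffel
  -- term in X. Absorbing this term into the covector puts the equation in the invariant form w(X l)
  -- + σ g(v, X' l) = 0.
  set B : Euc (n + 1) →L[ℝ] ℝ := η - σ • ξ.comp
    (chartChr g x₀ (chartFamily (n := n) x₀ Γ (p, s)) (chartVel (n := n) x₀ Γ (p, s))) with hB
  have hfr := h.isRayFrame hn hp hs
  have key := hfr.eq_zero_of_forall_add (w := (B.comp (toChartL x₀ (Γ (p, s)))).toLinearMap)
    (v := v) (σ := σ) ?_ ?_ ?_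
  · obtain ⟨k1, k2⟩ := key
    refine ⟨?_, k2⟩
    ext w
    obtain ⟨w, rfl⟩ := toChartL_surjective hx w
    have h3 := DFunLike.congr_fun k1 w
    change B (toChartL x₀ (Γ (p, s)) w) = 0 at h3
    simpa [hB, k2] using h3
  · change g.form _ v _ = 0
    rw [hform, h.family.toChart_rayVel hq hx, hξ]
  · change 0 < g.form _ v v
    rw [form_eq_chartMetric g hx]
    exact hνν
  · intro l
    change B (toChart x₀ (Γ (p, s)) (rayField Γ p l s)) +
      σ * g.form _ v (rayField' g Γ p l s) = 0
    have e1 : fderiv ℝ (chartFamily (n := n) x₀ Γ) (p, s) (l.1, l.2.1) +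
        (l.2.2 * s) • chartVel (n := n) x₀ Γ (p, s) =
        fderiv ℝ (chartFamily (n := n) x₀ Γ) (p, s) (l.1, l.2.1 + l.2.2 * s) := by
      rw [← h.fderiv_chartFamily_zero_one hp hs hx, ← map_smul, ← map_add]
      simp
    rw [hform, h.family.toChart_rayField hq hx, h.family.toChart_rayField' hq hx, e1]
    have := hη (l.1, l.2.1 + l.2.2 * s)
    simp only [hB, map_add, map_smul, hξ, sub_apply, smul_apply, smul_eq_mul,
      ContinuousLinearMap.comp_apply]
    linarith

/-- At spacelike covectors the derivatives of the family and of the pairing with its velocity can be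
prescribed together. -/
lemma exists_fderiv_eq (h : F.IsExtension Γ N I) (hn : 2 ≤ n) {p : RayParam n} (hp : p ∈ N)
    {s : ℝ} (hs : s ∈ Icc 0 F.ℓ) {x₀ : M} (hx : Γ (p, s) ∈ (lchart (n := n) x₀).source)
    {ξ : Euc (n + 1) →L[ℝ] ℝ} (hξ : ξ (chartVel (n := n) x₀ Γ (p, s)) = 0) {ν : Euc (n + 1)}
    (hν : ∀ w, chartMetric g x₀ (chartFamily (n := n) x₀ Γ (p, s)) ν w = ξ w)
    (hνν : 0 < chartMetric g x₀ (chartFamily (n := n) x₀ Γ (p, s)) ν ν) (y : Euc (n + 1)) (ρ : ℝ) :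
    ∃ w, fderiv ℝ (chartFamily (n := n) x₀ Γ) (p, s) w = y ∧ ξ
      (fderiv ℝ (chartVel (n := n) x₀ Γ) (p, s) w) = ρ := by
  have hq := h.mem hp hs
  obtain ⟨v, rfl⟩ := exists_toChart_eq hx ν
  obtain ⟨Y, rfl⟩ := exists_toChart_eq hx y
  have hform : ∀ w : TangentSpace (𝓡 (n + 1)) (Γ (p, s)),
      g.form (Γ (p, s)) v w = ξ (toChart x₀ (Γ (p, s)) w) := fun w =>
    (form_eq_chartMetric g hx v w).trans (hν _)
  have hvv : 0 < g.form (Γ (p, s)) v v := by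
    rw [form_eq_chartMetric g hx]
    exact hνν
  have hvu : g.form (Γ (p, s)) v (rayVel Γ p s) = 0 := by
    rw [hform, h.family.toChart_rayVel hq hx, hξ]
  have hfr := h.isRayFrame hn hp hs
  -- The derivative c v is admissible since v ⊥ u, and ξ(c v) = c g(v, v) takes every value because
  -- v is spacelike. The extra term on the right compensates the Christoffel correction.
  obtain ⟨c, hc⟩ : ∃ c : ℝ, c * g.form (Γ (p, s)) v v = ρ +
      ξ (chartChr g x₀ (chartFamily (n := n) x₀ Γ (p, s)) (chartVel (n := n) x₀ Γ (p, s))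
        (toChart x₀ (Γ (p, s)) Y)) := ⟨_, div_mul_cancel₀ _ hvv.ne'⟩
  obtain ⟨l, hl, hl'⟩ := hfr.surjective Y (v' := c • v) (by
    refine (g.symm _ _ _).trans ((form_smul_right _ _ _ _).trans ?_)
    rw [g.symm, hvu, mul_zero])
  have e1 : fderiv ℝ (chartFamily (n := n) x₀ Γ) (p, s) (l.1, l.2.1) +
      (l.2.2 * s) • chartVel (n := n) x₀ Γ (p, s) =
      fderiv ℝ (chartFamily (n := n) x₀ Γ) (p, s) (l.1, l.2.1 + l.2.2 * s) := by
    rw [← h.fderiv_chartFamily_zero_one hp hs hx, ← map_smul, ← map_add]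
    simp
  have e2 : fderiv ℝ (chartFamily (n := n) x₀ Γ) (p, s) (l.1, l.2.1 + l.2.2 * s) =
      toChart x₀ (Γ (p, s)) Y := by
    rw [← e1, ← h.family.toChart_rayField hq hx]
    exact congrArg (toChart x₀ (Γ (p, s))) hl
  refine ⟨(l.1, l.2.1 + l.2.2 * s), e2, ?_⟩
  have e3 : ξ (toChart x₀ (Γ (p, s)) (rayField' g Γ p l s)) = c * g.form (Γ (p, s)) v v := by
    rw [← hform]
    refine (congrArg (g.form (Γ (p, s)) v) hl').trans ?_
    exact form_smul_right _ _ _ _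
  rw [h.family.toChart_rayField' hq hx, hc, e2] at e3
  simp only [map_add, map_smul, hξ, smul_zero, add_zero] at e3
  linarith

end LightRayFamily.IsExtension

/-! ### Curves in the canonical relation; injectivity on the parameter side -/

namespace LightRayFamily.IsExtension

variable {n : ℕ} {M : Type*} [TopologicalSpace M] [ChartedSpace (Euc (n + 1)) M]
  [IsManifold (𝓡 (n + 1)) ∞ M] {g : LorentzianMetric n M} {F : LightRayFamily g}
  {Γ : RayParam n × ℝ → M} {N : Set (RayParam n)} {I : Set ℝ}

/-- The first derivatives of a curve in the canonical relation, in a chart. -/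
structure CurveData (F : LightRayFamily g) (Γ : RayParam n × ℝ → M) (q : ParamSpace n M)
    (c : ℝ → ParamSpace n M) (pd : RayParam n) (sd : ℝ) (ηd : Euc (n + 1) →L[ℝ] ℝ) : Prop where
  deriv_chart : deriv (fun t => extChartAt (paramModel n) q (c t)) 0 =
    ((pd.1, pd.2, sd), (fderiv ℝ (chartFamily (n := n) q.2.1 Γ) (parOf q, q.1.2.2) (pd, sd), ηd))
  constraint : ηd (chartVel (n := n) q.2.1 Γ (parOf q, q.1.2.2)) +
    (covChart q.2.1 q.2).2 (fderiv ℝ (chartVel (n := n) q.2.1 Γ) (parOf q, q.1.2.2) (pd, sd)) = 0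
  deriv_projZA : HasDerivAt (F.projZA ∘ c) (pd, coordsL n
    ((ηd.comp (fderiv ℝ (chartFamily (n := n) q.2.1 Γ) (parOf q, q.1.2.2)) +
      (covChart q.2.1 q.2).2.comp (fderiv ℝ (fderiv ℝ (chartFamily (n := n) q.2.1 Γ))
        (parOf q, q.1.2.2) (pd, sd))).comp (ContinuousLinearMap.inl ℝ (RayParam n) ℝ))) 0

/-- Along a curve in C₀ the base point equals Γ at the current parameters and the covector
annihilates the velocity. Differentiating these two identities leaves the velocities of (z, a), s
and the covector, subject to one linear constraint. -/
lemma exists_curveData (h : F.IsExtension Γ N I) {q : ParamSpace n M} (hq : q ∈ F.C₀)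
    (hp : parOf q ∈ N) {c : ℝ → ParamSpace n M} (hc : IsCurveThrough (paramModel n) F.C₀ q c) :
    ∃ pd sd ηd, CurveData F Γ q c pd sd ηd := by
  have hx : q.2.1 ∈ (lchart (n := n) q.2.1).source := mem_lchart_source _
  obtain ⟨hsI, hbase, hΩ, hξ0, hξ⟩ := (h.mem_C₀_iff hp hx).1 hq
  have hs := Ioo_subset_Icc_self hsI
  have hx' : Γ (parOf q, q.1.2.2) ∈ (lchart (n := n) q.2.1).source := hbase ▸ hx
  have hc0 := hc.at_zero
  have hc1 : ContDiffAt ℝ ∞ (fun t => (c t).1) 0 := by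
    have := hc.smooth.fst
    exact this.contDiffAt
  have hc2 : ContDiffAt ℝ ∞ (fun t => covChart q.2.1 (c t).2) 0 := by
    refine ContMDiffAt.contDiffAt ?_
    have h1 : ContMDiffAt (cotangentModel n) 𝓘(ℝ, Euc (n + 1) × (Euc (n + 1) →L[ℝ] ℝ)) ∞
        (covChart q.2.1) (c 0).2 := contMDiffAt_covChart (by rw [hc0]; exact hx)
    exact h1.comp 0 hc.smooth.snd
  have hd1 := (hc1.differentiableAt (by simp)).hasDerivAt
  have hd2 := (hc2.differentiableAt (by simp)).hasDerivAt
  set d1 := deriv (fun t => (c t).1) 0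
  set d2 := deriv (fun t => covChart q.2.1 (c t).2) 0
  set x₀ := q.2.1
  have hds : HasDerivAt (fun t => (parOf (c t), (c t).1.2.2)) ((d1.1, d1.2.1), d1.2.2) 0 := by
    have a1 := (ContinuousLinearMap.fst ℝ (Euc n) (Euc (n - 1) × ℝ)).hasFDerivAt.comp_hasDerivAt
      (0 : ℝ) hd1
    have a2 := (ContinuousLinearMap.snd ℝ (Euc n) (Euc (n - 1) × ℝ)).hasFDerivAt.comp_hasDerivAt
      (0 : ℝ) hd1
    have a3 := (ContinuousLinearMap.fst ℝ (Euc (n - 1)) ℝ).hasFDerivAt.comp_hasDerivAt (0 : ℝ) a2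
    have a4 := (ContinuousLinearMap.snd ℝ (Euc (n - 1)) ℝ).hasFDerivAt.comp_hasDerivAt (0 : ℝ) a2
    exact (a1.prodMk a3).prodMk a4
  have hη : HasDerivAt (fun t => (covChart x₀ (c t).2).2) d2.2 0 :=
    (ContinuousLinearMap.snd ℝ (Euc (n + 1))
      (Euc (n + 1) →L[ℝ] ℝ)).hasFDerivAt.comp_hasDerivAt (0 : ℝ) hd2
  have hb : HasDerivAt (fun t => (covChart x₀ (c t).2).1) d2.1 0 :=
    (ContinuousLinearMap.fst ℝ (Euc (n + 1))
      (Euc (n + 1) →L[ℝ] ℝ)).hasFDerivAt.comp_hasDerivAt (0 : ℝ) hd2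
  have hev : ∀ᶠ t in 𝓝 (0 : ℝ), c t ∈ F.C₀ ∧ parOf (c t) ∈ N ∧
      (c t).2.1 ∈ (lchart (n := n) x₀).source := by
    refine hc.mem.and (Filter.Eventually.and ?_ ?_)
    · have h1 : ContinuousAt (fun t => parOf (c t)) 0 := by
        have h2 := hc1.continuousAt
        exact h2.fst.prodMk h2.snd.fst
      refine h1.eventually (h.isOpen_N.mem_nhds ?_)
      change parOf (c 0) ∈ N
      rw [hc0]
      exact hp
    · have h1 : ContinuousAt (fun t => (c t).2) 0 := hc.smooth.continuousAt.snd
      have h2 := h1.eventually ((isOpen_covChart_source (n := n) x₀).mem_nhds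
        (mem_covChart_source.2 (by change (c 0).2.1 ∈ _; rw [hc0]; exact hx)))
      filter_upwards [h2] with t ht using mem_covChart_source.1 ht
  have hC := h.family.contDiffAt_chartFamily (h.mem hp hs) hx'
  have hV := h.family.contDiffAt_chartVel (h.mem hp hs) hx'
  have hC' : DifferentiableAt ℝ (fderiv ℝ (chartFamily (n := n) x₀ Γ)) (parOf q, q.1.2.2) :=
    (hC.fderiv_right (m := 1) (by norm_cast)).differentiableAt (by simp)
  have e0 : (parOf (c 0), (c 0).1.2.2) = (parOf q, q.1.2.2) := by rw [hc0]
  have hCd := HasFDerivAt.comp_hasDerivAt (f := fun t => (parOf (c t), (c t).1.2.2)) (0 : ℝ)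
    (e0.symm ▸ (hC.differentiableAt (by simp)).hasFDerivAt) hds
  have hVd := HasFDerivAt.comp_hasDerivAt (f := fun t => (parOf (c t), (c t).1.2.2)) (0 : ℝ)
    (e0.symm ▸ (hV.differentiableAt (by simp)).hasFDerivAt) hds
  have hC'd := HasFDerivAt.comp_hasDerivAt (f := fun t => (parOf (c t), (c t).1.2.2)) (0 : ℝ)
    (e0.symm ▸ hC'.hasFDerivAt) hds
  have ed2 : d2.1 = fderiv ℝ (chartFamily (n := n) x₀ Γ) (parOf q, q.1.2.2)
      ((d1.1, d1.2.1), d1.2.2) := by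
    rw [hc0] at hCd
    refine hb.unique (hCd.congr_of_eventuallyEq ?_)
    filter_upwards [hev] with t ht
    have h1 := ((h.mem_C₀_iff ht.2.1 ht.2.2).1 ht.1).2.1
    rw [covChart_apply ht.2.2]
    exact congrArg (lchart (n := n) x₀) h1
  refine ⟨(d1.1, d1.2.1), d1.2.2, d2.2, ?_, ?_, ?_⟩
  · rw [extChartAt_paramSpace]
    have h1 := (hd1.prodMk hd2).deriv
    refine h1.trans ?_
    rw [← ed2]
  · have h1 := hη.clm_apply hVd
    have h2 : HasDerivAt (fun _ : ℝ => (0 : ℝ)) 0 0 := hasDerivAt_const 0 0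
    have h3 := h1.unique (h2.congr_of_eventuallyEq (by
      filter_upwards [hev] with t ht
      exact ((h.mem_C₀_iff ht.2.1 ht.2.2).1 ht.1).2.2.2.2))
    simpa only [Function.comp_apply, hc0] using h3
  · have h1 := (hη.clm_comp hC'd).clm_comp
      (hasDerivAt_const (0 : ℝ) (ContinuousLinearMap.inl ℝ (RayParam n) ℝ))
    have h2 := (coordsL n).hasFDerivAt.comp_hasDerivAt (0 : ℝ) h1
    have h3 := ((ContinuousLinearMap.fst ℝ (RayParam n) ℝ).hasFDerivAt.comp_hasDerivAt
      (0 : ℝ) hds).prodMk h2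
    have h4 := h3.congr_of_eventuallyEq (f₁ := F.projZA ∘ c) (by
      filter_upwards [hev] with t ht
      exact h.projZA_eq ht.1 ht.2.1 ht.2.2)
    refine h4.congr_deriv ?_
    simp only [Function.comp_apply, hc0, ContinuousLinearMap.comp_zero, add_zero]
    rfl

/-- Equal image velocities force equal velocities of (z, a). The differences of the covector and
time velocities then solve the homogeneous equation of `eq_zero_of_forall_chart`. -/
lemma differentialInjectiveAt_projZA (h : F.IsExtension Γ N I) (hn : 2 ≤ n) {q : ParamSpace n M}
    (hq : q ∈ F.C₀) (hp : parOf q ∈ N) (hsp : IsSpacelike g q.2) :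
    DifferentialInjectiveAt (paramModel n) 𝓘(ℝ, CotangentZA n) F.C₀ F.projZA q := by
  refine ⟨fun c hc => ?_, fun c₁ c₂ hc₁ hc₂ heq => ?_⟩
  · obtain ⟨pd, sd, ηd, hd⟩ := h.exists_curveData hq hp hc
    exact hd.deriv_projZA.differentiableAt.mdifferentiableAt
  obtain ⟨pd₁, sd₁, ηd₁, hd₁⟩ := h.exists_curveData hq hp hc₁
  obtain ⟨pd₂, sd₂, ηd₂, hd₂⟩ := h.exists_curveData hq hp hc₂
  have hx : q.2.1 ∈ (lchart (n := n) q.2.1).source := mem_lchart_source _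
  obtain ⟨hsI, hbase, hΩ, hξ0, hξ⟩ := (h.mem_C₀_iff hp hx).1 hq
  have hs := Ioo_subset_Icc_self hsI
  have hx' : Γ (parOf q, q.1.2.2) ∈ (lchart (n := n) q.2.1).source := hbase ▸ hx
  have e1 := deriv_eq_of_curveVelTB_eq (p := F.projZA q)
    hd₁.deriv_projZA.differentiableAt.mdifferentiableAt
    hd₂.deriv_projZA.differentiableAt.mdifferentiableAt
    (congrArg F.projZA hc₁.at_zero) (congrArg F.projZA hc₂.at_zero) heq
  simp only [extChartAt_model_space_eq_id, PartialEquiv.refl_coe, id_eq] at e1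
  have e2 := hd₁.deriv_projZA.deriv.symm.trans (e1.trans hd₂.deriv_projZA.deriv)
  obtain ⟨e3, e4⟩ := Prod.ext_iff.1 e2
  have e5 := coordsL_injective n e4
  obtain ⟨ν, hν, hνν⟩ := (isSpacelike_iff hx).1 hsp
  have hCx : lchart (n := n) q.2.1 q.2.1 = chartFamily (n := n) q.2.1 Γ (parOf q, q.1.2.2) :=
    congrArg (lchart (n := n) q.2.1) hbase
  rw [hCx] at hν hνν
  obtain ⟨k1, k2⟩ := h.eq_zero_of_forall_chart hn hp hs hx' hξ hν hνν (η := ηd₁ - ηd₂)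
    (σ := sd₁ - sd₂) (by
      intro w
      have hsplit : w = (w.1, 0) + w.2 • ((0, 1) : RayParam n × ℝ) := by
        ext <;> simp
      have h1 := DFunLike.congr_fun e5 w.1
      have e3' : pd₁ = pd₂ := e3
      subst e3'
      have hsp : ∀ r : ℝ, ((pd₁, r) : RayParam n × ℝ) = (pd₁, 0) + r • (0, 1) := by
        intro r
        ext <;> simp
      have h2 : ∀ r w, fderiv ℝ (fderiv ℝ (chartFamily (n := n) q.2.1 Γ)) (parOf q, q.1.2.2)
          (pd₁, r) w = fderiv ℝ (fderiv ℝ (chartFamily (n := n) q.2.1 Γ)) (parOf q, q.1.2.2)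
          (pd₁, 0) w + r • fderiv ℝ (chartVel (n := n) q.2.1 Γ) (parOf q, q.1.2.2) w := by
        intro r w
        rw [← h.fderiv_fderiv_chartFamily hp hs hx', hsp r, map_add, map_smul]
        rfl
      have h3 : ∀ r, fderiv ℝ (chartVel (n := n) q.2.1 Γ) (parOf q, q.1.2.2) (pd₁, r) =
          fderiv ℝ (chartVel (n := n) q.2.1 Γ) (parOf q, q.1.2.2) (pd₁, 0) +
          r • fderiv ℝ (chartVel (n := n) q.2.1 Γ) (parOf q, q.1.2.2) (0, 1) := by
        intro r
        rw [hsp r, map_add, map_smul]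
      have h4 := hd₁.constraint
      have h5 := hd₂.constraint
      rw [h3] at h4 h5
      simp only [ContinuousLinearMap.comp_apply, add_apply, ContinuousLinearMap.inl_apply] at h1
      rw [h2 sd₁, h2 sd₂] at h1
      simp only [map_add, map_smul, smul_eq_mul] at h1 h4 h5
      rw [hsplit]
      simp only [map_add, map_smul, smul_eq_mul, sub_apply,
        h.fderiv_chartFamily_zero_one hp hs hx']
      -- The parameter directions of the equation come from the fibre components of the projection,
      -- and the time direction comes from the linearised constraint.
      linear_combination h1 + w.2 * (h4 - h5))
  have m₁ := hc₁.smooth.mdifferentiableAt (by simp)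
  have m₂ := hc₂.smooth.mdifferentiableAt (by simp)
  refine curveVelTB_eq_of_deriv_eq m₁ m₂ hc₁.at_zero hc₂.at_zero ?_
  rw [hd₁.deriv_chart, hd₂.deriv_chart]
  have e3' : pd₁ = pd₂ := e3
  rw [e3', sub_eq_zero.1 k1, sub_eq_zero.1 k2]

end LightRayFamily.IsExtension

/-! ### Surjectivity on the side of the cotangent bundle of M -/

namespace LightRayFamily.IsExtension

variable {n : ℕ} {M : Type*} [TopologicalSpace M] [ChartedSpace (Euc (n + 1)) M]
  [IsManifold (𝓡 (n + 1)) ∞ M] {g : LorentzianMetric n M} {F : LightRayFamily g}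
  {Γ : RayParam n × ℝ → M} {N : Set (RayParam n)} {I : Set ℝ}

lemma chartVel_ne_zero (h : F.IsExtension Γ N I) (hn : 2 ≤ n) {p : RayParam n} (hp : p ∈ N)
    {s : ℝ} (hs : s ∈ Icc 0 F.ℓ) {x₀ : M} (hx : Γ (p, s) ∈ (lchart (n := n) x₀).source) :
    chartVel (n := n) x₀ Γ (p, s) ≠ 0 := by
  rw [← h.family.toChart_rayVel (h.mem hp hs) hx]
  intro h0
  exact (h.isRayFrame hn hp hs).u_ne_zero
    (toChartL_injective hx (h0.trans (map_zero (toChartL (n := n) x₀ (Γ (p, s)))).symm))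

/-- A point of the canonical relation given by its coordinates in a chart. -/
def ofCoords (x₀ : M) (Γ : RayParam n × ℝ → M) (r : RayParam n × ℝ) (η : Euc (n + 1) →L[ℝ] ℝ) :
    ParamSpace n M :=
  ((r.1.1, r.1.2, r.2), (covChart x₀).symm (chartFamily (n := n) x₀ Γ r, η))

lemma covChart_ofCoords {x₀ : M} {r : RayParam n × ℝ} (hr : Γ r ∈ (lchart (n := n) x₀).source)
    (η : Euc (n + 1) →L[ℝ] ℝ) :
    covChart x₀ (ofCoords x₀ Γ r η).2 = (chartFamily (n := n) x₀ Γ r, η) := by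
  refine (covChart x₀).right_inv ?_
  rw [covChart_target]
  exact ⟨(lchart (n := n) x₀).map_source hr, mem_univ _⟩

lemma ofCoords_mem_source {x₀ : M} {r : RayParam n × ℝ} (hr : Γ r ∈ (lchart (n := n) x₀).source)
    (η : Euc (n + 1) →L[ℝ] ℝ) : (ofCoords x₀ Γ r η).2.1 ∈ (lchart (n := n) x₀).source := by
  refine mem_covChart_source.1 ((covChart x₀).map_target ?_)
  rw [covChart_target]
  exact ⟨(lchart (n := n) x₀).map_source hr, mem_univ _⟩

lemma ofCoords_base {x₀ : M} {r : RayParam n × ℝ} (hr : Γ r ∈ (lchart (n := n) x₀).source)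
    (η : Euc (n + 1) →L[ℝ] ℝ) : (ofCoords x₀ Γ r η).2.1 = Γ r := by
  have h1 := covChart_ofCoords hr η
  have h2 := ofCoords_mem_source hr η
  rw [covChart_apply h2] at h1
  exact (lchart (n := n) x₀).injOn h2 hr (congrArg Prod.fst h1)

lemma ofCoords_mem_C₀ (h : F.IsExtension Γ N I) {x₀ : M} {r : RayParam n × ℝ} (hrN : r.1 ∈ N)
    (hrs : r.2 ∈ Ioo 0 F.ℓ) (hrΩ : Γ r ∈ F.Ω) (hr : Γ r ∈ (lchart (n := n) x₀).source)
    {η : Euc (n + 1) →L[ℝ] ℝ} (hη : η ≠ 0) (hηv : η (chartVel (n := n) x₀ Γ r) = 0) :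
    ofCoords x₀ Γ r η ∈ F.C₀ := by
  refine (h.mem_C₀_iff (q := ofCoords x₀ Γ r η) hrN (ofCoords_mem_source hr η)).2
    ⟨hrs, ofCoords_base hr η, ?_, ?_, ?_⟩
  · rw [ofCoords_base hr η]
    exact hrΩ
  · rw [covChart_ofCoords hr η]
    exact hη
  · rw [covChart_ofCoords hr η]
    exact hηv

/-- To realise a velocity (y, η₁), the parameters move along a line r₀ + t δ and the covector ξ + t
η₁ is corrected along a fixed covector `m` so as to annihilate the velocity of the ray. With δ from
`exists_fderiv_eq` the correction vanishes to first order at t = 0, so it does not change η₁. -/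
lemma differentialSurjectiveAt_projM (h : F.IsExtension Γ N I) (hn : 2 ≤ n) {q : ParamSpace n M}
    (hq : q ∈ F.C₀) (hp : parOf q ∈ N) (hsp : IsSpacelike g q.2) :
    DifferentialSurjectiveAt (paramModel n) (cotangentModel n) F.C₀ F.projM q := by
  refine ⟨fun c hc => (hc.smooth.snd).mdifferentiableAt (by simp), fun w => ?_⟩
  have hx : q.2.1 ∈ (lchart (n := n) q.2.1).source := mem_lchart_source _
  obtain ⟨hsI, hbase, hΩ, hξ0, hξ⟩ := (h.mem_C₀_iff hp hx).1 hq
  have hs := Ioo_subset_Icc_self hsI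
  have hx' : Γ (parOf q, q.1.2.2) ∈ (lchart (n := n) q.2.1).source := hbase ▸ hx
  obtain ⟨ν, hν, hνν⟩ := (isSpacelike_iff hx).1 hsp
  have hCx : lchart (n := n) q.2.1 q.2.1 = chartFamily (n := n) q.2.1 Γ (parOf q, q.1.2.2) :=
    congrArg (lchart (n := n) q.2.1) hbase
  rw [hCx] at hν hνν
  set x₀ := q.2.1
  set r₀ : RayParam n × ℝ := (parOf q, q.1.2.2)
  set ξ := (covChart x₀ q.2).2
  obtain ⟨y, η₁⟩ : Euc (n + 1) × (Euc (n + 1) →L[ℝ] ℝ) := w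
  obtain ⟨δ, hδ, hδ'⟩ := h.exists_fderiv_eq hn hp hs hx' hξ hν hνν y
    (-η₁ (chartVel (n := n) x₀ Γ r₀))
  have hv := h.chartVel_ne_zero hn hp hs hx'
  set v := chartVel (n := n) x₀ Γ r₀
  obtain ⟨m, hm⟩ : ∃ m : Euc (n + 1) →L[ℝ] ℝ, m v ≠ 0 := ⟨innerSL ℝ v, by simpa using hv⟩
  have hC := h.family.contDiffAt_chartFamily (h.mem hp hs) hx'
  have hV := h.family.contDiffAt_chartVel (h.mem hp hs) hx'
  have hline : HasDerivAt (fun t : ℝ => r₀ + t • δ) δ 0 := by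
    simpa using ((hasDerivAt_id (0 : ℝ)).smul_const δ).const_add r₀
  have hlineC : ContDiff ℝ ∞ (fun t : ℝ => r₀ + t • δ) := by fun_prop
  have hl0 : r₀ + (0 : ℝ) • δ = r₀ := by simp
  have hCt : ContDiffAt ℝ ∞ (fun t : ℝ => chartFamily (n := n) x₀ Γ (r₀ + t • δ)) 0 :=
    ContDiffAt.comp (g := chartFamily (n := n) x₀ Γ) (f := fun t : ℝ => r₀ + t • δ) 0
      (by rw [hl0]; exact hC) hlineC.contDiffAt
  have hVt : ContDiffAt ℝ ∞ (fun t : ℝ => chartVel (n := n) x₀ Γ (r₀ + t • δ)) 0 :=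
    ContDiffAt.comp (g := chartVel (n := n) x₀ Γ) (f := fun t : ℝ => r₀ + t • δ) 0
      (by rw [hl0]; exact hV) hlineC.contDiffAt
  have hCd : HasDerivAt (fun t : ℝ => chartFamily (n := n) x₀ Γ (r₀ + t • δ)) y 0 := by
    rw [← hδ]
    exact HasFDerivAt.comp_hasDerivAt (f := fun t : ℝ => r₀ + t • δ) (0 : ℝ)
      (by rw [hl0]; exact (hC.differentiableAt (by simp)).hasFDerivAt) hline
  have hVd : HasDerivAt (fun t : ℝ => chartVel (n := n) x₀ Γ (r₀ + t • δ))
      (fderiv ℝ (chartVel (n := n) x₀ Γ) r₀ δ) 0 :=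
    HasFDerivAt.comp_hasDerivAt (l := chartVel (n := n) x₀ Γ) (f := fun t : ℝ => r₀ + t • δ) (0 : ℝ)
      (by rw [hl0]; exact (hV.differentiableAt (by simp)).hasFDerivAt) hline
  set V : ℝ → Euc (n + 1) := fun t => chartVel (n := n) x₀ Γ (r₀ + t • δ) with hVdef
  have hV0 : V 0 = v := congrArg (chartVel (n := n) x₀ Γ) hl0
  -- Projection along `m` onto the annihilator of V(t), which is possible near t = 0 because m(V(0))
  -- ≠ 0.
  set η : ℝ → (Euc (n + 1) →L[ℝ] ℝ) := fun t =>
    ξ + t • η₁ - ((ξ + t • η₁) (V t) * (m (V t))⁻¹) • m with hηdef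
  have hη0 : η 0 = ξ := by simp [hηdef, hV0, v, hξ]
  have hmV : m (V 0) ≠ 0 := by rw [hV0]; exact hm
  have hlin : ContDiffAt ℝ ∞ (fun t : ℝ => ξ + t • η₁) 0 :=
    contDiffAt_const.add (contDiffAt_id.smul contDiffAt_const)
  have hηC : ContDiffAt ℝ ∞ η 0 :=
    hlin.sub (((hlin.clm_apply hVt).mul
      ((contDiffAt_const.clm_apply hVt).inv hmV)).smul contDiffAt_const)
  have hηd : HasDerivAt η η₁ 0 := by
    have a1 : HasDerivAt (fun t : ℝ => ξ + t • η₁) η₁ 0 := by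
      simpa using ((hasDerivAt_id (0 : ℝ)).smul_const η₁).const_add ξ
    have a2 := a1.clm_apply hVd
    have a3 : HasDerivAt (fun t => (m (V t))⁻¹) (deriv (fun t => (m (V t))⁻¹) 0) 0 :=
      (((contDiffAt_const.clm_apply hVt).inv hmV).differentiableAt (by simp)).hasDerivAt
    have a4 := a1.sub ((a2.mul a3).smul_const m)
    refine a4.congr_deriv ?_
    have b1 : (ξ + (0 : ℝ) • η₁) (V 0) = 0 := by simp [hV0, v, hξ]
    -- This is the linearised constraint, and the reason for prescribing ξ(DV δ) = -η₁(v) in the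
    -- choice of δ.
    have b2 : η₁ (V 0) + (ξ + (0 : ℝ) • η₁) (fderiv ℝ (chartVel (n := n) x₀ Γ) r₀ δ) = 0 := by
      rw [hV0, zero_smul, add_zero]
      exact (congrArg (η₁ v + ·) hδ').trans (add_neg_cancel _)
    change η₁ - ((η₁ (V 0) + (ξ + (0 : ℝ) • η₁) (fderiv ℝ (chartVel (n := n) x₀ Γ) r₀ δ)) *
      (m (V 0))⁻¹ + (ξ + (0 : ℝ) • η₁) (V 0) * _) • m = η₁
    rw [b1, b2]
    simp
  have hq0 : ofCoords x₀ Γ r₀ ξ = q := by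
    have h1 : (chartFamily (n := n) x₀ Γ r₀, ξ) = covChart x₀ q.2 := by
      refine Prod.ext ?_ rfl
      rw [covChart_apply hx, hCx]
    rw [ofCoords, h1, (covChart x₀).left_inv (mem_covChart_source.2 hx)]
    rfl
  have hc0 : ofCoords x₀ Γ (r₀ + (0 : ℝ) • δ) (η 0) = q := by rw [hl0, hη0, hq0]
  have htarget : chartFamily (n := n) x₀ Γ (r₀ + (0 : ℝ) • δ) ∈ (lchart (n := n) x₀).target := by
    rw [hl0]
    exact (lchart (n := n) x₀).map_source hx'
  have hsnd : ContMDiffAt 𝓘(ℝ, ℝ) (cotangentModel n) ∞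
      (fun t : ℝ => (covChart x₀).symm (chartFamily (n := n) x₀ Γ (r₀ + t • δ), η t)) 0 := by
    have a1 : ContMDiffAt 𝓘(ℝ, ℝ) 𝓘(ℝ, Euc (n + 1) × (Euc (n + 1) →L[ℝ] ℝ)) ∞
        (fun t : ℝ => (chartFamily (n := n) x₀ Γ (r₀ + t • δ), η t)) 0 :=
      (hCt.prodMk hηC).contMDiffAt
    exact ContMDiffAt.comp (0 : ℝ) (contMDiffAt_covChart_symm htarget) a1
  have hΓc : ContinuousAt (fun t : ℝ => Γ (r₀ + t • δ)) 0 := by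
    have h1 : ContinuousAt Γ (r₀ + (0 : ℝ) • δ) := by
      rw [hl0]
      exact (h.family.contMDiffAt (h.mem hp hs)).continuousAt
    exact h1.comp (f := fun t : ℝ => r₀ + t • δ) hlineC.continuous.continuousAt
  have hsrc : ∀ᶠ t : ℝ in 𝓝 0, Γ (r₀ + t • δ) ∈ (lchart (n := n) x₀).source :=
    hΓc.eventually ((isOpen_lchart_source x₀).mem_nhds (by
      change Γ (r₀ + (0 : ℝ) • δ) ∈ _
      rw [hl0]
      exact hx'))
  refine ⟨fun t => ofCoords x₀ Γ (r₀ + t • δ) (η t), ⟨hc0, ?_, ?_⟩, ?_⟩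
  · refine ContMDiffAt.prodMk ?_ hsnd
    refine ContDiffAt.contMDiffAt ?_
    have := hlineC
    have a1 : ContDiff ℝ ∞ (fun t : ℝ => (r₀ + t • δ).1.1) := by fun_prop
    have a2 : ContDiff ℝ ∞ (fun t : ℝ => (r₀ + t • δ).1.2) := by fun_prop
    have a3 : ContDiff ℝ ∞ (fun t : ℝ => (r₀ + t • δ).2) := by fun_prop
    exact (a1.prodMk (a2.prodMk a3)).contDiffAt
  · have b1 : ∀ᶠ t : ℝ in 𝓝 0, (r₀ + t • δ).1 ∈ N ∧ (r₀ + t • δ).2 ∈ Ioo 0 F.ℓ := by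
      refine (hlineC.continuous.continuousAt (x := 0)).eventually
        ((h.isOpen_N.prod isOpen_Ioo).mem_nhds ?_)
      change r₀ + (0 : ℝ) • δ ∈ N ×ˢ Ioo 0 F.ℓ
      rw [hl0]
      exact ⟨hp, hsI⟩
    have b2 : ∀ᶠ t : ℝ in 𝓝 0, Γ (r₀ + t • δ) ∈ F.Ω :=
      hΓc.eventually (F.isOpen_Ω.mem_nhds (by
        change Γ (r₀ + (0 : ℝ) • δ) ∈ _
        rw [hl0, ← hbase]
        exact hΩ))
    have b3 : ∀ᶠ t : ℝ in 𝓝 0, η t ≠ 0 :=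
      hηC.continuousAt.eventually_ne (by rw [hη0]; exact hξ0)
    have b4 : ∀ᶠ t : ℝ in 𝓝 0, m (V t) ≠ 0 :=
      (contDiffAt_const.clm_apply hVt).continuousAt.eventually_ne hmV
    filter_upwards [b1, b2, b3, b4, hsrc] with t t1 t2 t3 t4 t5
    refine h.ofCoords_mem_C₀ t1.1 t1.2 t2 t5 t3 ?_
    change η t (V t) = 0
    simp only [hηdef, sub_apply, smul_apply, smul_eq_mul]
    rw [mul_assoc, inv_mul_cancel₀ t4, mul_one, sub_self]
  · refine curveVelTB_eq_mk (p := F.projM q) (hsnd.mdifferentiableAt (by simp))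
      (congrArg Prod.snd hc0) _ ?_
    have e1 : (fun t => covChart x₀ (ofCoords x₀ Γ (r₀ + t • δ) (η t)).2) =ᶠ[𝓝 0]
        fun t => (chartFamily (n := n) x₀ Γ (r₀ + t • δ), η t) := by
      filter_upwards [hsrc] with t t5 using covChart_ofCoords t5 _
    have e2 := ((hCd.prodMk hηd).congr_of_eventuallyEq e1).deriv
    rw [extChartAt_cotangent]
    exact e2

end LightRayFamily.IsExtension

/-! ### The image in the cotangent bundle of M -/

namespace LightRayFamily

variable {n : ℕ} {M : Type*} [TopologicalSpace M] [ChartedSpace (Euc (n + 1)) M]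
  [IsManifold (𝓡 (n + 1)) ∞ M] {g : LorentzianMetric n M} {F : LightRayFamily g}
  {Γ : RayParam n × ℝ → M} {N : Set (RayParam n)} {I : Set ℝ}

/-- The canonical relation covers a neighbourhood of each of its spacelike covectors. -/
lemma IsExtension.image_projM_mem_nhds (h : F.IsExtension Γ N I) (hn : 2 ≤ n) {q : ParamSpace n M}
    (hq : q ∈ F.C₀) (hp : IsExtension.parOf q ∈ N) (hsp : IsSpacelike g q.2) :
    F.projM '' F.C₀ ∈ 𝓝 q.2 := by
  have hx : q.2.1 ∈ (lchart (n := n) q.2.1).source := mem_lchart_source _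
  obtain ⟨hsI, hbase, hΩ, hξ0, hξ⟩ := (h.mem_C₀_iff hp hx).1 hq
  have hs := Ioo_subset_Icc_self hsI
  have hx' : Γ (parOf q, q.1.2.2) ∈ (lchart (n := n) q.2.1).source := hbase ▸ hx
  obtain ⟨ν, hν, hνν⟩ := (isSpacelike_iff hx).1 hsp
  have hCx : lchart (n := n) q.2.1 q.2.1 = chartFamily (n := n) q.2.1 Γ (parOf q, q.1.2.2) :=
    congrArg (lchart (n := n) q.2.1) hbase
  rw [hCx] at hν hνν
  set x₀ := q.2.1
  set r₀ : RayParam n × ℝ := (parOf q, q.1.2.2)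
  set ξ := (covChart x₀ q.2).2
  have hC := h.family.contDiffAt_chartFamily (h.mem hp hs) hx'
  have hV := h.family.contDiffAt_chartVel (h.mem hp hs) hx'
  have hCs := (hC.hasStrictFDerivAt (by simp)).comp (x := (r₀, ξ))
    (f := fun a : (RayParam n × ℝ) × (Euc (n + 1) →L[ℝ] ℝ) => a.1) (hasStrictFDerivAt_fst)
  have hVs := (hV.hasStrictFDerivAt (by simp)).comp (x := (r₀, ξ))
    (f := fun a : (RayParam n × ℝ) × (Euc (n + 1) →L[ℝ] ℝ) => a.1) (hasStrictFDerivAt_fst)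
  have hηs : HasStrictFDerivAt (fun a : (RayParam n × ℝ) × (Euc (n + 1) →L[ℝ] ℝ) => a.2)
    (ContinuousLinearMap.snd ℝ _ _) (r₀, ξ) := hasStrictFDerivAt_snd
  -- The map (r, η) ↦ ((Γ r, η), η(V r)) is a submersion at (r₀, ξ), hence open there. Within the
  -- open conditions on r and η, points of C₀ are the zeros of its last component.
  have hΦ := (hCs.prodMk hηs).prodMk (hηs.clm_apply hVs)
  have hmap := hΦ.map_nhds_eq_of_surj (by
    rw [LinearMap.range_eq_top]
    rintro ⟨⟨y, η₁⟩, ρ⟩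
    obtain ⟨δ, hδ, hδ'⟩ := h.exists_fderiv_eq hn hp hs hx' hξ hν hνν y
      (ρ - η₁ (chartVel (n := n) x₀ Γ r₀))
    refine ⟨(δ, η₁), Prod.ext (Prod.ext hδ rfl) ?_⟩
    change ξ (fderiv ℝ (chartVel (n := n) x₀ Γ) r₀ δ) + η₁ (chartVel (n := n) x₀ Γ r₀) = ρ
    rw [hδ']
    ring)
  have hG : {a : (RayParam n × ℝ) × (Euc (n + 1) →L[ℝ] ℝ) | (a.1.1 ∈ N ∧ a.1.2 ∈ Ioo 0 F.ℓ) ∧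
      Γ a.1 ∈ F.Ω ∧ Γ a.1 ∈ (lchart (n := n) x₀).source ∧ a.2 ≠ 0} ∈ 𝓝 (r₀, ξ) := by
    have hΓc : ContinuousAt (fun a : (RayParam n × ℝ) × (Euc (n + 1) →L[ℝ] ℝ) => Γ a.1) (r₀, ξ) :=
      ContinuousAt.comp (f := fun a : (RayParam n × ℝ) × (Euc (n + 1) →L[ℝ] ℝ) => a.1) (g := Γ)
        (h.family.contMDiffAt (h.mem hp hs)).continuousAt continuousAt_fst
    refine Filter.inter_mem ?_ (Filter.inter_mem ?_ (Filter.inter_mem ?_ ?_))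
    · exact continuousAt_fst.preimage_mem_nhds ((h.isOpen_N.prod isOpen_Ioo).mem_nhds ⟨hp, hsI⟩)
    · exact hΓc.preimage_mem_nhds (F.isOpen_Ω.mem_nhds (by
        change Γ r₀ ∈ _
        rw [← hbase]
        exact hΩ))
    · exact hΓc.preimage_mem_nhds ((isOpen_lchart_source x₀).mem_nhds hx')
    · exact continuousAt_snd.eventually_ne hξ0
  have hG' := Filter.image_mem_map (m := fun a : (RayParam n × ℝ) × (Euc (n + 1) →L[ℝ] ℝ) =>
    ((chartFamily (n := n) x₀ Γ a.1, a.2), a.2 (chartVel (n := n) x₀ Γ a.1))) hG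
  have hG'' := hmap.ge hG'
  -- A covector Q near the given one corresponds to the target (Q, 0). Openness provides a preimage,
  -- which is a point of C₀ over Q.
  have hcont : ContinuousAt (fun Q : CotangentBundle n M => (covChart x₀ Q, (0 : ℝ))) q.2 :=
    (contMDiffAt_covChart hx).continuousAt.prodMk continuousAt_const
  have hval : (covChart x₀ q.2, (0 : ℝ)) =
      ((chartFamily (n := n) x₀ Γ r₀, ξ), ξ (chartVel (n := n) x₀ Γ r₀)) := by
    rw [hξ, ← hCx]
    refine Prod.ext (Prod.ext ?_ rfl) rfl
    rw [covChart_apply hx]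
  have h1 := hcont.preimage_mem_nhds (by rw [hval]; exact hG'')
  filter_upwards [h1, (isOpen_covChart_source (n := n) x₀).mem_nhds (mem_covChart_source.2 hx)]
    with Q hQ hQs
  obtain ⟨⟨r, η⟩, ⟨⟨k1, k1'⟩, k2, k3, k4⟩, k5⟩ := hQ
  obtain ⟨k6, k7⟩ := Prod.ext_iff.1 k5
  refine ⟨ofCoords x₀ Γ r η, h.ofCoords_mem_C₀ k1 k1' k2 k3 k4 k7, ?_⟩
  change (covChart x₀).symm (chartFamily (n := n) x₀ Γ r, η) = Q
  have k6' : (chartFamily (n := n) x₀ Γ r, η) = covChart x₀ Q := k6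
  rw [k6', (covChart x₀).left_inv hQs]

lemma zero_mem_param (F : LightRayFamily g) : (0 : RayParam n) ∈ F.param :=
  ⟨F.zero_mem_Z, F.zero_mem_A⟩

/-- Spacelike covectors are nonzero. -/
lemma ne_zero_of_isSpacelike {p : CotangentBundle n M} (h : IsSpacelike g p) : p.2 ≠ 0 := by
  obtain ⟨v, hv, hvv⟩ := h
  intro h0
  rw [hv v, h0] at hvv
  exact lt_irrefl _ hvv

lemma mem_Ioo_of_mem {p : RayParam n} (hp : p ∈ F.param) {s : ℝ} (hs : s ∈ Icc 0 F.ℓ)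
    (hΩ : F.ray p s ∈ F.Ω) : s ∈ Ioo 0 F.ℓ := by
  refine ⟨hs.1.lt_of_ne ?_, hs.2.lt_of_ne ?_⟩
  · rintro rfl
    exact F.start_notMem _ hp.1 _ hp.2 (subset_closure hΩ)
  · rintro rfl
    exact F.end_notMem _ hp.1 _ hp.2 (subset_closure hΩ)

/-- The interior of the image serves as `W`: a spacelike conormal covector of γ₀ over Ω lifts to C₀,
the end points of the ray being outside Ω, and the image is a neighbourhood of it. -/
lemma exists_isOpen_subset_image_projM [T2Space M] (F : LightRayFamily g) (hn : 2 ≤ n) :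
    ∃ W : Set (CotangentBundle n M), IsOpen W ∧
      {p ∈ spacelikeCone g ∩ conormal F.γ₀ F.ℓ | p.1 ∈ F.Ω} ⊆ W ∧
      W ∩ spacelikeCone g ⊆ F.projM '' F.C₀ := by
  refine ⟨interior (F.projM '' F.C₀), isOpen_interior, ?_,
    inter_subset_left.trans interior_subset⟩
  rintro p ⟨⟨hsp, s, hs, ξ, rfl, hξ⟩, hΩ⟩
  obtain ⟨Γ, N, I, h0, h⟩ := F.exists_isExtension F.zero_mem_param
  have hsI := mem_Ioo_of_mem F.zero_mem_param hs hΩ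
  have hq : (((0, 0, s), ⟨F.γ₀ s, ξ⟩) : ParamSpace n M) ∈ F.C₀ :=
    ⟨0, F.zero_mem_Z, 0, F.zero_mem_A, s, hsI, ξ, rfl, hΩ, ne_zero_of_isSpacelike hsp, hξ⟩
  exact mem_interior_iff_mem_nhds.2 (h.image_projM_mem_nhds hn hq h0 hsp)

lemma differentials [T2Space M] (F : LightRayFamily g) (hn : 2 ≤ n) {q : ParamSpace n M}
    (hq : q ∈ F.C₀) (hsp : IsSpacelike g q.2) :
    DifferentialInjectiveAt (paramModel n) 𝓘(ℝ, CotangentZA n) F.C₀ F.projZA q ∧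
      DifferentialSurjectiveAt (paramModel n) (cotangentModel n) F.C₀ F.projM q := by
  obtain ⟨Γ, N, I, h0, h⟩ := F.exists_isExtension (p := IsExtension.parOf q) (by
    obtain ⟨z, hz, a, ha, s, hs, ξ, rfl, -⟩ := hq
    exact ⟨hz, ha⟩)
  exact ⟨h.differentialInjectiveAt_projZA hn hq h0 hsp,
    h.differentialSurjectiveAt_projM hn hq h0 hsp⟩

end LightRayFamily

/-! ### Points of the canonical relation on a given ray -/

section Cone

variable {n : ℕ} {M : Type*} [TopologicalSpace M] [ChartedSpace (Euc (n + 1)) M]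
  [IsManifold (𝓡 (n + 1)) ∞ M] (g : LorentzianMetric n M)

/-- In a chart, being spacelike means that the inverse metric is positive on the covector, which is
a strict inequality between continuous functions. -/
lemma isOpen_spacelikeCone : IsOpen (spacelikeCone g) := by
  rw [isOpen_iff_mem_nhds]
  intro p hp
  have hx := mem_lchart_source (n := n) p.1
  set x₀ := p.1
  have hinv : ∀ {y : Euc (n + 1)}, y ∈ (lchart (n := n) x₀).target →
      ∀ η, chartMetric g x₀ y ((chartMetric g x₀ y).inverse η) = η := by
    intro y hy η
    obtain ⟨e, he⟩ := isInvertible_chartMetric g hy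
    rw [← he, ContinuousLinearMap.inverse_equiv]
    exact e.apply_symm_apply η
  have hy := (lchart (n := n) x₀).map_source hx
  have hcont : ContinuousAt (fun Q : CotangentBundle n M => (covChart x₀ Q).2
      ((chartMetric g x₀ (covChart x₀ Q).1).inverse (covChart x₀ Q).2)) p := by
    have h1 : ContinuousAt (covChart (n := n) x₀) p := (contMDiffAt_covChart hx).continuousAt
    have h2 : ContinuousAt (fun y => (chartMetric g x₀ y).inverse) (covChart (n := n) x₀ p).1 := by
      rw [covChart_apply hx]
      obtain ⟨e, he⟩ := isInvertible_chartMetric g hy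
      exact ContinuousAt.comp (he ▸ (contDiffAt_map_inverse (n := 1) e).continuousAt)
        (contDiffAt_chartMetric g hy).continuousAt
    have h3 := ContinuousAt.comp (f := fun Q : CotangentBundle n M => (covChart x₀ Q).1) (x := p)
      h2 h1.fst
    exact h1.snd.clm_apply (h3.clm_apply h1.snd)
  obtain ⟨ν, hν, hνν⟩ := (isSpacelike_iff hx).1 hp
  have hpos : 0 < (covChart x₀ p).2
      ((chartMetric g x₀ (covChart x₀ p).1).inverse (covChart x₀ p).2) := by
    have h1 : (covChart x₀ p).1 = lchart (n := n) x₀ x₀ := by rw [covChart_apply hx]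
    have h2 : (chartMetric g x₀ (lchart (n := n) x₀ x₀)).inverse (covChart x₀ p).2 = ν := by
      refine sub_eq_zero.1 (chartMetric_nondegenerate g hy _ fun w => ?_)
      rw [map_sub, hinv hy, sub_apply, hν, sub_self]
    rw [h1, h2, ← hν]
    exact hνν
  filter_upwards [hcont.eventually (lt_mem_nhds hpos),
    (isOpen_covChart_source (n := n) x₀).mem_nhds (mem_covChart_source.2 hx)] with Q hQ hQs
  have hQx := mem_covChart_source.1 hQs
  have h1 : (covChart x₀ Q).1 = lchart (n := n) x₀ Q.1 := by rw [covChart_apply hQx]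
  rw [h1] at hQ
  have hyQ := (lchart (n := n) x₀).map_source hQx
  refine (isSpacelike_iff hQx).2 ⟨_, fun w => DFunLike.congr_fun (hinv hyQ _) w, ?_⟩
  rw [hinv hyQ]
  exact hQ

end Cone

namespace LightRayFamily.IsExtension

variable {n : ℕ} {M : Type*} [TopologicalSpace M] [ChartedSpace (Euc (n + 1)) M]
  [IsManifold (𝓡 (n + 1)) ∞ M] {g : LorentzianMetric n M} {F : LightRayFamily g}
  {Γ : RayParam n × ℝ → M} {N : Set (RayParam n)} {I : Set ℝ}

/-- The point of `ParamSpace` given by a time and a covector on a ray. -/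
def rayPoint (Γ : RayParam n × ℝ → M) (p : RayParam n) (s : ℝ)
    (ξ : TangentSpace (𝓡 (n + 1)) (Γ (p, s)) →L[ℝ] ℝ) : ParamSpace n M :=
  ((p.1, p.2, s), ⟨Γ (p, s), ξ⟩)

lemma rayPoint_mem_C₀_iff (h : F.IsExtension Γ N I) {p : RayParam n} (hp : p ∈ N) {s : ℝ}
    {ξ : TangentSpace (𝓡 (n + 1)) (Γ (p, s)) →L[ℝ] ℝ} :
    rayPoint Γ p s ξ ∈ F.C₀ ↔
      s ∈ Ioo 0 F.ℓ ∧ Γ (p, s) ∈ F.Ω ∧ ξ ≠ 0 ∧ ξ (rayVel Γ p s) = 0 := by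
  have hx := mem_lchart_source (n := n) (Γ (p, s))
  have hξ : (covChart (Γ (p, s)) (rayPoint Γ p s ξ).2).2 ≠ 0 ↔ ξ ≠ 0 := by
    refine not_congr ⟨fun h0 => ?_, fun h0 => ?_⟩
    · ext v
      exact (covChart_toChart (p := (rayPoint Γ p s ξ).2) hx v).symm.trans
        (DFunLike.congr_fun h0 (toChart (Γ (p, s)) (Γ (p, s)) v))
    · subst h0
      rw [covChart_apply (p := (rayPoint Γ p s 0).2) hx]
      ext v
      rfl
  rw [h.mem_C₀_iff (q := rayPoint Γ p s ξ) hp (x₀ := Γ (p, s)) hx, hξ]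
  refine and_congr_right fun hs => ?_
  have hv := h.family.toChart_rayVel (h.mem hp (Ioo_subset_Icc_self hs)) hx
  have hv' := covChart_toChart (p := (rayPoint Γ p s ξ).2) hx (rayVel Γ p s)
  constructor
  · rintro ⟨-, h2, h3, h4⟩
    refine ⟨h2, h3, hv'.symm.trans ?_⟩
    refine (congrArg _ hv).trans h4
  · rintro ⟨h2, h3, h4⟩
    refine ⟨rfl, h2, h3, ?_⟩
    refine (congrArg _ hv).symm.trans (hv'.trans h4)

lemma exists_eq_rayPoint (h : F.IsExtension Γ N I) {q : ParamSpace n M} (hq : q ∈ F.C₀)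
    (hp : parOf q ∈ N) : ∃ s ξ, q = rayPoint Γ (parOf q) s ξ := by
  obtain ⟨-, hb, -⟩ := (h.mem_C₀_iff hp (mem_lchart_source q.2.1)).1 hq
  obtain ⟨⟨z, a, s⟩, ⟨x, ξ⟩⟩ := q
  change x = Γ ((z, a), s) at hb
  subst hb
  exact ⟨s, ξ, rfl⟩

lemma projZA_rayPoint (h : F.IsExtension Γ N I) {p : RayParam n} (hp : p ∈ N) {s : ℝ}
    {ξ : TangentSpace (𝓡 (n + 1)) (Γ (p, s)) →L[ℝ] ℝ} (hq : rayPoint Γ p s ξ ∈ F.C₀) :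
    ∃ f : RayParam n →L[ℝ] ℝ, (∀ δ, f δ = ξ (rayField Γ p (δ, 0, 0) s)) ∧
      F.projZA (rayPoint Γ p s ξ) = (p, coordsL n f) := by
  have hx := mem_lchart_source (n := n) (Γ (p, s))
  have hs := Ioo_subset_Icc_self ((h.rayPoint_mem_C₀_iff hp).1 hq).1
  refine ⟨_, fun δ => ?_, h.projZA_eq hq hp (x₀ := Γ (p, s)) hx⟩
  have h1 := h.family.toChart_rayField (h.mem hp hs) hx (δ, 0, 0)
  rw [zero_mul, zero_smul, add_zero] at h1
  refine Eq.trans ?_ (covChart_toChart (p := (rayPoint Γ p s ξ).2) hx _)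
  exact congrArg (covChart (Γ (p, s)) (rayPoint Γ p s ξ).2).2 h1.symm

/-- Two points over one ray have the same image if and only if their covectors agree on all
variation fields. -/
lemma projZA_rayPoint_eq_iff (h : F.IsExtension Γ N I) {p : RayParam n} (hp : p ∈ N) {s₁ s₂ : ℝ}
    {ξ₁ : TangentSpace (𝓡 (n + 1)) (Γ (p, s₁)) →L[ℝ] ℝ}
    {ξ₂ : TangentSpace (𝓡 (n + 1)) (Γ (p, s₂)) →L[ℝ] ℝ} (hq₁ : rayPoint Γ p s₁ ξ₁ ∈ F.C₀)
    (hq₂ : rayPoint Γ p s₂ ξ₂ ∈ F.C₀) :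
    F.projZA (rayPoint Γ p s₁ ξ₁) = F.projZA (rayPoint Γ p s₂ ξ₂) ↔
      ∀ l, ξ₁ (rayField Γ p l s₁) = ξ₂ (rayField Γ p l s₂) := by
  obtain ⟨f₁, hf₁, e₁⟩ := h.projZA_rayPoint hp hq₁
  obtain ⟨f₂, hf₂, e₂⟩ := h.projZA_rayPoint hp hq₂
  obtain ⟨hs₁, -, -, hv₁⟩ := (h.rayPoint_mem_C₀_iff hp).1 hq₁
  obtain ⟨hs₂, -, -, hv₂⟩ := (h.rayPoint_mem_C₀_iff hp).1 hq₂
  have hm₁ := h.mem hp (Ioo_subset_Icc_self hs₁)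
  have hm₂ := h.mem hp (Ioo_subset_Icc_self hs₂)
  -- The projection records only the pairings with ∂_z and ∂_a. Covectors annihilating u pair to
  -- zero with u and s u, so nothing is lost by testing on all of L.
  have key : ∀ {s : ℝ} (ξ : TangentSpace (𝓡 (n + 1)) (Γ (p, s)) →L[ℝ] ℝ), (p, s) ∈ N ×ˢ I →
      ξ (rayVel Γ p s) = 0 →
      ∀ l, ξ (rayField Γ p l s) = ξ (rayField Γ p (l.1, 0, 0) s) := by
    intro s ξ hm hξ l
    have hl : l = (l.1, 0, 0) + (l.2.1 • ((0, 1, 0) : RayParam n × ℝ × ℝ) +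
        l.2.2 • ((0, 0, 1) : RayParam n × ℝ × ℝ)) := by
      ext <;> simp
    conv_lhs => rw [hl]
    rw [rayField_add, rayField_add, rayField_smul, rayField_smul, h.family.rayField_e₃ hm,
      h.family.rayField_e₄ hm]
    simp only [map_add, map_smul, hξ, smul_zero, add_zero]
  rw [e₁, e₂, Prod.mk_right_inj, (coordsL_injective n).eq_iff]
  constructor
  · intro hf l
    rw [key ξ₁ hm₁ hv₁, key ξ₂ hm₂ hv₂, ← hf₁, ← hf₂, hf]
  · intro hl
    ext δ
    · exact (hf₁ _).trans ((hl _).trans (hf₂ _).symm)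
    · exact (hf₁ _).trans ((hl _).trans (hf₂ _).symm)

end LightRayFamily.IsExtension

/-! ### Simultaneous zeros of a family of linear maps -/

section Zeros

variable {P L E E₁ E₂ : Type*} [NormedAddCommGroup P] [NormedSpace ℝ P] [NormedAddCommGroup L]
  [NormedSpace ℝ L] [FiniteDimensional ℝ L] [NormedAddCommGroup E] [NormedSpace ℝ E]
  [NormedAddCommGroup E₁] [NormedSpace ℝ E₁] [NormedAddCommGroup E₂] [NormedSpace ℝ E₂]

/-- An injective linear map on a finite-dimensional space satisfies ‖l‖ ≤ K ‖T l‖. Taking c = 1/(2K)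
turns smallness of both images into ‖l‖ ≤ ‖l‖/2. -/
lemma exists_pos_bound_of_injective_pair {T₁ : L →L[ℝ] E₁} {T₂ : L →L[ℝ] E₂}
    (h : ∀ l, T₁ l = 0 → T₂ l = 0 → l = 0) :
    ∃ c > 0, ∀ l, ‖T₁ l‖ ≤ c * ‖l‖ → ‖T₂ l‖ ≤ c * ‖l‖ → l = 0 := by
  obtain ⟨K, hK, hT⟩ := LinearMap.exists_antilipschitzWith (T₁.prod T₂).toLinearMap (by
    rw [LinearMap.ker_eq_bot']
    intro l hl
    obtain ⟨h1, h2⟩ := Prod.ext_iff.1 hl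
    exact h l h1 h2)
  refine ⟨(2 * (K : ℝ))⁻¹, by positivity, fun l h1 h2 => ?_⟩
  have h3 := hT.le_mul_dist l 0
  have hK' : (0 : ℝ) < K := hK
  rw [dist_zero_right, map_zero, dist_zero_right] at h3
  have h4 : ‖(T₁ l, T₂ l)‖ ≤ (2 * (K : ℝ))⁻¹ * ‖l‖ := max_le h1 h2
  have h5 : ‖l‖ ≤ K * ((2 * (K : ℝ))⁻¹ * ‖l‖) := h3.trans (by gcongr; exact h4)
  have h6 : (K : ℝ) * ((2 * (K : ℝ))⁻¹ * ‖l‖) = ‖l‖ / 2 := by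
    field_simp
  rw [h6] at h5
  exact norm_le_zero_iff.1 (by linarith)

lemma norm_apply_le_of_mem_closedBall {A B : L →L[ℝ] E} {c : ℝ} (h : A ∈ Metric.closedBall B c)
    {l : L} (hl : A l = 0) : ‖B l‖ ≤ c * ‖l‖ := by
  have h1 : B l = -((A - B) l) := by simp [hl]
  rw [h1, norm_neg]
  exact (ContinuousLinearMap.le_opNorm _ _).trans (by
    gcongr
    exact mem_closedBall_iff_norm.1 h)

/-- A pair of linear maps without common zeros keeps this property under small perturbations. -/
lemma eventually_injective_pair {X₁ X₂ : Type*} [TopologicalSpace X₁] [TopologicalSpace X₂]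
    {f₁ : X₁ → L →L[ℝ] E₁} {f₂ : X₂ → L →L[ℝ] E₂} {x₁ : X₁} {x₂ : X₂} (h₁ : ContinuousAt f₁ x₁)
    (h₂ : ContinuousAt f₂ x₂) (h : ∀ l, f₁ x₁ l = 0 → f₂ x₂ l = 0 → l = 0) :
    ∀ᶠ y in 𝓝 (x₁, x₂), ∀ l, f₁ y.1 l = 0 → f₂ y.2 l = 0 → l = 0 := by
  obtain ⟨c, hc, hl⟩ := exists_pos_bound_of_injective_pair h
  have e₁ := (h₁.comp (f := Prod.fst) (x := (x₁, x₂)) continuousAt_fst).eventually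
    (Metric.closedBall_mem_nhds _ hc)
  have e₂ := (h₂.comp (f := Prod.snd) (x := (x₁, x₂)) continuousAt_snd).eventually
    (Metric.closedBall_mem_nhds _ hc)
  filter_upwards [e₁, e₂] with y hy₁ hy₂ l k₁ k₂
  refine hl l ?_ ?_
  · exact norm_apply_le_of_mem_closedBall hy₁ k₁
  · exact norm_apply_le_of_mem_closedBall hy₂ k₂

/-- If no `l` is a zero of both `f` and its derivative in the second variable, then nearby zeros in
the second variable are isolated. -/
lemma eventually_no_common_zero {f : P × ℝ → L →L[ℝ] E} {f' : P × ℝ →L[ℝ] L →L[ℝ] E} {p₀ : P}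
    {s₀ : ℝ} (hf : HasStrictFDerivAt f f' (p₀, s₀))
    (h : ∀ l, f (p₀, s₀) l = 0 → f' (0, 1) l = 0 → l = 0) :
    ∀ᶠ y : P × ℝ × ℝ in 𝓝 (p₀, s₀, s₀), y.2.1 ≠ y.2.2 →
      ∀ l, f (y.1, y.2.1) l = 0 → f (y.1, y.2.2) l = 0 → l = 0 := by
  obtain ⟨c, hc, hl⟩ := exists_pos_bound_of_injective_pair h
  have t₁ : ContinuousAt (fun y : P × ℝ × ℝ => (y.1, y.2.1)) (p₀, s₀, s₀) := by fun_prop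
  have t₂ : ContinuousAt (fun y : P × ℝ × ℝ => (y.1, y.2.2)) (p₀, s₀, s₀) := by fun_prop
  have e₁ := (hf.continuousAt.comp (f := fun y : P × ℝ × ℝ => (y.1, y.2.1)) (x := (p₀, s₀, s₀))
    t₁).eventually (Metric.closedBall_mem_nhds _ hc)
  -- Strict differentiability bounds the difference quotients in s uniformly for nearby p, s₁ and
  -- s₂: two zeros of f(·) l make f'(0, 1) l small relative to l.
  have e₂ := (t₁.prodMk t₂).eventually (hf.isLittleO.def hc)
  filter_upwards [e₁, e₂] with y hy₁ hy₂ hne l k₁ k₂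
  refine hl l ?_ ?_
  · exact norm_apply_le_of_mem_closedBall hy₁ k₁
  · have h1 : ((y.1, y.2.1) - (y.1, y.2.2) : P × ℝ) = (y.2.1 - y.2.2) • (0, 1) := by
      ext <;> simp
    have h2 : ‖((0, 1) : P × ℝ)‖ = 1 := by simp
    have hy := hy₂
    simp only [h1, norm_smul, h2, mul_one, map_smul] at hy
    have h3 : (y.2.1 - y.2.2) • f' (0, 1) l =
        -((f (y.1, y.2.1) - f (y.1, y.2.2) - (y.2.1 - y.2.2) • f' (0, 1)) l) := by
      simp [k₁, k₂]
    have h4 : ‖y.2.1 - y.2.2‖ * ‖f' (0, 1) l‖ ≤ ‖y.2.1 - y.2.2‖ * (c * ‖l‖) := by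
      rw [← norm_smul, h3, norm_neg]
      refine (ContinuousLinearMap.le_opNorm _ _).trans ?_
      calc _ ≤ (c * ‖y.2.1 - y.2.2‖) * ‖l‖ := by gcongr
        _ = _ := by ring
    exact le_of_mul_le_mul_left h4 (norm_pos_iff.2 (sub_ne_zero.2 hne))

end Zeros

/-- An open condition on pairs which holds on the square of an open set of times persists, fibrewise
and for pairs, near this set. -/
lemma exists_isOpen_fibrewise {P : Type*} [TopologicalSpace P] {p₀ : P} {S : Set ℝ}
    (hS : IsOpen S) {R : Set (P × ℝ × ℝ)} (hR : IsOpen R)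
    (h : ∀ s₁ ∈ S, ∀ s₂ ∈ S, (p₀, s₁, s₂) ∈ R) :
    ∃ O : Set (P × ℝ), IsOpen O ∧ (∀ s ∈ S, (p₀, s) ∈ O) ∧
      ∀ p s₁ s₂, (p, s₁) ∈ O → (p, s₂) ∈ O → (p, s₁, s₂) ∈ R := by
  have : LocallyCompactSpace S := hS.locallyCompactSpace
  -- S is not compact, so no single parameter neighbourhood need work. Over the interior of `K j`
  -- the parameters are restricted to V 0 ∩ … ∩ V j; for two times with indices i and j, the larger
  -- compact set contains both times and its V contains the parameter.
  let K : CompactExhaustion S := CompactExhaustion.choice S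
  have hK : ∀ j, IsCompact ((↑) '' K j : Set ℝ) := fun j =>
    (K.isCompact j).image continuous_subtype_val
  have hV : ∀ j, ∃ V : Set P, IsOpen V ∧ p₀ ∈ V ∧
      V ×ˢ (((↑) '' K j : Set ℝ) ×ˢ ((↑) '' K j : Set ℝ)) ⊆ R := by
    intro j
    obtain ⟨V, W, hV, -, hpV, hKW, hVW⟩ := generalized_tube_lemma (isCompact_singleton (x := p₀))
      ((hK j).prod (hK j)) hR (by
        rintro ⟨p, s₁, s₂⟩ ⟨rfl, ⟨a, -, rfl⟩, ⟨b, -, rfl⟩⟩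
        exact h a a.2 b b.2)
    exact ⟨V, hV, hpV rfl, (prod_mono_right hKW).trans hVW⟩
  choose V hVo hpV hVR using hV
  refine ⟨⋃ j, (⋂ i ∈ Finset.range (j + 1), V i) ×ˢ ((↑) '' interior (K j) : Set ℝ), ?_, ?_, ?_⟩
  · refine isOpen_iUnion fun j => IsOpen.prod ?_ ?_
    · exact isOpen_biInter_finset fun i _ => hVo i
    · exact hS.isOpenMap_subtype_val _ isOpen_interior
  · intro s hs
    obtain ⟨j, hj⟩ := K.exists_mem ⟨s, hs⟩
    exact mem_iUnion.2 ⟨j + 1, mem_iInter₂.2 fun i _ => hpV i,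
      ⟨s, hs⟩, K.subset_interior_succ j hj, rfl⟩
  · intro p s₁ s₂ h₁ h₂
    obtain ⟨i, hi, hi'⟩ := mem_iUnion.1 h₁
    obtain ⟨j, hj, hj'⟩ := mem_iUnion.1 h₂
    refine hVR (max i j) ⟨?_, ?_, ?_⟩
    · rcases max_choice i j with hm | hm <;> rw [hm]
      · exact mem_iInter₂.1 hi i (by simp)
      · exact mem_iInter₂.1 hj j (by simp)
    · exact image_mono (interior_subset.trans (K.subset (le_max_left i j))) hi'
    · exact image_mono (interior_subset.trans (K.subset (le_max_right i j))) hj'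

/-! ### Fields along curves which agree -/

section Congr

variable {n : ℕ} {M : Type*} [TopologicalSpace M] [ChartedSpace (Euc (n + 1)) M]
  [IsManifold (𝓡 (n + 1)) ∞ M] {g : LorentzianMetric n M} {γ σ : ℝ → M}
  {V : ∀ s, TangentSpace (𝓡 (n + 1)) (γ s)} {W : ∀ s, TangentSpace (𝓡 (n + 1)) (σ s)}

/-- The covariant derivative depends only on the germ of the field. Equality is expressed in the
tangent bundle because the fields live over different curves. -/
lemma covDeriv_congr {s : ℝ} (h : ∀ᶠ r in 𝓝 s, (⟨γ r, V r⟩ : TangentBundle (𝓡 (n + 1)) M) = ⟨σ r, W r⟩) :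
    (⟨γ s, covDeriv g γ V s⟩ : TangentBundle (𝓡 (n + 1)) M) = ⟨σ s, covDeriv g σ W s⟩ := by
  have hs := h.self_of_nhds
  have hγ : γ =ᶠ[𝓝 s] σ := h.mono fun r hr => congrArg Bundle.TotalSpace.proj hr
  have h1 : ∀ x : M, (fun r => toChart (n := n) x (γ r) (V r)) =ᶠ[𝓝 s]
      fun r => toChart (n := n) x (σ r) (W r) := fun x =>
    h.mono fun r hr => toChart_eq_of_tangentBundle_eq x hr
  have h2 : ∀ x : M, (fun r => lchart (n := n) x (γ r)) =ᶠ[𝓝 s] fun r => lchart (n := n) x (σ r) :=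
    fun x => hγ.mono fun r hr => congrArg (lchart (n := n) x) hr
  have h3 : ∀ x : M, (ofOwnChart x (deriv (fun r => toChart x (γ r) (V r)) s
      + WithLp.toLp 2 fun k => ∑ i, ∑ j, christoffel g x k i j (extChartAt (𝓡 (n + 1)) x x)
          * deriv (fun r => extChartAt (𝓡 (n + 1)) x (γ r)) s i * toChart x (γ s) (V s) j)) =
      ofOwnChart x (deriv (fun r => toChart x (σ r) (W r)) s
      + WithLp.toLp 2 fun k => ∑ i, ∑ j, christoffel g x k i j (extChartAt (𝓡 (n + 1)) x x)
          * deriv (fun r => extChartAt (𝓡 (n + 1)) x (σ r)) s i * toChart x (σ s) (W s) j) := by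
    intro x
    rw [(h1 x).deriv_eq, (h2 x).deriv_eq, toChart_eq_of_tangentBundle_eq x hs]
  have h4 := h3 (γ s)
  have key : ∀ x, x = σ s → (⟨x, ofOwnChart x (deriv (fun r => toChart x (σ r) (W r)) s
      + WithLp.toLp 2 fun k => ∑ i, ∑ j, christoffel g x k i j (extChartAt (𝓡 (n + 1)) x x)
          * deriv (fun r => extChartAt (𝓡 (n + 1)) x (σ r)) s i * toChart x (σ s) (W s) j)⟩ :
      TangentBundle (𝓡 (n + 1)) M) = ⟨σ s, covDeriv g σ W s⟩ := by
    rintro _ rfl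
    rfl
  refine Eq.trans ?_ (key _ hγ.self_of_nhds)
  exact congrArg (fun v => (⟨γ s, v⟩ : TangentBundle (𝓡 (n + 1)) M)) h4

lemma jacobi_expr_congr {x y : M} {a u v : TangentSpace (𝓡 (n + 1)) x}
    {a' u' v' : TangentSpace (𝓡 (n + 1)) y}
    (ha : (⟨x, a⟩ : TangentBundle (𝓡 (n + 1)) M) = ⟨y, a'⟩)
    (hu : (⟨x, u⟩ : TangentBundle (𝓡 (n + 1)) M) = ⟨y, u'⟩)
    (hv : (⟨x, v⟩ : TangentBundle (𝓡 (n + 1)) M) = ⟨y, v'⟩)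
    (h : a + riemann g x u v v = 0) : a' + riemann g y u' v' v' = 0 := by
  obtain rfl : x = y := congrArg Bundle.TotalSpace.proj ha
  have inj : ∀ {b b' : TangentSpace (𝓡 (n + 1)) x},
      (⟨x, b⟩ : TangentBundle (𝓡 (n + 1)) M) = ⟨x, b'⟩ → b = b' := fun hb =>
    Bundle.TotalSpace.mk_injective x hb
  rw [← inj ha, ← inj hu, ← inj hv]
  exact h

lemma IsJacobiOpen.congr {U : Set ℝ} (hU : IsOpen U) (hJ : IsJacobiOpen g γ V U)
    (h : ∀ s ∈ U, (⟨γ s, V s⟩ : TangentBundle (𝓡 (n + 1)) M) = ⟨σ s, W s⟩) :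
    IsJacobiOpen g σ W U := by
  refine ⟨ContMDiffOn.congr hJ.smooth fun s hs => (h s hs).symm, fun s hs => ?_⟩
  have e1 : ∀ r ∈ U, (⟨γ r, covDeriv g γ V r⟩ : TangentBundle (𝓡 (n + 1)) M) =
      ⟨σ r, covDeriv g σ W r⟩ := fun r hr =>
    covDeriv_congr (Filter.eventually_of_mem (hU.mem_nhds hr) h)
  have e2 := covDeriv_congr (g := g) (Filter.eventually_of_mem (hU.mem_nhds hs) e1)
  have e3 : (⟨γ s, curveVel (𝓡 (n + 1)) γ s⟩ : TangentBundle (𝓡 (n + 1)) M) =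
      ⟨σ s, curveVel (𝓡 (n + 1)) σ s⟩ :=
    curveVelTB_eq_of_eventuallyEq (Filter.eventually_of_mem (hU.mem_nhds hs)
      fun r hr => congrArg Bundle.TotalSpace.proj (h r hr))
  exact jacobi_expr_congr e2 (h s hs) e3 (hJ.eq s hs)

end Congr

namespace LightRayFamily.IsExtension

variable {n : ℕ} {M : Type*} [TopologicalSpace M] [ChartedSpace (Euc (n + 1)) M]
  [IsManifold (𝓡 (n + 1)) ∞ M] {g : LorentzianMetric n M} {F : LightRayFamily g}
  {Γ : RayParam n × ℝ → M} {N : Set (RayParam n)} {I : Set ℝ}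

/-- The extended rays agree with the given ones near `[0, ℓ]`. -/
lemma exists_isOpen_eqOn [T2Space M] (h : F.IsExtension Γ N I) {p : RayParam n} (hp : p ∈ N) :
    ∃ U : Set ℝ, IsOpen U ∧ Icc 0 F.ℓ ⊆ U ∧ U ⊆ I ∧ ∀ s ∈ U, Γ (p, s) = F.ray p s := by
  obtain ⟨U₀, hU₀, hU₀'⟩ := isGeodesicOn_iff.1
      (F.γ_geodesic p.1 (h.subset hp).1 p.2 (h.subset hp).2)
  have h1 := IsGeodesicOpen.eqOn (h.family.slice p) hU₀ isPreconnected_Icc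
    (fun s hs => h.mem hp hs) hU₀' (s₀ := 0) zero_mem (h.agrees (p, 0) (h.mem hp zero_mem) zero_mem)
  refine ⟨{s | (fun r => Γ (p, r)) =ᶠ[𝓝 s] F.ray p} ∩ I,
    IsOpen.inter isOpen_setOfPred_eventually_nhds h.isOpen_I,
    fun s hs => ⟨h1 s hs, h.Icc_subset hs⟩, inter_subset_right, fun s hs => ?_⟩
  exact hs.1.self_of_nhds

/-- A variation field vanishes together with its derivative only if it is trivial. -/
lemma eq_zero_of_chart (h : F.IsExtension Γ N I) (hn : 2 ≤ n) {p : RayParam n} (hp : p ∈ N)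
    {s : ℝ} (hs : s ∈ Icc 0 F.ℓ) {x₀ : M} (hx : Γ (p, s) ∈ (lchart (n := n) x₀).source)
    {l : RayParam n × ℝ × ℝ} (h₀ : toChart (n := n) x₀ (Γ (p, s)) (rayField Γ p l s) = 0)
    (h₁ : fderiv ℝ (chartVel (n := n) x₀ Γ) (p, s) (l.1, l.2.1 + l.2.2 * s) +
      l.2.2 • chartVel (n := n) x₀ Γ (p, s) = 0) : l = 0 := by
  have hm := h.mem hp hs
  refine (h.isRayFrame hn hp hs).injective ?_ ?_
  · exact toChartL_injective hx (h₀.trans (map_zero (toChartL (n := n) x₀ (Γ (p, s)))).symm)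
  · refine toChartL_injective hx (Eq.trans ?_ (map_zero (toChartL (n := n) x₀ (Γ (p, s)))).symm)
    refine (h.family.toChart_rayField' hm hx l).trans ?_
    rw [h₁, zero_add]
    rw [h.family.toChart_rayField hm hx] at h₀
    have e : fderiv ℝ (chartFamily (n := n) x₀ Γ) (p, s) (l.1, l.2.1 + l.2.2 * s) =
        fderiv ℝ (chartFamily (n := n) x₀ Γ) (p, s) (l.1, l.2.1) +
        (l.2.2 * s) • chartVel (n := n) x₀ Γ (p, s) := by
      rw [← h.fderiv_chartFamily_zero_one hp hs hx, ← map_smul, ← map_add]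
      simp
    rw [e, h₀, map_zero]

/-- A field vanishing on all of [0, ℓ] would vanish together with its derivative at an interior
time, contrary to `eq_zero_of_chart`. -/
lemma exists_rayField_ne_zero (h : F.IsExtension Γ N I) (hn : 2 ≤ n) {p : RayParam n} (hp : p ∈ N)
    {l : RayParam n × ℝ × ℝ} (hl : l ≠ 0) : ∃ s ∈ Icc 0 F.ℓ, rayField (n := n) Γ p l s ≠ 0 := by
  by_contra! hc
  have hℓ := F.ℓ_pos
  -- Any interior time would do: a two-sided neighbourhood of zeros is needed to compute the
  -- derivative.
  have hs : F.ℓ / 2 ∈ Ioo 0 F.ℓ := ⟨by linarith, by linarith⟩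
  have hs' := Ioo_subset_Icc_self hs
  have hx := mem_lchart_source (n := n) (Γ (p, F.ℓ / 2))
  have hz : ∀ s ∈ Icc 0 F.ℓ, toChart (n := n) (Γ (p, F.ℓ / 2)) (Γ (p, s)) (rayField Γ p l s) = 0 :=
    fun s hs => (congrArg (toChartL (n := n) (Γ (p, F.ℓ / 2)) (Γ (p, s))) (hc s hs)).trans
      (map_zero (toChartL (n := n) (Γ (p, F.ℓ / 2)) (Γ (p, s))))
  refine hl (h.eq_zero_of_chart hn hp hs' hx (hz _ hs') ?_)
  refine (h.family.hasDerivAt_rayField (h.mem hp hs') hx l).unique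
    ((hasDerivAt_const _ (0 : Euc (n + 1))).congr_of_eventuallyEq ?_)
  filter_upwards [isOpen_Ioo.mem_nhds hs] with r hr using hz r (Ioo_subset_Icc_self hr)

/-- A nontrivial variation field with two zeros gives conjugate points. -/
lemma areConjugate [T2Space M] (h : F.IsExtension Γ N I) (hn : 2 ≤ n) {p : RayParam n}
    (hp : p ∈ N) {l : RayParam n × ℝ × ℝ} (hl : l ≠ 0) {s₁ s₂ : ℝ} (hs : s₁ ≠ s₂)
    (h₁ : rayField (n := n) Γ p l s₁ = 0)
    (h₂ : rayField (n := n) Γ p l s₂ = 0) : AreConjugate g (F.ray p) F.ℓ s₁ s₂ := by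
  obtain ⟨U, hU, hIU, hUI, he⟩ := h.exists_isOpen_eqOn hp
  obtain ⟨s, hs', hne⟩ := h.exists_rayField_ne_zero hn hp hl
  have hJ : IsJacobiOpen g (fun r => Γ (p, r)) (rayField Γ p l) U :=
    (h.family.isJacobiOpen_rayField p l).mono fun r hr => ⟨hp, hUI hr⟩
  have hJ' : IsJacobiOpen g (F.ray p)
      (fun s => (rayField (n := n) Γ p l s : TangentSpace (𝓡 (n + 1)) (F.ray p s))) U :=
    hJ.congr hU fun s hs => Bundle.TotalSpace.ext (he s hs) HEq.rfl
  exact ⟨hs, _, ⟨U, hU, hIU, hJ'.smooth, hJ'.eq⟩, ⟨s, hs', hne⟩, h₁, h₂⟩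

end LightRayFamily.IsExtension

/-! ### Injectivity without conjugate points -/

section ChartField

variable {n : ℕ} {M : Type*} [TopologicalSpace M] [ChartedSpace (Euc (n + 1)) M]
  [IsManifold (𝓡 (n + 1)) ∞ M] {g : LorentzianMetric n M}
  {V : Type*} [NormedAddCommGroup V] [NormedSpace ℝ V] {Γ : V × ℝ → M} {O : Set (V × ℝ)}

/-- The variation fields at a point, in a chart, as a linear map in the direction. -/
def chartField (x₀ : M) (Γ : V × ℝ → M) (q : V × ℝ) : V × ℝ × ℝ →L[ℝ] Euc (n + 1) :=
  (fderiv ℝ (chartFamily (n := n) x₀ Γ) q).comp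
      ((ContinuousLinearMap.fst ℝ V (ℝ × ℝ)).prod
        ((ContinuousLinearMap.fst ℝ ℝ ℝ).comp (ContinuousLinearMap.snd ℝ V (ℝ × ℝ)))) +
    q.2 • ContinuousLinearMap.smulRightL ℝ (V × ℝ × ℝ) (Euc (n + 1))
      ((ContinuousLinearMap.snd ℝ ℝ ℝ).comp (ContinuousLinearMap.snd ℝ V (ℝ × ℝ)))
        (chartVel (n := n) x₀ Γ q)

lemma IsGeodesicFamily.chartField_apply (h : IsGeodesicFamily g Γ O) {p : V} {s : ℝ}
    (hq : (p, s) ∈ O) {x₀ : M} (hx : Γ (p, s) ∈ (lchart (n := n) x₀).source) (l : V × ℝ × ℝ) :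
    chartField (n := n) x₀ Γ (p, s) l = toChart x₀ (Γ (p, s)) (rayField (n := n) Γ p l s) := by
  rw [h.toChart_rayField hq hx, mul_comm, mul_smul]
  rfl

lemma IsGeodesicFamily.contDiffAt_chartField (h : IsGeodesicFamily g Γ O) {q : V × ℝ}
    (hq : q ∈ O) {x₀ : M} (hx : Γ q ∈ (lchart (n := n) x₀).source) :
    ContDiffAt ℝ ∞ (chartField (n := n) x₀ Γ) q := by
  have h1 : ContDiffAt ℝ ∞ (fderiv ℝ (chartFamily (n := n) x₀ Γ)) q :=
    (h.contDiffAt_chartFamily hq hx).fderiv_right (by norm_cast)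
  have h2 := h.contDiffAt_chartVel hq hx
  exact (h1.clm_comp contDiffAt_const).add
    (contDiffAt_snd.smul ((ContinuousLinearMap.contDiff _).contDiffAt.comp q h2))

lemma IsGeodesicFamily.fderiv_chartField (h : IsGeodesicFamily g Γ O) {p : V} {s : ℝ}
    (hq : (p, s) ∈ O) {x₀ : M} (hx : Γ (p, s) ∈ (lchart (n := n) x₀).source) (l : V × ℝ × ℝ) :
    fderiv ℝ (chartField (n := n) x₀ Γ) (p, s) (0, 1) l =
      fderiv ℝ (chartVel (n := n) x₀ Γ) (p, s) (l.1, l.2.1 + l.2.2 * s) +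
        l.2.2 • chartVel (n := n) x₀ Γ (p, s) := by
  have h1 := IsGeodesicFamily.hasDerivAt_slice
    ((h.contDiffAt_chartField hq hx).differentiableAt (by simp))
  have h2 := h1.clm_apply (hasDerivAt_const s l)
  simp only [map_zero, add_zero] at h2
  refine h2.unique ((h.hasDerivAt_rayField hq hx l).congr_of_eventuallyEq ?_)
  have h3 : ContinuousAt (fun r : ℝ => (p, r)) s := by fun_prop
  filter_upwards [h3.eventually (h.eventually_mem hq hx)] with r hr
  exact h.chartField_apply hr.1 hr.2 l

lemma toChart_eq_zero_iff {x₀ x : M} (hx : x ∈ (lchart (n := n) x₀).source)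
    {v : TangentSpace (𝓡 (n + 1)) x} :
    toChart x₀ x v = 0 ↔ v = 0 :=
  ⟨fun h => toChartL_injective hx (h.trans (map_zero (toChartL (n := n) x₀ x)).symm),
    fun h => (congrArg (toChartL (n := n) x₀ x) h).trans (map_zero (toChartL (n := n) x₀ x))⟩

end ChartField

namespace LightRayFamily

variable {n : ℕ} {M : Type*} [TopologicalSpace M] [ChartedSpace (Euc (n + 1)) M]
  [IsManifold (𝓡 (n + 1)) ∞ M] {g : LorentzianMetric n M} {F : LightRayFamily g}
  {Γ : RayParam n × ℝ → M} {N : Set (RayParam n)} {I : Set ℝ}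

/-- The absence of variation fields with two given distinct zeros is stable. -/
lemma IsExtension.eventually_no_vanishing (h : F.IsExtension Γ N I) (hn : 2 ≤ n)
    {p : RayParam n} (hp : p ∈ N) {s₁ s₂ : ℝ} (hs₁ : s₁ ∈ Icc 0 F.ℓ) (hs₂ : s₂ ∈ Icc 0 F.ℓ)
    (hne : s₁ ≠ s₂ → ∀ l, rayField (n := n) Γ p l s₁ = 0 → rayField (n := n) Γ p l s₂ = 0 → l = 0) :
    ∀ᶠ y : RayParam n × ℝ × ℝ in 𝓝 (p, s₁, s₂), y.2.1 ≠ y.2.2 → ∀ l,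
      rayField (n := n) Γ y.1 l y.2.1 = 0 → rayField (n := n) Γ y.1 l y.2.2 = 0 → l = 0 := by
  have hm₁ := h.mem hp hs₁
  have hm₂ := h.mem hp hs₂
  have hx₁ := mem_lchart_source (n := n) (Γ (p, s₁))
  have t₁ : ContinuousAt (fun y : RayParam n × ℝ × ℝ => (y.1, y.2.1)) (p, s₁, s₂) := by fun_prop
  have t₂ : ContinuousAt (fun y : RayParam n × ℝ × ℝ => (y.1, y.2.2)) (p, s₁, s₂) := by fun_prop
  have e₁ := t₁.eventually (h.family.eventually_mem hm₁ hx₁)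
  rcases eq_or_ne s₁ s₂ with rfl | hs
  · have e₂ := t₂.eventually (h.family.eventually_mem hm₁ hx₁)
    -- On the diagonal the hypothesis about two distinct zeros says nothing. Instead, a nontrivial
    -- field and its time derivative have no common zero, which separates nearby zeros uniformly.
    have key := eventually_no_common_zero
      ((h.family.contDiffAt_chartField hm₁ hx₁).hasStrictFDerivAt (by simp)) (by
        intro l h₀ h₁
        rw [h.family.chartField_apply hm₁ hx₁] at h₀
        rw [h.family.fderiv_chartField hm₁ hx₁] at h₁
        exact h.eq_zero_of_chart hn hp hs₁ hx₁ h₀ h₁)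
    filter_upwards [e₁, e₂, key] with y hy₁ hy₂ hy hne l k₁ k₂
    refine hy hne l ?_ ?_
    · rw [h.family.chartField_apply hy₁.1 hy₁.2]
      exact (toChart_eq_zero_iff hy₁.2).2 k₁
    · rw [h.family.chartField_apply hy₂.1 hy₂.2]
      exact (toChart_eq_zero_iff hy₂.2).2 k₂
  · have hx₂ := mem_lchart_source (n := n) (Γ (p, s₂))
    have e₂ := t₂.eventually (h.family.eventually_mem hm₂ hx₂)
    have key := eventually_injective_pair (h.family.contDiffAt_chartField hm₁ hx₁).continuousAt
      (h.family.contDiffAt_chartField hm₂ hx₂).continuousAt (by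
        intro l h₀ h₁
        rw [h.family.chartField_apply hm₁ hx₁] at h₀
        rw [h.family.chartField_apply hm₂ hx₂] at h₁
        exact hne hs l ((toChart_eq_zero_iff hx₁).1 h₀) ((toChart_eq_zero_iff hx₂).1 h₁))
    filter_upwards [e₁, e₂, (t₁.prodMk t₂).eventually key] with y hy₁ hy₂ hy _ l k₁ k₂
    refine hy l ?_ ?_
    · rw [h.family.chartField_apply hy₁.1 hy₁.2]
      exact (toChart_eq_zero_iff hy₁.2).2 k₁
    · rw [h.family.chartField_apply hy₂.1 hy₂.2]
      exact (toChart_eq_zero_iff hy₂.2).2 k₂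

/-- On a single ray without conjugate points the covector is determined by its pairing with the
variation fields. -/
lemma IsExtension.rayPoint_eq (h : F.IsExtension Γ N I) (hn : 2 ≤ n) {p : RayParam n}
    (hp : p ∈ N) {s₁ s₂ : ℝ} {ξ₁ : TangentSpace (𝓡 (n + 1)) (Γ (p, s₁)) →L[ℝ] ℝ}
    {ξ₂ : TangentSpace (𝓡 (n + 1)) (Γ (p, s₂)) →L[ℝ] ℝ} (hq₁ : rayPoint Γ p s₁ ξ₁ ∈ F.C₀)
    (hq₂ : rayPoint Γ p s₂ ξ₂ ∈ F.C₀) (hsp₁ : IsSpacelike g (rayPoint Γ p s₁ ξ₁).2)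
    (hsp₂ : IsSpacelike g (rayPoint Γ p s₂ ξ₂).2)
    (hne : s₁ ≠ s₂ → ∀ l, rayField (n := n) Γ p l s₁ = 0 → rayField (n := n) Γ p l s₂ = 0 → l = 0)
    (heq : F.projZA (rayPoint Γ p s₁ ξ₁) = F.projZA (rayPoint Γ p s₂ ξ₂)) :
    rayPoint Γ p s₁ ξ₁ = rayPoint Γ p s₂ ξ₂ := by
  obtain ⟨hs₁, -, -, hv₁⟩ := (h.rayPoint_mem_C₀_iff hp).1 hq₁
  obtain ⟨hs₂, -, -, hv₂⟩ := (h.rayPoint_mem_C₀_iff hp).1 hq₂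
  have hl := (h.projZA_rayPoint_eq_iff hp hq₁ hq₂).1 heq
  have fr₁ := h.isRayFrame hn hp (Ioo_subset_Icc_self hs₁)
  have fr₂ := h.isRayFrame hn hp (Ioo_subset_Icc_self hs₂)
  obtain ⟨v₁, hξ₁, hvv₁⟩ : ∃ v : TangentSpace (𝓡 (n + 1)) (Γ (p, s₁)),
    (∀ w, g.form (Γ (p, s₁)) v w = ξ₁ w) ∧ 0 < g.form (Γ (p, s₁)) v v := hsp₁
  obtain ⟨v₂, hξ₂, -⟩ : ∃ v : TangentSpace (𝓡 (n + 1)) (Γ (p, s₂)),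
    (∀ w, g.form (Γ (p, s₂)) v w = ξ₂ w) ∧ 0 < g.form (Γ (p, s₂)) v v := hsp₂
  have hl' : ∀ l, g.form (Γ (p, s₁)) v₁ (rayField Γ p l s₁) =
      g.form (Γ (p, s₂)) v₂ (rayField Γ p l s₂) := fun l =>
    (hξ₁ _).trans ((hl l).trans (hξ₂ _).symm)
  rcases eq_or_ne s₁ s₂ with rfl | hs
  · have h1 : (v₁ - v₂ : TangentSpace (𝓡 (n + 1)) (Γ (p, s₁))) = 0 := by
      refine fr₁.eq_zero_of_forall fun l => ?_
      change g.form (Γ (p, s₁)) (v₁ - v₂) (rayField Γ p l s₁) = 0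
      rw [map_sub, sub_apply, hl' l, sub_self]
    have h2 : v₁ = v₂ := sub_eq_zero.1 h1
    have h3 : ξ₁ = ξ₂ := by
      ext w
      exact (hξ₁ w).symm.trans ((congrArg (fun v => g.form (Γ (p, s₁)) v w) h2).trans (hξ₂ w))
    rw [h3]
  · obtain ⟨l, hl0, k₁, k₂⟩ := IsRayFrame.exists_vanishing fr₁ fr₂ hs
      ((hξ₁ _).trans hv₁) ((hξ₂ _).trans hv₂) hvv₁ hl'
    exact (hl0 (hne hs l k₁ k₂)).elim

/-- Two points with the same image have the same (z, a), so only pairs of times on one ray matter.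
For γ₀ such pairs are controlled by the absence of conjugate points, and the open, fibrewise version
of this condition yields the neighbourhood. -/
lemma exists_injOn_of_noConjugatePoints [T2Space M] (F : LightRayFamily g) (hn : 2 ≤ n)
    (hF : F.NoConjugatePoints) : ∃ U : Set (ParamSpace n M), IsOpen U ∧
      F.centralSpacelike ⊆ U ∧ InjOn F.projZA (U ∩ F.C₀) := by
  obtain ⟨Γ, N, I, h0, h⟩ := F.exists_isExtension F.zero_mem_param
  obtain ⟨U₁, hU₁, hIU₁, hU₁I, he⟩ := h.exists_isOpen_eqOn h0
  set S : Set ℝ := (fun s => Γ (0, s)) ⁻¹' F.Ω ∩ (Ioo 0 F.ℓ)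
  have hS : IsOpen S := by
    rw [isOpen_iff_mem_nhds]
    intro s hs
    have h1 : ContinuousAt (fun s => Γ (0, s)) s :=
      ((h.family.contMDiffAt (h.mem h0 (Ioo_subset_Icc_self hs.2))).continuousAt).comp
        (f := fun s : ℝ => ((0 : RayParam n), s)) (by fun_prop)
    exact Filter.inter_mem (h1.preimage_mem_nhds (F.isOpen_Ω.mem_nhds hs.1))
      (isOpen_Ioo.mem_nhds hs.2)
  obtain ⟨O, hO, hSO, hOR⟩ := exists_isOpen_fibrewise (p₀ := (0 : RayParam n)) hS
    (isOpen_interior (s := {y : RayParam n × ℝ × ℝ | y.2.1 ≠ y.2.2 → ∀ l,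
      rayField (n := n) Γ y.1 l y.2.1 = 0 → rayField (n := n) Γ y.1 l y.2.2 = 0 → l = 0})) (by
    intro s₁ hs₁ s₂ hs₂
    refine mem_interior_iff_mem_nhds.2 (h.eventually_no_vanishing hn h0
      (Ioo_subset_Icc_self hs₁.2) (Ioo_subset_Icc_self hs₂.2) fun hs l k₁ k₂ => ?_)
    by_contra hl
    have i₁ := Ioo_subset_Icc_self hs₁.2
    have i₂ := Ioo_subset_Icc_self hs₂.2
    have b₁ : F.γ₀ s₁ ∈ F.Ω := by
      have := hs₁.1
      rw [mem_preimage, he s₁ (hIU₁ i₁)] at this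
      exact this
    have b₂ : F.γ₀ s₂ ∈ F.Ω := by
      have := hs₂.1
      rw [mem_preimage, he s₂ (hIU₁ i₂)] at this
      exact this
    exact hF s₁ i₁ s₂ i₂ b₁ b₂ (h.areConjugate hn h0 hl hs k₁ k₂))
  -- Spacelikeness is built into the neighbourhood, since the comparison of two covectors on one ray
  -- relies on it; it is an open condition.
  refine ⟨{q | IsExtension.parOf q ∈ N ∧ (IsExtension.parOf q, q.1.2.2) ∈ O ∧ IsSpacelike g q.2},
    ?_, ?_, ?_⟩
  · have c₁ : Continuous (fun q : ParamSpace n M => IsExtension.parOf q) := by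
      unfold IsExtension.parOf
      fun_prop
    have c₂ : Continuous (fun q : ParamSpace n M => (IsExtension.parOf q, q.1.2.2)) :=
      c₁.prodMk (by fun_prop)
    exact (h.isOpen_N.preimage c₁).inter ((hO.preimage c₂).inter
      ((isOpen_spacelikeCone g).preimage continuous_snd))
  · rintro q ⟨hq, h1, h2, hsp⟩
    have hpar : IsExtension.parOf q = 0 := Prod.ext h1 h2
    have hpN : IsExtension.parOf q ∈ N := by rw [hpar]; exact h0
    refine ⟨hpN, ?_, hsp⟩
    obtain ⟨hs, hb, hΩ, -⟩ := (h.mem_C₀_iff hpN (mem_lchart_source q.2.1)).1 hq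
    rw [hpar] at hb ⊢
    refine hSO _ ⟨?_, hs⟩
    rw [mem_preimage, ← hb]
    exact hΩ
  · rintro q₁ ⟨⟨hp₁, hO₁, hsp₁⟩, hq₁⟩ q₂ ⟨⟨hp₂, hO₂, hsp₂⟩, hq₂⟩ heq
    have hpp : IsExtension.parOf q₁ = IsExtension.parOf q₂ := congrArg Prod.fst heq
    obtain ⟨s₁, ξ₁, e₁⟩ := h.exists_eq_rayPoint hq₁ hp₁
    obtain ⟨s₂, ξ₂, e₂⟩ := h.exists_eq_rayPoint hq₂ hp₂
    generalize hp : IsExtension.parOf q₁ = p at *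
    generalize IsExtension.parOf q₂ = p' at *
    subst hpp
    subst e₁ e₂
    exact h.rayPoint_eq hn hp₁ hq₁ hq₂ hsp₁ hsp₂ (interior_subset (hOR p s₁ s₂ hO₁ hO₂)) heq

end LightRayFamily

/-! ### Conjugate points destroy injectivity -/

section Lorentz

variable {n : ℕ} {M : Type*} [TopologicalSpace M] [ChartedSpace (Euc (n + 1)) M]
  [IsManifold (𝓡 (n + 1)) ∞ M] (g : LorentzianMetric n M)

/-- A vector orthogonal to a lightlike vector, and not proportional to it, is spacelike. -/
lemma form_pos_of_orthogonal_null {x : M} {u v : TangentSpace (𝓡 (n + 1)) x}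
    (hu : g.form x u u = 0) (hu0 : u ≠ 0) (huv : g.form x v u = 0) (hv : ∀ c : ℝ, v ≠ c • u) :
    0 < g.form x v v := by
  obtain ⟨b, hb⟩ := g.signature x
  have hform : ∀ a c, g.form x a c =
      -(b.repr a 0 * b.repr c 0) + ∑ i : Fin n, b.repr a i.succ * b.repr c i.succ := by
    intro a c
    have h1 : g.form x a c = ∑ i, ∑ j, b.repr a i * (b.repr c j * g.form x (b i) (b j)) := by
      conv_lhs => rw [← b.sum_repr a, ← b.sum_repr c]
      simp only [map_sum, map_smul, FunLike.coe_sum, Finset.sum_apply,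
        smul_apply, smul_eq_mul, Finset.mul_sum]
      exact Finset.sum_comm.trans (Finset.sum_congr rfl fun i _ => Finset.sum_congr rfl
        fun j _ => by ring)
    rw [h1]
    simp only [hb, mul_ite, mul_zero, Finset.sum_ite_eq, Finset.mem_univ, if_true]
    rw [Fin.sum_univ_succ]
    simp [Fin.succ_ne_zero]
  have hzero : ∀ a : TangentSpace (𝓡 (n + 1)) x, b.repr a 0 = 0 → g.form x a a ≤ 0 → a = 0 := by
    intro a h0 ha
    rw [hform, h0, mul_zero, neg_zero, zero_add] at ha
    have hs : ∑ i : Fin n, b.repr a i.succ * b.repr a i.succ = 0 :=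
      le_antisymm ha (Finset.sum_nonneg fun i _ => mul_self_nonneg _)
    have hs' := (Finset.sum_eq_zero_iff_of_nonneg fun i _ => mul_self_nonneg _).1 hs
    refine (b.repr.map_eq_zero_iff).1 (Finsupp.ext fun i => ?_)
    refine Fin.cases h0 (fun i => ?_) i
    exact mul_self_eq_zero.1 (hs' i (Finset.mem_univ i))
  have hu00 : b.repr u 0 ≠ 0 := fun h => hu0 (hzero u h hu.le)
  by_contra hneg
  -- Subtracting c u removes the time component of v without changing g(v, v), because u is null and
  -- orthogonal to v. A nonzero vector without time component is spacelike.
  set c := b.repr v 0 / b.repr u 0 with hc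
  have hw0 : b.repr (v - c • u) 0 = 0 := by
    rw [map_sub, map_smul, Finsupp.sub_apply, Finsupp.smul_apply, smul_eq_mul, hc,
      div_mul_cancel₀ _ hu00, sub_self]
  have hww : g.form x (v - c • u) (v - c • u) = g.form x v v := by
    have huv' : g.form x u v = 0 := (g.symm x u v).trans huv
    simp only [map_sub, map_smul, sub_apply, smul_apply, smul_eq_mul, hu, huv, huv']
    ring
  refine hv c (sub_eq_zero.1 (hzero _ hw0 ?_))
  rw [hww]
  exact not_lt.1 hneg

end Lorentz

lemma eq_of_hasDerivAt_zero {f : ℝ → ℝ} {ℓ : ℝ} (h : ∀ r ∈ Icc 0 ℓ, HasDerivAt f 0 r) {s t : ℝ}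
    (hs : s ∈ Icc 0 ℓ) (ht : t ∈ Icc 0 ℓ) : f s = f t := by
  have key := constant_of_has_deriv_right_zero
    (fun r hr => (h r hr).continuousAt.continuousWithinAt)
    (fun r hr => (h r (Ico_subset_Icc_self hr)).hasDerivWithinAt)
  rw [key s hs, key t ht]

namespace LightRayFamily

variable {n : ℕ} {M : Type*} [TopologicalSpace M] [ChartedSpace (Euc (n + 1)) M]
  [IsManifold (𝓡 (n + 1)) ∞ M] {g : LorentzianMetric n M} {F : LightRayFamily g}
  {Γ : RayParam n × ℝ → M} {N : Set (RayParam n)} {I : Set ℝ}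

namespace IsExtension

variable {p : RayParam n} {U : Set ℝ} {J : ∀ s, TangentSpace (𝓡 (n + 1)) (Γ (p, s))}

lemma isGeodesicOpen (h : F.IsExtension Γ N I) (hp : p ∈ N) (hU : IsOpen U) (hUI : U ⊆ I) :
    IsGeodesicOpen g (fun r => Γ (p, r)) U :=
  (h.family.slice p).mono hU fun _ hr => ⟨hp, hUI hr⟩

lemma isJacobiOpen (h : F.IsExtension Γ N I) (hp : p ∈ N) (hUI : U ⊆ I)
    (l : RayParam n × ℝ × ℝ) : IsJacobiOpen g (fun r => Γ (p, r)) (rayField Γ p l) U :=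
  (h.family.isJacobiOpen_rayField p l).mono fun _ hr => ⟨hp, hUI hr⟩

lemma wronskian_jacobi_eq (h : F.IsExtension Γ N I) (hp : p ∈ N) (hU : IsOpen U) (hUI : U ⊆ I)
    (hIU : Icc 0 F.ℓ ⊆ U) (hJ : IsJacobiOpen g (fun r => Γ (p, r)) J U)
    (m : RayParam n × ℝ × ℝ) {s t : ℝ} (hs : s ∈ Icc 0 F.ℓ) (ht : t ∈ Icc 0 F.ℓ) :
    wronskian g (fun r => Γ (p, r)) J (rayField Γ p m) s =
      wronskian g (fun r => Γ (p, r)) J (rayField Γ p m) t :=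
  eq_of_hasDerivAt_zero (fun _ hr => hasDerivAt_wronskian_jacobi (h.isGeodesicOpen hp hU hUI) hJ
    (h.isJacobiOpen hp hUI m) (hIU hr)) hs ht

/-- Jacobi fields are determined by their initial data. -/
lemma jacobi_eq_rayField (h : F.IsExtension Γ N I) (hn : 2 ≤ n) (hp : p ∈ N) (hU : IsOpen U)
    (hUI : U ⊆ I) (hIU : Icc 0 F.ℓ ⊆ U) (hJ : IsJacobiOpen g (fun r => Γ (p, r)) J U)
    {l : RayParam n × ℝ × ℝ} {s₁ : ℝ} (hs₁ : s₁ ∈ Icc 0 F.ℓ) (h₀ : J s₁ = rayField Γ p l s₁)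
    (h₁ : covDeriv g (fun r => Γ (p, r)) J s₁ = rayField' g Γ p l s₁) {s : ℝ}
    (hs : s ∈ Icc 0 F.ℓ) : J s = rayField Γ p l s := by
  have hγ := h.isGeodesicOpen hp hU hUI
  have hl := h.isJacobiOpen hp hUI l
  have hW : ∀ s ∈ Icc 0 F.ℓ, ∀ m,
      g.form (Γ (p, s)) (covDeriv g (fun r => Γ (p, r)) J s - rayField' g Γ p l s)
        (rayField Γ p m s) = g.form (Γ (p, s)) (J s - rayField Γ p l s) (rayField' g Γ p m s) := by
    intro s hs m
    have e1 := h.wronskian_jacobi_eq hp hU hUI hIU hJ m hs hs₁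
    have e2 := h.wronskian_jacobi_eq hp hU hUI hIU hl m hs hs₁
    have e3 : wronskian g (fun r => Γ (p, r)) J (rayField Γ p m) s₁ =
        wronskian g (fun r => Γ (p, r)) (rayField Γ p l) (rayField Γ p m) s₁ := by
      unfold wronskian
      rw [h₀, h₁]
      rfl
    have e4 := e1.trans (e3.trans e2.symm)
    simp only [map_sub, sub_apply]
    change g.form (Γ (p, s)) (covDeriv g (fun r => Γ (p, r)) J s) (rayField Γ p m s) -
      g.form (Γ (p, s)) (J s) (rayField' g Γ p m s) =
      g.form (Γ (p, s)) (rayField' g Γ p l s) (rayField Γ p m s) -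
      g.form (Γ (p, s)) (rayField Γ p l s) (rayField' g Γ p m s) at e4
    linarith
  -- Equality of Wronskians links J' - l' to J - l. Replacing `m` by the field with the same value
  -- and zero derivative at s removes the term with J - l.
  have hw : ∀ s ∈ Icc 0 F.ℓ, ∀ m,
      g.form (Γ (p, s)) (covDeriv g (fun r => Γ (p, r)) J s - rayField' g Γ p l s)
        (rayField Γ p m s) = 0 := by
    intro s hs m
    obtain ⟨m', hm, hm'⟩ := (h.isRayFrame hn hp hs).surjective (rayField Γ p m s) (v' := 0)
      (by simp)
    have e1 := hW s hs m'
    have hm0 : rayField Γ p m' s = rayField Γ p m s := hm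
    have hm0' : rayField' g Γ p m' s = 0 := hm'
    rwa [hm0, hm0', map_zero] at e1
  -- Consequently g(J - l, m) is constant for every variation field m. It vanishes at s₁, and the
  -- values of the fields m fill the tangent space at each time.
  have hf : ∀ m, ∀ r ∈ Icc 0 F.ℓ, HasDerivAt (fun r => g.form (Γ (p, r)) (J r) (rayField Γ p m r) -
      g.form (Γ (p, r)) (rayField Γ p l r) (rayField Γ p m r)) 0 r := by
    intro m r hr
    have hm := h.isJacobiOpen hp hUI m
    have d1 := hasDerivAt_form (g := g) hγ.smooth hU hJ.smooth hm.smooth (hIU hr)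
    have d2 := hasDerivAt_form (g := g) hγ.smooth hU hl.smooth hm.smooth (hIU hr)
    refine (d1.sub d2).congr_deriv ?_
    have e1 := hw r hr m
    have e2 := hW r hr m
    rw [e1] at e2
    simp only [map_sub, sub_apply] at e1 e2
    change g.form (Γ (p, r)) (covDeriv g (fun r => Γ (p, r)) J r) (rayField Γ p m r) +
      g.form (Γ (p, r)) (J r) (rayField' g Γ p m r) -
      (g.form (Γ (p, r)) (rayField' g Γ p l r) (rayField Γ p m r) +
      g.form (Γ (p, r)) (rayField Γ p l r) (rayField' g Γ p m r)) = 0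
    linarith
  refine sub_eq_zero.1 ((h.isRayFrame hn hp hs).eq_zero_of_forall fun m => ?_)
  have e1 := eq_of_hasDerivAt_zero (hf m) hs hs₁
  simp only [h₀, sub_self] at e1
  change g.form (Γ (p, s)) (J s - rayField Γ p l s) (rayField Γ p m s) = 0
  rw [map_sub, sub_apply]
  exact e1

/-- A Jacobi field with two zeros is orthogonal to the ray, and so is its derivative. -/
lemma covDeriv_orthogonal (h : F.IsExtension Γ N I) (hp : p ∈ N) (hU : IsOpen U)
    (hUI : U ⊆ I) (hIU : Icc 0 F.ℓ ⊆ U) (hJ : IsJacobiOpen g (fun r => Γ (p, r)) J U)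
    {s₁ s₂ : ℝ} (hs₁ : s₁ ∈ Icc 0 F.ℓ) (hs₂ : s₂ ∈ Icc 0 F.ℓ) (hs : s₁ ≠ s₂) (h₁ : J s₁ = 0)
    (h₂ : J s₂ = 0) :
    g.form (Γ (p, s₁)) (covDeriv g (fun r => Γ (p, r)) J s₁) (rayVel Γ p s₁) = 0 := by
  have hγ := h.isGeodesicOpen hp hU hUI
  have he := h.isJacobiOpen hp hUI (e₃ n)
  set k := g.form (Γ (p, s₁)) (covDeriv g (fun r => Γ (p, r)) J s₁) (rayVel Γ p s₁)
  -- The Wronskian with the parallel field u shows that g(J', u) is a constant k. Thus g(J, u) - k s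
  -- is constant, and two zeros of J force k = 0.
  have hk : ∀ s ∈ Icc 0 F.ℓ, g.form (Γ (p, s)) (covDeriv g (fun r => Γ (p, r)) J s)
      (rayField Γ p (e₃ n) s) = k ∧
      g.form (Γ (p, s)) (J s) (covDeriv g (fun r => Γ (p, r)) (rayField Γ p (e₃ n)) s) = 0 := by
    intro s hs
    have z : ∀ s ∈ Icc 0 F.ℓ, covDeriv g (fun r => Γ (p, r)) (rayField Γ p (e₃ n)) s = 0 :=
      fun s hs => h.family.rayField'_e₃ (h.mem hp hs)
    have e1 := h.wronskian_jacobi_eq hp hU hUI hIU hJ (e₃ n) hs hs₁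
    unfold wronskian at e1
    rw [z s hs, z s₁ hs₁, map_zero, map_zero, sub_zero, sub_zero,
      h.family.rayField_e₃ (h.mem hp hs₁)] at e1
    exact ⟨e1, by rw [z s hs, map_zero]⟩
  have hd : ∀ r ∈ Icc 0 F.ℓ, HasDerivAt
      (fun r => g.form (Γ (p, r)) (J r) (rayField Γ p (e₃ n) r) - r * k) 0 r := by
    intro r hr
    have d1 := hasDerivAt_form (g := g) hγ.smooth hU hJ.smooth he.smooth (hIU hr)
    refine (d1.sub ((hasDerivAt_id r).mul_const k)).congr_deriv ?_
    have e1 := hk r hr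
    rw [e1.1, e1.2]
    ring
  have e1 := eq_of_hasDerivAt_zero hd hs₁ hs₂
  simp only [h₁, h₂, map_zero, zero_apply, zero_sub, neg_inj] at e1
  by_contra hk0
  exact hs (mul_right_cancel₀ hk0 e1)

/-- A Jacobi field along a given ray with two zeros is a variation field. -/
lemma exists_rayField_of_areConjugate [T2Space M] (h : F.IsExtension Γ N I) (hn : 2 ≤ n)
    (hp : p ∈ N) {s₁ s₂ : ℝ} (hs₁ : s₁ ∈ Icc 0 F.ℓ) (hs₂ : s₂ ∈ Icc 0 F.ℓ)
    (hc : AreConjugate g (F.ray p) F.ℓ s₁ s₂) :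
    ∃ l, l ≠ 0 ∧ rayField (n := n) Γ p l s₁ = 0 ∧ rayField (n := n) Γ p l s₂ = 0 := by
  obtain ⟨hs, J₀, ⟨U₀, hU₀, hIU₀, hJ₀, hJ₀'⟩, ⟨s, hs', hne⟩, h₁, h₂⟩ := hc
  obtain ⟨U₁, hU₁, hIU₁, hU₁I, he⟩ := h.exists_isOpen_eqOn hp
  have hU : IsOpen (U₀ ∩ U₁) := hU₀.inter hU₁
  have hUI : U₀ ∩ U₁ ⊆ I := inter_subset_right.trans hU₁I
  have hIU : Icc 0 F.ℓ ⊆ U₀ ∩ U₁ := subset_inter hIU₀ hIU₁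
  -- The same vectors, regarded along the extended ray, which coincides with the given one near [0,
  -- ℓ]. All tangent spaces are the same model space, so no transport is needed.
  obtain ⟨J, hJ, hJJ⟩ : ∃ J : ∀ s, TangentSpace (𝓡 (n + 1)) (Γ (p, s)),
      IsJacobiOpen g (fun r => Γ (p, r)) J (U₀ ∩ U₁) ∧
      ∀ s, (J s : Euc (n + 1)) = J₀ s := by
    refine ⟨fun s => (J₀ s : TangentSpace (𝓡 (n + 1)) (Γ (p, s))), ?_, fun s => rfl⟩
    refine IsJacobiOpen.congr hU
      ((⟨hJ₀, hJ₀'⟩ : IsJacobiOpen g (F.ray p) J₀ U₀).mono inter_subset_left) fun s hs => ?_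
    exact Bundle.TotalSpace.ext (he s hs.2).symm HEq.rfl
  have k₁ : J s₁ = 0 := (hJJ s₁).trans h₁
  have k₂ : J s₂ = 0 := (hJJ s₂).trans h₂
  have ho := h.covDeriv_orthogonal hp hU hUI hIU hJ hs₁ hs₂ hs k₁ k₂
  -- The data (0, J'(s₁)) are admissible because J'(s₁) ⊥ u, so a variation field has the same
  -- initial data as J.
  obtain ⟨l, hl, hl'⟩ := (h.isRayFrame hn hp hs₁).surjective 0 ho
  have hl0 : rayField (n := n) Γ p l s₁ = 0 := hl
  have heq : ∀ {s}, s ∈ Icc 0 F.ℓ → J s = rayField Γ p l s := fun hs =>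
    h.jacobi_eq_rayField hn hp hU hUI hIU hJ hs₁ (k₁.trans hl0.symm) hl'.symm hs
  refine ⟨l, ?_, hl0, (heq hs₂).symm.trans k₂⟩
  rintro rfl
  refine hne ((hJJ s).symm.trans ((heq hs').trans ?_))
  exact map_zero (rayFieldL (n := n) Γ p s)

/-- At a zero of a variation field with another zero the derivative is spacelike. -/
lemma rayField'_spacelike (h : F.IsExtension Γ N I) (hn : 2 ≤ n) (hp : p ∈ N)
    {l : RayParam n × ℝ × ℝ} (hl : l ≠ 0) {s₁ s₂ : ℝ} (hs : s₁ ≠ s₂) (hs₁ : s₁ ∈ Icc 0 F.ℓ)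
    (hs₂ : s₂ ∈ Icc 0 F.ℓ) (h₁ : rayField (n := n) Γ p l s₁ = 0)
    (h₂ : rayField (n := n) Γ p l s₂ = 0) :
    0 < g.form (Γ (p, s₁)) (rayField' g Γ p l s₁) (rayField' g Γ p l s₁) := by
  have fr₁ := h.isRayFrame hn hp hs₁
  have fr₂ := h.isRayFrame hn hp hs₂
  refine form_pos_of_orthogonal_null g fr₁.null fr₁.u_ne_zero (fr₁.orth l) fun b hb => ?_
  -- If the derivative at s₁ were b u, the field would be b (s - s₁) u, which vanishes at s₂ only
  -- for b = 0.
  have hlb : l = b • e₄ n - (b * s₁) • e₃ n := by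
    refine sub_eq_zero.1 (fr₁.injective ?_ ?_)
    · have h₁' : rayFieldL (n := n) Γ p s₁ l = 0 := h₁
      rw [map_sub, map_sub, map_smul, map_smul, fr₁.X_e₃, fr₁.X_e₄, h₁']
      module
    · have hb' : h.family.rayFieldL' (h.mem hp hs₁) l = b • rayVel Γ p s₁ := hb
      rw [map_sub, map_sub, map_smul, map_smul, fr₁.X'_e₃, fr₁.X'_e₄, hb']
      module
  have e1 : rayFieldL (n := n) Γ p s₂ l = 0 := h₂
  rw [hlb, map_sub, map_smul, map_smul, fr₂.X_e₃, fr₂.X_e₄, smul_smul, ← sub_smul, ← mul_sub,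
    smul_eq_zero, mul_eq_zero] at e1
  rcases e1 with (hb0 | h0) | h0
  · rw [hb0, zero_mul, zero_smul, zero_smul, sub_zero] at hlb
    exact hl hlb
  · exact hs (sub_eq_zero.1 h0).symm
  · exact fr₂.u_ne_zero h0

/-- The covector dual to the derivative of a variation field with two zeros. -/
lemma conjugate_rayPoint (h : F.IsExtension Γ N I) (hn : 2 ≤ n) (hp : p ∈ N)
    {l : RayParam n × ℝ × ℝ} (hl : l ≠ 0) {s₁ s₂ : ℝ} (hs : s₁ ≠ s₂) (hs₁ : s₁ ∈ Ioo 0 F.ℓ)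
    (hs₂ : s₂ ∈ Icc 0 F.ℓ) (h₁ : rayField (n := n) Γ p l s₁ = 0)
    (h₂ : rayField (n := n) Γ p l s₂ = 0) (hΩ : Γ (p, s₁) ∈ F.Ω) :
    rayPoint Γ p s₁ (g.form (Γ (p, s₁)) (rayField' g Γ p l s₁)) ∈ F.C₀ ∧
      IsSpacelike g (rayPoint Γ p s₁ (g.form (Γ (p, s₁)) (rayField' g Γ p l s₁))).2 ∧
      ∀ m, g.form (Γ (p, s₁)) (rayField' g Γ p l s₁) (rayField Γ p m s₁) =
        rayWronskian g Γ p l m := by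
  have i₁ := Ioo_subset_Icc_self hs₁
  have hsp := h.rayField'_spacelike hn hp hl hs i₁ hs₂ h₁ h₂
  have hsp' : IsSpacelike g
      (rayPoint Γ p s₁ (g.form (Γ (p, s₁)) (rayField' g Γ p l s₁))).2 :=
    ⟨rayField' g Γ p l s₁, fun w => rfl, hsp⟩
  refine ⟨(h.rayPoint_mem_C₀_iff hp).2 ⟨hs₁, hΩ, ne_zero_of_isSpacelike hsp', h.orth hp l i₁⟩,
    hsp', fun m => ?_⟩
  have e1 := wronskian_eq_rayWronskian h.family h.Icc_subset hp l m i₁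
  rwa [h₁, map_zero, zero_apply, sub_zero] at e1

end IsExtension

/-- A field with zeros at s₁ and s₂ gives two central spacelike points, dual to its derivatives at
these times. Both pair with a variation field m to the Wronskian of l and m, up to no sign, so they
have the same image although their times differ. -/
lemma noConjugatePoints_of_injOn [T2Space M] (F : LightRayFamily g) (hn : 2 ≤ n)
    {U : Set (ParamSpace n M)} (hU : F.centralSpacelike ⊆ U) (hF : InjOn F.projZA (U ∩ F.C₀)) :
    F.NoConjugatePoints := by
  intro s₁ hs₁ s₂ hs₂ hΩ₁ hΩ₂ hc
  obtain ⟨Γ, N, I, h0, h⟩ := F.exists_isExtension F.zero_mem_param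
  have i₁ := mem_Ioo_of_mem F.zero_mem_param hs₁ hΩ₁
  have i₂ := mem_Ioo_of_mem F.zero_mem_param hs₂ hΩ₂
  have o₁ : Γ (0, s₁) ∈ F.Ω := by rw [h.eq 0 s₁ hs₁]; exact hΩ₁
  have o₂ : Γ (0, s₂) ∈ F.Ω := by rw [h.eq 0 s₂ hs₂]; exact hΩ₂
  obtain ⟨l, hl, k₁, k₂⟩ := h.exists_rayField_of_areConjugate hn h0 hs₁ hs₂ hc
  obtain ⟨m₁, p₁, w₁⟩ := h.conjugate_rayPoint hn h0 hl hc.1 i₁ hs₂ k₁ k₂ o₁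
  obtain ⟨m₂, p₂, w₂⟩ := h.conjugate_rayPoint hn h0 hl hc.1.symm i₂ hs₁ k₂ k₁ o₂
  have heq := (h.projZA_rayPoint_eq_iff h0 m₁ m₂).2 fun m => (w₁ m).trans (w₂ m).symm
  have key := hF ⟨hU ⟨m₁, rfl, rfl, p₁⟩, m₁⟩ ⟨hU ⟨m₂, rfl, rfl, p₂⟩, m₂⟩ heq
  exact hc.1 (congrArg (fun q : ParamSpace n M => q.1.2.2) key)

end LightRayFamily

end

theorem lemma3p9 (n : ℕ) (hn : 2 ≤ n) (M : Type*) [TopologicalSpace M] [T2Space M]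
    [ChartedSpace (Euc (n + 1)) M] [IsManifold (𝓡 (n + 1)) ∞ M]
    (g : LorentzianMetric n M) (F : LightRayFamily g) :
    (∀ q ∈ F.C₀, IsSpacelike g q.2 →
      DifferentialInjectiveAt (paramModel n) 𝓘(ℝ, CotangentZA n) F.C₀ F.projZA q ∧
      DifferentialSurjectiveAt (paramModel n) (cotangentModel n) F.C₀ F.projM q) ∧
    ((∃ U : Set (ParamSpace n M), IsOpen U ∧ F.centralSpacelike ⊆ U ∧
        InjOn F.projZA (U ∩ F.C₀)) ↔ F.NoConjugatePoints) ∧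
    (∃ W : Set (CotangentBundle n M), IsOpen W ∧
      {p ∈ spacelikeCone g ∩ conormal F.γ₀ F.ℓ | p.1 ∈ F.Ω} ⊆ W ∧
      W ∩ spacelikeCone g ⊆ F.projM '' F.C₀) := by
  refine ⟨fun q hq hsp => F.differentials hn hq hsp, ⟨?_, ?_⟩,
    F.exists_isOpen_subset_image_projM hn⟩
  · rintro ⟨U, -, hU, hF⟩
    exact F.noConjugatePoints_of_injOn hn hU hF
  · exact F.exists_injOn_of_noConjugatePoints hn
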